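/- **Setting.** Let $d,K\ge 1$ be integers, $\mathcal X=[0,1]^d$ with the sup norm, $B(x,r)=\{y:\|x-y\|_\infty\le r\}$, and $a\vee b$, $a\wedge b$ the maximum and minimum. A target bandit $Q$ and a source bandit $P$ are laws of $(X,Y^{(1)},\dots,Y^{(K)})\in\mathcal X\times[0,1]^K$ with covariate marginals $Q_X$, $P_X$, with the same conditional laws of $Y^{(k)}$ given $X$, and $\mathbb E[Y^{(k)}\mid X]=f_k(X)$ with $f_k:\mathcal X\to[0,1]$. The source data are i.i.d. observations $(X_i^P,\pi_i^P,Y_i^P)$, $1\le i\le n_P$, where $X_i^P\sim P_X$, $\pi_i^P\sim\mu(\cdot\mid X_i^P)$, and $Y_i^P$ is the reward of arm $\pi_i^P$ (arm and rewards are conditionally independent given $X_i^P$). For $t=1,\dots,n_Q$ the learner sees $X_t^Q\sim Q_X$, pulls an arm $\pi_t$ based on the source data, the past target observations, $X_t^Q$ and own randomization, and observes $Y_t^{Q,(\pi_t)}$. The expected regret is $\mathbb E[R_{n_Q}(\pi)]=\mathbb E\sum_{t=1}^{n_Q}\big(\max_kf_k(X_t^Q)-f_{\pi_t}(X_t^Q)\big)$.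 Put $n=n_P\vee n_Q$. **Bins.** $\mathcal B_l$ is the set of the $2^{ld}$ closed dyadic subcubes of $\mathcal X$ of side $2^{-l}$; $|B|=2^{-l}$ for $B\in\mathcal B_l$; the children of $B\in\mathcal B_l$ are the $B'\in\mathcal B_{l+1}$ with $B'\subset B$. Whenever "the bin containing $x$" in a given collection is not unique, one whose center is closest to the origin is taken. $\lceil a\rceil$ denotes the smallest integer strictly larger than $a$. **Class of bandits.** $\Pi(\beta,\gamma,\kappa)$ is the set of all such pairs that satisfy, for fixed constants $\alpha\ge0$, $C_\beta,C_\alpha>0$, $\overline q>\underline q>0$, $c_\gamma\in(0,1]$, an integer $l_0\ge0$ and $b>0$: (i) $|f_k(x)-f_k(x')|\le C_\beta\|x-x'\|_\infty^\beta$ for all $k$ and $x,x'\in\mathcal X$; (ii) $Q_X(0<f_{(1)}-f_{(2)}\le\delta)\le C_\alpha\delta^\alpha$ for $0<\delta\le1$, where $f_{(1)}=\max_kf_k$ and $f_{(2)}(x)$ is the largest of the values $f_k(x)$ that are smaller than $f_{(1)}(x)$, and $f_{(2)}(x)=f_{(1)}(x)$ if there is none; (iii) $\underline q r^d\le Q_X(B(x,r))\le\overline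 q r^d$ for $x\in\mathrm{supp}(Q_X)$, $r\in(0,1]$; (iv) $P_X(B(x,r))\ge c_\gamma r^\gamma Q_X(B(x,r))$ for $x\in\mathrm{supp}(Q_X)$, $r\in(0,1]$; (v) $K\mu(k\mid x)\ge\kappa$ for all $k$ and $x\in\mathrm{supp}(Q_X)$; (vi) (self-similarity) some $f\in\{f_1,\dots,f_K\}$ satisfies, for both $\mu'=Q_X$ and $\mu'=P_X$ and all integers $l\ge l_0$: $\mu'(B)>0$ for all $B\in\mathcal B_l$, and $\max_{B\in\mathcal B_l}\sup_{x\in B}|\Gamma f(x;B,\mu')-f(x)|\ge b2^{-\beta l}$, where $\Gamma f(x;B,\mu')$ is the constant $c$ that minimizes $\int_{\{\|u-x\|_\infty\le2^{-l}\}}|f(u)-c|^2\,\mu'(du\mid B)$. **Algorithm.** Inputs: $n_Q$, $0<\underline\beta<\overline\beta\le1$, $\overline C_\beta\ge C_\beta$, $\overline\gamma\ge0$, the source data, and an arbitrary rule for breaking ties between arms. *Stage 1.* Let $g=\overline\gamma$ if $n_P>n_Q$, and $g=0$ otherwise. Set $l_1=\lceil\underline\beta\log_2(n)/(d+2\overline\beta+g)^2\rceil$,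 $l_2=\lceil l_1+\underline\beta^{-1}\log_2\log n\rceil$, $l_3=\lceil(\overline\beta/\underline\beta)l_1+\underline\beta^{-1}\log_2\log n\rceil$ and $T=\big\lfloor n^{\underline\beta/(d+2\overline\beta+g)}(\log n)^{(d+\overline\beta+g)/\underline\beta}\big\rfloor$ (usual integer part). (If an argument of $\lceil\cdot\rceil$ is negative, which is possible only for $n=2$, the value $1$ is used.) If $n_P>n_Q$, let $\mathcal D$ be the first $T$ source observations (all if $T>n_P$), $s_P=T$, $s_Q=0$. Otherwise pull independent uniformly random arms in rounds $1,\dots,T$ (up to $n_Q$), let $\mathcal D$ be the observations of these rounds, $s_P=0$, $s_Q=T$. For $x$ in the grid $\mathcal M=\mathcal X\cap2^{-l_3}\mathbb Z^d$, $i\in\{1,2\}$ and each arm $k$ let $\widehat f_k(x;2^{-l_i})$ be the mean reward of the observations in $\mathcal D$ with arm $k$ whose covariate lies in the bin of $\mathcal B_{l_i}$ containing $x$ and within distance $2^{-l_i}$ of $x$ ($0$ if there are none). Let $\mathsf b=\max_{k,\,x\in\mathcal M}|\widehat f_k(x;2^{-l_1})-\widehat f_k(x;2^{-l_2})|$ and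 $\widehat\beta=\overline\beta\wedge\big(\underline\beta\vee(-l_1^{-1}\log_2\mathsf b-\log_2(\log n)/\log_2n)\big)$, with $-\log_2 0=\infty$. *Stage 2* (rounds $t=s_Q+1,\dots,n_Q$). Let $\mathcal D_2$ be the source observations with index $i>s_P$; $n_k(B)$ and $\overline Y_k^P(B)$ are the number and the mean reward ($0$ if none) of those with arm $k$ and covariate in $B$. Put $\widehat U_k(\tau,B)=2\sqrt{\tfrac{2}{\tau+n_k(B)}\log n}\,\vee\,2\overline C_\beta|B|^{\widehat\beta}$ (with $1/0=\infty$) and $\widehat\tau_k(B)=\min\{\tau\in\{0,1,2,\dots\}:\widehat U_k(\tau,B)\le2\overline C_\beta|B|^{\widehat\beta}\}$. A partition $\mathcal L$ of $\mathcal X$ into bins is maintained, initially $\{\mathcal X\}$. Each $B\in\mathcal L$ carries a set $\mathcal I(B)$ of active arms, initially all arms for $B=\mathcal X$, and its own run of the procedure E below. In each round let $B\in\mathcal L$ contain $X_t^Q$. While $|\mathcal I(B)|>1$ and every $k\in\mathcal I(B)$ has been pulled at least $\widehat\tau_k(B)$ times in the run for $B$: if $\widehat\tau_k(B)=0$ for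 all $k\in\mathcal I(B)$, keep in $\mathcal I(B)$ only the arms with $\overline Y^P_k(B)+\widehat U_k(0,B)\ge\max_{j\in\mathcal I(B)}\{\overline Y^P_j(B)-\widehat U_j(0,B)\}$; replace $B$ in $\mathcal L$ by its children, each with active set $\mathcal I(B)$ and a fresh run of E; and let $B$ be the bin of the new partition that contains $X_t^Q$. Then pull the next arm prescribed by the run of E for $B$. *Procedure E for $(B,\mathcal I)$.* Start with pull counts $\tau_k=0$, means $\overline Y_k=\overline Y_k^P(B)$ and $\underline Y=\max_{k\in\mathcal I}\{\overline Y_k-\widehat U_k(0,B)\}$. Repeat: (a) if $\tau_k\ge\widehat\tau_k(B)$ for all $k\in\mathcal I$, pull an arm of $\mathcal I$ with largest $\overline Y_k$ and update its count $\tau_k$ and its mean $\overline Y_k$ (over the $n_k(B)+\tau_k$ rewards); (b) otherwise go once through the arms $k\in\mathcal I$ in increasing order: if $\tau_k<\widehat\tau_k(B)$ and $\overline Y_k+\widehat U_k(\tau_k,B)\ge\underline Y$, pull $k$, update its count and mean and then set $\underline Y=\max_{j\in\mathcal I}\{\overline Y_j-\widehat U_j(\tau_j,B)\}$; if $\tau_k<\widehat\tau_k(B)$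 and the inequality fails, remove $k$ from $\mathcal I$; if $\tau_k\ge\widehat\tau_k(B)$, skip $k$. The procedure pauses after each pull until the next round in which its bin is used. **Theorem.** Let $d,K\ge1$, $0<\underline\beta<\overline\beta\le1$, $\overline\gamma\ge0$, $\overline C_\beta\ge C_\beta$ and $\kappa_0>0$. There are constants $C_1,C_2>0$, depending only on these quantities and on the constants of the class, and in particular neither on $n_Q,n_P$ nor on the rule for breaking ties, such that for all $n_Q,n_P\ge0$ with $n_Q\vee n_P\ge2$, all $\beta\in[\underline\beta,\overline\beta]$ with $\alpha\beta\le d$, all $\gamma\in[0,\overline\gamma]$ and all $\kappa\in[\kappa_0,1]$, the policy $\pi_{\mathsf a}$ of the algorithm satisfies $$\sup_{\Pi(\beta,\gamma,\kappa)}\mathbb E[R_{n_Q}(\pi_{\mathsf a})]\le C_1\,n_Q\Big(n_Q+(\kappa n_P)^{\frac{d+2\beta}{d+2\beta+\gamma}}\Big)^{-\frac{\beta(1+\alpha)}{2\beta+d}}\log^{C_2}(n_P+n_Q).$$ -/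

import Mathlib

open MeasureTheory ProbabilityTheory

namespace TransferBandit

noncomputable section

open scoped Classical

/-! ### Covariates and dyadic bins -/

/-- Covariates, with the sup norm (the default norm on `Fin d → ℝ`). -/
abbrev Cov (d : ℕ) : Type := Fin d → ℝ

/-- The covariate space `[0,1]^d`. -/
def cube (d : ℕ) : Set (Cov d) := Set.Icc 0 1

/-- A dyadic bin: its level `l` and its (zero-based) multi-index in `{0, …, 2^l - 1}^d`. -/
abbrev Bin (d : ℕ) : Type := (l : ℕ) × (Fin d → Fin (2 ^ l))

/-- The closed hypercube of side length `2^{-l}` described by a bin. -/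
def Bin.carrier {d : ℕ} (B : Bin d) : Set (Cov d) :=
  {x | ∀ i, ((B.2 i : ℕ) : ℝ) * (1 / 2) ^ B.1 ≤ x i ∧
    x i ≤ (((B.2 i : ℕ) : ℝ) + 1) * (1 / 2) ^ B.1}

/-- The side length `|B| = 2^{-l}`. -/
def Bin.side {d : ℕ} (B : Bin d) : ℝ := (1 / 2) ^ B.1

/-- Squared Euclidean distance from the center of the bin to the origin. -/
def Bin.centerSq {d : ℕ} (B : Bin d) : ℝ :=
  ∑ i, ((((B.2 i : ℕ) : ℝ) + 1 / 2) * (1 / 2) ^ B.1) ^ 2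

/-- The bin `[0,1]^d` of level `0`. -/
def root (d : ℕ) : Bin d := ⟨0, fun _ => ⟨0, by norm_num⟩⟩

/-- The collection of all bins of level `l`. -/
def binsAt (d l : ℕ) : Finset (Bin d) :=
  (Finset.univ : Finset (Fin d → Fin (2 ^ l))).image (fun k => (⟨l, k⟩ : Bin d))

/-- The bins of the next level contained in `B`. -/
def Bin.children {d : ℕ} (B : Bin d) : Finset (Bin d) :=
  (binsAt d (B.1 + 1)).filter (fun B' => B'.carrier ⊆ B.carrier)

/-- The bin of the collection `L` that contains `x`; if there are several, one whose center is
closest to the origin. -/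
def locate {d : ℕ} (L : Finset (Bin d)) (x : Cov d) : Bin d :=
  if h : (L.filter (fun B => x ∈ B.carrier)).Nonempty then
    (Finset.exists_min_image (L.filter (fun B => x ∈ B.carrier)) Bin.centerSq h).choose
  else root d

/-! ### The transfer bandit model -/

/-- A pair of contextual `K`-armed bandits (target `Q`, source `P`) under covariate shift,
together with the random arm selection rule of the source data. -/
structure Model (d K : ℕ) where
  /-- law of the target covariates -/
  QX : Measure (Cov d)
  /-- law of the source covariates -/
  PX : Measure (Cov d)
  /-- conditional law of the reward vector given the covariate, target bandit -/
  rewardQ : Kernel (Cov d) (Fin K → ℝ)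
  /-- conditional law of the reward vector given the covariate, source bandit -/
  rewardP : Kernel (Cov d) (Fin K → ℝ)
  /-- conditional law of the arm pulled in the source data given the covariate -/
  armP : Kernel (Cov d) (Fin K)
  /-- the reward functions -/
  f : Fin K → Cov d → ℝ
  probQX : IsProbabilityMeasure QX
  probPX : IsProbabilityMeasure PX
  markovQ : IsMarkovKernel rewardQ
  markovP : IsMarkovKernel rewardP
  markovArm : IsMarkovKernel armP
  QX_cube : QX (cube d)ᶜ = 0
  PX_cube : PX (cube d)ᶜ = 0
  rewardQ_mem : ∀ x, ∀ᵐ y ∂(rewardQ x), ∀ k, y k ∈ Set.Icc (0 : ℝ) 1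
  rewardP_mem : ∀ x, ∀ᵐ y ∂(rewardP x), ∀ k, y k ∈ Set.Icc (0 : ℝ) 1
  /-- covariate shift: given the covariate, each reward has the same law in both bandits -/
  shift : ∀ k x, (rewardQ x).map (fun y => y k) = (rewardP x).map (fun y => y k)
  f_mem : ∀ k, ∀ x ∈ cube d, f k x ∈ Set.Icc (0 : ℝ) 1
  meanQ : ∀ k, ∀ᵐ x ∂QX, ∫ y, y k ∂(rewardQ x) = f k x
  meanP : ∀ k, ∀ᵐ x ∂PX, ∫ y, y k ∂(rewardP x) = f k x

/-- Pointwise maximum of the reward functions. -/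
def fMax {d K : ℕ} (f : Fin K → Cov d → ℝ) (x : Cov d) : ℝ := ⨆ k, f k x

/-- Second pointwise maximum: the largest value strictly below the maximum, or the maximum if all
values agree. -/
def fSecond {d K : ℕ} (f : Fin K → Cov d → ℝ) (x : Cov d) : ℝ :=
  if h : (Finset.univ.filter (fun k => f k x < fMax f x)).Nonempty then
    (Finset.univ.filter (fun k => f k x < fMax f x)).sup' h (fun k => f k x)
  else fMax f x

/-- `(β, C)`-Hölder continuity on `[0,1]^d` in the sup norm. -/
def IsHolder {d : ℕ} (β C : ℝ) (g : Cov d → ℝ) : Prop :=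
  ∀ x ∈ cube d, ∀ y ∈ cube d, |g x - g y| ≤ C * ‖x - y‖ ^ β

/-- Margin condition. -/
def Margin {d K : ℕ} (α C : ℝ) (f : Fin K → Cov d → ℝ) (QX : Measure (Cov d)) : Prop :=
  ∀ δ : ℝ, 0 < δ → δ ≤ 1 →
    QX.real {x | 0 < fMax f x - fSecond f x ∧ fMax f x - fSecond f x ≤ δ} ≤ C * δ ^ α

/-- Bounded density of the target covariates on their support. -/
def BoundedDensity {d : ℕ} (qlo qhi : ℝ) (QX : Measure (Cov d)) : Prop :=
  ∀ x ∈ QX.support, ∀ r : ℝ, 0 < r → r ≤ 1 →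
    qlo * r ^ d ≤ QX.real (Metric.closedBall x r) ∧ QX.real (Metric.closedBall x r) ≤ qhi * r ^ d

/-- Transfer condition with exponent `γ` and constant `c`. -/
def Transfer {d : ℕ} (γ c : ℝ) (PX QX : Measure (Cov d)) : Prop :=
  ∀ x ∈ QX.support, ∀ r : ℝ, 0 < r → r ≤ 1 →
    c * r ^ γ * QX.real (Metric.closedBall x r) ≤ PX.real (Metric.closedBall x r)

/-- Exploration condition: each arm is pulled in the source data with probability at least
`κ / K` over the support of the target covariates. -/
def Exploration {d K : ℕ} (κ : ℝ) (arm : Kernel (Cov d) (Fin K)) (QX : Measure (Cov d)) : Prop :=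
  ∀ k : Fin K, ∀ x ∈ QX.support, κ ≤ K * (arm x).real {k}

/-- `g` minimizes the local least squares criterion for `f` at `x` among the polynomials of
degree at most `p`: the squared error is integrated with respect to `μ` conditioned on the bin
`B`, over the points at distance at most `h` from `x`. -/
def IsPolyProj {d : ℕ} (p : ℕ) (h : ℝ) (f : Cov d → ℝ) (x : Cov d) (B : Bin d)
    (μ : Measure (Cov d)) (g : MvPolynomial (Fin d) ℝ) : Prop :=
  g.totalDegree ≤ p ∧ ∀ g' : MvPolynomial (Fin d) ℝ, g'.totalDegree ≤ p →
    ∫ u in Metric.closedBall x h, |f u - MvPolynomial.eval u g| ^ 2 ∂(cond μ B.carrier) ≤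
      ∫ u in Metric.closedBall x h, |f u - MvPolynomial.eval u g'| ^ 2 ∂(cond μ B.carrier)

/-- The value at `x` of the local polynomial projection of `f`. -/
def polyProj {d : ℕ} (p : ℕ) (h : ℝ) (f : Cov d → ℝ) (x : Cov d) (B : Bin d)
    (μ : Measure (Cov d)) : ℝ :=
  MvPolynomial.eval x (Classical.epsilon (IsPolyProj p h f x B μ))

/-- Self-similarity of `f` under `μ`. The projections refer to the conditional laws of `μ` given
the bins, so all bins of the levels considered have to have positive mass. -/
def SelfSimilar {d : ℕ} (β : ℝ) (l₀ : ℕ) (b : ℝ) (f : Cov d → ℝ) (μ : Measure (Cov d)) : Prop :=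
  ∀ l : ℕ, l₀ ≤ l →
    (∀ B ∈ binsAt d l, 0 < μ B.carrier) ∧
    b * (2 : ℝ) ^ (-(β * l)) ≤
      sSup {r : ℝ | ∃ B ∈ binsAt d l, ∃ x ∈ B.carrier,
        r = |polyProj 0 ((1 / 2 : ℝ) ^ l) f x B μ - f x|}

/-- The class of transfer bandits with smoothness `(β, Cβ)`, margin `(α, Cα)`, density bounds
`(qlo, qhi)`, transfer exponent `(γ, cγ)`, exploration `κ` and self-similarity `(l₀, b)`. -/
structure InClass {d K : ℕ} (M : Model d K) (β Cβ α Cα qlo qhi γ cγ κ : ℝ) (l₀ : ℕ) (b : ℝ) :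
    Prop where
  smooth : ∀ k, IsHolder β Cβ (M.f k)
  margin : Margin α Cα M.f M.QX
  density : BoundedDensity qlo qhi M.QX
  transfer : Transfer γ cγ M.PX M.QX
  explore : Exploration κ M.armP M.QX
  selfSim : ∃ k, SelfSimilar β l₀ b (M.f k) M.QX ∧ SelfSimilar β l₀ b (M.f k) M.PX

/-! ### Policies and regret -/

/-- One observed round: covariate, pulled arm, observed reward. -/
abbrev Obs (d K : ℕ) : Type := Cov d × Fin K × ℝ

/-- A (randomized) policy: from the source data, the past target observations (oldest first), the
current covariate and a fresh uniform arm, it determines the arm to pull. -/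
abbrev Policy (d K : ℕ) : Type := List (Obs d K) → List (Obs d K) → Cov d → Fin K → Fin K

/-- Randomness of one target round: covariate, reward vector, auxiliary uniform arm. -/
abbrev RoundQ (d K : ℕ) : Type := (Cov d × (Fin K → ℝ)) × Fin K

/-- Randomness of one source round: covariate, pulled arm, reward vector. -/
abbrev RoundP (d K : ℕ) : Type := Cov d × (Fin K × (Fin K → ℝ))

/-- The observed part of a source round. -/
def RoundP.obs {d K : ℕ} (z : RoundP d K) : Obs d K := (z.1, z.2.1, z.2.2 z.2.1)

/-- The observed source data. -/
def sourceData {d K nP : ℕ} (w : Fin nP → RoundP d K) : List (Obs d K) :=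
  List.ofFn (fun i => RoundP.obs (w i))

/-- The target observations of the first `t` rounds when the policy `π` is played. -/
def history {d K : ℕ} (π : Policy d K) (src : List (Obs d K)) (v : ℕ → RoundQ d K) :
    ℕ → List (Obs d K)
  | 0 => []
  | t + 1 =>
      history π src v t ++
        [((v t).1.1, π src (history π src v t) (v t).1.1 (v t).2,
          (v t).1.2 (π src (history π src v t) (v t).1.1 (v t).2))]

/-- The arm pulled in round `t` (rounds are counted from `0`). -/
def pulledArm {d K : ℕ} (π : Policy d K) (src : List (Obs d K)) (v : ℕ → RoundQ d K) (t : ℕ) :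
    Fin K :=
  π src (history π src v t) (v t).1.1 (v t).2

/-- The cumulative regret over the first `nQ` rounds. -/
def regret {d K : ℕ} (f : Fin K → Cov d → ℝ) (π : Policy d K) (src : List (Obs d K))
    (v : ℕ → RoundQ d K) (nQ : ℕ) : ℝ :=
  ∑ t ∈ Finset.range nQ, (fMax f (v t).1.1 - f (pulledArm π src v t) (v t).1.1)

/-- Law of one target round. -/
def Model.lawQ {d K : ℕ} (M : Model d K) : Measure (RoundQ d K) :=
  (M.QX.compProd M.rewardQ).prod (uniformOn (Set.univ : Set (Fin K)))

/-- Law of one source round: the arm and the reward vector are conditionally independent given the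
covariate. -/
def Model.lawP {d K : ℕ} (M : Model d K) : Measure (RoundP d K) :=
  M.PX.compProd (M.armP.prod M.rewardP)

/-- Joint law of `nP` i.i.d. source rounds and an independent i.i.d. sequence of target rounds. -/
def Model.law {d K : ℕ} (M : Model d K) (nP : ℕ) :
    Measure ((Fin nP → RoundP d K) × (ℕ → RoundQ d K)) :=
  (Measure.pi (fun _ : Fin nP => M.lawP)).prod (Measure.infinitePi (fun _ : ℕ => M.lawQ))

/-- The expected (nonnegative) regret of a policy. -/
def Model.expectedRegret {d K : ℕ} (M : Model d K) (π : Policy d K) (nQ nP : ℕ) : ENNReal :=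
  ∫⁻ ω, ENNReal.ofReal (regret M.f π (sourceData ω.1) ω.2 nQ) ∂(M.law nP)

/-! ### Smoothness estimation -/

/-- Tuning parameters: lower and upper bound for the smoothness, upper bound for the transfer
exponent, upper bound for the Hölder constant. -/
structure Tuning where
  βlo : ℝ
  βhi : ℝ
  γhi : ℝ
  Chi : ℝ

/-- The smallest integer strictly larger than `a` (for `0 ≤ a`). -/
def ceilStrict (a : ℝ) : ℕ := ⌊a⌋₊ + 1

/-- The upper bound of the transfer exponent if source data are used (`nP > nQ`), and `0` if target
data are used. -/
def gammaEff (θ : Tuning) (nQ nP : ℕ) : ℝ := if nQ < nP then θ.γhi else 0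

/-- The larger sample size `n`. -/
def nMax (nQ nP : ℕ) : ℝ := ((max nQ nP : ℕ) : ℝ)

/-- Level of the coarse bins. -/
def level₁ (θ : Tuning) (d nQ nP : ℕ) : ℕ :=
  ceilStrict (θ.βlo * Real.logb 2 (nMax nQ nP) / (d + 2 * θ.βhi + gammaEff θ nQ nP) ^ 2)

/-- Level of the fine bins. -/
def level₂ (θ : Tuning) (d nQ nP : ℕ) : ℕ :=
  ceilStrict (level₁ θ d nQ nP + θ.βlo⁻¹ * Real.logb 2 (Real.log (nMax nQ nP)))

/-- Level of the grid. -/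
def level₃ (θ : Tuning) (d nQ nP : ℕ) : ℕ :=
  ceilStrict (θ.βhi / θ.βlo * level₁ θ d nQ nP +
    θ.βlo⁻¹ * Real.logb 2 (Real.log (nMax nQ nP)))

/-- Number of samples `1 ≤ i ≤ T` used for the estimation of the smoothness. -/
def sampleSize (θ : Tuning) (d nQ nP : ℕ) : ℕ :=
  ⌊nMax nQ nP ^ (θ.βlo / (d + 2 * θ.βhi + gammaEff θ nQ nP)) *
    Real.log (nMax nQ nP) ^ ((d + θ.βhi + gammaEff θ nQ nP) / θ.βlo)⌋₊

/-- Number of target rounds used for the estimation of the smoothness. -/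
def stepQ (θ : Tuning) (d nQ nP : ℕ) : ℕ := if nQ < nP then 0 else sampleSize θ d nQ nP

/-- Number of source rounds used for the estimation of the smoothness. -/
def stepP (θ : Tuning) (d nQ nP : ℕ) : ℕ := if nQ < nP then sampleSize θ d nQ nP else 0

/-- Local average of the rewards of arm `k` at `x` with bandwidth `2^{-l}` (`0` without data). -/
def localEstimate {d K : ℕ} (D : List (Obs d K)) (l : ℕ) (k : Fin K) (x : Cov d) : ℝ :=
  let S := D.filter (fun z => z.1 ∈ (locate (binsAt d l) x).carrier ∧ z.2.1 = k ∧
    ‖z.1 - x‖ ≤ (1 / 2 : ℝ) ^ l)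
  (S.map (fun z => z.2.2)).sum / S.length

/-- The grid point with integer coordinates `j` on the grid of mesh `2^{-l}`. -/
def gridPoint {d l : ℕ} (j : Fin d → Fin (2 ^ l + 1)) : Cov d :=
  fun i => ((j i : ℕ) : ℝ) * (1 / 2) ^ l

/-- Maximal difference over the arms and over the grid of the estimates at the two levels. -/
def maxDiff {d K : ℕ} (θ : Tuning) (nQ nP : ℕ) (D : List (Obs d K)) : ℝ :=
  ⨆ p : Fin K × (Fin d → Fin (2 ^ level₃ θ d nQ nP + 1)),
    |localEstimate D (level₁ θ d nQ nP) p.1 (gridPoint p.2) -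
      localEstimate D (level₂ θ d nQ nP) p.1 (gridPoint p.2)|

/-- The smoothness estimate, truncated to `[βlo, βhi]`; the convention is `-log 0 = ∞`. -/
def smoothnessEstimate {d K : ℕ} (θ : Tuning) (nQ nP : ℕ) (D : List (Obs d K)) : ℝ :=
  if maxDiff θ nQ nP D = 0 then θ.βhi
  else
    min (max θ.βlo
      (-(Real.logb 2 (maxDiff θ nQ nP D) / level₁ θ d nQ nP) -
        Real.logb 2 (Real.log (nMax nQ nP)) / Real.logb 2 (nMax nQ nP))) θ.βhi

/-! ### Elimination in a single bin -/

/-- Input of the second stage: larger sample size, bound for the Hölder constant, smoothness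
estimate, remaining source data, and the rule by which ties between arms are broken. -/
structure Stage (d K : ℕ) where
  n : ℝ
  C : ℝ
  β : ℝ
  D : List (Obs d K)
  tie : Finset (Fin K) → Fin K

/-- The source observations of arm `k` in the bin `B`. -/
def Stage.obsIn {d K : ℕ} (S : Stage d K) (B : Bin d) (k : Fin K) : List (Obs d K) :=
  S.D.filter (fun z => z.1 ∈ B.carrier ∧ z.2.1 = k)

/-- Number of source observations of arm `k` in `B`. -/
def Stage.count {d K : ℕ} (S : Stage d K) (B : Bin d) (k : Fin K) : ℕ := (S.obsIn B k).length

/-- Mean reward of the source observations of arm `k` in `B` (with `0 / 0 = 0`). -/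
def Stage.srcMean {d K : ℕ} (S : Stage d K) (B : Bin d) (k : Fin K) : ℝ :=
  ((S.obsIn B k).map (fun z => z.2.2)).sum / S.count B k

/-- The confidence bound for arm `k` in `B` after `τ` pulls (with `1 / 0 = ∞`). -/
def Stage.conf {d K : ℕ} (S : Stage d K) (B : Bin d) (k : Fin K) (τ : ℕ) : EReal :=
  if τ + S.count B k = 0 then ⊤
  else ((max (2 * √(2 / ((τ : ℝ) + S.count B k) * Real.log S.n))
    (2 * S.C * B.side ^ S.β) : ℝ) : EReal)

/-- The number of pulls of arm `k` in `B` needed to balance deviation and bias. -/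
def Stage.limit {d K : ℕ} (S : Stage d K) (B : Bin d) (k : Fin K) : ℕ :=
  sInf {τ : ℕ | S.conf B k τ ≤ ((2 * S.C * B.side ^ S.β : ℝ) : EReal)}

/-- State of the elimination procedure in a bin: active arms, numbers of pulls, mean rewards,
current maximal lower confidence bound, and the arms still to be visited in the current pass. -/
structure Node (K : ℕ) where
  active : Finset (Fin K)
  pulls : Fin K → ℕ
  mean : Fin K → ℝ
  lower : EReal
  queue : List (Fin K)

/-- Starting state of the elimination procedure in `B` with active arms `I`. -/
def Stage.start {d K : ℕ} (S : Stage d K) (B : Bin d) (I : Finset (Fin K)) : Node K where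
  active := I
  pulls := fun _ => 0
  mean := S.srcMean B
  lower := I.sup (fun k => (S.srcMean B k : EReal) - S.conf B k 0)
  queue := []

/-- Continue a pass over the arms in the given list until an arm is pulled (returned as `some`) or
the list is exhausted: arms below their limit are pulled if they pass the test and eliminated
otherwise; other arms are skipped. -/
def Stage.scan {d K : ℕ} (S : Stage d K) (B : Bin d) :
    List (Fin K) → Node K → Node K × Option (Fin K)
  | [], s => ({ s with queue := [] }, none)
  | k :: q, s =>
      if s.pulls k < S.limit B k then
        if s.lower ≤ (s.mean k : EReal) + S.conf B k (s.pulls k) then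
          ({ s with queue := q }, some k)
        else Stage.scan S B q { s with active := s.active.erase k }
      else Stage.scan S B q s

/-- An active arm with the largest mean reward. -/
def Stage.best {d K : ℕ} (S : Stage d K) (s : Node K) : Fin K :=
  S.tie (s.active.filter (fun k => ∀ j ∈ s.active, s.mean j ≤ s.mean k))

/-- The next arm pulled by the elimination procedure: finish the current pass; if nothing is pulled,
make a new pass over the active arms; if nothing is pulled then either, all active arms have
reached their limits and the best one is pulled. -/
def Stage.next {d K : ℕ} (S : Stage d K) (B : Bin d) (s : Node K) : Node K × Fin K :=
  match S.scan B s.queue s with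
  | (s₁, some k) => (s₁, k)
  | (s₁, none) =>
      match S.scan B s₁.active.sort s₁ with
      | (s₂, some k) => (s₂, k)
      | (s₂, none) => (s₂, S.best s₂)

/-- Update after arm `k` was pulled in `B` with reward `y`; the maximal lower confidence bound is
recomputed only during the exploration of `k`. -/
def Stage.observe {d K : ℕ} (S : Stage d K) (B : Bin d) (s : Node K) (k : Fin K) (y : ℝ) :
    Node K :=
  let pulls' := Function.update s.pulls k (s.pulls k + 1)
  let m : ℝ := (S.count B k : ℝ) + ((s.pulls k : ℝ) + 1)
  let mean' := Function.update s.mean k ((y + (m - 1) * s.mean k) / m)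
  { active := s.active
    pulls := pulls'
    mean := mean'
    lower :=
      if s.pulls k < S.limit B k then
        s.active.sup (fun j => (mean' j : EReal) - S.conf B j (pulls' j))
      else s.lower
    queue := s.queue }

/-! ### Adaptive partition -/

/-- State of the second stage: the current partition and the states of the bins. -/
structure Tree (d K : ℕ) where
  leaves : Finset (Bin d)
  node : Bin d → Node K

/-- Starting state: the trivial partition, all arms active. -/
def Stage.startTree {d K : ℕ} (S : Stage d K) : Tree d K where
  leaves := {root d}
  node := fun B => S.start B Finset.univ

/-- The arms of `B` handed over to the children when `B` is split. -/
def Stage.passOn {d K : ℕ} (S : Stage d K) (B : Bin d) (I : Finset (Fin K)) : Finset (Fin K) :=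
  if ∀ k ∈ I, S.limit B k = 0 then
    I.filter (fun k => I.sup (fun j => (S.srcMean B j : EReal) - S.conf B j 0) ≤
      (S.srcMean B k : EReal) + S.conf B k 0)
  else I

/-- Replace the bin `B` of the partition by its children. -/
def Stage.split {d K : ℕ} (S : Stage d K) (B : Bin d) (T : Tree d K) : Tree d K where
  leaves := T.leaves.erase B ∪ B.children
  node := fun B' =>
    if B' ∈ B.children then S.start B' (S.passOn B (T.node B).active) else T.node B'

/-- The bin has several active arms and all of them have reached their limits. -/
def Stage.exhausted {d K : ℕ} (S : Stage d K) (B : Bin d) (T : Tree d K) : Prop :=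
  1 < (T.node B).active.card ∧ ∀ k ∈ (T.node B).active, S.limit B k ≤ (T.node B).pulls k

/-- Iterate `body` as long as `c` holds (only used for loops that terminate). -/
def whileLoop {σ : Type} (c : σ → Prop) (body : σ → σ) (s : σ) : σ :=
  if h : ∃ m : ℕ, ¬ c (body^[m] s) then body^[Nat.find h] s else s

/-- Split bins containing `x` until the one at hand is not exhausted. -/
def Stage.refine {d K : ℕ} (S : Stage d K) (x : Cov d) (T : Tree d K) : Tree d K :=
  whileLoop (fun T' : Tree d K => S.exhausted (locate T'.leaves x) T')
    (fun T' => S.split (locate T'.leaves x) T') T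

/-- The arm pulled at the covariate `x`. -/
def Stage.arm {d K : ℕ} (S : Stage d K) (T : Tree d K) (x : Cov d) : Fin K :=
  (S.next (locate (S.refine x T).leaves x)
    ((S.refine x T).node (locate (S.refine x T).leaves x))).2

/-- The state after a round with covariate `x` and observed reward `y`. -/
def Stage.step {d K : ℕ} (S : Stage d K) (T : Tree d K) (x : Cov d) (y : ℝ) : Tree d K :=
  let T' := S.refine x T
  let B := locate T'.leaves x
  let r := S.next B (T'.node B)
  { leaves := T'.leaves, node := Function.update T'.node B (S.observe B r.1 r.2 y) }

/-! ### The adaptive policy -/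

/-- The data from which the smoothness is estimated. -/
def estimationData {d K : ℕ} (θ : Tuning) (nQ nP : ℕ) (src hist : List (Obs d K)) :
    List (Obs d K) :=
  if nQ < nP then src.take (sampleSize θ d nQ nP) else hist.take (sampleSize θ d nQ nP)

/-- The input of the second stage computed from the data of the first stage. -/
def stageOf {d K : ℕ} (θ : Tuning) (tie : Finset (Fin K) → Fin K) (nQ nP : ℕ)
    (src hist : List (Obs d K)) : Stage d K where
  n := nMax nQ nP
  C := θ.Chi
  β := smoothnessEstimate θ nQ nP (estimationData θ nQ nP src hist)
  D := src.drop (stepP θ d nQ nP)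
  tie := tie

/-- The two-stage adaptive policy: pull uniformly random arms in the first `stepQ` rounds; then
run the elimination scheme on the adaptive partition with the estimated smoothness. -/
def adaptivePolicy {d K : ℕ} (θ : Tuning) (tie : Finset (Fin K) → Fin K) (nQ nP : ℕ) :
    Policy d K :=
  fun src hist x u =>
    if hist.length < stepQ θ d nQ nP then u
    else
      let S := stageOf θ tie nQ nP src hist
      S.arm ((hist.drop (stepQ θ d nQ nP)).foldl (fun T z => S.step T z.1 z.2.2) S.startTree) x

end

end TransferBandit

namespace TransferBandit

noncomputable section

open scoped Classical

/-! ### Geometry of the dyadic bins -/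

variable {d K : ℕ}

/-! Elimination. Fix the source data and the smoothness estimate `β̂`, and suppose that every mean
lies within its confidence bound of `f k x`. Then an optimal arm never fails a test, and an arm
still active in `B` has, at every point of `B`, a gap of at most a constant times `|A| ^ β̂` for
each proper ancestor `A` of `B` (`Stage.FineInv.step`, `Stage.FineInv.child`, `round_spec`). The
delicate case is an arm whose source sample already fills its quota in a bin while that of another
arm does not, so that the arm is not tested there. Source data are balanced between the arms up to a
constant, so a fixed number of levels higher the source sample was sufficient for all arms, and the
test made there controls the gap.

Counting. A bin is used at most `2 * ∑ k, limit` times while several arms are active (`visits_le`).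
This is zero at the levels below `lP`, where the source data suffice, and otherwise of order `log n
* 2 ^ (2 l β)`. A visit at level `l` costs at most `w_l`, which is `2 ^ (-l β)` up to logarithms,
and only if some arm has a positive gap of at most `w_l` at the covariate. Splitting looks only at
the bin reached, so given the past and the bin the covariate has the law `Q_X` conditioned on the
bin. A budget with mean-zero increments, up to the charge for deep levels, turns this into a bound
for the expected cost (`Budget.integral_round`, `Budget.lintegral_regret_le`). By the density and
margin conditions level `l` contributes `2 ^ (l (d + 2β)) * 2 ^ (-l β (1 + α))`, which increases in
`l` because `α β ≤ d`. So the deepest level `top = max lP lQ` governs the sum, and all deeper rounds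
are charged at the price of `top` (`secondBudget_le`). Taking `lP` and `lQ` as large as the two
samples permit makes `2 ^ (top (2β + d))` comparable to the effective sample size up to a logarithm
(`rate_of_levels`).

Noise. For each bin, arm, sign and possible number `m` of observations there is an exponential
supermartingale that stops at `m` observations. It is `0` until the first observation. Hence the sum
over all bins grows in each round by at most one per sign and per `m`, however fine the partition
is. On the event that this sum is large, a small multiple of it pays the trivial regret.

Smoothness. Self-similarity forces an oscillation of order `2 ^ (-β l₁)` in some bin of level `l₁`.
The coarse estimate is constant at interior grid points of that bin, while the fine estimate follows
`f`, so the maximal difference is of exact order `2 ^ (-β l₁)` (`maxDiff_bounds`). Taking logarithms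
and subtracting `log log n / log n` gives `β̂ ≤ β` with `β - β̂ = O(log log n / log n)`. The first
inequality keeps the bias bounds valid. The second costs a power of `log n` at the levels that can
be reached (`scale_le_weight`).

Measurability. The policy is never shown to be measurable. `∫⁻` of an arbitrary function is a lower
integral, for which the inequalities `∫ over a product ≤ iterated integral` still hold, and only
these are used for the regret. Points on dyadic boundaries are null, so the partition is analysed at
generic points, which have one bin per level. -/

theorem mem_binsAt {l : ℕ} {B : Bin d} : B ∈ binsAt d l ↔ B.1 = l := by
  unfold binsAt
  simp only [Finset.mem_image, Finset.mem_univ, true_and]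
  constructor
  · rintro ⟨k, rfl⟩; rfl
  · rintro rfl; exact ⟨B.2, rfl⟩

theorem card_binsAt (l : ℕ) : (binsAt d l).card = 2 ^ (l * d) := by
  unfold binsAt
  rw [Finset.card_image_of_injective]
  · simp [pow_mul]
  · intro a b h
    simpa using h

theorem half_pow_pos (l : ℕ) : (0 : ℝ) < (1 / 2) ^ l := by positivity

theorem Bin.side_pos (B : Bin d) : 0 < B.side := half_pow_pos _

theorem Bin.side_le_one (B : Bin d) : B.side ≤ 1 :=
  pow_le_one₀ (by norm_num) (by norm_num)

theorem Bin.dist_le {B : Bin d} {x y : Cov d} (hx : x ∈ B.carrier) (hy : y ∈ B.carrier) :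
    ‖x - y‖ ≤ B.side := by
  rw [pi_norm_le_iff_of_nonneg B.side_pos.le]
  intro i
  have h1 := hx i
  have h2 := hy i
  unfold Bin.side
  rw [Pi.sub_apply, Real.norm_eq_abs, abs_le]
  constructor <;> nlinarith

theorem Bin.carrier_subset_cube (B : Bin d) : B.carrier ⊆ cube d := by
  intro x hx
  have hs := half_pow_pos B.1
  have h2 : (2 : ℝ) ^ B.1 * (1 / 2) ^ B.1 = 1 := by rw [← mul_pow]; norm_num
  constructor
  · intro i
    refine le_trans ?_ (hx i).1
    simp only [Pi.zero_apply]; positivity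
  · intro i
    refine le_trans (hx i).2 ?_
    have : ((B.2 i : ℕ) : ℝ) + 1 ≤ 2 ^ B.1 := by exact_mod_cast (B.2 i).2
    simp only [Pi.one_apply]
    calc _ ≤ (2 : ℝ) ^ B.1 * (1 / 2) ^ B.1 := by gcongr
      _ = 1 := h2

/-- The center of a bin. -/
def Bin.center (B : Bin d) : Cov d := fun i => (((B.2 i : ℕ) : ℝ) + 1 / 2) * (1 / 2) ^ B.1

/-- In the sup norm a cube is a ball, so the density and transfer conditions, which concern balls,
apply directly to bins. -/
theorem Bin.carrier_eq_closedBall (B : Bin d) :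
    B.carrier = Metric.closedBall B.center (B.side / 2) := by
  ext x
  have hs := B.side_pos
  rw [Metric.mem_closedBall, dist_pi_le_iff (by positivity)]
  refine forall_congr' fun i => ?_
  rw [Real.dist_eq, abs_le]
  unfold Bin.center Bin.side
  constructor
  · rintro ⟨h1, h2⟩; constructor <;> nlinarith
  · rintro ⟨h1, h2⟩; constructor <;> nlinarith

theorem Bin.center_mem (B : Bin d) : B.center ∈ B.carrier := by
  rw [B.carrier_eq_closedBall]
  exact Metric.mem_closedBall_self (by have := B.side_pos; positivity)

theorem Bin.isClosed_carrier (B : Bin d) : IsClosed B.carrier := by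
  rw [B.carrier_eq_closedBall]; exact Metric.isClosed_closedBall

theorem Bin.measurableSet_carrier (B : Bin d) : MeasurableSet B.carrier :=
  B.isClosed_carrier.measurableSet

theorem root_carrier : (root d).carrier = cube d := by
  ext x
  simp only [Bin.carrier, root, cube, Set.mem_ofPred_eq, Set.mem_Icc, Pi.le_def]
  simp
  exact forall_and

/-- The level-`l` bin containing `x` (the lower one on dyadic boundaries). -/
def cell (l : ℕ) (x : Cov d) : Bin d :=
  ⟨l, fun i => ⟨min ⌊x i * 2 ^ l⌋₊ (2 ^ l - 1), by
    have : 0 < 2 ^ l := by positivity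
    omega⟩⟩

@[simp] theorem cell_fst (l : ℕ) (x : Cov d) : (cell l x).1 = l := rfl

theorem half_pow_eq (l : ℕ) : ((1 : ℝ) / 2) ^ l = (2 ^ l)⁻¹ := by
  rw [one_div, inv_pow]

theorem mem_carrier_iff {B : Bin d} {x : Cov d} :
    x ∈ B.carrier ↔ ∀ i, ((B.2 i : ℕ) : ℝ) ≤ x i * 2 ^ B.1 ∧ x i * 2 ^ B.1 ≤ (B.2 i : ℕ) + 1 := by
  refine forall_congr' fun i => ?_
  rw [half_pow_eq, ← div_eq_mul_inv, ← div_eq_mul_inv, div_le_iff₀ (by positivity),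
    le_div_iff₀ (by positivity)]

theorem mem_cell {x : Cov d} (hx : x ∈ cube d) (l : ℕ) : x ∈ (cell l x).carrier := by
  rw [mem_carrier_iff]
  intro i
  have h0 : 0 ≤ x i := hx.1 i
  have h1 : x i ≤ 1 := hx.2 i
  have hp : (0 : ℝ) < 2 ^ l := by positivity
  have h0' : 0 ≤ x i * 2 ^ l := by positivity
  have h1' : x i * 2 ^ l ≤ 2 ^ l := by nlinarith
  have hf := Nat.floor_le h0'
  have hf2 := Nat.lt_floor_add_one (x i * 2 ^ l)
  have hpn : 1 ≤ 2 ^ l := Nat.one_le_two_pow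
  simp only [cell]
  rcases le_total ⌊x i * 2 ^ l⌋₊ (2 ^ l - 1) with h | h
  · rw [min_eq_left h]
    exact ⟨hf, hf2.le⟩
  · rw [min_eq_right h]
    have h3 : ((2 ^ l - 1 : ℕ) : ℝ) = 2 ^ l - 1 := by push_cast [Nat.cast_sub hpn]; ring
    have h4 : ((2 ^ l - 1 : ℕ) : ℝ) ≤ (⌊x i * 2 ^ l⌋₊ : ℝ) := by exact_mod_cast h
    exact ⟨h4.trans hf, by rw [h3]; linarith⟩

/-- Points of the cube none of whose coordinates is dyadic. -/
def Generic (x : Cov d) : Prop :=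
  x ∈ cube d ∧ ∀ i, ∀ l j : ℕ, x i * 2 ^ l ≠ (j : ℝ)

/-- A generic point is interior to every bin containing it, so it has one bin per level and the rule
for ambiguous bins in `locate` plays no role. -/
theorem Generic.eq_cell {x : Cov d} (hx : Generic x) {B : Bin d} (hB : x ∈ B.carrier) :
    B = cell B.1 x := by
  obtain ⟨l, a⟩ := B
  rw [mem_carrier_iff] at hB
  simp only [cell]
  congr 1
  funext i
  apply Fin.ext
  have h := hB i
  simp only at h ⊢
  have h1 := hx.2 i l ((a i : ℕ) + 1)
  push_cast at h1
  have h2 : ⌊x i * 2 ^ l⌋₊ = a i := by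
    rw [Nat.floor_eq_iff (le_trans (by positivity) h.1)]
    exact ⟨h.1, lt_of_le_of_ne h.2 h1⟩
  rw [h2]
  have := (a i).2
  omega

theorem Bin.mem_children {B B' : Bin d} :
    B' ∈ B.children ↔ B'.1 = B.1 + 1 ∧ B'.carrier ⊆ B.carrier := by
  rw [Bin.children, Finset.mem_filter, mem_binsAt]

/-- In units of the finer mesh the two cells are `[2a, 2a + 2]` and `[c, c + 1]` in each coordinate.
A common interior point gives `2a < c + 1` and `c < 2a + 2`, and for integers this is containment.
-/
theorem cell_succ_mem_children {x : Cov d} (hx : Generic x) (l : ℕ) :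
    cell (l + 1) x ∈ (cell l x).children := by
  rw [Bin.mem_children]
  refine ⟨rfl, fun y hy => ?_⟩
  rw [mem_carrier_iff] at hy ⊢
  intro i
  have h := hy i
  have hl := (mem_carrier_iff.1 (mem_cell hx.1 l)) i
  have hl' := (mem_carrier_iff.1 (mem_cell hx.1 (l + 1))) i
  have hg := hx.2 i l (((cell l x).2 i : ℕ) + 1)
  have hg' := hx.2 i (l + 1) (((cell (l + 1) x).2 i : ℕ) + 1)
  simp only [cell_fst] at h hl hl' hg hg' ⊢
  generalize (((cell l x).2 i : ℕ)) = a at *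
  generalize (((cell (l + 1) x).2 i : ℕ)) = c at *
  rw [pow_succ] at h hl' hg'
  have e1 : (c : ℝ) < 2 * (a + 1) := by
    have : x i * 2 ^ l < a + 1 := lt_of_le_of_ne hl.2 (by exact_mod_cast hg)
    nlinarith
  have e2 : (2 * a : ℝ) < c + 1 := by
    have : x i * (2 ^ l * 2) < c + 1 := lt_of_le_of_ne hl'.2 (by exact_mod_cast hg')
    nlinarith
  have e1' : c < 2 * (a + 1) := by exact_mod_cast e1
  have e2' : 2 * a < c + 1 := by exact_mod_cast e2
  have e3 : (2 * a : ℝ) ≤ c := by exact_mod_cast (by omega : 2 * a ≤ c)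
  have e4 : (c : ℝ) + 1 ≤ 2 * a + 2 := by exact_mod_cast (by omega : c + 1 ≤ 2 * a + 2)
  constructor <;> nlinarith

theorem cell_carrier_anti {x : Cov d} (hx : Generic x) {l l' : ℕ} (h : l ≤ l') :
    (cell l' x).carrier ⊆ (cell l x).carrier := by
  induction l', h using Nat.le_induction with
  | base => exact subset_rfl
  | succ m _ ih => exact ((Bin.mem_children.1 (cell_succ_mem_children hx m)).2).trans ih

theorem cell_eq_of_mem {x y : Cov d} (hx : Generic x) (hy : Generic y) {l : ℕ}
    (h : y ∈ (cell l x).carrier) {l' : ℕ} (hl : l' ≤ l) : cell l' y = cell l' x :=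
  (hy.eq_cell (cell_carrier_anti hx hl h)).symm

theorem locate_mem {L : Finset (Bin d)} {x : Cov d} (h : ∃ B ∈ L, x ∈ B.carrier) :
    locate L x ∈ L ∧ x ∈ (locate L x).carrier := by
  have hne : (L.filter (fun B => x ∈ B.carrier)).Nonempty := by
    obtain ⟨B, hB, hx⟩ := h
    exact ⟨B, Finset.mem_filter.2 ⟨hB, hx⟩⟩
  have hs := (Finset.exists_min_image (L.filter (fun B => x ∈ B.carrier)) Bin.centerSq
    hne).choose_spec.1
  rw [Finset.mem_filter] at hs
  rw [locate, dif_pos hne]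
  exact hs

theorem locate_eq {L : Finset (Bin d)} {x : Cov d} {B : Bin d} (hB : B ∈ L) (hx : x ∈ B.carrier)
    (hu : ∀ B' ∈ L, x ∈ B'.carrier → B' = B) : locate L x = B :=
  let h := locate_mem ⟨B, hB, hx⟩
  hu _ h.1 h.2

theorem locate_binsAt {x : Cov d} (hx : x ∈ cube d) (l : ℕ) :
    (locate (binsAt d l) x).1 = l ∧ x ∈ (locate (binsAt d l) x).carrier := by
  have h := locate_mem (L := binsAt d l) ⟨cell l x, mem_binsAt.2 rfl, mem_cell hx l⟩
  exact ⟨mem_binsAt.1 h.1, h.2⟩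

/-- Off the mesh a coordinate determines the index as its floor; on the mesh the index `ceil - 1` is
possible too. Two choices per coordinate give `2 ^ d`. -/
theorem card_bins_containing_le (l : ℕ) (x : Cov d) :
    ((binsAt d l).filter (fun B => x ∈ B.carrier)).card ≤ 2 ^ d := by
  set s : Fin d → Finset ℕ := fun i => {⌊x i * 2 ^ l⌋₊, ⌈x i * 2 ^ l⌉₊ - 1}
  have hcard : (Fintype.piFinset s).card ≤ 2 ^ d := by
    rw [Fintype.card_piFinset]
    calc ∏ i, (s i).card ≤ ∏ _i : Fin d, 2 := Finset.prod_le_prod' fun i _ => Finset.card_le_two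
      _ = 2 ^ d := by simp
  refine le_trans (Finset.card_le_card_of_injOn
    (f := fun B : Bin d => fun i => ((B.2 i : ℕ))) ?_ ?_) hcard
  · intro B hB
    rw [Finset.mem_coe, Finset.mem_filter, mem_binsAt] at hB
    obtain ⟨hBl, hB⟩ := hB
    rw [mem_carrier_iff] at hB
    rw [Finset.mem_coe, Fintype.mem_piFinset]
    intro i
    obtain ⟨l', a⟩ := B
    obtain rfl : l' = l := hBl
    have h := hB i
    simp only [s, Finset.mem_insert, Finset.mem_singleton]
    rcases h.2.lt_or_eq with h2 | h2
    · left
      exact ((Nat.floor_eq_iff (le_trans (Nat.cast_nonneg _) h.1)).2 ⟨h.1, h2⟩).symm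
    · right
      have : x i * 2 ^ l' = ((a i + 1 : ℕ) : ℝ) := by push_cast; exact h2
      rw [this, Nat.ceil_natCast]; omega
  · intro B hB B' hB' h
    rw [Finset.mem_coe, Finset.mem_filter, mem_binsAt] at hB hB'
    obtain ⟨l1, a1⟩ := B
    obtain ⟨l2, a2⟩ := B'
    obtain rfl : l1 = l := hB.1
    obtain rfl : l2 = l1 := hB'.1
    congr 1
    funext i
    exact Fin.ext (congrFun h i)

/-- Summing indicators of the bins of one level counts each point at most `2 ^ d` times. -/
theorem sum_measure_bins_le (μ : Measure (Cov d)) (l : ℕ) {s : Set (Cov d)} :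
    ∑ B ∈ binsAt d l, μ (s ∩ B.carrier) ≤ 2 ^ d * μ s := by
  have h1 : ∀ B ∈ binsAt d l, μ (s ∩ B.carrier) =
      ∫⁻ x in s, B.carrier.indicator 1 x ∂μ := by
    intro B _
    rw [lintegral_indicator_one B.measurableSet_carrier,
      Measure.restrict_apply B.measurableSet_carrier, Set.inter_comm]
  rw [Finset.sum_congr rfl h1, ← lintegral_finsetSum _
    (fun B _ => measurable_one.indicator B.measurableSet_carrier)]
  calc _ ≤ ∫⁻ _ in s, (2 : ENNReal) ^ d ∂μ := by
        refine lintegral_mono fun x => ?_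
        have := card_bins_containing_le l x
        simp only [Set.indicator_apply, Pi.one_apply]
        rw [← Finset.sum_filter, Finset.sum_const, nsmul_eq_mul, mul_one]
        exact_mod_cast this
    _ = 2 ^ d * μ s := by simp

/-- If every bin of every large level has positive mass then the cube lies in the support. -/
theorem cube_subset_support {μ : Measure (Cov d)} {l₀ : ℕ}
    (h : ∀ l, l₀ ≤ l → ∀ B ∈ binsAt d l, 0 < μ B.carrier) : cube d ⊆ μ.support := by
  intro x hx
  rw [Measure.mem_support_iff_forall]
  intro U hU
  obtain ⟨ε, hε, hεU⟩ := Metric.mem_nhds_iff.1 hU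
  obtain ⟨m, hm⟩ := exists_pow_lt_of_lt_one hε (by norm_num : (1 / 2 : ℝ) < 1)
  set l := max l₀ m
  refine lt_of_lt_of_le (h l (le_max_left _ _) (cell l x) (mem_binsAt.2 rfl)) (measure_mono ?_)
  refine subset_trans (fun y hy => ?_) hεU
  rw [Metric.mem_ball, dist_eq_norm]
  refine lt_of_le_of_lt (Bin.dist_le hy (mem_cell hx l)) (lt_of_le_of_lt ?_ hm)
  exact pow_le_pow_of_le_one (by norm_num) (by norm_num) (le_max_right _ _)

/-- The slice is covered by `2 ^ (l (d - 1))` balls of radius `2 ^ (-l)` centered in the slice, each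
of mass at most `qhi * 2 ^ (-l d)`; the total is of order `2 ^ (-l)`. -/
theorem hyperplane_null {μ : Measure (Cov d)} [IsFiniteMeasure μ] {qhi : ℝ}
    (h : ∀ x ∈ cube d, ∀ r : ℝ, 0 < r → r ≤ 1 → μ.real (Metric.closedBall x r) ≤ qhi * r ^ d)
    (i : Fin d) (c : ℝ) : μ (cube d ∩ {x | x i = c}) = 0 := by
  have hd : 0 < d := i.pos
  by_cases hc : c ∈ Set.Icc (0 : ℝ) 1
  swap
  · have : cube d ∩ {x : Cov d | x i = c} = ∅ := by
      rw [Set.eq_empty_iff_forall_notMem]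
      rintro x ⟨hx, rfl⟩
      exact hc ⟨hx.1 i, hx.2 i⟩
    rw [this, measure_empty]
  have hq : 0 ≤ qhi := by
    have := h 0 ⟨le_rfl, zero_le_one⟩ 1 one_pos le_rfl
    have h2 : 0 ≤ μ.real (Metric.closedBall (0 : Cov d) 1) := measureReal_nonneg
    simp at this; linarith
  set H : Set (Cov d) := cube d ∩ {x | x i = c}
  have key : ∀ l : ℕ, μ.real H ≤ 2 ^ d * qhi * (1 / 2) ^ l := by
    intro l
    let P : ({j : Fin d // j ≠ i} → Fin (2 ^ l)) → Cov d := fun a j =>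
      if hj : j ≠ i then ((a ⟨j, hj⟩ : ℕ) : ℝ) * (1 / 2) ^ l else c
    have hP : ∀ a, P a ∈ cube d := by
      intro a
      have h2 : (2 : ℝ) ^ l * (1 / 2) ^ l = 1 := by rw [← mul_pow]; norm_num
      constructor <;> intro j <;> by_cases hj : j ≠ i
      · simp only [P, dif_pos hj, Pi.zero_apply]; positivity
      · simp only [P, dif_neg hj, Pi.zero_apply]; exact hc.1
      · simp only [P, dif_pos hj, Pi.one_apply]
        have : ((a ⟨j, hj⟩ : ℕ) : ℝ) ≤ 2 ^ l := by exact_mod_cast (a ⟨j, hj⟩).2.le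
        calc _ ≤ (2 : ℝ) ^ l * (1 / 2) ^ l := by gcongr
          _ = 1 := h2
      · simp only [P, dif_neg hj, Pi.one_apply]; exact hc.2
    have hcov : H ⊆ ⋃ a ∈ (Finset.univ : Finset ({j : Fin d // j ≠ i} → Fin (2 ^ l))),
        Metric.closedBall (P a) ((1 / 2) ^ l) := by
      rintro x ⟨hx, hxi⟩
      simp only [Set.mem_iUnion]
      refine ⟨fun j => (cell l x).2 j, Finset.mem_univ _, ?_⟩
      rw [Metric.mem_closedBall, dist_pi_le_iff (by positivity)]
      intro j
      by_cases hj : j ≠ i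
      · have := mem_cell hx l j
        simp only [P, dif_pos hj, cell_fst] at this ⊢
        rw [Real.dist_eq, abs_le]
        constructor <;> nlinarith [half_pow_pos l]
      · push Not at hj
        subst hj
        have : P (fun j => (cell l x).2 j) j = c := by simp [P]
        rw [this, show x j = c from hxi, dist_self]; positivity
    calc μ.real H ≤ μ.real (⋃ a ∈ (Finset.univ : Finset ({j : Fin d // j ≠ i} → Fin (2 ^ l))),
          Metric.closedBall (P a) ((1 / 2) ^ l)) := measureReal_mono hcov (measure_ne_top _ _)
      _ ≤ ∑ a : {j : Fin d // j ≠ i} → Fin (2 ^ l),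
          μ.real (Metric.closedBall (P a) ((1 / 2) ^ l)) := measureReal_biUnion_finset_le _ _
      _ ≤ ∑ _a : {j : Fin d // j ≠ i} → Fin (2 ^ l), qhi * ((1 / 2) ^ l) ^ d :=
          Finset.sum_le_sum fun a _ => h _ (hP a) _ (by positivity)
            (pow_le_one₀ (by norm_num) (by norm_num))
      _ = ((2 : ℝ) ^ l) ^ (d - 1) * (qhi * ((1 / 2) ^ l) ^ d) := by
          have hcard : Fintype.card {j : Fin d // j ≠ i} = d - 1 := by
            rw [Fintype.card_subtype_compl]; simp
          simp [hcard]
      _ = qhi * (1 / 2) ^ l := by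
          obtain ⟨e, rfl⟩ : ∃ e, d = e + 1 := ⟨d - 1, by omega⟩
          have h2 : (2 : ℝ) ^ l * (1 / 2) ^ l = 1 := by rw [← mul_pow]; norm_num
          rw [Nat.add_sub_cancel, pow_succ]
          calc _ = ((2 : ℝ) ^ l * (1 / 2) ^ l) ^ e * (qhi * (1 / 2) ^ l) := by rw [mul_pow]; ring
            _ = _ := by rw [h2]; ring
      _ ≤ 2 ^ d * qhi * (1 / 2) ^ l := by
          have : (1 : ℝ) ≤ 2 ^ d := one_le_pow₀ (by norm_num)
          have h3 : 0 ≤ qhi * (1 / 2) ^ l := by positivity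
          nlinarith
  have hlim : Filter.Tendsto (fun l : ℕ => 2 ^ d * qhi * (1 / 2 : ℝ) ^ l) Filter.atTop (nhds 0) := by
    have := (tendsto_pow_atTop_nhds_zero_of_lt_one (by norm_num : (0 : ℝ) ≤ 1 / 2)
      (by norm_num)).const_mul (2 ^ d * qhi)
    simpa using this
  have h0 : μ.real H ≤ 0 := ge_of_tendsto' hlim key
  have h1 : μ.real H = 0 := le_antisymm h0 measureReal_nonneg
  exact (measureReal_eq_zero_iff).1 h1

theorem ae_generic {μ : Measure (Cov d)} [IsFiniteMeasure μ] {qhi : ℝ} (hcube : μ (cube d)ᶜ = 0)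
    (h : ∀ x ∈ cube d, ∀ r : ℝ, 0 < r → r ≤ 1 → μ.real (Metric.closedBall x r) ≤ qhi * r ^ d) :
    ∀ᵐ x ∂μ, Generic x := by
  have h1 : ∀ᵐ x ∂μ, x ∈ cube d := by
    rw [ae_iff]; exact hcube
  have h2 : ∀ᵐ x ∂μ, ∀ i, ∀ l j : ℕ, ¬ (x ∈ cube d ∩ {x | x i = (j : ℝ) / 2 ^ l}) := by
    rw [ae_all_iff]; intro i
    rw [ae_all_iff]; intro l
    rw [ae_all_iff]; intro j
    rw [ae_iff]
    simp only [not_not]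
    exact hyperplane_null h i ((j : ℝ) / 2 ^ l)
  filter_upwards [h1, h2] with x hx1 hx2
  refine ⟨hx1, fun i l j hj => hx2 i l j ⟨hx1, ?_⟩⟩
  rw [Set.mem_ofPred_eq, eq_div_iff (by positivity)]
  exact hj

/-! ### Lower integrals and product measures -/

section Tools

variable {α' β' Ω : Type*} [MeasurableSpace α'] [MeasurableSpace β'] [MeasurableSpace Ω]

/-- A lower integral is attained by a measurable minorant, for which the iterated integral is exact.
This half of Fubini's theorem holds for arbitrary `F`. -/
theorem lintegral_compProd_le (μ : Measure α') [SFinite μ] (κ : Kernel α' β') [IsSFiniteKernel κ]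
    (F : α' × β' → ENNReal) :
    ∫⁻ z, F z ∂(μ.compProd κ) ≤ ∫⁻ x, ∫⁻ y, F (x, y) ∂(κ x) ∂μ := by
  obtain ⟨g, hg, hgF, he⟩ := exists_measurable_le_lintegral_eq (μ.compProd κ) F
  rw [he, Measure.lintegral_compProd hg]
  exact lintegral_mono fun x => lintegral_mono fun y => hgF (x, y)

/-- Resampling one coordinate of an i.i.d. sequence preserves its law. This replaces conditioning on
the other coordinates and is compatible with lower integrals. -/
theorem infinitePi_map_update (ν : Measure Ω) [IsProbabilityMeasure ν] (t : ℕ) :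
    ((Measure.infinitePi (fun _ : ℕ => ν)).prod ν).map
      (fun p : (ℕ → Ω) × Ω => Function.update p.1 t p.2) = Measure.infinitePi (fun _ : ℕ => ν) := by
  have hm : Measurable (fun p : (ℕ → Ω) × Ω => Function.update p.1 t p.2) := by
    refine measurable_pi_iff.2 fun i => ?_
    by_cases hi : i = t
    · subst hi; simpa using measurable_snd
    · simp only [Function.update_of_ne hi]
      exact (measurable_pi_apply i).comp measurable_fst
  refine Measure.eq_infinitePi _ fun s A hA => ?_
  rw [Measure.map_apply hm (.pi s.countable_toSet fun i _ => hA i)]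
  by_cases ht : t ∈ s
  · have : (fun p : (ℕ → Ω) × Ω => Function.update p.1 t p.2) ⁻¹' (Set.pi s A) =
        (Set.pi (s.erase t) A) ×ˢ (A t) := by
      ext ⟨v, z⟩
      simp only [Set.mem_preimage, Set.mem_pi, Set.mem_prod, Finset.mem_coe, Finset.mem_erase]
      constructor
      · intro h
        refine ⟨fun i hi => ?_, ?_⟩
        · simpa [Function.update_of_ne hi.1] using h i hi.2
        · simpa using h t ht
      · rintro ⟨h1, h2⟩ i hi
        by_cases hit : i = t
        · subst hit; simpa using h2
        · simpa [Function.update_of_ne hit] using h1 i ⟨hit, hi⟩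
    rw [this, Measure.prod_prod, Measure.infinitePi_pi _ (fun i _ => hA i), mul_comm,
      Finset.mul_prod_erase s (fun i => ν (A i)) ht]
  · have : (fun p : (ℕ → Ω) × Ω => Function.update p.1 t p.2) ⁻¹' (Set.pi s A) =
        (Set.pi s A) ×ˢ Set.univ := by
      ext ⟨v, z⟩
      simp only [Set.mem_preimage, Set.mem_pi, Set.mem_prod, Finset.mem_coe, Set.mem_univ, and_true]
      refine forall₂_congr fun i hi => ?_
      rw [Function.update_of_ne (fun h : i = t => ht (h ▸ hi))]
    rw [this, Measure.prod_prod, Measure.infinitePi_pi _ (fun i _ => hA i), measure_univ, mul_one]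

/-- Integrating out one coordinate, for arbitrary functions (lower integrals). -/
theorem lintegral_infinitePi_le (ν : Measure Ω) [IsProbabilityMeasure ν] (t : ℕ)
    (F : (ℕ → Ω) → ENNReal) :
    ∫⁻ v, F v ∂(Measure.infinitePi (fun _ : ℕ => ν)) ≤
      ∫⁻ v, ∫⁻ z, F (Function.update v t z) ∂ν ∂(Measure.infinitePi (fun _ : ℕ => ν)) := by
  conv_lhs => rw [← infinitePi_map_update ν t]
  exact (lintegral_map_le _ _).trans (lintegral_prod_le _)

/-- A potential that grows by at most `c` in conditional mean per round. -/
theorem lintegral_potential_le (ν : Measure Ω) [IsProbabilityMeasure ν]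
    (Φ : ℕ → (ℕ → Ω) → ENNReal) (c : ENNReal) (n : ℕ)
    (h : ∀ t < n, ∀ v, ∫⁻ z, Φ (t + 1) (Function.update v t z) ∂ν ≤ Φ t v + c) :
    ∫⁻ v, Φ n v ∂(Measure.infinitePi (fun _ : ℕ => ν)) ≤
      ∫⁻ v, Φ 0 v ∂(Measure.infinitePi (fun _ : ℕ => ν)) + n * c := by
  induction n with
  | zero => simp
  | succ m ih =>
    calc _ ≤ ∫⁻ v, ∫⁻ z, Φ (m + 1) (Function.update v m z) ∂ν
          ∂(Measure.infinitePi (fun _ : ℕ => ν)) := lintegral_infinitePi_le ν m _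
      _ ≤ ∫⁻ v, (Φ m v + c) ∂(Measure.infinitePi (fun _ : ℕ => ν)) :=
          lintegral_mono fun v => h m (Nat.lt_succ_self m) v
      _ = ∫⁻ v, Φ m v ∂(Measure.infinitePi (fun _ : ℕ => ν)) + c := by
          rw [lintegral_add_right _ measurable_const]; simp
      _ ≤ _ := by
          rw [Nat.cast_add, Nat.cast_one, add_mul, one_mul, ← add_assoc]
          gcongr
          exact ih fun t ht => h t (ht.trans (Nat.lt_succ_self m))

theorem measurable_prod_coord {g : ℕ → Ω → ENNReal} (hg : ∀ i, Measurable (g i)) (I : Finset ℕ) :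
    Measurable (fun v : ℕ → Ω => ∏ i ∈ I, g i (v i)) :=
  Finset.measurable_prod _ fun i _ => (hg i).comp (measurable_pi_apply i)

theorem lintegral_prod_infinitePi_le (ν : Measure Ω) [IsProbabilityMeasure ν] (I : Finset ℕ)
    {g : ℕ → Ω → ENNReal} (hg : ∀ i, Measurable (g i)) :
    ∫⁻ v, ∏ i ∈ I, g i (v i) ∂(Measure.infinitePi (fun _ : ℕ => ν)) ≤ ∏ i ∈ I, ∫⁻ z, g i z ∂ν := by
  induction I using Finset.induction_on with
  | empty => simp
  | insert a s ha ih =>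
    refine (lintegral_infinitePi_le ν a _).trans ?_
    have h1 : ∀ v : ℕ → Ω, ∫⁻ z, ∏ i ∈ insert a s, g i (Function.update v a z i) ∂ν =
        (∫⁻ z, g a z ∂ν) * ∏ i ∈ s, g i (v i) := by
      intro v
      rw [← lintegral_mul_const _ (hg a)]
      refine lintegral_congr fun z => ?_
      rw [Finset.prod_insert ha, Function.update_self]
      congr 1
      refine Finset.prod_congr rfl fun i hi => ?_
      rw [Function.update_of_ne (fun h : i = a => ha (h ▸ hi))]
    simp only [h1]
    rw [lintegral_const_mul _ (measurable_prod_coord hg s), Finset.prod_insert ha]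
    gcongr

/-- If `h = 1` off `C` and the integral of `h` over `C` is at most the mass of `C`, then the
product of `h` over i.i.d. samples, on the event that `C` is hit, has mean at most the expected
number of hits bound `|I| ν(C)`. -/
theorem lintegral_touched_prod_le (ν : Measure Ω) [IsProbabilityMeasure ν] (I : Finset ℕ)
    {C : Set Ω} (hC : MeasurableSet C) {h : Ω → ENNReal} (hm : Measurable h)
    (h1 : ∀ z, z ∉ C → h z = 1) (hi : ∫⁻ z in C, h z ∂ν ≤ ν C) :
    ∫⁻ v, (if ∃ i ∈ I, v i ∈ C then ∏ i ∈ I, h (v i) else 0)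
      ∂(Measure.infinitePi (fun _ : ℕ => ν)) ≤ I.card * ν C := by
  have hle : ∫⁻ z, h z ∂ν ≤ 1 := by
    rw [← lintegral_add_compl h hC]
    have : ∫⁻ z in Cᶜ, h z ∂ν = ν Cᶜ := by
      rw [setLIntegral_congr_fun hC.compl (g := fun _ => 1) (fun z hz => h1 z hz)]
      simp
    rw [this]
    calc _ ≤ ν C + ν Cᶜ := by gcongr
      _ = 1 := by rw [measure_add_measure_compl hC, measure_univ]
  have hg : ∀ i j : ℕ, Measurable (if j = i then C.indicator h else h) := by
    intro i j
    split_ifs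
    · exact hm.indicator hC
    · exact hm
  -- Sum over the index that hits `C`: its factor is restricted to `C` and integrates to at most `ν
  -- C`, all other factors to at most one.
  calc _ ≤ ∫⁻ v, ∑ i ∈ I, ∏ j ∈ I, (if j = i then C.indicator h else h) (v j)
        ∂(Measure.infinitePi (fun _ : ℕ => ν)) := by
        refine lintegral_mono fun v => ?_
        split_ifs with hex
        · obtain ⟨i, hiI, hiC⟩ := hex
          refine le_trans (le_of_eq ?_) (Finset.single_le_sum (fun _ _ => zero_le) hiI)
          refine Finset.prod_congr rfl fun j _ => ?_
          split_ifs with hji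
          · subst hji; rw [Set.indicator_of_mem hiC]
          · rfl
        · exact zero_le
    _ = ∑ i ∈ I, ∫⁻ v, ∏ j ∈ I, (if j = i then C.indicator h else h) (v j)
        ∂(Measure.infinitePi (fun _ : ℕ => ν)) :=
        lintegral_finsetSum _ fun i _ => measurable_prod_coord (hg i) I
    _ ≤ ∑ i ∈ I, ν C := by
        refine Finset.sum_le_sum fun i hiI => (lintegral_prod_infinitePi_le ν I (hg i)).trans ?_
        rw [← Finset.mul_prod_erase I _ hiI]
        simp only [if_true]
        rw [lintegral_indicator hC]
        calc _ ≤ ν C * ∏ j ∈ I.erase i, (1 : ENNReal) := by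
              gcongr with j hj
              rw [if_neg (Finset.ne_of_mem_erase hj)]
              exact hle
          _ = ν C := by simp
    _ = _ := by simp

/-- Hoeffding's lemma: a variable in `[0,1]` is sub-Gaussian with variance proxy `1/4`. All
compensators `l ^ 2 / 8` below stem from it. -/
theorem lintegral_exp_centered_le (μ : Measure Ω) [IsProbabilityMeasure μ] {X : Ω → ℝ}
    (hm : AEMeasurable X μ) (hb : ∀ᵐ ω ∂μ, X ω ∈ Set.Icc (0 : ℝ) 1) (c : ℝ)
    (hc : ∫ ω, X ω ∂μ = c) (l : ℝ) :
    ∫⁻ ω, ENNReal.ofReal (Real.exp (l * (X ω - c) - l ^ 2 / 8)) ∂μ ≤ 1 := by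
  have h := hasSubgaussianMGF_of_mem_Icc hm hb
  rw [hc] at h
  have h1 := h.mgf_le l
  have h2 := h.integrable_exp_mul l
  have h3 : ((((‖(1 : ℝ) - 0‖₊ / 2) ^ 2 : NNReal) : ℝ)) * l ^ 2 / 2 = l ^ 2 / 8 := by
    push_cast; norm_num; ring
  rw [h3] at h1
  have h4 : ∀ ω, ENNReal.ofReal (Real.exp (l * (X ω - c) - l ^ 2 / 8)) =
      ENNReal.ofReal (Real.exp (- (l ^ 2 / 8))) *
        ENNReal.ofReal (Real.exp (l * (X ω - c))) := by
    intro ω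
    rw [← ENNReal.ofReal_mul (Real.exp_nonneg _), ← Real.exp_add]
    congr 2; ring
  simp only [h4]
  rw [lintegral_const_mul' _ _ ENNReal.ofReal_ne_top,
    ← ofReal_integral_eq_lintegral_ofReal h2 (.of_forall fun _ => Real.exp_nonneg _),
    ← ENNReal.ofReal_mul (Real.exp_nonneg _)]
  rw [← ENNReal.ofReal_one]
  refine ENNReal.ofReal_le_ofReal ?_
  calc _ ≤ Real.exp (- (l ^ 2 / 8)) * Real.exp (l ^ 2 / 8) := by gcongr; exact h1
    _ = 1 := by rw [← Real.exp_add]; simp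

theorem measure_ge_le_lintegral {μ : Measure Ω} {F : Ω → ENNReal} (hF : Measurable F) {A : ℝ}
    (hA : 0 < A) {q : ENNReal} (h : ∫⁻ z, F z ∂μ ≤ q) :
    μ {z | ENNReal.ofReal A ≤ F z} ≤ ENNReal.ofReal A⁻¹ * q := by
  refine (meas_ge_le_lintegral_div hF.aemeasurable (by simpa using hA) (by simp)).trans ?_
  rw [ENNReal.div_eq_inv_mul, ENNReal.ofReal_inv_of_pos hA]
  gcongr

end Tools

/-! ### Laws of single observations -/

/-- The law of one observation: each arm is pulled with probability at least `κ / K` given the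
covariate, and the reward of the pulled arm has conditional mean `f` and lies in `[0,1]`. -/
structure ObsLaw {d K : ℕ} (f : Fin K → Cov d → ℝ) (κ : ℝ) (ρ : Measure (Obs d K)) : Prop where
  prob : IsProbabilityMeasure ρ
  noise : ∀ (B : Bin d) (k : Fin K) (l : ℝ),
    ∫⁻ o in {o : Obs d K | o.1 ∈ B.carrier ∧ o.2.1 = k},
      ENNReal.ofReal (Real.exp (l * (o.2.2 - f k o.1) - l ^ 2 / 8)) ∂ρ ≤
        ρ {o | o.1 ∈ B.carrier ∧ o.2.1 = k}
  explore : ∀ (B : Bin d) (k : Fin K),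
    ENNReal.ofReal (κ / K) * ρ {o | o.1 ∈ B.carrier} ≤ ρ {o | o.1 ∈ B.carrier ∧ o.2.1 = k}

/-- The continuous extension of a function on the cube. -/
def extend {d : ℕ} (g : Cov d → ℝ) (x : Cov d) : ℝ := g (fun i => max 0 (min 1 (x i)))

theorem extend_of_mem {d : ℕ} (g : Cov d → ℝ) {x : Cov d} (hx : x ∈ cube d) : extend g x = g x := by
  unfold extend
  congr 1
  funext i
  rw [min_eq_right (show x i ≤ 1 from hx.2 i), max_eq_right (show 0 ≤ x i from hx.1 i)]

/-- The reward functions are constrained on the cube only. The extension is continuous, hence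
measurable, on the whole space and agrees with them where the covariates live. -/
theorem continuous_extend {d : ℕ} {g : Cov d → ℝ} {β C : ℝ} (hβ : 0 < β)
    (hg : IsHolder β C g) : Continuous (extend g) := by
  have hcl : Continuous (fun (x : Cov d) (i : Fin d) => max (0 : ℝ) (min 1 (x i))) := by fun_prop
  have hmem : ∀ x : Cov d, (fun i => max (0 : ℝ) (min 1 (x i))) ∈ cube d := by
    intro x
    constructor <;> intro i <;> simp
  have hcont : ContinuousOn g (cube d) := by
    intro x hx
    rw [ContinuousWithinAt, tendsto_iff_norm_sub_tendsto_zero]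
    have hlim : Filter.Tendsto (fun y : Cov d => C * ‖y - x‖ ^ β) (nhdsWithin x (cube d))
        (nhds 0) := by
      have h1 : Filter.Tendsto (fun y : Cov d => ‖y - x‖) (nhdsWithin x (cube d)) (nhds 0) := by
        have : Filter.Tendsto (fun y : Cov d => ‖y - x‖) (nhds x) (nhds ‖x - x‖) :=
          ((continuous_id.sub continuous_const).norm).tendsto x
        rw [sub_self, norm_zero] at this
        exact this.mono_left nhdsWithin_le_nhds
      have h2 := (h1.rpow_const (Or.inr hβ.le)).const_mul C
      rwa [Real.zero_rpow hβ.ne', mul_zero] at h2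
    refine squeeze_zero' (.of_forall fun y => norm_nonneg _) ?_ hlim
    filter_upwards [self_mem_nhdsWithin] with y hy
    exact hg y hy x hx
  exact hcont.comp_continuous hcl hmem

section ModelLaws

variable {d K : ℕ}

/-- Observation of a target round in which the auxiliary uniform arm is pulled. -/
def uniformObs (z : RoundQ d K) : Obs d K := (z.1.1, z.2, z.1.2 z.2)

theorem measurable_eval_arm : Measurable (fun p : Fin K × (Fin K → ℝ) => p.2 p.1) :=
  measurable_from_prod_countable_right fun k => measurable_pi_apply k

theorem measurable_obs : Measurable (RoundP.obs : RoundP d K → Obs d K) := by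
  unfold RoundP.obs
  exact measurable_fst.prodMk ((measurable_fst.comp measurable_snd).prodMk
    (measurable_eval_arm.comp measurable_snd))

theorem measurable_uniformObs : Measurable (uniformObs : RoundQ d K → Obs d K) := by
  unfold uniformObs
  exact (measurable_fst.comp measurable_fst).prodMk (measurable_snd.prodMk
    (measurable_eval_arm.comp (measurable_snd.prodMk (measurable_snd.comp measurable_fst))))

theorem measurableSet_obsIn (B : Bin d) (k : Fin K) :
    MeasurableSet {o : Obs d K | o.1 ∈ B.carrier ∧ o.2.1 = k} :=
  (measurable_fst B.measurableSet_carrier).inter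
    ((measurable_fst.comp measurable_snd) (measurableSet_singleton k))

theorem measurableSet_obsBin (B : Bin d) : MeasurableSet {o : Obs d K | o.1 ∈ B.carrier} :=
  measurable_fst B.measurableSet_carrier

theorem measurable_noise {f : Fin K → Cov d → ℝ} (hf : ∀ k, Measurable (f k)) (k : Fin K) (l : ℝ) :
    Measurable (fun o : Obs d K =>
      ENNReal.ofReal (Real.exp (l * (o.2.2 - f k o.1) - l ^ 2 / 8))) := by
  have := (hf k).comp (measurable_fst : Measurable (Prod.fst : Obs d K → Cov d))
  have h2 : Measurable (fun o : Obs d K => o.2.2) := measurable_snd.comp measurable_snd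
  exact ENNReal.measurable_ofReal.comp (Real.measurable_exp.comp
    (((h2.sub this).const_mul l).sub_const _))

/-- Given the covariate, arm and rewards are independent, so the reward of the pulled arm keeps the
conditional mean `f k x` and Hoeffding's lemma applies in each fibre. -/
theorem obsLaw_source (M : Model d K) {κ : ℝ} {f : Fin K → Cov d → ℝ}
    (hf : ∀ k, Measurable (f k)) (hfM : ∀ k, ∀ x ∈ cube d, f k x = M.f k x)
    (hκ : ∀ k : Fin K, ∀ x ∈ cube d, κ / K ≤ (M.armP x).real {k}) :
    ObsLaw f κ (M.lawP.map RoundP.obs) := by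
  have := M.probPX
  have := M.markovP
  have := M.markovArm
  have hcube : ∀ᵐ x ∂M.PX, x ∈ cube d := by rw [ae_iff]; exact M.PX_cube
  have hC : ∀ (B : Bin d) (k : Fin K) (x : Cov d) (q : Fin K × (Fin K → ℝ)),
      RoundP.obs (x, q) ∈ {o : Obs d K | o.1 ∈ B.carrier ∧ o.2.1 = k} ↔
        x ∈ B.carrier ∧ q.1 = k := fun B k x q => Iff.rfl
  have hmass : ∀ (B : Bin d) (k : Fin K),
      (M.lawP.map RoundP.obs) {o : Obs d K | o.1 ∈ B.carrier ∧ o.2.1 = k} =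
        ∫⁻ x in B.carrier, M.armP x {k} ∂M.PX := by
    intro B k
    rw [Measure.map_apply measurable_obs (measurableSet_obsIn B k), Model.lawP,
      show RoundP.obs ⁻¹' {o : Obs d K | o.1 ∈ B.carrier ∧ o.2.1 = k} =
        B.carrier ×ˢ (({k} : Set (Fin K)) ×ˢ (Set.univ : Set (Fin K → ℝ))) by
        ext ⟨x, a, y⟩; simp [RoundP.obs],
      Measure.compProd_apply_prod B.measurableSet_carrier
        ((measurableSet_singleton k).prod MeasurableSet.univ)]
    refine lintegral_congr fun x => ?_
    rw [Kernel.prod_apply, Measure.prod_prod, measure_univ, mul_one]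
  refine ⟨?_, fun B k l => ?_, fun B k => ?_⟩
  · have : IsProbabilityMeasure M.lawP := by unfold Model.lawP; infer_instance
    exact Measure.isProbabilityMeasure_map measurable_obs.aemeasurable
  · rw [hmass, ← lintegral_indicator (measurableSet_obsIn B k),
      lintegral_map ((measurable_noise hf k l).indicator (measurableSet_obsIn B k)) measurable_obs,
      Model.lawP]
    refine (lintegral_compProd_le _ _ _).trans ?_
    rw [← lintegral_indicator B.measurableSet_carrier]
    refine lintegral_mono_ae ?_
    filter_upwards [hcube, M.meanP k] with x hx hmean
    by_cases hxB : x ∈ B.carrier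
    swap
    · rw [Set.indicator_of_notMem hxB]
      simp only [Set.indicator_apply, hC, hxB, false_and, if_false]
      simp
    rw [Set.indicator_of_mem hxB, Kernel.prod_apply]
    refine (lintegral_prod_le _).trans ?_
    rw [← lintegral_indicator_one (measurableSet_singleton k)]
    refine lintegral_mono fun a => ?_
    simp only [Set.indicator_apply, hC, hxB, true_and, Set.mem_singleton_iff, Pi.one_apply]
    by_cases hak : a = k
    · subst hak
      simp only [if_true]
      have := lintegral_exp_centered_le (M.rewardP x) (X := fun y => y a)
        (measurable_pi_apply a).aemeasurable
        ((M.rewardP_mem x).mono fun y hy => hy a) (f a x) (by rw [hmean, hfM a x hx]) l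
      exact this
    · simp [hak]
  · rw [hmass, Measure.map_apply measurable_obs (measurableSet_obsBin B), Model.lawP,
      show RoundP.obs ⁻¹' {o : Obs d K | o.1 ∈ B.carrier} =
        B.carrier ×ˢ (Set.univ : Set (Fin K × (Fin K → ℝ))) by
        ext ⟨x, a, y⟩; simp [RoundP.obs],
      Measure.compProd_apply_prod B.measurableSet_carrier MeasurableSet.univ]
    simp only [measure_univ]
    rw [← lintegral_const_mul _ measurable_const]
    refine lintegral_mono_ae ?_
    filter_upwards [ae_restrict_of_ae hcube] with x hx
    rw [mul_one, ENNReal.ofReal_le_iff_le_toReal (measure_ne_top _ _)]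
    exact hκ k x hx

theorem map_obs_bin (M : Model d K) (B : Bin d) :
    (M.lawP.map RoundP.obs) {o : Obs d K | o.1 ∈ B.carrier} = M.PX B.carrier := by
  have := M.probPX
  have := M.markovP
  have := M.markovArm
  rw [Measure.map_apply measurable_obs (measurableSet_obsBin B), Model.lawP,
      show RoundP.obs ⁻¹' {o : Obs d K | o.1 ∈ B.carrier} =
        B.carrier ×ˢ (Set.univ : Set (Fin K × (Fin K → ℝ))) by
        ext ⟨x, a, y⟩; simp [RoundP.obs],
      Measure.compProd_apply_prod B.measurableSet_carrier MeasurableSet.univ]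
  simp

/-- Uniform exploration is the case `κ = 1`: each arm has probability `1 / K`, independently of
covariate and rewards. -/
theorem obsLaw_uniform (M : Model d K) (hK : 1 ≤ K) {f : Fin K → Cov d → ℝ}
    (hf : ∀ k, Measurable (f k)) (hfM : ∀ k, ∀ x ∈ cube d, f k x = M.f k x) :
    ObsLaw f 1 (M.lawQ.map uniformObs) := by
  have := M.probQX
  have := M.markovQ
  have : Nonempty (Fin K) := ⟨⟨0, hK⟩⟩
  have hU : IsProbabilityMeasure (uniformOn (Set.univ : Set (Fin K))) :=
    isProbabilityMeasure_uniformOn Set.finite_univ Set.univ_nonempty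
  have hcube : ∀ᵐ x ∂M.QX, x ∈ cube d := by rw [ae_iff]; exact M.QX_cube
  have hC : ∀ (B : Bin d) (k : Fin K) (x : Cov d) (y : Fin K → ℝ) (a : Fin K),
      uniformObs ((x, y), a) ∈ {o : Obs d K | o.1 ∈ B.carrier ∧ o.2.1 = k} ↔
        x ∈ B.carrier ∧ a = k := fun B k x y a => Iff.rfl
  have hu : ∀ k : Fin K, uniformOn (Set.univ : Set (Fin K)) {k} = (K : ENNReal)⁻¹ := by
    intro k
    rw [uniformOn_univ, Measure.count_singleton]
    simp
  have hmassB : ∀ (B : Bin d) (s : Set (Fin K)),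
      M.lawQ ((B.carrier ×ˢ (Set.univ : Set (Fin K → ℝ))) ×ˢ s) =
        M.QX B.carrier * uniformOn (Set.univ : Set (Fin K)) s := by
    intro B s
    rw [Model.lawQ, Measure.prod_prod, Measure.compProd_apply_prod B.measurableSet_carrier
      MeasurableSet.univ]
    simp
  have hmass : ∀ (B : Bin d) (k : Fin K),
      (M.lawQ.map uniformObs) {o : Obs d K | o.1 ∈ B.carrier ∧ o.2.1 = k} =
        M.QX B.carrier * (K : ENNReal)⁻¹ := by
    intro B k
    rw [Measure.map_apply measurable_uniformObs (measurableSet_obsIn B k),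
      show uniformObs ⁻¹' {o : Obs d K | o.1 ∈ B.carrier ∧ o.2.1 = k} =
        (B.carrier ×ˢ (Set.univ : Set (Fin K → ℝ))) ×ˢ ({k} : Set (Fin K)) by
        ext ⟨⟨x, y⟩, a⟩; simp [uniformObs], hmassB, hu]
  refine ⟨?_, fun B k l => ?_, fun B k => ?_⟩
  · have : IsProbabilityMeasure M.lawQ := by unfold Model.lawQ; infer_instance
    exact Measure.isProbabilityMeasure_map measurable_uniformObs.aemeasurable
  · rw [hmass, ← lintegral_indicator (measurableSet_obsIn B k),
      lintegral_map ((measurable_noise hf k l).indicator (measurableSet_obsIn B k))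
        measurable_uniformObs, Model.lawQ]
    refine (lintegral_prod_le _).trans ?_
    refine (lintegral_compProd_le _ _ _).trans ?_
    rw [← lintegral_indicator_one B.measurableSet_carrier, ← lintegral_mul_const _
      (measurable_one.indicator B.measurableSet_carrier)]
    refine lintegral_mono_ae ?_
    filter_upwards [hcube, M.meanQ k] with x hx hmean
    by_cases hxB : x ∈ B.carrier
    swap
    · rw [Set.indicator_of_notMem hxB]
      simp only [Set.indicator_apply, hC, hxB, false_and, if_false]
      simp
    rw [Set.indicator_of_mem hxB, Pi.one_apply, one_mul]
    have h1 : ∀ y : Fin K → ℝ, ∫⁻ a, {o : Obs d K | o.1 ∈ B.carrier ∧ o.2.1 = k}.indicator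
        (fun o : Obs d K => ENNReal.ofReal (Real.exp (l * (o.2.2 - f k o.1) - l ^ 2 / 8)))
          (uniformObs ((x, y), a)) ∂(uniformOn (Set.univ : Set (Fin K))) =
        ENNReal.ofReal (Real.exp (l * (y k - f k x) - l ^ 2 / 8)) * (K : ENNReal)⁻¹ := by
      intro y
      rw [← hu k, ← lintegral_indicator_const (measurableSet_singleton k)]
      refine lintegral_congr fun a => ?_
      simp only [Set.indicator_apply, hC, hxB, true_and, Set.mem_singleton_iff]
      by_cases hak : a = k
      · subst hak; simp [uniformObs]
      · simp [hak]
    simp only [h1]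
    rw [lintegral_mul_const' _ _ (by simp; omega)]
    refine mul_le_of_le_one_left' ?_
    exact lintegral_exp_centered_le (M.rewardQ x) (X := fun y => y k)
        (measurable_pi_apply k).aemeasurable
        ((M.rewardQ_mem x).mono fun y hy => hy k) (f k x) (by rw [hmean, hfM k x hx]) l
  · rw [hmass, Measure.map_apply measurable_uniformObs (measurableSet_obsBin B),
      show uniformObs ⁻¹' {o : Obs d K | o.1 ∈ B.carrier} =
        (B.carrier ×ˢ (Set.univ : Set (Fin K → ℝ))) ×ˢ (Set.univ : Set (Fin K)) by
        ext ⟨⟨x, y⟩, a⟩; simp [uniformObs], hmassB, measure_univ, mul_one, mul_comm]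
    gcongr
    rw [one_div, ENNReal.ofReal_inv_of_pos (by positivity)]
    simp

theorem map_uniformObs_bin (M : Model d K) (hK : 1 ≤ K) (B : Bin d) :
    (M.lawQ.map uniformObs) {o : Obs d K | o.1 ∈ B.carrier} = M.QX B.carrier := by
  have := M.probQX
  have := M.markovQ
  have : Nonempty (Fin K) := ⟨⟨0, hK⟩⟩
  have hU : IsProbabilityMeasure (uniformOn (Set.univ : Set (Fin K))) :=
    isProbabilityMeasure_uniformOn Set.finite_univ Set.univ_nonempty
  rw [Measure.map_apply measurable_uniformObs (measurableSet_obsBin B),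
      show uniformObs ⁻¹' {o : Obs d K | o.1 ∈ B.carrier} =
        (B.carrier ×ˢ (Set.univ : Set (Fin K → ℝ))) ×ˢ (Set.univ : Set (Fin K)) by
        ext ⟨⟨x, y⟩, a⟩; simp [uniformObs], Model.lawQ, Measure.prod_prod,
      Measure.compProd_apply_prod B.measurableSet_carrier MeasurableSet.univ]
  simp

end ModelLaws

/-! ### Concentration for i.i.d. observations -/

section IID

variable {d K : ℕ}

/-- The indices of the observations of arm `k` in `B`. -/
def hits (I : Finset ℕ) (o : ℕ → Obs d K) (B : Bin d) (k : Fin K) : Finset ℕ :=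
  I.filter (fun i => (o i).1 ∈ B.carrier ∧ (o i).2.1 = k)

/-- The indices of the observations in `B`. -/
def hitsBin (I : Finset ℕ) (o : ℕ → Obs d K) (B : Bin d) : Finset ℕ :=
  I.filter (fun i => (o i).1 ∈ B.carrier)

theorem hits_subset_hitsBin (I : Finset ℕ) (o : ℕ → Obs d K) (B : Bin d) (k : Fin K) :
    hits I o B k ⊆ hitsBin I o B := by
  intro i hi
  simp only [hits, hitsBin, Finset.mem_filter] at hi ⊢
  exact ⟨hi.1, hi.2.1⟩

/-- The centered sum of the rewards of arm `k` observed in `B`. -/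
def dev (I : Finset ℕ) (f : Fin K → Cov d → ℝ) (o : ℕ → Obs d K) (B : Bin d) (k : Fin K) : ℝ :=
  ∑ i ∈ hits I o B k, ((o i).2.2 - f k (o i).1)

/-- The exponential potential of the centered sum, if there is an observation. -/
def expDev (I : Finset ℕ) (f : Fin K → Cov d → ℝ) (l : ℝ) (o : ℕ → Obs d K) (B : Bin d)
    (k : Fin K) : ENNReal :=
  if 0 < (hits I o B k).card then
    ENNReal.ofReal (Real.exp (l * dev I f o B k - l ^ 2 / 8 * (hits I o B k).card))
  else 0

theorem setLIntegral_eq_const {Ω : Type*} [MeasurableSpace Ω] {ν : Measure Ω} {S : Set Ω}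
    (hS : MeasurableSet S) {g : Ω → ENNReal} {c : ENNReal} (h : ∀ z ∈ S, g z = c) :
    ∫⁻ z in S, g z ∂ν = c * ν S := by
  rw [setLIntegral_congr_fun hS h, setLIntegral_const]

variable {Ω : Type*} [MeasurableSpace Ω] {ν : Measure Ω} [IsProbabilityMeasure ν]
  {φ : Ω → Obs d K} {f : Fin K → Cov d → ℝ} {κ : ℝ}

theorem measurable_touched {C : Set Ω} (hC : MeasurableSet C) {h : Ω → ENNReal}
    (hm : Measurable h) (I : Finset ℕ) :
    Measurable (fun v : ℕ → Ω => if ∃ i ∈ I, v i ∈ C then ∏ i ∈ I, h (v i) else 0) := by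
  refine Measurable.ite ?_ (measurable_prod_coord (fun _ => hm) I) measurable_const
  have : {v : ℕ → Ω | ∃ i ∈ I, v i ∈ C} = ⋃ i ∈ I, (fun v : ℕ → Ω => v i) ⁻¹' C := by
    ext v; simp
  rw [this]
  exact Finset.measurableSet_biUnion _ fun i _ => (measurable_pi_apply i) hC

theorem expDev_eq (I : Finset ℕ) (l : ℝ) (o : ℕ → Obs d K) (B : Bin d) (k : Fin K) :
    expDev I f l o B k =
      if ∃ i ∈ I, (o i).1 ∈ B.carrier ∧ (o i).2.1 = k then
        ∏ i ∈ I, (if (o i).1 ∈ B.carrier ∧ (o i).2.1 = k then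
          ENNReal.ofReal (Real.exp (l * ((o i).2.2 - f k (o i).1) - l ^ 2 / 8)) else 1) else 0 := by
  unfold expDev
  have h1 : 0 < (hits I o B k).card ↔ ∃ i ∈ I, (o i).1 ∈ B.carrier ∧ (o i).2.1 = k := by
    rw [Finset.card_pos, hits, Finset.filter_nonempty_iff]
  simp only [h1]
  split_ifs with h
  · rw [← Finset.prod_filter, ← ENNReal.ofReal_prod_of_nonneg fun _ _ => Real.exp_nonneg _,
      ← Real.exp_sum, Finset.sum_sub_distrib, ← Finset.mul_sum, Finset.sum_const, nsmul_eq_mul]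
    unfold dev hits
    congr 2
    ring
  · rfl

theorem measurable_expDev (hφ : Measurable φ) (hf : ∀ k, Measurable (f k)) (I : Finset ℕ) (l : ℝ)
    (B : Bin d) (k : Fin K) :
    Measurable (fun v : ℕ → Ω => expDev I f l (fun i => φ (v i)) B k) := by
  have hC := hφ (measurableSet_obsIn B k)
  have hm : Measurable (fun z : Ω => if (φ z).1 ∈ B.carrier ∧ (φ z).2.1 = k then
      ENNReal.ofReal (Real.exp (l * ((φ z).2.2 - f k (φ z).1) - l ^ 2 / 8)) else 1) :=
    Measurable.ite hC ((measurable_noise hf k l).comp hφ) measurable_const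
  have := measurable_touched hC hm I
  simp only [expDev_eq]
  refine cast (congrArg Measurable (funext fun v => ?_)) this
  congr 1

/-- The potential vanishes without data, so a bin is charged its expected number of hits rather than
one. Summed over a level the charges stay bounded by `2 ^ d * I.card`, whatever the number of bins.
-/
theorem lintegral_expDev_le (hφ : Measurable φ) (hf : ∀ k, Measurable (f k))
    (hν : ObsLaw f κ (ν.map φ)) (I : Finset ℕ) (l : ℝ) (B : Bin d) (k : Fin K) :
    ∫⁻ v, expDev I f l (fun i => φ (v i)) B k ∂(Measure.infinitePi (fun _ : ℕ => ν)) ≤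
      I.card * (ν.map φ) {o | o.1 ∈ B.carrier} := by
  have hC := hφ (measurableSet_obsIn B k)
  have hm : Measurable (fun z : Ω => if (φ z).1 ∈ B.carrier ∧ (φ z).2.1 = k then
      ENNReal.ofReal (Real.exp (l * ((φ z).2.2 - f k (φ z).1) - l ^ 2 / 8)) else 1) :=
    Measurable.ite hC ((measurable_noise hf k l).comp hφ) measurable_const
  have h := lintegral_touched_prod_le ν I hC hm (fun z hz => if_neg hz) (by
    have h1 := hν.noise B k l
    rw [Measure.map_apply hφ (measurableSet_obsIn B k), ← lintegral_indicator
      (measurableSet_obsIn B k), lintegral_map ((measurable_noise hf k l).indicator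
      (measurableSet_obsIn B k)) hφ] at h1
    refine le_trans (le_of_eq ?_) h1
    rw [← lintegral_indicator hC]
    refine lintegral_congr fun z => ?_
    simp only [Set.indicator_apply, Set.mem_preimage, Set.mem_ofPred_eq]
    split_ifs <;> rfl)
  simp only [expDev_eq]
  refine le_trans (le_of_eq ?_) (h.trans ?_)
  · refine lintegral_congr fun v => ?_
    congr 1
  gcongr
  rw [Measure.map_apply hφ (measurableSet_obsBin B)]
  refine measure_mono fun z hz => ?_
  exact hz.1

theorem sum_obsBin_le (ρ : Measure (Obs d K)) [IsProbabilityMeasure ρ] (l : ℕ) :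
    ∑ B ∈ binsAt d l, ρ {o | o.1 ∈ B.carrier} ≤ 2 ^ d := by
  have h := sum_measure_bins_le (ρ.map Prod.fst) l (s := Set.univ)
  rw [Measure.map_apply measurable_fst MeasurableSet.univ, Set.preimage_univ, measure_univ,
    mul_one] at h
  refine le_trans (le_of_eq ?_) h
  refine Finset.sum_congr rfl fun B _ => ?_
  rw [Set.univ_inter, Measure.map_apply measurable_fst B.measurableSet_carrier]
  rfl

/-- The tilt `l = 4 e` maximizes `l e - l ^ 2 / 8`, with value `2 e ^ 2` per observation; the sign
`s` selects the tail. -/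
theorem exp_le_expDev {I : Finset ℕ} {o : ℕ → Obs d K} {B : Bin d} {k : Fin K} {N e s : ℝ}
    (hN : 0 < N) (he : 0 ≤ e) (hc : N ≤ (hits I o B k).card) (hs : s ^ 2 = 1)
    (hd : (hits I o B k).card * e ≤ s * dev I f o B k) :
    ENNReal.ofReal (Real.exp (2 * e ^ 2 * N)) ≤ expDev I f (4 * e * s) o B k := by
  have hpos : 0 < (hits I o B k).card := by
    have : (0 : ℝ) < (hits I o B k).card := hN.trans_le hc
    exact_mod_cast this
  rw [expDev, if_pos hpos]
  refine ENNReal.ofReal_le_ofReal (Real.exp_le_exp.2 ?_)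
  have h1 : 4 * e * s * dev I f o B k ≥ 4 * e * ((hits I o B k).card * e) := by
    have := mul_le_mul_of_nonneg_left hd (by positivity : 0 ≤ 4 * e)
    linarith
  have h2 : (4 * e * s) ^ 2 / 8 = 2 * e ^ 2 := by rw [mul_pow, hs]; ring
  rw [h2]
  have h3 := mul_le_mul_of_nonneg_left hc (by positivity : 0 ≤ 2 * e ^ 2)
  nlinarith

theorem measure_dev_gt_le (hφ : Measurable φ) (hf : ∀ k, Measurable (f k))
    (hν : ObsLaw f κ (ν.map φ)) (I : Finset ℕ) {N e : ℝ} (hN : 0 < N) (he : 0 ≤ e)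
    (B : Bin d) (k : Fin K) :
    Measure.infinitePi (fun _ : ℕ => ν) {v | N ≤ (hits I (fun i => φ (v i)) B k).card ∧
        (hits I (fun i => φ (v i)) B k).card * e < |dev I f (fun i => φ (v i)) B k|} ≤
      ENNReal.ofReal (2 * Real.exp (-(2 * e ^ 2 * N))) *
        (I.card * (ν.map φ) {o | o.1 ∈ B.carrier}) := by
  have h1 := fun l => measure_ge_le_lintegral (measurable_expDev hφ hf I l B k)
    (Real.exp_pos (2 * e ^ 2 * N)) (lintegral_expDev_le hφ hf hν I l B k)
  refine le_trans (measure_mono (t := {v | ENNReal.ofReal (Real.exp (2 * e ^ 2 * N)) ≤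
      expDev I f (4 * e * 1) (fun i => φ (v i)) B k} ∪ {v | ENNReal.ofReal (Real.exp (2 * e ^ 2 * N))
      ≤ expDev I f (4 * e * (-1)) (fun i => φ (v i)) B k}) ?_) ?_
  · rintro v ⟨hc, hd⟩
    rcases le_total 0 (dev I f (fun i => φ (v i)) B k) with h | h
    · left
      rw [abs_of_nonneg h] at hd
      exact exp_le_expDev hN he hc (by norm_num) (by linarith)
    · right
      rw [abs_of_nonpos h] at hd
      exact exp_le_expDev hN he hc (by norm_num) (by linarith)
  · refine (measure_union_le _ _).trans ((add_le_add (h1 _) (h1 _)).trans (le_of_eq ?_))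
    rw [← Real.exp_neg, ← two_mul, ← mul_assoc, ENNReal.ofReal_mul (by norm_num)]
    simp

/-- A factor `1/2` per hit serves as the exponential tilt in Chernoff's bound for the lower tail,
through `1 - p / 2 ≤ exp (-p / 2)`. -/
theorem lintegral_half_pow_le (hφ : Measurable φ) {C : Set (Obs d K)} (hC : MeasurableSet C)
    {p : ℝ} (hp : ENNReal.ofReal p ≤ (ν.map φ) C) :
    ∫⁻ z, (if φ z ∈ C then ENNReal.ofReal (1 / 2) else 1) ∂ν ≤
      ENNReal.ofReal (Real.exp (-(p / 2))) := by
  have hm : Measurable (fun z => if φ z ∈ C then ENNReal.ofReal (1 / 2) else 1) :=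
    Measurable.ite (hφ hC) measurable_const measurable_const
  have hCm := hφ hC
  rw [Measure.map_apply hφ hC] at hp
  have h1 : ∫⁻ z, (if φ z ∈ C then ENNReal.ofReal (1 / 2) else 1) ∂ν =
      ENNReal.ofReal (1 / 2) * ν (φ ⁻¹' C) + ν (φ ⁻¹' C)ᶜ := by
    have e1 : ∫⁻ z in φ ⁻¹' C, (if φ z ∈ C then ENNReal.ofReal (1 / 2) else 1) ∂ν =
        ENNReal.ofReal (1 / 2) * ν (φ ⁻¹' C) :=
      setLIntegral_eq_const hCm (fun z hz => if_pos hz)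
    have e2 : ∫⁻ z in (φ ⁻¹' C)ᶜ, (if φ z ∈ C then ENNReal.ofReal (1 / 2) else 1) ∂ν =
        1 * ν (φ ⁻¹' C)ᶜ :=
      setLIntegral_eq_const hCm.compl (fun z hz => if_neg hz)
    rw [← lintegral_add_compl _ hCm, e1, e2, one_mul]
  rw [h1]
  have hfin : ν (φ ⁻¹' C) ≠ ⊤ := measure_ne_top _ _
  have hr : ν (φ ⁻¹' C) = ENNReal.ofReal (ν.real (φ ⁻¹' C)) := by simp
  have hrc : ν (φ ⁻¹' C)ᶜ = ENNReal.ofReal (1 - ν.real (φ ⁻¹' C)) := by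
    rw [← probReal_compl_eq_one_sub hCm]; simp
  rw [hrc, hr, ← ENNReal.ofReal_mul (by norm_num), ← ENNReal.ofReal_add (by positivity)
    (by linarith [measureReal_le_one (μ := ν) (s := φ ⁻¹' C)])]
  refine ENNReal.ofReal_le_ofReal ?_
  have h2 : p ≤ ν.real (φ ⁻¹' C) := by
    rw [hr] at hp
    exact (ENNReal.ofReal_le_ofReal_iff measureReal_nonneg).1 hp
  have := Real.add_one_le_exp (-(p / 2))
  linarith

theorem log_two_le_one : Real.log 2 ≤ 1 := by
  have := Real.log_two_lt_d9; linarith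

/-- Lower tail of the number of observations of an arm in a bin. -/
theorem measure_hits_le (hφ : Measurable φ) (I : Finset ℕ) (B : Bin d) (k : Fin K) {p : ℝ}
    (hp : ENNReal.ofReal p ≤ (ν.map φ) {o | o.1 ∈ B.carrier ∧ o.2.1 = k}) :
    Measure.infinitePi (fun _ : ℕ => ν)
        {v | ((hits I (fun i => φ (v i)) B k).card : ℝ) ≤ I.card * p / 4} ≤
      ENNReal.ofReal (Real.exp (-(I.card * p / 4))) := by
  have hCm := measurableSet_obsIn B k
  set h : Ω → ENNReal := fun z => if φ z ∈ {o : Obs d K | o.1 ∈ B.carrier ∧ o.2.1 = k} then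
    ENNReal.ofReal (1 / 2) else 1
  have hm : Measurable h := Measurable.ite (hφ hCm) measurable_const measurable_const
  have hint : ∫⁻ v, ∏ i ∈ I, h (v i) ∂(Measure.infinitePi (fun _ : ℕ => ν)) ≤
      ENNReal.ofReal (Real.exp (-(I.card * p / 2))) := by
    refine (lintegral_prod_infinitePi_le ν I fun _ => hm).trans ?_
    refine (Finset.prod_le_prod' (g := fun _ => ENNReal.ofReal (Real.exp (-(p / 2))))
      (f := fun _ => ∫⁻ z, h z ∂ν) (s := I)
      fun i _ => ?_).trans (le_of_eq ?_)
    · refine le_trans (le_of_eq (lintegral_congr fun z => ?_)) (lintegral_half_pow_le hφ hCm hp)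
      simp only [h]
      congr 1
    rw [Finset.prod_const, ← ENNReal.ofReal_pow (Real.exp_nonneg _), ← Real.exp_nat_mul]
    congr 2; ring
  -- The product has mean at most `exp (-|I| p / 2)`, but it is at least `exp (-|I| p / 4)` when
  -- there are no more than `|I| p / 4` hits.
  have hA := measure_ge_le_lintegral (measurable_prod_coord (fun _ => hm) I)
    (Real.exp_pos (-(I.card * p / 4))) hint
  refine le_trans (measure_mono ?_) (hA.trans (le_of_eq ?_))
  · intro v hv
    rw [Set.mem_ofPred_eq] at hv ⊢
    have h1 : ∏ i ∈ I, h (v i) =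
        ENNReal.ofReal ((1 / 2) ^ (hits I (fun i => φ (v i)) B k).card) := by
      rw [ENNReal.ofReal_pow (by norm_num), ← Finset.prod_const, hits, Finset.prod_filter]
      rfl
    rw [h1]
    refine ENNReal.ofReal_le_ofReal ?_
    have h2 : (1 / 2 : ℝ) ^ (hits I (fun i => φ (v i)) B k).card =
        Real.exp (-(Real.log 2 * (hits I (fun i => φ (v i)) B k).card)) := by
      rw [← Real.rpow_natCast, Real.rpow_def_of_pos (by norm_num), one_div, Real.log_inv]
      ring_nf
    rw [h2]
    refine Real.exp_le_exp.2 ?_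
    have := mul_le_mul_of_nonneg_right log_two_le_one
      (Nat.cast_nonneg (α := ℝ) (hits I (fun i => φ (v i)) B k).card)
    linarith
  · rw [← Real.exp_neg, ← ENNReal.ofReal_mul (Real.exp_nonneg _), ← Real.exp_add]
    congr 2; ring

/-- Each arm gets its share of the observations in a bin. -/
theorem measure_ratio_le (hφ : Measurable φ) (hν : ObsLaw f κ (ν.map φ)) (hκ : 0 ≤ κ)
    (I : Finset ℕ) {N : ℝ} (hN : 0 < N) (B : Bin d) (k : Fin K) :
    Measure.infinitePi (fun _ : ℕ => ν) {v | N ≤ (hitsBin I (fun i => φ (v i)) B).card ∧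
        ((hits I (fun i => φ (v i)) B k).card : ℝ) <
          κ / (4 * K) * (hitsBin I (fun i => φ (v i)) B).card} ≤
      ENNReal.ofReal (Real.exp (-(κ / (4 * K) * N))) *
        (I.card * (ν.map φ) {o | o.1 ∈ B.carrier}) := by
  have hBm := hφ (measurableSet_obsBin (K := K) B)
  have hCm := hφ (measurableSet_obsIn B k)
  have := hν.prob
  -- Each observation in `B` has weight `exp a`, halved if it shows arm `k`. By exploration its mean
  -- given `B` is at most `exp a * (1 - a) ≤ 1`. If arm `k` has less than the fraction `a / 2` of at
  -- least `N` observations, the product of the weights is at least `exp (a N / 2)`.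
  set a : ℝ := κ / (2 * K) with ha
  have ha0 : 0 ≤ a := by positivity
  set h : Ω → ENNReal := fun z => if (φ z).1 ∈ B.carrier then
    (ENNReal.ofReal (Real.exp a) * if (φ z).1 ∈ B.carrier ∧ (φ z).2.1 = k then
    ENNReal.ofReal (1 / 2) else 1) else 1 with hh
  have hm : Measurable h := Measurable.ite hBm ((Measurable.ite hCm measurable_const
    measurable_const).const_mul _) measurable_const
  have hsub : φ ⁻¹' {o : Obs d K | o.1 ∈ B.carrier ∧ o.2.1 = k} ⊆
    φ ⁻¹' {o : Obs d K | o.1 ∈ B.carrier} := fun z hz => hz.1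
  have hint := lintegral_touched_prod_le ν I hBm hm (fun z hz => if_neg hz) (by
    have h1 := hν.explore B k
    rw [Measure.map_apply hφ (measurableSet_obsIn B k),
      Measure.map_apply hφ (measurableSet_obsBin B)] at h1
    have hr : ∫⁻ z in φ ⁻¹' {o : Obs d K | o.1 ∈ B.carrier}, h z ∂ν =
        ∫⁻ z in φ ⁻¹' {o : Obs d K | o.1 ∈ B.carrier}, ENNReal.ofReal (Real.exp a) *
          (if z ∈ φ ⁻¹' {o : Obs d K | o.1 ∈ B.carrier ∧ o.2.1 = k} then
            ENNReal.ofReal (1 / 2) else 1) ∂ν :=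
      setLIntegral_congr_fun hBm (fun z hz => by
        have hz' : (φ z).1 ∈ B.carrier := hz
        simp only [hh, if_pos hz']
        congr 2)
    rw [hr, lintegral_const_mul' _ _ ENNReal.ofReal_ne_top]
    clear hr hm
    clear_value h
    generalize hS : φ ⁻¹' {o : Obs d K | o.1 ∈ B.carrier} = S at *
    generalize hT : φ ⁻¹' {o : Obs d K | o.1 ∈ B.carrier ∧ o.2.1 = k} = T at *
    have h2 : ∫⁻ z in S, (if z ∈ T then ENNReal.ofReal (1 / 2) else 1) ∂ν =
        ENNReal.ofReal (1 / 2) * ν T + ν (S \ T) := by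
      have e1 : ∫⁻ z in S ∩ T, (if z ∈ T then ENNReal.ofReal (1 / 2) else 1) ∂ν =
          ENNReal.ofReal (1 / 2) * ν (S ∩ T) :=
        setLIntegral_eq_const (hBm.inter hCm) (fun z hz => if_pos hz.2)
      have e2 : ∫⁻ z in S \ T, (if z ∈ T then ENNReal.ofReal (1 / 2) else 1) ∂ν =
          1 * ν (S \ T) :=
        setLIntegral_eq_const (hBm.diff hCm) (fun z hz => if_neg hz.2)
      rw [← lintegral_inter_add_sdiff (A := S) (B := T) _ hCm, e1, e2, one_mul,
        Set.inter_eq_right.2 hsub]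
    rw [h2]
    have hd : ν (S \ T) = ENNReal.ofReal (ν.real S - ν.real T) := by
      rw [← measureReal_sdiff hsub hCm]; simp
    have hSr : ν S = ENNReal.ofReal (ν.real S) := by simp
    have hTr : ν T = ENNReal.ofReal (ν.real T) := by simp
    have hST : ν.real T ≤ ν.real S := measureReal_mono hsub
    rw [hSr, hTr, ← ENNReal.ofReal_mul (by positivity),
      ENNReal.ofReal_le_ofReal_iff measureReal_nonneg] at h1
    rw [hd, hTr, hSr, ← ENNReal.ofReal_mul (by norm_num), ← ENNReal.ofReal_add (by positivity)
      (by linarith), ← ENNReal.ofReal_mul (Real.exp_nonneg _)]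
    refine ENNReal.ofReal_le_ofReal ?_
    have h3 : κ / K = 2 * a := by rw [ha]; ring
    rw [h3] at h1
    have h4 : Real.exp a * (1 - a) ≤ 1 := by
      have := Real.add_one_le_exp (-a)
      calc _ ≤ Real.exp a * Real.exp (-a) := by gcongr; linarith
        _ = 1 := by rw [← Real.exp_add]; simp
    calc _ ≤ Real.exp a * ((1 - a) * ν.real S) := by gcongr; linarith
      _ = (Real.exp a * (1 - a)) * ν.real S := by ring
      _ ≤ 1 * ν.real S := by gcongr
      _ = _ := one_mul _)
  have hA := measure_ge_le_lintegral (measurable_touched hBm hm I)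
    (Real.exp_pos (κ / (4 * K) * N)) hint
  rw [← Real.exp_neg] at hA
  rw [Measure.map_apply hφ (measurableSet_obsBin B)]
  refine le_trans (measure_mono ?_) hA
  rintro v ⟨hv1, hv2⟩
  rw [Set.mem_ofPred_eq]
  set o : ℕ → Obs d K := fun i => φ (v i)
  have hpos : 0 < (hitsBin I o B).card := by
    have : (0 : ℝ) < (hitsBin I o B).card := hN.trans_le hv1
    exact_mod_cast this
  have hex : ∃ i ∈ I, v i ∈ φ ⁻¹' {o : Obs d K | o.1 ∈ B.carrier} := by
    obtain ⟨i, hi⟩ := Finset.card_pos.1 hpos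
    rw [hitsBin, Finset.mem_filter] at hi
    exact ⟨i, hi.1, hi.2⟩
  rw [if_pos hex]
  have h1 : ∏ i ∈ I, h (v i) = ENNReal.ofReal (Real.exp a ^ (hitsBin I o B).card *
      (1 / 2) ^ (hits I o B k).card) := by
    rw [ENNReal.ofReal_mul (pow_nonneg (Real.exp_nonneg _) _), ENNReal.ofReal_pow
      (Real.exp_nonneg _), ENNReal.ofReal_pow (by norm_num), ← Finset.prod_const, ← Finset.prod_const, hits,
      hitsBin, Finset.prod_filter, Finset.prod_filter, ← Finset.prod_mul_distrib]
    refine Finset.prod_congr rfl fun i _ => ?_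
    simp only [hh, o]
    by_cases hi : (φ (v i)).1 ∈ B.carrier
    · simp [hi]
    · simp [hi]
  rw [h1]
  refine ENNReal.ofReal_le_ofReal ?_
  have h2 : (1 / 2 : ℝ) ^ (hits I o B k).card = Real.exp (-(Real.log 2 * (hits I o B k).card)) := by
    rw [← Real.rpow_natCast, Real.rpow_def_of_pos (by norm_num), one_div, Real.log_inv]
    ring_nf
  rw [h2, ← Real.exp_nat_mul, ← Real.exp_add]
  refine Real.exp_le_exp.2 ?_
  have h3 := mul_le_mul_of_nonneg_right log_two_le_one
      (Nat.cast_nonneg (α := ℝ) (hits I o B k).card)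
  have h4 : κ / (4 * K) = a / 2 := by rw [ha]; ring
  rw [h4] at hv2 ⊢
  have h5 := mul_le_mul_of_nonneg_left hv1 (by positivity : 0 ≤ a / 2)
  nlinarith

end IID

/-! ### Confidence bounds and pull limits -/

section Elimination

variable {d K : ℕ}

/-- The standing assumptions on the input of the second stage. -/
structure Stage.Valid (S : Stage d K) : Prop where
  n_gt : 1 < S.n
  C_pos : 0 < S.C
  β_pos : 0 < S.β
  tie_mem : ∀ s : Finset (Fin K), s.Nonempty → S.tie s ∈ s

/-- The bias scale `|B| ^ β` of a bin. -/
def Stage.scale (S : Stage d K) (B : Bin d) : ℝ := B.side ^ S.β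

/-- The (real) number of observations at which deviation and bias balance. -/
def Stage.need (S : Stage d K) (B : Bin d) : ℝ :=
  2 * Real.log S.n / (S.C * S.scale B) ^ 2

theorem Stage.scale_pos (S : Stage d K) (B : Bin d) : 0 < S.scale B :=
  Real.rpow_pos_of_pos B.side_pos _

variable {S : Stage d K}

theorem Stage.Valid.log_pos (h : S.Valid) : 0 < Real.log S.n := Real.log_pos h.n_gt

theorem Stage.Valid.need_pos (h : S.Valid) (B : Bin d) : 0 < S.need B := by
  have := h.log_pos
  have := h.C_pos
  have := S.scale_pos B
  unfold Stage.need; positivity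

/-- The real version of the confidence bound. -/
def Stage.radius (S : Stage d K) (B : Bin d) (k : Fin K) (τ : ℕ) : ℝ :=
  max (2 * √(2 / ((τ : ℝ) + S.count B k) * Real.log S.n)) (2 * S.C * S.scale B)

theorem Stage.conf_eq (S : Stage d K) (B : Bin d) (k : Fin K) (τ : ℕ) :
    S.conf B k τ = if τ + S.count B k = 0 then ⊤ else (S.radius B k τ : EReal) := rfl

/-- With a fraction `ρ` of the balancing number of observations the deviation term is at most `ρ ^
(-1/2)` times its balanced value; the bias term does not depend on the number. -/
theorem Stage.Valid.conf_le_of_need (h : S.Valid) {B : Bin d} {k : Fin K} {τ : ℕ} {ρ : ℝ}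
    (hρ : 0 < ρ) (hρ1 : ρ ≤ 1) (hm : ρ * S.need B ≤ (τ : ℝ) + S.count B k) :
    S.conf B k τ ≤ ((2 * S.C * S.scale B / √ρ : ℝ) : EReal) := by
  have hl := h.log_pos
  have hC := h.C_pos
  have hw := S.scale_pos B
  have hn := h.need_pos B
  have hm0 : 0 < (τ : ℝ) + S.count B k := lt_of_lt_of_le (by positivity) hm
  have hne : ¬ (τ + S.count B k = 0) := by
    intro h0
    have : (τ : ℝ) + S.count B k = 0 := by exact_mod_cast h0
    linarith
  rw [Stage.conf_eq, if_neg hne, EReal.coe_le_coe_iff]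
  have hsq : 0 < √ρ := Real.sqrt_pos.2 hρ
  have hsq1 : √ρ ≤ 1 := Real.sqrt_le_one.2 hρ1
  refine max_le ?_ ?_
  · have h1 : 2 / ((τ : ℝ) + S.count B k) * Real.log S.n ≤ (S.C * S.scale B / √ρ) ^ 2 := by
      rw [div_pow, Real.sq_sqrt hρ.le, div_mul_eq_mul_div, div_le_div_iff₀ hm0 hρ]
      have h2 : S.need B * (S.C * S.scale B) ^ 2 = 2 * Real.log S.n := by
        unfold Stage.need; field_simp
      rw [← h2]
      have := mul_le_mul_of_nonneg_right hm (by positivity : 0 ≤ (S.C * S.scale B) ^ 2)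
      linarith
    have h3 := Real.sqrt_le_sqrt h1
    rw [Real.sqrt_sq (by positivity)] at h3
    calc _ ≤ 2 * (S.C * S.scale B / √ρ) := by linarith
      _ = _ := by ring
  · rw [le_div_iff₀ hsq]
    have : 0 < 2 * S.C * S.scale B := by positivity
    nlinarith

theorem Stage.Valid.conf_le_iff (h : S.Valid) (B : Bin d) (k : Fin K) (τ : ℕ) :
    S.conf B k τ ≤ ((2 * S.C * B.side ^ S.β : ℝ) : EReal) ↔
      S.need B ≤ (τ : ℝ) + S.count B k := by
  have hl := h.log_pos
  have hC := h.C_pos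
  have hw := S.scale_pos B
  change _ ≤ ((2 * S.C * S.scale B : ℝ) : EReal) ↔ _
  constructor
  · intro hc
    rw [Stage.conf_eq] at hc
    split_ifs at hc with h0
    · exact absurd hc (not_le.2 (EReal.coe_lt_top _))
    · rw [EReal.coe_le_coe_iff] at hc
      have h1 := (le_max_left _ _).trans hc
      have hm0 : 0 < (τ : ℝ) + S.count B k := by
        have : 0 < τ + S.count B k := Nat.pos_of_ne_zero h0
        exact_mod_cast this
      have h2 : √(2 / ((τ : ℝ) + S.count B k) * Real.log S.n) ≤ S.C * S.scale B := by linarith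
      rw [Real.sqrt_le_left (by positivity), div_mul_eq_mul_div, div_le_iff₀ hm0] at h2
      unfold Stage.need
      rw [div_le_iff₀ (by positivity)]
      linarith
  · intro hm
    have := h.conf_le_of_need one_pos le_rfl (by rwa [one_mul] : (1 : ℝ) * S.need B ≤ _)
    simpa using this

/-- The set in the infimum is nonempty and upward closed, so the infimum is attained. In particular
a limit `0` means that the source sample fills the need, and is never the default value of `sInf ∅`.
-/
theorem Stage.Valid.limit_le_iff (h : S.Valid) (B : Bin d) (k : Fin K) (τ : ℕ) :
    S.limit B k ≤ τ ↔ S.need B ≤ (τ : ℝ) + S.count B k := by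
  have hset : {τ : ℕ | S.conf B k τ ≤ ((2 * S.C * B.side ^ S.β : ℝ) : EReal)} =
      {τ : ℕ | S.need B ≤ (τ : ℝ) + S.count B k} := by
    ext τ; exact h.conf_le_iff B k τ
  unfold Stage.limit
  rw [hset]
  constructor
  · intro hle
    have hne : {τ : ℕ | S.need B ≤ (τ : ℝ) + S.count B k}.Nonempty := by
      obtain ⟨m, hm⟩ := exists_nat_ge (S.need B)
      exact ⟨m, by rw [Set.mem_ofPred_eq]; have : (0 : ℝ) ≤ S.count B k := Nat.cast_nonneg _; linarith⟩
    have hm := Nat.sInf_mem hne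
    rw [Set.mem_ofPred_eq] at hm
    have : ((sInf {τ : ℕ | S.need B ≤ (τ : ℝ) + S.count B k} : ℕ) : ℝ) ≤ τ := by exact_mod_cast hle
    linarith
  · intro hm
    exact Nat.sInf_le hm

theorem Stage.Valid.limit_le_need (h : S.Valid) (B : Bin d) (k : Fin K) :
    (S.limit B k : ℝ) ≤ S.need B + 1 := by
  have h1 : S.limit B k ≤ ⌈S.need B⌉₊ := by
    rw [h.limit_le_iff]
    have := Nat.le_ceil (S.need B)
    have : (0 : ℝ) ≤ S.count B k := Nat.cast_nonneg _
    linarith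
  have h2 := Nat.ceil_lt_add_one (h.need_pos B).le
  have h3 : (S.limit B k : ℝ) ≤ (⌈S.need B⌉₊ : ℝ) := by exact_mod_cast h1
  linarith

/-- The mean `m` lies within the confidence bound of `f k x`. -/
def Stage.InConf (S : Stage d K) (B : Bin d) (k : Fin K) (τ : ℕ) (m y : ℝ) : Prop :=
  τ + S.count B k = 0 ∨ |m - y| ≤ S.radius B k τ

theorem Stage.InConf.sub_le {B : Bin d} {k : Fin K} {τ : ℕ} {m y : ℝ} (h : S.InConf B k τ m y) :
    (m : EReal) - S.conf B k τ ≤ (y : EReal) := by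
  rw [Stage.conf_eq]
  split_ifs with h0
  · rw [EReal.sub_top]; exact bot_le
  · have := (abs_le.1 (h.resolve_left h0)).2
    rw [← EReal.coe_sub, EReal.coe_le_coe_iff]
    linarith

theorem Stage.InConf.le_add {B : Bin d} {k : Fin K} {τ : ℕ} {m y : ℝ} (h : S.InConf B k τ m y) :
    (y : EReal) ≤ (m : EReal) + S.conf B k τ := by
  rw [Stage.conf_eq]
  split_ifs with h0
  · rw [EReal.coe_add_top]; exact le_top
  · have := (abs_le.1 (h.resolve_left h0)).1
    rw [← EReal.coe_add, EReal.coe_le_coe_iff]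
    linarith

theorem Stage.InConf.le_sub {B : Bin d} {k : Fin K} {τ : ℕ} {m y u : ℝ} (h : S.InConf B k τ m y)
    (hu : S.conf B k τ ≤ (u : EReal)) : ((y - 2 * u : ℝ) : EReal) ≤ (m : EReal) - S.conf B k τ := by
  rw [Stage.conf_eq] at hu ⊢
  split_ifs at hu ⊢ with h0
  · exact absurd hu (not_le.2 (EReal.coe_lt_top _))
  · have := (abs_le.1 (h.resolve_left h0)).1
    rw [EReal.coe_le_coe_iff] at hu
    rw [← EReal.coe_sub, EReal.coe_le_coe_iff]
    linarith

theorem Stage.InConf.add_le {B : Bin d} {k : Fin K} {τ : ℕ} {m y u : ℝ} (h : S.InConf B k τ m y)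
    (hu : S.conf B k τ ≤ (u : EReal)) : (m : EReal) + S.conf B k τ ≤ ((y + 2 * u : ℝ) : EReal) := by
  rw [Stage.conf_eq] at hu ⊢
  split_ifs at hu ⊢ with h0
  · exact absurd hu (not_le.2 (EReal.coe_lt_top _))
  · have := (abs_le.1 (h.resolve_left h0)).2
    rw [EReal.coe_le_coe_iff] at hu
    rw [← EReal.coe_add, EReal.coe_le_coe_iff]
    linarith

/-! ### One pass of the elimination procedure -/

/-- Among the arms below their limit, those still queued have `p - 1` pulls and those already
visited in this pass have `p`. A scan changes only the active set and the queue, so the tests that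
eliminated arms failed, and the test that the returned arm passed, all refer to the counts, means
and lower bound from before the scan. -/
theorem Stage.scan_spec (S : Stage d K) (B : Bin d) (p : ℕ) : ∀ (q : List (Fin K)) (s : Node K),
    q.Nodup → q ⊆ s.active.toList →
    (∀ j ∈ s.active, S.limit B j ≤ s.pulls j ∨ s.pulls j + (if j ∈ q then 1 else 0) = p) →
    (S.scan B q s).1.pulls = s.pulls ∧ (S.scan B q s).1.mean = s.mean ∧
    (S.scan B q s).1.lower = s.lower ∧ (S.scan B q s).1.active ⊆ s.active ∧
    (S.scan B q s).1.queue.Nodup ∧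
    (S.scan B q s).1.queue ⊆ (S.scan B q s).1.active.toList ∧
    (∀ k ∈ s.active, k ∉ (S.scan B q s).1.active → s.pulls k < S.limit B k ∧
      ¬ s.lower ≤ (s.mean k : EReal) + S.conf B k (s.pulls k)) ∧
    (∀ k, (S.scan B q s).2 = some k → k ∈ (S.scan B q s).1.active ∧ s.pulls k < S.limit B k ∧
      s.lower ≤ (s.mean k : EReal) + S.conf B k (s.pulls k) ∧ k ∉ (S.scan B q s).1.queue ∧
      ∀ j ∈ (S.scan B q s).1.active, S.limit B j ≤ s.pulls j ∨
        s.pulls j + (if j ∈ (S.scan B q s).1.queue ∨ j = k then 1 else 0) = p) ∧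
    ((S.scan B q s).2 = none → (S.scan B q s).1.queue = [] ∧
      ∀ j ∈ (S.scan B q s).1.active, S.limit B j ≤ s.pulls j ∨ (s.pulls j = p ∧ j ∉ q)) := by
  intro q
  induction q with
  | nil =>
    intro s _ _ hp
    simp only [Stage.scan]
    simp only [List.not_mem_nil, if_false, add_zero] at hp
    simp only [true_and, subset_rfl, List.nodup_nil, List.nil_subset, reduceCtorEq, false_imp_iff,
      implies_true, not_false_eq_true, and_true, true_imp_iff, List.not_mem_nil]
    exact ⟨fun k h1 h2 => absurd h1 h2, hp⟩
  | cons k q ih =>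
    intro s hnd hsub hp
    rw [List.nodup_cons] at hnd
    rw [List.cons_subset] at hsub
    unfold Stage.scan
    by_cases h1 : s.pulls k < S.limit B k
    · rw [if_pos h1]
      by_cases h2 : s.lower ≤ (s.mean k : EReal) + S.conf B k (s.pulls k)
      · rw [if_pos h2]
        refine ⟨rfl, rfl, rfl, subset_rfl, hnd.2, hsub.2, fun j hj hj' => absurd hj hj', ?_, ?_⟩
        · rintro j hj
          obtain rfl : k = j := by simpa using hj
          refine ⟨by simpa using hsub.1, h1, h2, hnd.1, fun j hj => ?_⟩
          simpa [or_comm] using hp j hj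
        · intro h; exact absurd h (by simp)
      · rw [if_neg h2]
        have hsub' : q ⊆ (s.active.erase k).toList := by
          intro j hj
          rw [Finset.mem_toList, Finset.mem_erase]
          exact ⟨fun h => hnd.1 (h ▸ hj), by simpa using hsub.2 hj⟩
        have := ih { s with active := s.active.erase k } hnd.2 hsub' (by
          intro j hj
          rw [Finset.mem_erase] at hj
          have := hp j hj.2
          simpa [hj.1] using this)
        obtain ⟨e1, e2, e3, e4, e5, e6, e7, e8, e9⟩ := this
        refine ⟨e1, e2, e3, e4.trans (Finset.erase_subset _ _), e5, e6, ?_, e8, ?_⟩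
        · intro j hj hj'
          by_cases hjk : j = k
          · subst hjk; exact ⟨h1, h2⟩
          · exact e7 j (Finset.mem_erase.2 ⟨hjk, hj⟩) hj'
        · intro hn
          refine ⟨(e9 hn).1, fun j hj => ?_⟩
          have hjk : j ≠ k := (Finset.mem_erase.1 (e4 hj)).1
          simpa [hjk] using (e9 hn).2 j hj
    · rw [if_neg h1]
      have := ih s hnd.2 hsub.2 (by
        intro j hj
        by_cases hjk : j = k
        · subst hjk; left; omega
        · simpa [hjk] using hp j hj)
      obtain ⟨e1, e2, e3, e4, e5, e6, e7, e8, e9⟩ := this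
      refine ⟨e1, e2, e3, e4, e5, e6, e7, e8, fun hn => ⟨(e9 hn).1, fun j hj => ?_⟩⟩
      by_cases hjk : j = k
      · subst hjk; left; omega
      · simpa [hjk] using (e9 hn).2 j hj

/-- The structural invariant of a pass: the queue consists of distinct active arms, and arms below
their limit differ in their numbers of pulls only by whether they were visited in this pass. -/
structure Stage.PassInv (S : Stage d K) (B : Bin d) (s : Node K) : Prop where
  nodup : s.queue.Nodup
  sub : s.queue ⊆ s.active.toList
  pass : ∃ p : ℕ, ∀ j ∈ s.active,
    S.limit B j ≤ s.pulls j ∨ s.pulls j + (if j ∈ s.queue then 1 else 0) = p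

/-- A fresh pass over all active arms returns nothing only if every survivor has reached its limit.
The final dichotomy, an arm below its limit that passed its test or a bin without arms below their
limits, drives both the count of visits and the gap bound. -/
theorem Stage.next_spec {B : Bin d} {s : Node K} (hs : S.PassInv B s) :
    (S.next B s).1.pulls = s.pulls ∧ (S.next B s).1.mean = s.mean ∧
    (S.next B s).1.lower = s.lower ∧ (S.next B s).1.active ⊆ s.active ∧
    (S.next B s).1.queue.Nodup ∧ (S.next B s).1.queue ⊆ (S.next B s).1.active.toList ∧
    (∀ k ∈ s.active, k ∉ (S.next B s).1.active → s.pulls k < S.limit B k ∧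
      ¬ s.lower ≤ (s.mean k : EReal) + S.conf B k (s.pulls k)) ∧
    (((S.next B s).2 ∈ (S.next B s).1.active ∧
      s.pulls (S.next B s).2 < S.limit B (S.next B s).2 ∧
      s.lower ≤ (s.mean (S.next B s).2 : EReal) + S.conf B (S.next B s).2
        (s.pulls (S.next B s).2) ∧ (S.next B s).2 ∉ (S.next B s).1.queue ∧
      ∃ p : ℕ, ∀ j ∈ (S.next B s).1.active, S.limit B j ≤ s.pulls j ∨
        s.pulls j + (if j ∈ (S.next B s).1.queue ∨ j = (S.next B s).2 then 1 else 0) = p) ∨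
    ((∀ j ∈ (S.next B s).1.active, S.limit B j ≤ s.pulls j) ∧
      (S.next B s).2 = S.best (S.next B s).1)) := by
  obtain ⟨p, hp⟩ := hs.pass
  have H1 := S.scan_spec B p s.queue s hs.nodup hs.sub hp
  unfold Stage.next
  rcases hsc : S.scan B s.queue s with ⟨s₁, o₁⟩
  rw [hsc] at H1
  obtain ⟨a1, a2, a3, a4, a5, a6, a7, a8, a9⟩ := H1
  rcases o₁ with _ | k
  · simp only
    have a9' := a9 rfl
    -- After a completed pass every active arm below its limit has `p` pulls; queueing all of them
    -- again gives the pass invariant with `p + 1`.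
    have H2 := S.scan_spec B (p + 1) s₁.active.sort s₁ (Finset.sort_nodup _ _)
      (by intro j hj; simpa using hj) (by
        intro j hj
        rw [if_pos (by simpa using hj)]
        rcases a9'.2 j hj with h | h
        · left; simp only at a1; rw [a1]; exact h
        · right; simp only at a1; rw [a1, h.1])
    rcases hsc2 : S.scan B s₁.active.sort s₁ with ⟨s₂, o₂⟩
    rw [hsc2] at H2
    simp only [hsc2]
    obtain ⟨b1, b2, b3, b4, b5, b6, b7, b8, b9⟩ := H2
    simp only at a1 a2 a3 a4 a7 b1 b2 b3 b4 b5 b6 b7 b8 b9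
    have hel : ∀ k ∈ s.active, k ∉ s₂.active → s.pulls k < S.limit B k ∧
        ¬ s.lower ≤ (s.mean k : EReal) + S.conf B k (s.pulls k) := by
      intro k hk hk2
      by_cases hk1 : k ∈ s₁.active
      · have := b7 k hk1 hk2
        rwa [a1, a2, a3] at this
      · exact a7 k hk hk1
    rcases o₂ with _ | k
    · refine ⟨b1.trans a1, b2.trans a2, b3.trans a3, b4.trans a4, b5, b6, hel, Or.inr ⟨?_, rfl⟩⟩
      intro j hj
      rcases (b9 rfl).2 j hj with h | h
      · rwa [a1] at h
      · exact absurd (by simpa using b4 hj) h.2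
    · refine ⟨b1.trans a1, b2.trans a2, b3.trans a3, b4.trans a4, b5, b6, hel, Or.inl ?_⟩
      obtain ⟨c1, c2, c3, c4, c5⟩ := b8 k rfl
      rw [a1] at c2 c3 c5
      rw [a2, a3] at c3
      exact ⟨c1, c2, c3, c4, p + 1, c5⟩
  · simp only
    refine ⟨a1, a2, a3, a4, a5, a6, a7, Or.inl ?_⟩
    obtain ⟨c1, c2, c3, c4, c5⟩ := a8 k rfl
    exact ⟨c1, c2, c3, c4, p, c5⟩

theorem Stage.Valid.best_mem (h : S.Valid) {s : Node K} (hs : s.active.Nonempty) :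
    S.best s ∈ s.active := by
  obtain ⟨k, hk, hmax⟩ := Finset.exists_max_image s.active s.mean hs
  have := h.tie_mem (s.active.filter (fun k => ∀ j ∈ s.active, s.mean j ≤ s.mean k))
    ⟨k, Finset.mem_filter.2 ⟨hk, hmax⟩⟩
  exact (Finset.mem_filter.1 this).1

end Elimination

/-! ### The adaptive partition -/

section Partition

variable {d K : ℕ}

/-- The leaves of `T` partition the generic points and have level at most `L`; each leaf satisfies
`P`, and the bins strictly below a leaf satisfy `F`. -/
structure TreeInv (L : ℕ) (P : Bin d → Node K → Prop) (F : Bin d → Prop) (T : Tree d K) :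
    Prop where
  ex : ∀ x : Cov d, Generic x → ∃ l, cell l x ∈ T.leaves
  uniq : ∀ x : Cov d, Generic x → ∀ l l', cell l x ∈ T.leaves → cell l' x ∈ T.leaves → l = l'
  lev : ∀ B ∈ T.leaves, B.1 ≤ L
  below : ∀ x : Cov d, Generic x → ∀ l l', l < l' → cell l x ∈ T.leaves → F (cell l' x)
  leaf : ∀ x : Cov d, Generic x → ∀ l, cell l x ∈ T.leaves → P (cell l x) (T.node (cell l x))

variable {S : Stage d K} {L : ℕ} {P : Bin d → Node K → Prop} {F : Bin d → Prop} {T : Tree d K}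

theorem TreeInv.locate_eq (h : TreeInv L P F T) {x : Cov d} (hx : Generic x) {l : ℕ}
    (hl : cell l x ∈ T.leaves) : locate T.leaves x = cell l x := by
  refine TransferBandit.locate_eq hl (mem_cell hx.1 l) fun B' hB' hxB' => ?_
  have h1 := hx.eq_cell hxB'
  rw [h1] at hB' ⊢
  rw [h.uniq x hx _ _ hB' hl]

/-- Generic points of the split cell get exactly one of its children as leaf, all others keep
theirs. The property `F` of bins strictly below a leaf, namely that they were never used, is what
the new nodes start from. -/
theorem TreeInv.split (h : TreeInv L P F T) {x : Cov d} (hx : Generic x) {l : ℕ}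
    (hl : cell l x ∈ T.leaves) (hlL : l < L)
    (hP : ∀ y, Generic y → y ∈ (cell l x).carrier → F (cell (l + 1) y) →
      P (cell (l + 1) y) (S.start (cell (l + 1) y)
        (S.passOn (cell l x) (T.node (cell l x)).active))) :
    TreeInv L P F (S.split (cell l x) T) := by
  have hmem : ∀ B, B ∈ (S.split (cell l x) T).leaves ↔
      (B ≠ cell l x ∧ B ∈ T.leaves) ∨ B ∈ (cell l x).children := by
    intro B
    simp only [Stage.split, Finset.mem_union, Finset.mem_erase]
  have hchild : ∀ y, Generic y → ∀ m, cell m y ∈ (cell l x).children →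
      m = l + 1 ∧ y ∈ (cell l x).carrier ∧ cell l y = cell l x := by
    intro y hy m hm
    obtain ⟨h1, h2⟩ := Bin.mem_children.1 hm
    have h3 := h2 (mem_cell hy.1 m)
    exact ⟨h1, h3, cell_eq_of_mem hx hy h3 le_rfl⟩
  have hnew : ∀ y, Generic y → y ∈ (cell l x).carrier → cell (l + 1) y ∈ (cell l x).children := by
    intro y hy hyB
    rw [← cell_eq_of_mem hx hy hyB le_rfl]
    exact cell_succ_mem_children hy l
  have hold : ∀ y, Generic y → ∀ m, cell m y ≠ cell l x → cell m y ∈ T.leaves →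
      y ∉ (cell l x).carrier := by
    intro y hy m hne hm hyB
    have he := cell_eq_of_mem hx hy hyB le_rfl
    have := h.uniq y hy m l hm (he ▸ hl)
    subst this
    exact hne he
  refine ⟨?_, ?_, ?_, ?_, ?_⟩
  · intro y hy
    by_cases hyB : y ∈ (cell l x).carrier
    · exact ⟨l + 1, (hmem _).2 (Or.inr (hnew y hy hyB))⟩
    · obtain ⟨m, hm⟩ := h.ex y hy
      refine ⟨m, (hmem _).2 (Or.inl ⟨fun he => hyB ?_, hm⟩)⟩
      rw [← he]; exact mem_cell hy.1 m
  · intro y hy m m' hm hm'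
    rcases (hmem _).1 hm with ⟨h1, h2⟩ | h1 <;> rcases (hmem _).1 hm' with ⟨h1', h2'⟩ | h1'
    · exact h.uniq y hy _ _ h2 h2'
    · exact absurd (hchild y hy _ h1').2.1 (hold y hy m h1 h2)
    · exact absurd (hchild y hy _ h1).2.1 (hold y hy m' h1' h2')
    · rw [(hchild y hy _ h1).1, (hchild y hy _ h1').1]
  · intro B hB
    rcases (hmem _).1 hB with ⟨_, h2⟩ | h1
    · exact h.lev B h2
    · have := (Bin.mem_children.1 h1).1
      rw [cell_fst] at this
      omega
  · intro y hy m m' hlt hm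
    rcases (hmem _).1 hm with ⟨_, h2⟩ | h1
    · exact h.below y hy m m' hlt h2
    · obtain ⟨h3, _, h5⟩ := hchild y hy _ h1
      exact h.below y hy l m' (by omega) (h5 ▸ hl)
  · intro y hy m hm
    rcases (hmem _).1 hm with ⟨h1, h2⟩ | h1
    · have : cell m y ∉ (cell l x).children := fun hc =>
        hold y hy m h1 h2 (hchild y hy m hc).2.1
      simp only [Stage.split, if_neg this]
      exact h.leaf y hy m h2
    · obtain ⟨h3, h4, h5⟩ := hchild y hy _ h1
      simp only [Stage.split, if_pos h1]
      subst h3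
      exact hP y hy h4 (h.below y hy l (l + 1) (Nat.lt_succ_self l) (h5 ▸ hl))

/-- The hypothesis under which `P` passes from a split bin to its children. -/
def SplitOK (S : Stage d K) (L : ℕ) (P : Bin d → Node K → Prop) (F : Bin d → Prop) : Prop :=
  ∀ (x : Cov d), Generic x → ∀ (l : ℕ) (s : Node K), P (cell l x) s → 1 < s.active.card →
    (∀ k ∈ s.active, S.limit (cell l x) k ≤ s.pulls k) →
    l < L ∧ ∀ y, Generic y → y ∈ (cell l x).carrier → F (cell (l + 1) y) →
      P (cell (l + 1) y) (S.start (cell (l + 1) y) (S.passOn (cell l x) s.active))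

theorem TreeInv.iterate (h : TreeInv L P F T) (hsp : SplitOK S L P F) {x : Cov d}
    (hx : Generic x) {l : ℕ} (hl : cell l x ∈ T.leaves) (m : ℕ)
    (hm : ∀ j < m, S.exhausted
      (locate ((fun T' => S.split (locate T'.leaves x) T')^[j] T).leaves x)
      ((fun T' => S.split (locate T'.leaves x) T')^[j] T)) :
    TreeInv L P F ((fun T' => S.split (locate T'.leaves x) T')^[m] T) ∧
      cell (l + m) x ∈ ((fun T' => S.split (locate T'.leaves x) T')^[m] T).leaves := by
  induction m with
  | zero => exact ⟨h, hl⟩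
  | succ m ih =>
    obtain ⟨h1, h2⟩ := ih fun j hj => hm j (hj.trans (Nat.lt_succ_self m))
    have h3 := hm m (Nat.lt_succ_self m)
    rw [Function.iterate_succ_apply']
    generalize (fun T' => S.split (locate T'.leaves x) T')^[m] T = T' at *
    rw [h1.locate_eq hx h2] at h3 ⊢
    obtain ⟨h4, h5⟩ := hsp x hx (l + m) _ (h1.leaf x hx _ h2) h3.1 h3.2
    refine ⟨h1.split hx h2 h4 h5, ?_⟩
    simp only [Stage.split, Finset.mem_union]
    right
    exact cell_succ_mem_children hx (l + m)

/-- Each split moves the leaf of `x` one level down, and only leaves of level less than `L` can be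
split. Hence the loop ends, and `whileLoop` does not return its default value. -/
theorem TreeInv.exists_not_exhausted (h : TreeInv L P F T) (hsp : SplitOK S L P F) {x : Cov d}
    (hx : Generic x) : ∃ m, ¬ S.exhausted
      (locate ((fun T' => S.split (locate T'.leaves x) T')^[m] T).leaves x)
      ((fun T' => S.split (locate T'.leaves x) T')^[m] T) := by
  by_contra hcon
  push Not at hcon
  obtain ⟨l, hl⟩ := h.ex x hx
  obtain ⟨h1, h2⟩ := h.iterate hsp hx hl L fun j _ => hcon j
  have h3 := hcon L
  rw [h1.locate_eq hx h2] at h3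
  have := (hsp x hx (l + L) _ (h1.leaf x hx _ h2) h3.1 h3.2).1
  omega

theorem whileLoop_eq {σ : Type} {c : σ → Prop} {body : σ → σ} {s : σ}
    (h : ∃ m : ℕ, ¬ c (body^[m] s)) :
    ∃ m : ℕ, whileLoop c body s = body^[m] s ∧ ¬ c (body^[m] s) ∧
      ∀ j < m, c (body^[j] s) := by
  refine ⟨Nat.find h, ?_, Nat.find_spec h, fun j hj => ?_⟩
  · unfold whileLoop
    rw [dif_pos h]
  · have := Nat.find_min h hj
    push Not at this
    exact this

theorem TreeInv.refine_spec (h : TreeInv L P F T) (hsp : SplitOK S L P F) {x : Cov d}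
    (hx : Generic x) : ∃ m, S.refine x T = (fun T' => S.split (locate T'.leaves x) T')^[m] T ∧
      ¬ S.exhausted (locate ((fun T' => S.split (locate T'.leaves x) T')^[m] T).leaves x)
        ((fun T' => S.split (locate T'.leaves x) T')^[m] T) ∧
      ∀ j < m, S.exhausted
        (locate ((fun T' => S.split (locate T'.leaves x) T')^[j] T).leaves x)
        ((fun T' => S.split (locate T'.leaves x) T')^[j] T) :=
  whileLoop_eq (c := fun T' : Tree d K => S.exhausted (locate T'.leaves x) T')
    (h.exists_not_exhausted hsp hx)

theorem TreeInv.refine (h : TreeInv L P F T) (hsp : SplitOK S L P F) {x : Cov d}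
    (hx : Generic x) : TreeInv L P F (S.refine x T) ∧
      ¬ S.exhausted (locate (S.refine x T).leaves x) (S.refine x T) := by
  obtain ⟨l, hl⟩ := h.ex x hx
  obtain ⟨m, h1, h2, h3⟩ := h.refine_spec hsp hx
  rw [h1]
  exact ⟨(h.iterate hsp hx hl m h3).1, h2⟩

/-- The refinement does not depend on the position of the point in the bin finally reached. -/
theorem TreeInv.refine_eq (h : TreeInv L P F T) (hsp : SplitOK S L P F) {x y : Cov d}
    (hx : Generic x) (hy : Generic y)
    (hyx : y ∈ (locate (S.refine x T).leaves x).carrier) :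
    S.refine y T = S.refine x T ∧
      locate (S.refine y T).leaves y = locate (S.refine x T).leaves x := by
  obtain ⟨l, hl⟩ := h.ex x hx
  obtain ⟨a, hrw, hxa, hxj⟩ := h.refine_spec hsp hx
  obtain ⟨b, hrwy, hyb, hyj⟩ := h.refine_spec hsp hy
  have hit : ∀ m ≤ a,
      TreeInv L P F ((fun T' => S.split (locate T'.leaves x) T')^[m] T) ∧
      cell (l + m) x ∈ ((fun T' => S.split (locate T'.leaves x) T')^[m] T).leaves :=
    fun m hm => h.iterate hsp hx hl m fun j hj => hxj j (lt_of_lt_of_le hj hm)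
  have hyc : y ∈ (cell (l + a) x).carrier := by
    rw [hrw, (hit _ le_rfl).1.locate_eq hx (hit _ le_rfl).2] at hyx
    exact hyx
  have hcell : ∀ m ≤ a, cell (l + m) y = cell (l + m) x := fun m hm =>
    cell_eq_of_mem hx hy hyc (by omega)
  have hloc : ∀ m ≤ a,
      locate ((fun T' => S.split (locate T'.leaves x) T')^[m] T).leaves y =
        locate ((fun T' => S.split (locate T'.leaves x) T')^[m] T).leaves x := by
    intro m hm
    obtain ⟨h1, h2⟩ := hit m hm
    rw [h1.locate_eq hx h2, h1.locate_eq hy (by rw [hcell m hm]; exact h2), hcell m hm]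
  have hiter : ∀ m ≤ a, (fun T' => S.split (locate T'.leaves y) T')^[m] T =
      (fun T' => S.split (locate T'.leaves x) T')^[m] T := by
    intro m
    induction m with
    | zero => intro _; rw [Function.iterate_zero_apply, Function.iterate_zero_apply]
    | succ m ih =>
      intro hm
      rw [Function.iterate_succ_apply', Function.iterate_succ_apply', ih (by omega),
        hloc m (by omega)]
  -- Up to step `a` the two loops run through the same trees and the same leaves, so they stop at
  -- the same step.
  have hfind : b = a := by
    rcases lt_trichotomy b a with hlt | he | hlt
    · rw [hiter _ hlt.le, hloc _ hlt.le] at hyb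
      exact absurd (hxj b hlt) hyb
    · exact he
    · have := hyj a hlt
      rw [hiter _ le_rfl, hloc _ le_rfl] at this
      exact absurd this hxa
  have he : S.refine y T = S.refine x T := by
    rw [hrw, hrwy, hfind, hiter _ le_rfl]
  refine ⟨he, ?_⟩
  rw [he, hrw]
  exact hloc _ le_rfl

/-- The bin used in the round is a leaf, so by uniqueness it does not lie strictly below another
leaf; it may lose the property `F` without harm. -/
theorem TreeInv.update {P' : Bin d → Node K → Prop} {F' : Bin d → Prop}
    (h : TreeInv L P F T) {x : Cov d} {l : ℕ} (hl : cell l x ∈ T.leaves)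
    {s : Node K} (hs : P' (cell l x) s)
    (hP : ∀ B s', B ≠ cell l x → P B s' → P' B s')
    (hF : ∀ B, B ≠ cell l x → F B → F' B) :
    TreeInv L P' F' { leaves := T.leaves, node := Function.update T.node (cell l x) s } := by
  refine ⟨h.ex, h.uniq, h.lev, ?_, ?_⟩
  · intro y hy m m' hlt hm
    refine hF _ (fun he => ?_) (h.below y hy m m' hlt hm)
    have h1 : m' = l := by
      have := congrArg Sigma.fst he
      simpa using this
    have h2 : cell m' y ∈ T.leaves := he ▸ hl
    exact absurd (h.uniq y hy _ _ hm h2) (by omega)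
  · intro y hy m hm
    by_cases he : cell m y = cell l x
    · simp only [he, Function.update_self]
      exact hs
    · simp only [Function.update_of_ne he]
      exact hP _ _ he (h.leaf y hy m hm)

end Partition

/-! ### The path of the elimination scheme -/

section Path

variable {d K : ℕ}

/-- The bin in which an arm is pulled at covariate `x`. -/
def Stage.binOf (S : Stage d K) (T : Tree d K) (x : Cov d) : Bin d := locate (S.refine x T).leaves x

/-- The state of that bin. -/
def Stage.nodeOf (S : Stage d K) (T : Tree d K) (x : Cov d) : Node K :=
  (S.refine x T).node (S.binOf T x)

/-- The states of the scheme along a sequence of covariates and reward vectors. -/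
def Stage.run (S : Stage d K) (xs : ℕ → Cov d) (ys : ℕ → Fin K → ℝ) : ℕ → Tree d K
  | 0 => S.startTree
  | t + 1 => S.step (Stage.run S xs ys t) (xs t) (ys t (S.arm (Stage.run S xs ys t) (xs t)))

/-- The rounds before `t` in which arm `k` was pulled in `B`. -/
def Stage.pulledIn (S : Stage d K) (xs : ℕ → Cov d) (ys : ℕ → Fin K → ℝ) (t : ℕ) (B : Bin d)
    (k : Fin K) : Finset ℕ :=
  (Finset.range t).filter
    (fun s => S.binOf (S.run xs ys s) (xs s) = B ∧ S.arm (S.run xs ys s) (xs s) = k)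

/-- The number of rounds before `t` spent in `B` while several arms were active. -/
def Stage.visits (S : Stage d K) (xs : ℕ → Cov d) (ys : ℕ → Fin K → ℝ) (t : ℕ) (B : Bin d) : ℕ :=
  ((Finset.range t).filter (fun s => S.binOf (S.run xs ys s) (xs s) = B ∧
    1 < (S.nodeOf (S.run xs ys s) (xs s)).active.card)).card

/-- The sum of the source rewards of arm `k` in `B`. -/
def Stage.srcSum (S : Stage d K) (B : Bin d) (k : Fin K) : ℝ :=
  ((S.obsIn B k).map (fun z => z.2.2)).sum

/-- The centered sum of the source rewards of arm `k` in `B`. -/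
def Stage.srcDev (S : Stage d K) (f : Fin K → Cov d → ℝ) (B : Bin d) (k : Fin K) : ℝ :=
  ((S.obsIn B k).map (fun z => z.2.2 - f k z.1)).sum

theorem Stage.count_mul_srcMean (S : Stage d K) (B : Bin d) (k : Fin K) :
    (S.count B k : ℝ) * S.srcMean B k = S.srcSum B k := by
  unfold Stage.srcMean Stage.srcSum
  by_cases h : S.count B k = 0
  · have : S.obsIn B k = [] := List.eq_nil_of_length_eq_zero h
    simp [h, this]
  · field_simp

theorem Stage.count_mono (S : Stage d K) {A B : Bin d} (h : B.carrier ⊆ A.carrier) (k : Fin K) :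
    S.count B k ≤ S.count A k := by
  unfold Stage.count Stage.obsIn
  refine List.Sublist.length_le (List.monotone_filter_right _ fun z hz => ?_)
  simp only [decide_eq_true_eq] at hz ⊢
  exact ⟨h hz.1, hz.2⟩

/-- The structural invariant of the state of a bin. -/
structure Stage.CoreInv (S : Stage d K) (xs : ℕ → Cov d) (ys : ℕ → Fin K → ℝ) (t : ℕ) (B : Bin d)
    (s : Node K) : Prop where
  pass : S.PassInv B s
  pulls : ∀ k, s.pulls k = (S.pulledIn xs ys t B k).card
  mean : ∀ k, ((S.count B k : ℝ) + s.pulls k) * s.mean k =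
    S.srcSum B k + ∑ i ∈ S.pulledIn xs ys t B k, ys i k
  mem : ∀ k, ∀ i ∈ S.pulledIn xs ys t B k, xs i ∈ B.carrier
  visits : S.visits xs ys t B ≤ ∑ k, min (s.pulls k) (S.limit B k) ∨
    (S.visits xs ys t B ≤ ∑ k, min (s.pulls k) (S.limit B k) + 1 ∧
      (∀ k ∈ s.active, S.limit B k ≤ s.pulls k) ∧ ∃ k, 0 < S.limit B k)

/-- No round was spent in `B`. -/
def Stage.Fresh (S : Stage d K) (xs : ℕ → Cov d) (ys : ℕ → Fin K → ℝ) (t : ℕ) (B : Bin d) : Prop :=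
  (∀ k, S.pulledIn xs ys t B k = ∅) ∧ S.visits xs ys t B = 0

variable {S : Stage d K} {xs : ℕ → Cov d} {ys : ℕ → Fin K → ℝ}

theorem Stage.coreInv_start {t : ℕ} {B : Bin d} (h : S.Fresh xs ys t B) (I : Finset (Fin K)) :
    S.CoreInv xs ys t B (S.start B I) where
  pass := ⟨by simp [Stage.start], by simp [Stage.start], 0, fun j _ => by simp [Stage.start]⟩
  pulls k := by simp [Stage.start, h.1 k]
  mean k := by
    rw [h.1 k]
    simp only [Stage.start, Nat.cast_zero, add_zero, Finset.sum_empty]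
    exact S.count_mul_srcMean B k
  mem k i hi := by rw [h.1 k] at hi; simp at hi
  visits := by left; rw [h.2]; exact Nat.zero_le _

/-- The one extra visit requires a positive limit and is absorbed by the factor `2`. So a bin with
all limits zero is never visited with several active arms, which makes coarse bins with enough
source data free. -/
theorem Stage.CoreInv.visits_le {t : ℕ} {B : Bin d} {s : Node K} (h : S.CoreInv xs ys t B s) :
    S.visits xs ys t B ≤ 2 * ∑ k, S.limit B k := by
  have h1 : ∑ k, min (s.pulls k) (S.limit B k) ≤ ∑ k, S.limit B k :=
    Finset.sum_le_sum fun k _ => min_le_right _ _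
  rcases h.visits with h2 | ⟨h2, _, k, hk⟩
  · omega
  · have := Finset.single_le_sum (f := fun k => S.limit B k) (fun _ _ => Nat.zero_le _)
      (Finset.mem_univ k)
    omega

theorem Stage.pulledIn_succ (t : ℕ) (B : Bin d) (k : Fin K) :
    S.pulledIn xs ys (t + 1) B k =
      if S.binOf (S.run xs ys t) (xs t) = B ∧ S.arm (S.run xs ys t) (xs t) = k then
        insert t (S.pulledIn xs ys t B k) else S.pulledIn xs ys t B k := by
  unfold Stage.pulledIn
  rw [Finset.range_add_one, Finset.filter_insert]

theorem Stage.notMem_pulledIn (t : ℕ) (B : Bin d) (k : Fin K) : t ∉ S.pulledIn xs ys t B k := by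
  unfold Stage.pulledIn
  simp

theorem Stage.visits_succ (t : ℕ) (B : Bin d) :
    S.visits xs ys (t + 1) B = S.visits xs ys t B +
      if S.binOf (S.run xs ys t) (xs t) = B ∧
        1 < (S.nodeOf (S.run xs ys t) (xs t)).active.card then 1 else 0 := by
  unfold Stage.visits
  rw [Finset.range_add_one, Finset.filter_insert]
  split_ifs
  · rw [Finset.card_insert_of_notMem (by simp)]
  · simp

/-- A visit to a bin that is not exhausted raises `∑ k, min (pulls k) (limit k)` by one, unless
eliminations in that round leave only arms at their limits. The latter happens at most once with
several arms active: afterwards the bin is exhausted or has at most one active arm. This is the `+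
1` in the visits clause. -/
theorem Stage.CoreInv.step {t : ℕ} {B : Bin d} {s : Node K}
    (h : S.CoreInv xs ys t B s)
    (hB : S.binOf (S.run xs ys t) (xs t) = B) (hs : S.nodeOf (S.run xs ys t) (xs t) = s)
    (hx : xs t ∈ B.carrier)
    (hex : ¬ (1 < s.active.card ∧ ∀ k ∈ s.active, S.limit B k ≤ s.pulls k)) :
    S.CoreInv xs ys (t + 1) B (S.observe B (S.next B s).1 (S.next B s).2
      (ys t (S.next B s).2)) := by
  have harm : S.arm (S.run xs ys t) (xs t) = (S.next B s).2 := by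
    rw [← hs, ← hB]; rfl
  obtain ⟨e1, e2, e3, e4, e5, e6, e7, e8⟩ := S.next_spec h.pass
  set s' := (S.next B s).1 with hs'
  set k := (S.next B s).2 with hk
  set y := ys t k
  have hpulls : ∀ j, (S.observe B s' k y).pulls j = if j = k then s.pulls j + 1 else s.pulls j := by
    intro j
    simp only [Stage.observe, e1, Function.update_apply]
    split_ifs with hj
    · rw [hj]
    · rfl
  have hpi : ∀ j, S.pulledIn xs ys (t + 1) B j =
      if j = k then insert t (S.pulledIn xs ys t B j) else S.pulledIn xs ys t B j := by
    intro j
    rw [Stage.pulledIn_succ, hB, harm]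
    simp only [true_and, eq_comm]
  have hmono : ∀ j, s.pulls j ≤ (S.observe B s' k y).pulls j := by
    intro j; rw [hpulls]; split_ifs <;> omega
  have hsum : ∑ j, min (s.pulls j) (S.limit B j) ≤
      ∑ j, min ((S.observe B s' k y).pulls j) (S.limit B j) :=
    Finset.sum_le_sum fun j _ => min_le_min_right _ (hmono j)
  have hvis := S.visits_succ (xs := xs) (ys := ys) t B
  rw [hB, hs] at hvis
  simp only [true_and] at hvis
  refine ⟨⟨e5, e6, ?_⟩, ?_, ?_, ?_, ?_⟩
  · rcases e8 with ⟨f1, f2, f3, f4, p, f5⟩ | ⟨f1, f2⟩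
    · refine ⟨p, fun j hj => ?_⟩
      rw [hpulls]
      rcases f5 j hj with h1 | h1
      · left; split_ifs <;> omega
      · right
        by_cases hjk : j = k
        · subst hjk
          simp only [or_true, if_true] at h1
          have : k ∉ (S.observe B s' k y).queue := f4
          rw [if_pos rfl, if_neg this]
          exact h1
        · rw [if_neg hjk]
          simp only [hjk, or_false] at h1
          exact h1
    · refine ⟨0, fun j hj => Or.inl ?_⟩
      exact (f1 j hj).trans (hmono j)
  · intro j
    rw [hpulls, hpi, h.pulls]
    split_ifs
    · rw [Finset.card_insert_of_notMem (Stage.notMem_pulledIn t B j)]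
    · rfl
  · intro j
    rw [hpulls, hpi]
    have hmean : (S.observe B s' k y).mean j = if j = k then
        (y + (((S.count B k : ℝ) + ((s.pulls k : ℝ) + 1)) - 1) * s.mean k) /
          ((S.count B k : ℝ) + ((s.pulls k : ℝ) + 1)) else s.mean j := by
      simp only [Stage.observe, e1, e2, Function.update_apply]
    rw [hmean]
    split_ifs with hj
    · subst hj
      have hpos : (0 : ℝ) < (S.count B k : ℝ) + ((s.pulls k : ℝ) + 1) := by positivity
      rw [Finset.sum_insert (Stage.notMem_pulledIn t B k)]
      push_cast
      rw [mul_div_cancel₀ _ hpos.ne']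
      have := h.mean k
      linear_combination this
    · exact h.mean j
  · intro j i hi
    rw [hpi] at hi
    split_ifs at hi
    · rcases Finset.mem_insert.1 hi with rfl | hi
      · exact hx
      · exact h.mem j i hi
    · exact h.mem j i hi
  · rw [hvis]
    by_cases hcard : 1 < s.active.card
    · rw [if_pos hcard]
      have hnot : ¬ ∀ k ∈ s.active, S.limit B k ≤ s.pulls k := fun hh => hex ⟨hcard, hh⟩
      have hV : S.visits xs ys t B ≤ ∑ k, min (s.pulls k) (S.limit B k) := by
        rcases h.visits with h1 | h1
        · exact h1
        · exact absurd h1.2.1 hnot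
      rcases e8 with ⟨f1, f2, f3, f4, p, f5⟩ | ⟨f1, f2⟩
      · left
        have : ∑ j, min (s.pulls j) (S.limit B j) <
            ∑ j, min ((S.observe B s' k y).pulls j) (S.limit B j) := by
          refine Finset.sum_lt_sum (fun j _ => min_le_min_right _ (hmono j))
            ⟨k, Finset.mem_univ k, ?_⟩
          rw [hpulls, if_pos rfl]
          omega
        omega
      · right
        refine ⟨by omega, fun j hj => (f1 j hj).trans (hmono j), ?_⟩
        push Not at hnot
        obtain ⟨j, _, hj⟩ := hnot
        exact ⟨j, by omega⟩
    · rw [if_neg hcard, add_zero]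
      rcases h.visits with h1 | ⟨h1, h2, h3⟩
      · left; omega
      · right
        refine ⟨by omega, fun j hj => ?_, h3⟩
        exact (h2 j (e4 hj)).trans (hmono j)

theorem Stage.CoreInv.succ_of_ne {t : ℕ} {B : Bin d} {s : Node K} (h : S.CoreInv xs ys t B s)
    (hB : B ≠ S.binOf (S.run xs ys t) (xs t)) : S.CoreInv xs ys (t + 1) B s := by
  have h1 : ∀ k, S.pulledIn xs ys (t + 1) B k = S.pulledIn xs ys t B k := by
    intro k; rw [Stage.pulledIn_succ, if_neg fun hh => hB hh.1.symm]
  have h2 : S.visits xs ys (t + 1) B = S.visits xs ys t B := by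
    rw [Stage.visits_succ, if_neg fun hh => hB hh.1.symm, add_zero]
  refine ⟨h.pass, ?_, ?_, ?_, ?_⟩
  · intro k; rw [h1]; exact h.pulls k
  · intro k; rw [h1]; exact h.mean k
  · intro k; rw [h1]; exact h.mem k
  · rw [h2]; exact h.visits

theorem Stage.Fresh.succ_of_ne {t : ℕ} {B : Bin d} (h : S.Fresh xs ys t B)
    (hB : B ≠ S.binOf (S.run xs ys t) (xs t)) : S.Fresh xs ys (t + 1) B := by
  refine ⟨fun k => ?_, ?_⟩
  · rw [Stage.pulledIn_succ, if_neg fun hh => hB hh.1.symm]; exact h.1 k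
  · rw [Stage.visits_succ, if_neg fun hh => hB hh.1.symm, add_zero]; exact h.2

end Path

/-! ### Behaviour of the scheme on the good event -/

section Good

variable {d K : ℕ}

/-- The good event of the second stage, for reward functions `f`, bins up to level `L` and the
first `N` rounds: deviations are within half of the confidence bounds, and the source data are
balanced between the arms, up to a shift by `m` levels. -/
structure Stage.Good (S : Stage d K) (f : Fin K → Cov d → ℝ) (L N m : ℕ) (ρ cA cm cG : ℝ)
    (xs : ℕ → Cov d) (ys : ℕ → Fin K → ℝ) : Prop where
  holder : ∀ B : Bin d, ∀ k, ∀ x ∈ B.carrier, ∀ y ∈ B.carrier, f k x - f k y ≤ S.C * S.scale B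
  gap_le_one : ∀ x ∈ cube d, ∀ j k, f j x - f k x ≤ 1
  noise : ∀ t ≤ N, ∀ B : Bin d, B.1 ≤ L → ∀ k,
    |S.srcDev f B k + ∑ i ∈ S.pulledIn xs ys t B k, (ys i k - f k (xs i))| ≤
      √(2 * ((S.count B k : ℝ) + (S.pulledIn xs ys t B k).card) * Real.log S.n)
  bal : ∀ (B : Bin d), B.1 ≤ L → ∀ (τ : ℕ) (k : Fin K), S.need B ≤ 2 * ((τ : ℝ) + S.count B k) →
    1 ≤ cA * S.scale B ∨ ∀ j, ρ * S.need B ≤ (τ : ℝ) + S.count B j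
  shift : ∀ A B : Bin d, A.1 + m = B.1 → S.need A ≤ ρ * S.need B ∧ S.scale A ≤ cm * S.scale B
  top : ∀ B : Bin d, B.1 < m → 1 ≤ cm * S.scale B
  m_pos : 0 < m
  need_ge : ∀ B : Bin d, 2 ≤ S.need B
  ρ_pos : 0 < ρ
  ρ_le : ρ ≤ 1 / 2
  cG₁ : 8 * S.C / √ρ ≤ cG
  cG₂ : cA ≤ cG
  cG₃ : cm ≤ cG
  cG₄ : 8 * S.C * cm ≤ cG

/-- The invariant of the state of a bin on the good event. -/
structure Stage.FineInv (S : Stage d K) (f : Fin K → Cov d → ℝ) (cG : ℝ) (B : Bin d) (s : Node K) :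
    Prop where
  best : ∀ x ∈ B.carrier, ∀ k, (∀ j, f j x ≤ f k x) → k ∈ s.active
  low : ∀ x ∈ B.carrier, ∀ k, (∀ j, f j x ≤ f k x) → s.lower ≤ (f k x : EReal)
  low_ge : (∃ k ∈ s.active, s.pulls k < S.limit B k) →
    ∀ j ∈ s.active, (s.mean j : EReal) - S.conf B j (s.pulls j) ≤ s.lower
  gap : ∀ k ∈ s.active, 0 < S.limit B k → S.limit B k ≤ s.pulls k →
    ∀ x ∈ B.carrier, ∀ j, f j x - f k x ≤ cG * S.scale B
  gap_above : ∀ k ∈ s.active, ∀ x ∈ B.carrier, ∀ j, ∀ A : Bin d, A.1 < B.1 →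
    B.carrier ⊆ A.carrier → f j x - f k x ≤ cG * S.scale A ∧
      ((∀ i, S.limit A i = 0) → f j x - f k x ≤ 8 * S.C * S.scale A)

variable {S : Stage d K} {f : Fin K → Cov d → ℝ} {L N m : ℕ} {ρ cA cm cG : ℝ}
  {xs : ℕ → Cov d} {ys : ℕ → Fin K → ℝ}

theorem exists_best_arm (f : Fin K → Cov d → ℝ) (k₀ : Fin K) (x : Cov d) :
    ∃ k, ∀ j, f j x ≤ f k x := by
  obtain ⟨k, _, hk⟩ := Finset.exists_max_image Finset.univ (fun k => f k x) ⟨k₀, Finset.mem_univ _⟩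
  exact ⟨k, fun j => hk j (Finset.mem_univ j)⟩

theorem Stage.limit_zero_iff (hS : S.Valid) (B : Bin d) (k : Fin K) :
    S.limit B k = 0 ↔ S.need B ≤ S.count B k := by
  have := hS.limit_le_iff B k 0
  rw [Nat.cast_zero, zero_add, Nat.le_zero] at this
  exact this

theorem sum_obs_sub_le (D : List (Obs d K)) (g : Cov d → ℝ) (y e : ℝ)
    (h : ∀ z ∈ D, |g z.1 - y| ≤ e) :
    |(D.map (fun z => z.2.2)).sum - (D.map (fun z => z.2.2 - g z.1)).sum - D.length * y| ≤
      D.length * e := by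
  induction D with
  | nil => simp
  | cons z D ih =>
    have h1 := ih fun z hz => h z (List.mem_cons_of_mem _ hz)
    have h2 := h z List.mem_cons_self
    simp only [List.map_cons, List.sum_cons, List.length_cons, Nat.cast_add, Nat.cast_one]
    rw [abs_le] at *
    constructor <;> linarith [h1.1, h1.2, h2.1, h2.2]

/-- With `M` observations the noise clause bounds the deviation of the mean by `√(2 log n / M)`, and
the oscillation of `f k` on the bin bounds its bias by `C * scale`. Each is half of one of the two
terms whose maximum is the radius. -/
theorem Stage.Good.inConf (hS : S.Valid) (hG : S.Good f L N m ρ cA cm cG xs ys) {t : ℕ}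
    (ht : t ≤ N) {B : Bin d} (hB : B.1 ≤ L) {k : Fin K} {τ : ℕ} {a : ℝ}
    (hτ : τ = (S.pulledIn xs ys t B k).card)
    (ha : ((S.count B k : ℝ) + τ) * a = S.srcSum B k + ∑ i ∈ S.pulledIn xs ys t B k, ys i k)
    (hmem : ∀ i ∈ S.pulledIn xs ys t B k, xs i ∈ B.carrier) {x : Cov d} (hx : x ∈ B.carrier) :
    S.InConf B k τ a (f k x) := by
  by_cases h0 : τ + S.count B k = 0
  · exact Or.inl h0
  right
  have hpos : 0 < (S.count B k : ℝ) + τ := by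
    have : 0 < S.count B k + τ := by omega
    exact_mod_cast this
  have hl := hS.log_pos
  have hnoise := hG.noise t ht B hB k
  rw [← hτ] at hnoise
  have hbias : ∀ y ∈ B.carrier, |f k y - f k x| ≤ S.C * S.scale B := fun y hy => by
    rw [abs_le]
    constructor <;> linarith [hG.holder B k y hy x hx, hG.holder B k x hx y hy]
  have h1 := sum_obs_sub_le (S.obsIn B k) (f k) (f k x) (S.C * S.scale B) (fun z hz => by
    unfold Stage.obsIn at hz
    rw [List.mem_filter, decide_eq_true_eq] at hz
    exact hbias _ hz.2.1)
  change |S.srcSum B k - S.srcDev f B k - S.count B k * f k x| ≤ S.count B k * _ at h1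
  have h2 : |∑ i ∈ S.pulledIn xs ys t B k, (f k (xs i) - f k x)| ≤ τ * (S.C * S.scale B) := by
    refine (Finset.abs_sum_le_sum_abs _ _).trans ?_
    rw [hτ, ← nsmul_eq_mul]
    exact Finset.sum_le_card_nsmul _ _ _ fun i hi => hbias _ (hmem i hi)
  have h3 : ∑ i ∈ S.pulledIn xs ys t B k, (f k (xs i) - f k x) =
      ∑ i ∈ S.pulledIn xs ys t B k, f k (xs i) - τ * f k x := by
    rw [Finset.sum_sub_distrib, Finset.sum_const, hτ, nsmul_eq_mul]
  rw [Finset.sum_sub_distrib] at hnoise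
  rw [h3] at h2
  set M := (S.count B k : ℝ) + τ
  have h4 : |M * (a - f k x)| ≤ √(2 * M * Real.log S.n) + M * (S.C * S.scale B) := by
    rw [mul_sub, ha]
    rw [abs_le] at *
    have e1 : M * f k x = S.count B k * f k x + τ * f k x := by ring
    have e2 : M * (S.C * S.scale B) = S.count B k * (S.C * S.scale B) + τ * (S.C * S.scale B) := by
      ring
    rw [e1, e2]
    constructor <;> linarith [h1.1, h1.2, h2.1, h2.2, hnoise.1, hnoise.2]
  rw [abs_mul, abs_of_pos hpos] at h4
  have h5 : √(2 * M * Real.log S.n) = M * √(2 / M * Real.log S.n) := by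
    rw [← Real.sqrt_sq hpos.le, ← Real.sqrt_mul (by positivity), Real.sqrt_sq hpos.le]
    congr 1
    field_simp
  rw [h5, ← mul_add] at h4
  have h6 := le_of_mul_le_mul_left h4 hpos
  have h7 : (τ : ℝ) + S.count B k = M := add_comm _ _
  unfold Stage.radius
  rw [h7]
  have h8 := le_max_left (2 * √(2 / M * Real.log S.n)) (2 * S.C * S.scale B)
  have h9 := le_max_right (2 * √(2 / M * Real.log S.n)) (2 * S.C * S.scale B)
  linarith

theorem Stage.Good.inConf_zero (hS : S.Valid) (hG : S.Good f L N m ρ cA cm cG xs ys)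
    {B : Bin d} (hB : B.1 ≤ L) (k : Fin K) {x : Cov d} (hx : x ∈ B.carrier) :
    S.InConf B k 0 (S.srcMean B k) (f k x) := by
  have he : S.pulledIn xs ys 0 B k = ∅ := by simp [Stage.pulledIn]
  refine hG.inConf hS (Nat.zero_le N) hB (by simp [he]) ?_ (by simp [he]) hx
  rw [he, Nat.cast_zero, add_zero, Finset.sum_empty, add_zero]
  exact S.count_mul_srcMean B k

/-- The lower bound of the better arm is at least `y - 2 u`, the upper bound of the surviving arm at
most `y' + 2 u`, and the test orders them. -/
theorem gap_le_of_conf {B : Bin d} {j k : Fin K} {τ τ' : ℕ} {a a' y y' u : ℝ} {low : EReal}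
    (hj : S.InConf B j τ a y) (hk : S.InConf B k τ' a' y') (hu : S.conf B j τ ≤ (u : EReal))
    (hu' : S.conf B k τ' ≤ (u : EReal)) (h1 : (a : EReal) - S.conf B j τ ≤ low)
    (h2 : low ≤ (a' : EReal) + S.conf B k τ') : y - y' ≤ 4 * u := by
  have h := ((hj.le_sub hu).trans h1).trans (h2.trans (hk.add_le hu'))
  rw [EReal.coe_le_coe_iff] at h
  linarith

theorem Stage.FineInv.start (hS : S.Valid) (hG : S.Good f L N m ρ cA cm cG xs ys) {B : Bin d}
    (hB : B.1 ≤ L) {I : Finset (Fin K)}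
    (hbest : ∀ x ∈ B.carrier, ∀ k, (∀ j, f j x ≤ f k x) → k ∈ I)
    (habove : ∀ k ∈ I, ∀ x ∈ B.carrier, ∀ j, ∀ A : Bin d, A.1 < B.1 →
      B.carrier ⊆ A.carrier → f j x - f k x ≤ cG * S.scale A ∧
        ((∀ i, S.limit A i = 0) → f j x - f k x ≤ 8 * S.C * S.scale A)) :
    S.FineInv f cG B (S.start B I) where
  best := hbest
  low x hx k hk := Finset.sup_le fun j _ =>
    (hG.inConf_zero hS hB j hx).sub_le.trans (EReal.coe_le_coe_iff.2 (hk j))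
  low_ge _ j hj := Finset.le_sup (f := fun k => (S.srcMean B k : EReal) - S.conf B k 0) hj
  gap k _ h1 h2 := absurd h2 (by simpa [Stage.start] using h1.ne')
  gap_above := habove

/-- The new content is `gap` at the pull with which arm `k` reaches its limit. Before this pull `k`
had half of the needed observations; an active arm is at its limit or, by the round-robin order, has
at least as many pulls as `k`. Balance of the source data then gives every active arm a fraction `ρ`
of the need, so the confidence bounds are of the order of the bias and the test just passed bounds
the gap. -/
theorem Stage.FineInv.step (hS : S.Valid) (hG : S.Good f L N m ρ cA cm cG xs ys) {t : ℕ}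
    (ht : t + 1 ≤ N) {B : Bin d} (hB : B.1 ≤ L) {s : Node K} (hc : S.CoreInv xs ys t B s)
    (h : S.FineInv f cG B s) {y : ℝ}
    (hc' : S.CoreInv xs ys (t + 1) B (S.observe B (S.next B s).1 (S.next B s).2 y)) :
    S.FineInv f cG B (S.observe B (S.next B s).1 (S.next B s).2 y) := by
  have hconf : ∀ x ∈ B.carrier, ∀ k, S.InConf B k (s.pulls k) (s.mean k) (f k x) :=
    fun x hx k => hG.inConf hS (by omega) hB (hc.pulls k) (hc.mean k) (hc.mem k) hx
  obtain ⟨e1, e2, e3, e4, e5, e6, e7, e8⟩ := S.next_spec hc.pass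
  set s' := (S.next B s).1 with hs'
  set k := (S.next B s).2 with hk
  set o := S.observe B s' k y with ho
  have hconf' : ∀ x ∈ B.carrier, ∀ k, S.InConf B k (o.pulls k) (o.mean k) (f k x) :=
    fun x hx k => hG.inConf hS ht hB (hc'.pulls k) (hc'.mean k) (hc'.mem k) hx
  have hpulls : ∀ j, o.pulls j = if j = k then s.pulls j + 1 else s.pulls j := by
    intro j
    simp only [ho, Stage.observe, e1, Function.update_apply]
    split_ifs with hj
    · rw [hj]
    · rfl
  -- All lower bounds are at most the optimal value, and the upper bound of an optimal arm is at
  -- least that value, so it cannot fail a test.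
  have hbest : ∀ x ∈ B.carrier, ∀ k, (∀ j, f j x ≤ f k x) → k ∈ s'.active := by
    intro x hx j hj
    by_contra hcon
    exact (e7 j (h.best x hx j hj) hcon).2 ((h.low x hx j hj).trans (hconf x hx j).le_add)
  have hlower : o.lower = if s.pulls k < S.limit B k then
      s'.active.sup (fun j => (o.mean j : EReal) - S.conf B j (o.pulls j)) else s.lower := by
    simp only [ho, Stage.observe, e1, e3]
  refine ⟨hbest, ?_, ?_, ?_, ?_⟩
  · intro x hx j hj
    rw [hlower]
    split_ifs
    · exact Finset.sup_le fun i _ =>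
        (hconf' x hx i).sub_le.trans (EReal.coe_le_coe_iff.2 (hj i))
    · exact h.low x hx j hj
  · rintro ⟨i, hi, hi2⟩ j hj
    rw [hlower]
    split_ifs with hlim
    · exact Finset.le_sup (f := fun j => (o.mean j : EReal) - S.conf B j (o.pulls j)) hj
    · rcases e8 with ⟨_, f2, _⟩ | ⟨f1, _⟩
      · exact absurd f2 hlim
      · have := f1 i hi
        rw [hpulls] at hi2
        split_ifs at hi2 <;> omega
  · intro j hj hpos hle x hx i
    by_cases hold : S.limit B j ≤ s.pulls j
    · exact h.gap j (e4 hj) hpos hold x hx i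
    rw [hpulls] at hle
    split_ifs at hle with hjk
    swap; · exact absurd hle hold
    subst hjk
    rcases e8 with ⟨_, f2, f3, _, p, f5⟩ | ⟨f1, _⟩
    swap; · exact absurd (f1 _ hj) hold
    have hn2 := hG.need_ge B
    have hneed := (hS.limit_le_iff B k _).1 hle
    push_cast at hneed
    -- The current pull contributes one observation; as the need is at least `2`, the earlier ones
    -- make up at least half of it.
    have hτ : S.need B ≤ 2 * ((s.pulls k : ℝ) + S.count B k) := by linarith
    have hsc := S.scale_pos B
    rcases hG.bal B hB (s.pulls k) k hτ with hA | hbal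
    · exact (hG.gap_le_one x (B.carrier_subset_cube hx) i k).trans
        (hA.trans (mul_le_mul_of_nonneg_right hG.cG₂ hsc.le))
    obtain ⟨b, hb⟩ := exists_best_arm f k x
    have hbs := hbest x hx b hb
    have hpb : S.conf B b (s.pulls b) ≤ ((2 * S.C * S.scale B / √ρ : ℝ) : EReal) := by
      have hρ1 : ρ ≤ 1 := hG.ρ_le.trans (by norm_num)
      refine hS.conf_le_of_need hG.ρ_pos hρ1 ?_
      rcases f5 b hbs with h1 | h1
      · have := (hS.limit_le_iff B b _).1 h1
        nlinarith
      · have h2 := (f5 k hj).resolve_left hold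
        rw [if_pos (Or.inr rfl)] at h2
        have h3 : s.pulls k ≤ s.pulls b := by split_ifs at h1 <;> omega
        have h4 : (s.pulls k : ℝ) ≤ s.pulls b := by exact_mod_cast h3
        linarith [hbal b]
    have hpk : S.conf B k (s.pulls k) ≤ ((2 * S.C * S.scale B / √ρ : ℝ) : EReal) :=
      hS.conf_le_of_need hG.ρ_pos (hG.ρ_le.trans (by norm_num)) (hbal k)
    have := gap_le_of_conf (hconf x hx b) (hconf x hx k) hpb hpk
      (h.low_ge ⟨k, e4 hj, f2⟩ b (e4 hbs)) f3
    have h5 : 4 * (2 * S.C * S.scale B / √ρ) = 8 * S.C / √ρ * S.scale B := by ring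
    rw [h5] at this
    have := mul_le_mul_of_nonneg_right hG.cG₁ hsc.le
    linarith [hb i]
  · intro j hj
    exact h.gap_above j (e4 hj)

/-- An arm passes a split in one of three ways. With a positive limit it reached it by pulls, and
`gap` applies. If all active arms have limit zero, it passed the test of the source means in
`passOn`. If its limit is zero but that of another active arm is not, it was not tested in this bin;
balance gives all arms a fraction `ρ` of the need, so `m` levels higher all limits vanish and the
source test made there bounds the gap, at the price of the factor `cm`. -/
theorem Stage.FineInv.child (hS : S.Valid) (hG : S.Good f L N m ρ cA cm cG xs ys) {x y : Cov d}
    (hx : Generic x) {l : ℕ} (hl : l < L) {s : Node K} (h : S.FineInv f cG (cell l x) s)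
    (hex : ∀ k ∈ s.active, S.limit (cell l x) k ≤ s.pulls k)
    (hy : Generic y) (hyx : y ∈ (cell l x).carrier) :
    S.FineInv f cG (cell (l + 1) y)
      (S.start (cell (l + 1) y) (S.passOn (cell l x) s.active)) := by
  have hlx : cell l y = cell l x := cell_eq_of_mem hx hy hyx le_rfl
  rw [← hlx] at h hex ⊢
  clear hlx hyx hx x
  have hsub : (cell (l + 1) y).carrier ⊆ (cell l y).carrier := cell_carrier_anti hy (Nat.le_succ l)
  have hL : (cell l y).1 ≤ L := hl.le
  have hpass : S.passOn (cell l y) s.active ⊆ s.active := by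
    unfold Stage.passOn
    split_ifs
    · exact Finset.filter_subset _ _
    · exact subset_rfl
  have hconf := fun k (x : Cov d) (hx : x ∈ (cell l y).carrier) => hG.inConf_zero hS hL k hx
  refine Stage.FineInv.start hS hG (by exact hl) ?_ ?_
  · intro x hx k hk
    have hmem := h.best x (hsub hx) k hk
    unfold Stage.passOn
    split_ifs
    · refine Finset.mem_filter.2 ⟨hmem, ?_⟩
      refine (Finset.sup_le fun j _ => ?_).trans (hconf k x (hsub hx)).le_add
      exact (hconf j x (hsub hx)).sub_le.trans (EReal.coe_le_coe_iff.2 (hk j))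
    · exact hmem
  · intro k hk x hx j A hA hBA
    have hAc : A = cell A.1 y := hy.eq_cell (hBA (mem_cell hy.1 _))
    have hks := hpass hk
    have hx' := hsub hx
    have hsc := S.scale_pos (cell l y)
    have hC := hS.C_pos
    rw [cell_fst] at hA
    rcases Nat.lt_succ_iff_lt_or_eq.1 hA with hlt | heq
    · refine h.gap_above k hks x hx' j A hlt ?_
      rw [hAc]
      exact cell_carrier_anti hy hlt.le
    · rw [heq] at hAc
      rw [hAc]
      have hcG8 : 8 * S.C ≤ cG := by
        refine le_trans ?_ hG.cG₁
        rw [le_div_iff₀ (Real.sqrt_pos.2 hG.ρ_pos)]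
        have : √ρ ≤ 1 := Real.sqrt_le_one.2 (hG.ρ_le.trans (by norm_num))
        nlinarith
      by_cases hlim : S.limit (cell l y) k = 0
      swap
      · exact ⟨h.gap k hks (Nat.pos_of_ne_zero hlim) (hex k hks) x hx' j,
          fun h0 => absurd (h0 k) hlim⟩
      by_cases hall : ∀ i ∈ s.active, S.limit (cell l y) i = 0
      · have hg : f j x - f k x ≤ 8 * S.C * S.scale (cell l y) := by
          unfold Stage.passOn at hk
          rw [if_pos hall, Finset.mem_filter] at hk
          obtain ⟨b, hb⟩ := exists_best_arm f k x
          have hbs := h.best x hx' b hb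
          have hcf : ∀ i ∈ s.active, S.conf (cell l y) i 0 ≤
              ((2 * S.C * S.scale (cell l y) : ℝ) : EReal) := by
            intro i hi
            refine (hS.conf_le_iff _ i 0).2 ?_
            rw [Nat.cast_zero, zero_add]
            exact (Stage.limit_zero_iff hS _ i).1 (hall i hi)
          have := gap_le_of_conf (hconf b x hx') (hconf k x hx') (hcf b hbs) (hcf k hks)
            (Finset.le_sup (f := fun j => (S.srcMean (cell l y) j : EReal) - S.conf (cell l y) j 0)
              hbs) hk.2
          linarith [hb j]
        exact ⟨hg.trans (mul_le_mul_of_nonneg_right hcG8 hsc.le), fun _ => hg⟩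
      · refine ⟨?_, fun h0 => absurd (fun i _ => h0 i) hall⟩
        have hn := (Stage.limit_zero_iff hS _ k).1 hlim
        have hpos := hS.need_pos (cell l y)
        have hone := hG.gap_le_one x ((cell l y).carrier_subset_cube hx') j k
        rcases hG.bal (cell l y) hL 0 k (by push_cast; linarith) with hA | hbal
        · exact hone.trans (hA.trans (mul_le_mul_of_nonneg_right hG.cG₂ hsc.le))
        -- Near the root there is no ancestor `m` levels up, but there the scale is bounded below
        -- and the trivial bound `1` for gaps is enough.
        rcases lt_or_ge l m with hm | hm
        · exact hone.trans ((hG.top (cell l y) hm).trans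
            (mul_le_mul_of_nonneg_right hG.cG₃ hsc.le))
        obtain ⟨g1, g2⟩ := hG.shift (cell (l - m) y) (cell l y) (by simp only [cell_fst]; omega)
        have hsub2 : (cell l y).carrier ⊆ (cell (l - m) y).carrier :=
          cell_carrier_anti hy (Nat.sub_le l m)
        have h0 : ∀ i, S.limit (cell (l - m) y) i = 0 := by
          intro i
          rw [Stage.limit_zero_iff hS]
          have h1 := hbal i
          have h2 : (S.count (cell l y) i : ℝ) ≤ S.count (cell (l - m) y) i := by
            exact_mod_cast S.count_mono hsub2 i
          push_cast at h1
          linarith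
        have := (h.gap_above k hks x hx' j (cell (l - m) y) (by
          simp only [cell_fst]; have := hG.m_pos; omega) hsub2).2 h0
        have h8 : 8 * S.C * S.scale (cell (l - m) y) ≤ 8 * S.C * cm * S.scale (cell l y) := by
          have := mul_le_mul_of_nonneg_left g2 (by positivity : 0 ≤ 8 * S.C)
          linarith
        have := mul_le_mul_of_nonneg_right hG.cG₄ hsc.le
        linarith

/-- The invariant of the leaves of the partition after `t` rounds. -/
def Stage.LeafInv (S : Stage d K) (f : Fin K → Cov d → ℝ) (L N m : ℕ) (ρ cA cm cG : ℝ)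
    (xs : ℕ → Cov d) (ys : ℕ → Fin K → ℝ) (t : ℕ) (B : Bin d) (s : Node K) : Prop :=
  B.1 ≤ L ∧ S.CoreInv xs ys t B s ∧
    (S.Good f L N m ρ cA cm cG xs ys → S.FineInv f cG B s)

theorem Stage.pulledIn_card_le (t : ℕ) (B : Bin d) (k : Fin K) :
    (S.pulledIn xs ys t B k).card ≤ t := by
  refine (Finset.card_filter_le _ _).trans ?_
  rw [Finset.card_range]

theorem Stage.count_le_length (B : Bin d) (k : Fin K) : S.count B k ≤ S.D.length :=
  List.length_filter_le _ _

/-- An exhausted bin has an arm with as many observations as needed. From level `L` on the need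
exceeds the whole sample, so splits occur only above that level. -/
theorem splitOK_leafInv (hS : S.Valid) (hlev : ∀ B : Bin d, L ≤ B.1 →
    (N : ℝ) + S.D.length < S.need B) {t : ℕ} (ht : t ≤ N) :
    SplitOK S L (S.LeafInv f L N m ρ cA cm cG xs ys t) (S.Fresh xs ys t) := by
  intro x hx l s hP hcard hex
  obtain ⟨hl, hc, hf⟩ := hP
  have hlt : l < L := by
    by_contra hcon
    obtain ⟨k, hk⟩ := Finset.card_pos.1 (by omega : 0 < s.active.card)
    have h1 := (hS.limit_le_iff _ k _).1 (hex k hk)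
    have h2 := hlev (cell l x) (by rw [cell_fst]; omega)
    rw [hc.pulls k] at h1
    have h3 : (S.pulledIn xs ys t (cell l x) k).card ≤ N :=
      (Stage.pulledIn_card_le t _ k).trans ht
    have h4 := S.count_le_length (cell l x) k
    have h5 : (((S.pulledIn xs ys t (cell l x) k).card : ℕ) : ℝ) ≤ N := by exact_mod_cast h3
    have h6 : (S.count (cell l x) k : ℝ) ≤ S.D.length := by exact_mod_cast h4
    linarith
  refine ⟨hlt, fun y hy hyx hF => ⟨hlt, Stage.coreInv_start hF _, fun hG => ?_⟩⟩
  exact (hf hG).child hS hG hx hlt hex hy hyx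

/-- The partition invariant along a path. -/
theorem treeInv_run (hS : S.Valid) (hlev : ∀ B : Bin d, L ≤ B.1 →
    (N : ℝ) + S.D.length < S.need B) {t : ℕ} (ht : t ≤ N) (hx : ∀ i < t, Generic (xs i)) :
    TreeInv L (S.LeafInv f L N m ρ cA cm cG xs ys t) (S.Fresh xs ys t) (S.run xs ys t) := by
  induction t with
  | zero =>
    have hfresh : ∀ B, S.Fresh xs ys 0 B := fun B =>
      ⟨fun k => by simp [Stage.pulledIn], by simp [Stage.visits]⟩
    have hroot : ∀ l (x : Cov d), Generic x →
        (cell l x ∈ (S.run xs ys 0).leaves ↔ l = 0) := by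
      intro l x hx
      simp only [Stage.run, Stage.startTree, Finset.mem_singleton]
      constructor
      · intro h
        exact congrArg Sigma.fst h
      · rintro rfl
        refine (hx.eq_cell (B := root d) ?_).symm
        rw [root_carrier]; exact hx.1
    refine ⟨fun x hx => ⟨0, (hroot 0 x hx).2 rfl⟩, fun x hx l l' h h' => ?_, fun B hB => ?_,
      fun x hx l l' _ _ => hfresh _, fun x hx l h => ?_⟩
    · rw [(hroot l x hx).1 h, (hroot l' x hx).1 h']
    · simp only [Stage.run, Stage.startTree, Finset.mem_singleton] at hB
      rw [hB]; exact Nat.zero_le _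
    · obtain rfl := (hroot l x hx).1 h
      refine ⟨Nat.zero_le _, Stage.coreInv_start (hfresh _) _, fun hG => ?_⟩
      exact Stage.FineInv.start hS hG (Nat.zero_le _) (fun x _ k _ => Finset.mem_univ k)
        fun k _ x _ j A hA => absurd hA (by rw [cell_fst]; omega)
  | succ t ih =>
    have ih := ih (by omega) fun i hi => hx i (by omega)
    have hxt := hx t (Nat.lt_succ_self t)
    have hsp : SplitOK S L (S.LeafInv f L N m ρ cA cm cG xs ys t) (S.Fresh xs ys t) :=
      splitOK_leafInv hS hlev (by omega)
    obtain ⟨h1, h2⟩ := ih.refine hsp hxt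
    obtain ⟨l, hl⟩ := h1.ex _ hxt
    have hloc := h1.locate_eq hxt hl
    have hbin : S.binOf (S.run xs ys t) (xs t) = cell l (xs t) := hloc
    have hnode : S.nodeOf (S.run xs ys t) (xs t) =
        (S.refine (xs t) (S.run xs ys t)).node (cell l (xs t)) := by
      unfold Stage.nodeOf; rw [hbin]
    rw [hloc] at h2
    obtain ⟨g1, g2, g3⟩ := h1.leaf _ hxt l hl
    set s := (S.refine (xs t) (S.run xs ys t)).node (cell l (xs t))
    have harm : S.arm (S.run xs ys t) (xs t) = (S.next (cell l (xs t)) s).2 := by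
      unfold Stage.arm; rw [hloc]
    have hrun : S.run xs ys (t + 1) =
        { leaves := (S.refine (xs t) (S.run xs ys t)).leaves
          node := Function.update (S.refine (xs t) (S.run xs ys t)).node (cell l (xs t))
            (S.observe (cell l (xs t)) (S.next (cell l (xs t)) s).1 (S.next (cell l (xs t)) s).2
              (ys t (S.next (cell l (xs t)) s).2)) } := by
      simp only [Stage.run, Stage.step]
      rw [hloc, harm]
    rw [hrun]
    have hc' := g2.step hbin hnode (mem_cell hxt.1 l) h2
    refine h1.update hl ⟨g1, hc', fun hG => ?_⟩ ?_ ?_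
    · exact (g3 hG).step hS hG ht g1 g2 hc'
    · intro B s' hne hP
      exact ⟨hP.1, hP.2.1.succ_of_ne (by rw [hbin]; exact hne), hP.2.2⟩
    · intro B hne hF
      exact hF.succ_of_ne (by rw [hbin]; exact hne)

/-- The conclusions about round `t`. -/
theorem round_spec (hS : S.Valid) (hK : 0 < K) (hlev : ∀ B : Bin d, L ≤ B.1 →
    (N : ℝ) + S.D.length < S.need B) {t : ℕ} (ht : t < N) (hx : ∀ i ≤ t, Generic (xs i)) :
    xs t ∈ (S.binOf (S.run xs ys t) (xs t)).carrier ∧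
    (S.binOf (S.run xs ys t) (xs t)).1 ≤ L ∧
    (S.Good f L N m ρ cA cm cG xs ys → ∀ j,
      (¬ 1 < (S.nodeOf (S.run xs ys t) (xs t)).active.card →
        f j (xs t) ≤ f (S.arm (S.run xs ys t) (xs t)) (xs t)) ∧
      ∀ l, l + 1 = (S.binOf (S.run xs ys t) (xs t)).1 →
        f j (xs t) - f (S.arm (S.run xs ys t) (xs t)) (xs t) ≤ cG * S.scale (cell l (xs t))) := by
  have hxt := hx t le_rfl
  have ih : TreeInv L (S.LeafInv f L N m ρ cA cm cG xs ys t) (S.Fresh xs ys t) (S.run xs ys t) :=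
    treeInv_run hS hlev ht.le fun i hi => hx i hi.le
  obtain ⟨h1, h2⟩ := ih.refine (splitOK_leafInv hS hlev ht.le) hxt
  obtain ⟨l, hl⟩ := h1.ex _ hxt
  have hloc := h1.locate_eq hxt hl
  have hbin : S.binOf (S.run xs ys t) (xs t) = cell l (xs t) := hloc
  have hnode : S.nodeOf (S.run xs ys t) (xs t) =
      (S.refine (xs t) (S.run xs ys t)).node (cell l (xs t)) := by
    unfold Stage.nodeOf; rw [hbin]
  have harm : S.arm (S.run xs ys t) (xs t) =
      (S.next (cell l (xs t)) (S.nodeOf (S.run xs ys t) (xs t))).2 := by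
    unfold Stage.arm; rw [hnode, hloc]
  obtain ⟨g1, g2, g3⟩ := h1.leaf _ hxt l hl
  rw [← hnode] at g2 g3
  rw [harm, hbin]
  set s := S.nodeOf (S.run xs ys t) (xs t)
  refine ⟨mem_cell hxt.1 l, g1, fun hG j => ?_⟩
  have hF := g3 hG
  obtain ⟨b, hb⟩ := exists_best_arm f ⟨0, hK⟩ (xs t)
  obtain ⟨e1, e2, e3, e4, e5, e6, e7, e8⟩ := S.next_spec g2.pass
  have hbs := hF.best _ (mem_cell hxt.1 l) b hb
  have hbs' : b ∈ (S.next (cell l (xs t)) s).1.active := by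
    by_contra hcon
    have hcf := hG.inConf hS ht.le g1 (g2.pulls b) (g2.mean b) (g2.mem b) (mem_cell hxt.1 l)
    exact (e7 b hbs hcon).2 ((hF.low _ (mem_cell hxt.1 l) b hb).trans hcf.le_add)
  have harms : (S.next (cell l (xs t)) s).2 ∈ s.active := by
    refine e4 ?_
    rcases e8 with h | h
    · exact h.1
    · rw [h.2]; exact hS.best_mem ⟨b, hbs'⟩
  constructor
  · intro hcard
    have hcard1 : s.active.card ≤ 1 := by omega
    rw [Finset.card_le_one.1 hcard1 _ harms _ hbs]
    exact hb j
  · intro l' hl'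
    rw [cell_fst] at hl'
    exact (hF.gap_above _ harms _ (mem_cell hxt.1 l) j (cell l' (xs t))
      (by simp only [cell_fst]; omega) (cell_carrier_anti hxt (by omega))).1

/-- The invariant speaks about leaves only, but the count of a bin changes only in rounds that use
it, and the bin used is a leaf at the end of the round. Bins split earlier keep their count. -/
theorem visits_le (hS : S.Valid) (hlev : ∀ B : Bin d, L ≤ B.1 →
    (N : ℝ) + S.D.length < S.need B) {t : ℕ} (ht : t ≤ N) (hx : ∀ i < t, Generic (xs i))
    (B : Bin d) : S.visits xs ys t B ≤ 2 * ∑ k, S.limit B k := by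
  induction t with
  | zero => simp [Stage.visits]
  | succ t ih =>
    by_cases hB : S.binOf (S.run xs ys t) (xs t) = B
    · have h1 : TreeInv L (S.LeafInv (fun _ _ => 0) L N 0 0 0 0 0 xs ys (t + 1))
        (S.Fresh xs ys (t + 1)) (S.run xs ys (t + 1)) := treeInv_run hS hlev ht hx
      have h0 : TreeInv L (S.LeafInv (fun _ _ => 0) L N 0 0 0 0 0 xs ys t)
        (S.Fresh xs ys t) (S.run xs ys t) := treeInv_run hS hlev (by omega) fun i hi => hx i (by omega)
      have hxt := hx t (Nat.lt_succ_self t)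
      obtain ⟨h2, _⟩ := h0.refine (splitOK_leafInv hS hlev (by omega)) hxt
      obtain ⟨l, hl⟩ := h2.ex _ hxt
      have hbin : S.binOf (S.run xs ys t) (xs t) = cell l (xs t) := h2.locate_eq hxt hl
      have hl' : cell l (xs t) ∈ (S.run xs ys (t + 1)).leaves := hl
      rw [← hB, hbin]
      exact (h1.leaf _ hxt l hl').2.1.visits_le
    · rw [Stage.visits_succ, if_neg fun h => hB h.1, add_zero]
      exact ih (by omega) fun i hi => hx i (by omega)

end Good

/-! ### Potentials along the path -/

section Potential

variable {d K : ℕ} {S : Stage d K} {xs xs' : ℕ → Cov d} {ys ys' : ℕ → Fin K → ℝ}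

/-- The scheme is nonanticipating. This is what allows the randomness of round `t` to be integrated
out with the earlier state held fixed. -/
theorem Stage.run_congr {t : ℕ} (hx : ∀ i < t, xs i = xs' i) (hy : ∀ i < t, ys i = ys' i) :
    S.run xs ys t = S.run xs' ys' t := by
  induction t with
  | zero => rfl
  | succ t ih =>
    have h := ih (fun i hi => hx i (by omega)) fun i hi => hy i (by omega)
    simp only [Stage.run]
    rw [h, hx t (by omega), hy t (by omega)]

theorem Stage.pulledIn_congr {t : ℕ} (hx : ∀ i < t, xs i = xs' i) (hy : ∀ i < t, ys i = ys' i)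
    (B : Bin d) (k : Fin K) : S.pulledIn xs ys t B k = S.pulledIn xs' ys' t B k := by
  unfold Stage.pulledIn
  refine Finset.filter_congr fun i hi => ?_
  rw [Finset.mem_range] at hi
  rw [Stage.run_congr (S := S) (fun j hj => hx j (hj.trans hi)) fun j hj => hy j (hj.trans hi),
    hx i hi]

/-- The number of observations of arm `k` in `B` after `t` rounds, including the source data. -/
def Stage.total (S : Stage d K) (xs : ℕ → Cov d) (ys : ℕ → Fin K → ℝ) (t : ℕ) (B : Bin d)
    (k : Fin K) : ℕ := S.count B k + (S.pulledIn xs ys t B k).card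

/-- The exponential potential of the deviation of arm `k` in `B`, stopped at `m` observations. -/
def Stage.pot (S : Stage d K) (f : Fin K → Cov d → ℝ) (lam : ℝ) (m : ℕ) (B : Bin d) (k : Fin K)
    (xs : ℕ → Cov d) (ys : ℕ → Fin K → ℝ) : ℕ → ENNReal
  | 0 => if 0 < S.count B k then
      ENNReal.ofReal (Real.exp (lam * S.srcDev f B k - lam ^ 2 / 8 * S.count B k)) else 0
  | t + 1 =>
      if S.binOf (S.run xs ys t) (xs t) = B ∧ S.arm (S.run xs ys t) (xs t) = k ∧
          S.total xs ys t B k < m then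
        (if S.total xs ys t B k = 0 then 1 else Stage.pot S f lam m B k xs ys t) *
          ENNReal.ofReal (Real.exp (lam * (ys t k - f k (xs t)) - lam ^ 2 / 8))
      else Stage.pot S f lam m B k xs ys t

variable {f : Fin K → Cov d → ℝ} {lam : ℝ} {m : ℕ} {B : Bin d} {k : Fin K}

theorem Stage.total_succ (t : ℕ) : S.total xs ys (t + 1) B k = S.total xs ys t B k +
    if S.binOf (S.run xs ys t) (xs t) = B ∧ S.arm (S.run xs ys t) (xs t) = k then 1 else 0 := by
  unfold Stage.total
  rw [Stage.pulledIn_succ]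
  split_ifs
  · rw [Finset.card_insert_of_notMem (Stage.notMem_pulledIn t B k)]; rfl
  · rfl

theorem Stage.total_mono {t t' : ℕ} (h : t ≤ t') : S.total xs ys t B k ≤ S.total xs ys t' B k := by
  induction t', h using Nat.le_induction with
  | base => exact le_rfl
  | succ n _ ih => rw [Stage.total_succ]; omega

/-- At a first observation the value `0` is replaced by `1` before multiplication. The sums are
empty before, so the closed form holds from the first observation on, until the count exceeds `m`.
-/
theorem Stage.pot_eq (t : ℕ) (h0 : 0 < S.total xs ys t B k) (hm : S.total xs ys t B k ≤ m) :
    S.pot f lam m B k xs ys t = ENNReal.ofReal (Real.exp (lam *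
      (S.srcDev f B k + ∑ i ∈ S.pulledIn xs ys t B k, (ys i k - f k (xs i))) -
        lam ^ 2 / 8 * S.total xs ys t B k)) := by
  induction t with
  | zero =>
    have he : S.pulledIn xs ys 0 B k = ∅ := by simp [Stage.pulledIn]
    simp only [Stage.total, he, Finset.card_empty, add_zero] at h0 hm
    simp only [Stage.pot, Stage.total, he, Finset.card_empty, add_zero, Finset.sum_empty,
      if_pos h0]
  | succ t ih =>
    have hs := Stage.total_succ (S := S) (xs := xs) (ys := ys) (B := B) (k := k) t
    by_cases hc : S.binOf (S.run xs ys t) (xs t) = B ∧ S.arm (S.run xs ys t) (xs t) = k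
    · rw [if_pos hc] at hs
      rw [Stage.pulledIn_succ, if_pos hc, Finset.sum_insert (Stage.notMem_pulledIn t B k)]
      simp only [Stage.pot]
      rw [if_pos ⟨hc.1, hc.2, by omega⟩]
      by_cases h0' : S.total xs ys t B k = 0
      · have hc0 : S.count B k = 0 := by unfold Stage.total at h0'; omega
        have he : S.pulledIn xs ys t B k = ∅ := by
          rw [← Finset.card_eq_zero]; unfold Stage.total at h0'; omega
        have hd : S.srcDev f B k = 0 := by
          have : S.obsIn B k = [] := List.eq_nil_of_length_eq_zero hc0
          simp [Stage.srcDev, this]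
        rw [if_pos h0', one_mul, he, hd, hs, h0']
        simp
      · rw [if_neg h0', ih (by omega) (by omega), ← ENNReal.ofReal_mul (Real.exp_pos _).le,
          ← Real.exp_add, hs]
        congr 2
        push_cast
        ring
    · rw [if_neg hc, add_zero] at hs
      rw [hs] at h0 hm ⊢
      rw [Stage.pulledIn_succ, if_neg hc]
      simp only [Stage.pot]
      rw [if_neg fun h => hc ⟨h.1, h.2.1⟩]
      exact ih h0 hm

/-- A large deviation at the moment with `m` observations remains visible in the final value of the
potential stopped at `m`. So it is enough to look at one final time, and no union over rounds is
needed. -/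
theorem Stage.pot_frozen {t t' : ℕ} (h : t ≤ t') (hm : m ≤ S.total xs ys t B k) :
    S.pot f lam m B k xs ys t' = S.pot f lam m B k xs ys t := by
  induction t', h using Nat.le_induction with
  | base => rfl
  | succ n hn ih =>
    simp only [Stage.pot]
    rw [if_neg fun hh => ?_, ih]
    have := Stage.total_mono (S := S) (xs := xs) (ys := ys) (B := B) (k := k) hn
    omega

theorem Stage.pot_congr {t : ℕ} (hx : ∀ i < t, xs i = xs' i) (hy : ∀ i < t, ys i = ys' i) :
    S.pot f lam m B k xs ys t = S.pot f lam m B k xs' ys' t := by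
  induction t with
  | zero => rfl
  | succ t ih =>
    have hx' := fun i (hi : i < t) => hx i (by omega)
    have hy' := fun i (hi : i < t) => hy i (by omega)
    have ht : S.total xs ys t B k = S.total xs' ys' t B k := by
      unfold Stage.total; rw [Stage.pulledIn_congr hx' hy']
    simp only [Stage.pot]
    rw [Stage.run_congr hx' hy', ih hx' hy', ht, hx t (by omega), hy t (by omega)]

/-- The sum of the potentials of all bins of level at most `L`, with both signs, stopped at any
number of observations up to `M`. -/
def Stage.noisePot (S : Stage d K) (f : Fin K → Cov d → ℝ) (lam : ℕ → ℝ) (L M : ℕ)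
    (xs : ℕ → Cov d) (ys : ℕ → Fin K → ℝ) (t : ℕ) : ENNReal :=
  ∑ m ∈ Finset.Icc 1 M, ∑ l ∈ Finset.range (L + 1), ∑ B ∈ binsAt d l, ∑ k,
    (S.pot f (lam m) m B k xs ys t + S.pot f (-lam m) m B k xs ys t)

/-- The deviations are below their bounds unless the potential is large. -/
theorem Stage.noise_of_pot {L M N : ℕ} (hn : 1 < S.n) (hM : N + S.D.length ≤ M)
    (h : S.noisePot f (fun m => 4 * √(2 * Real.log S.n / m)) L M xs ys N <
      ENNReal.ofReal (S.n ^ 4)) {t : ℕ} (ht : t ≤ N) {B : Bin d} (hB : B.1 ≤ L) (k : Fin K) :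
    |S.srcDev f B k + ∑ i ∈ S.pulledIn xs ys t B k, (ys i k - f k (xs i))| ≤
      √(2 * ((S.count B k : ℝ) + (S.pulledIn xs ys t B k).card) * Real.log S.n) := by
  set G := S.srcDev f B k + ∑ i ∈ S.pulledIn xs ys t B k, (ys i k - f k (xs i)) with hG
  set m := S.total xs ys t B k with hm
  have hcast : (S.count B k : ℝ) + (S.pulledIn xs ys t B k).card = m := by
    rw [hm]; unfold Stage.total; push_cast; rfl
  rw [hcast]
  have hl : 0 < Real.log S.n := Real.log_pos hn
  rcases Nat.eq_zero_or_pos m with h0 | hpos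
  · have hc0 : S.count B k = 0 := by rw [hm] at h0; unfold Stage.total at h0; omega
    have he : S.pulledIn xs ys t B k = ∅ := by
      rw [← Finset.card_eq_zero]; rw [hm] at h0; unfold Stage.total at h0; omega
    have hd : S.srcDev f B k = 0 := by
      have : S.obsIn B k = [] := List.eq_nil_of_length_eq_zero hc0
      simp [Stage.srcDev, this]
    rw [hG, hd, he, Finset.sum_empty, add_zero, abs_zero]
    exact Real.sqrt_nonneg _
  by_contra hcon
  push Not at hcon
  have hmpos : (0 : ℝ) < m := by exact_mod_cast hpos
  have hmM : m ≤ M := by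
    have h1 := S.count_le_length B k
    have h2 : (S.pulledIn xs ys t B k).card ≤ t := Stage.pulledIn_card_le t B k
    rw [hm]; unfold Stage.total; omega
  -- The tilt `4 e` with `e ^ 2 * m = 2 log n` gives the exponent `2 e ^ 2 * m = 4 log n` at the
  -- boundary, hence the threshold `n ^ 4`.
  set e := √(2 * Real.log S.n / m) with he
  have he2 : e ^ 2 * m = 2 * Real.log S.n := by
    rw [he, Real.sq_sqrt (by positivity)]; field_simp
  have hme : m * e = √(2 * m * Real.log S.n) := by
    have h1 : (m * e) ^ 2 = 2 * m * Real.log S.n := by linear_combination (m : ℝ) * he2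
    rw [← h1, Real.sqrt_sq (by positivity)]
  rw [← hme] at hcon
  have hval : ∀ s : ℝ, s ^ 2 = 1 → m * e < s * G →
      ENNReal.ofReal (S.n ^ 4) ≤ S.pot f (4 * e * s) m B k xs ys N := by
    intro s hs hsG
    rw [Stage.pot_frozen ht le_rfl, Stage.pot_eq t hpos le_rfl]
    refine ENNReal.ofReal_le_ofReal ?_
    have hn4 : S.n ^ 4 = Real.exp (4 * Real.log S.n) := by
      rw [mul_comm, Real.exp_mul, Real.exp_log (by linarith)]
      norm_num
    rw [hn4, Real.exp_le_exp]
    have h1 : 4 * e * (m * e) ≤ 4 * e * (s * G) :=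
      mul_le_mul_of_nonneg_left hsG.le (by positivity)
    have h2 : (4 * e * s) ^ 2 / 8 * (m : ℝ) = 2 * (e ^ 2 * m) * s ^ 2 := by ring
    change _ ≤ 4 * e * s * G - (4 * e * s) ^ 2 / 8 * (m : ℝ)
    rw [h2, hs, he2]
    nlinarith
  have hle : S.pot f (4 * e) m B k xs ys N + S.pot f (-(4 * e)) m B k xs ys N ≤
      S.noisePot f (fun m => 4 * √(2 * Real.log S.n / m)) L M xs ys N := by
    unfold Stage.noisePot
    refine le_trans ?_ (Finset.single_le_sum (fun _ _ => zero_le) (Finset.mem_Icc.2 ⟨hpos, hmM⟩))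
    refine le_trans ?_ (Finset.single_le_sum (fun _ _ => zero_le)
      (Finset.mem_range.2 (Nat.lt_succ_of_le hB)))
    refine le_trans ?_ (Finset.single_le_sum (fun _ _ => zero_le) (mem_binsAt.2 rfl : B ∈ _))
    exact Finset.single_le_sum (f := fun k => S.pot f (4 * e) m B k xs ys N +
      S.pot f (-(4 * e)) m B k xs ys N) (fun _ _ => zero_le) (Finset.mem_univ k)
  rcases lt_abs.1 hcon with h1 | h1
  · have h2 := hval 1 (by norm_num) (by linarith)
    rw [mul_one] at h2
    exact absurd h (not_lt.2 (h2.trans (le_self_add.trans hle)))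
  · have h2 := hval (-1) (by norm_num) (by linarith)
    rw [mul_neg_one] at h2
    exact absurd h (not_lt.2 (h2.trans (le_add_self.trans hle)))

theorem Stage.pot_update (t : ℕ) (x : Cov d) (y : Fin K → ℝ) :
    S.pot f lam m B k (Function.update xs t x) (Function.update ys t y) (t + 1) =
      if S.binOf (S.run xs ys t) x = B ∧ S.arm (S.run xs ys t) x = k ∧
          S.total xs ys t B k < m then
        (if S.total xs ys t B k = 0 then 1 else S.pot f lam m B k xs ys t) *
          ENNReal.ofReal (Real.exp (lam * (y k - f k x) - lam ^ 2 / 8))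
      else S.pot f lam m B k xs ys t := by
  have hx : ∀ i < t, Function.update xs t x i = xs i := fun i hi => by
    rw [Function.update_of_ne hi.ne]
  have hy : ∀ i < t, Function.update ys t y i = ys i := fun i hi => by
    rw [Function.update_of_ne hi.ne]
  simp only [Stage.pot]
  have ht : S.total (Function.update xs t x) (Function.update ys t y) t B k =
      S.total xs ys t B k := by
    unfold Stage.total; rw [Stage.pulledIn_congr hx hy]
  rw [Stage.run_congr hx hy, Stage.pot_congr hx hy, ht, Function.update_self, Function.update_self]

theorem measurable_exp_eval (lam c e : ℝ) (k : Fin K) :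
    Measurable (fun y : Fin K → ℝ => ENNReal.ofReal (Real.exp (lam * (y k - c) - e))) := by
  have : Measurable (fun y : Fin K → ℝ => y k) := measurable_pi_apply k
  exact ENNReal.measurable_ofReal.comp (Real.measurable_exp.comp
    (((this.sub_const c).const_mul lam).sub_const e))

theorem Stage.measurable_pot_update (t : ℕ) (x : Cov d) :
    Measurable (fun y => S.pot f lam m B k (Function.update xs t x)
      (Function.update ys t y) (t + 1)) := by
  simp only [Stage.pot_update]
  refine Measurable.ite (MeasurableSet.const _) ?_ measurable_const
  exact (measurable_exp_eval _ _ _ k).const_mul _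

/-- The arm is determined by the past and the covariate, so only its reward is averaged, and the
exponential factor has mean at most one. The potential can grow in mean only through the value `1`
created by a first observation. -/
theorem Stage.lintegral_pot_update_le (t : ℕ) (x : Cov d) {ρ : Measure (Fin K → ℝ)}
    [IsProbabilityMeasure ρ] (hρ : ∀ᵐ y ∂ρ, ∀ k, y k ∈ Set.Icc (0 : ℝ) 1)
    (hmean : ∀ k, ∫ y, y k ∂ρ = f k x) :
    ∫⁻ y, S.pot f lam m B k (Function.update xs t x) (Function.update ys t y) (t + 1) ∂ρ ≤
      S.pot f lam m B k xs ys t +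
        if S.binOf (S.run xs ys t) x = B ∧ S.arm (S.run xs ys t) x = k then 1 else 0 := by
  simp only [Stage.pot_update]
  by_cases h : S.binOf (S.run xs ys t) x = B ∧ S.arm (S.run xs ys t) x = k ∧
    S.total xs ys t B k < m
  · simp only [if_pos h]
    rw [lintegral_const_mul _ (measurable_exp_eval _ _ _ k), if_pos (show S.binOf (S.run xs ys t) x =
      B ∧ S.arm (S.run xs ys t) x = k from ⟨h.1, h.2.1⟩)]
    have h1 := lintegral_exp_centered_le ρ (X := fun y => y k)
      (measurable_pi_apply k).aemeasurable (hρ.mono fun y hy => hy k) (f k x) (hmean k) lam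
    calc _ ≤ (if S.total xs ys t B k = 0 then 1 else S.pot f lam m B k xs ys t) * 1 := by gcongr
      _ ≤ _ := by
        rw [mul_one]
        split_ifs
        · exact le_add_self
        · exact le_self_add
  · simp only [if_neg h]
    rw [lintegral_const, measure_univ, mul_one]
    exact le_self_add

/-- A round touches a single pair of bin and arm. For each stopping number and sign the sum over all
pairs therefore grows by at most one; two signs and `M` stopping numbers give `2 M`. -/
theorem Stage.lintegral_noisePot_update_le (lams : ℕ → ℝ) (L M t : ℕ) (x : Cov d)
    {ρ : Measure (Fin K → ℝ)} [IsProbabilityMeasure ρ]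
    (hρ : ∀ᵐ y ∂ρ, ∀ k, y k ∈ Set.Icc (0 : ℝ) 1) (hmean : ∀ k, ∫ y, y k ∂ρ = f k x) :
    ∫⁻ y, S.noisePot f lams L M (Function.update xs t x) (Function.update ys t y) (t + 1) ∂ρ ≤
      S.noisePot f lams L M xs ys t + 2 * M := by
  have hm := fun (l : ℝ) (m : ℕ) (B : Bin d) (k : Fin K) =>
    S.measurable_pot_update (f := f) (lam := l) (m := m) (B := B) (k := k) (xs := xs) (ys := ys) t x
  have hm1 : ∀ (m : ℕ) (B : Bin d) (k : Fin K), Measurable fun y =>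
      (S.pot f (lams m) m B k (Function.update xs t x) (Function.update ys t y) (t + 1) +
        S.pot f (-lams m) m B k (Function.update xs t x) (Function.update ys t y) (t + 1)) :=
    fun m B k => (hm _ m B k).add (hm _ m B k)
  have hm2 : ∀ (m : ℕ) (B : Bin d), Measurable fun y => ∑ k,
      (S.pot f (lams m) m B k (Function.update xs t x) (Function.update ys t y) (t + 1) +
        S.pot f (-lams m) m B k (Function.update xs t x) (Function.update ys t y) (t + 1)) :=
    fun m B => Finset.measurable_fun_sum _ fun k _ => hm1 m B k
  have hm3 : ∀ m l : ℕ, Measurable fun y => ∑ B ∈ binsAt d l, ∑ k,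
      (S.pot f (lams m) m B k (Function.update xs t x) (Function.update ys t y) (t + 1) +
        S.pot f (-lams m) m B k (Function.update xs t x) (Function.update ys t y) (t + 1)) :=
    fun m l => Finset.measurable_fun_sum _ fun B _ => hm2 m B
  have hm4 : ∀ m : ℕ, Measurable fun y => ∑ l ∈ Finset.range (L + 1), ∑ B ∈ binsAt d l, ∑ k,
      (S.pot f (lams m) m B k (Function.update xs t x) (Function.update ys t y) (t + 1) +
        S.pot f (-lams m) m B k (Function.update xs t x) (Function.update ys t y) (t + 1)) :=
    fun m => Finset.measurable_fun_sum _ fun l _ => hm3 m l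
  unfold Stage.noisePot
  rw [lintegral_finsetSum _ (fun m _ => hm4 m)]
  have hmain : ∀ m ∈ Finset.Icc 1 M, ∫⁻ y, ∑ l ∈ Finset.range (L + 1), ∑ B ∈ binsAt d l, ∑ k,
      (S.pot f (lams m) m B k (Function.update xs t x) (Function.update ys t y) (t + 1) +
        S.pot f (-lams m) m B k (Function.update xs t x) (Function.update ys t y) (t + 1)) ∂ρ ≤
      ∑ l ∈ Finset.range (L + 1), ∑ B ∈ binsAt d l, ∑ k,
        (S.pot f (lams m) m B k xs ys t + S.pot f (-lams m) m B k xs ys t) + 2 := by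
    intro m _
    rw [lintegral_finsetSum _ (fun l _ => hm3 m l)]
    have e1 : ∀ l ∈ Finset.range (L + 1), ∫⁻ y, ∑ B ∈ binsAt d l, ∑ k,
        (S.pot f (lams m) m B k (Function.update xs t x) (Function.update ys t y) (t + 1) +
        S.pot f (-lams m) m B k (Function.update xs t x) (Function.update ys t y) (t + 1)) ∂ρ ≤
        ∑ B ∈ binsAt d l, ∑ k, ((S.pot f (lams m) m B k xs ys t + S.pot f (-lams m) m B k xs ys t) +
          2 * if S.binOf (S.run xs ys t) x = B ∧ S.arm (S.run xs ys t) x = k then 1 else 0) := by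
      intro l _
      rw [lintegral_finsetSum _ (fun B _ => hm2 m B)]
      refine Finset.sum_le_sum fun B _ => ?_
      rw [lintegral_finsetSum _ (fun k _ => hm1 m B k)]
      refine Finset.sum_le_sum fun k _ => ?_
      rw [lintegral_add_left (hm _ m B k)]
      refine (add_le_add (S.lintegral_pot_update_le t x hρ hmean)
        (S.lintegral_pot_update_le t x hρ hmean)).trans (le_of_eq ?_)
      ring
    refine (Finset.sum_le_sum e1).trans ?_
    simp only [Finset.sum_add_distrib, ← Finset.mul_sum]
    gcongr
    have e2 : ∀ l ∈ Finset.range (L + 1), (∑ B ∈ binsAt d l, ∑ k,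
        if S.binOf (S.run xs ys t) x = B ∧ S.arm (S.run xs ys t) x = k then (1 : ENNReal) else 0) ≤
        if (S.binOf (S.run xs ys t) x).1 = l then 1 else 0 := by
      intro l _
      calc _ = ∑ B ∈ binsAt d l, if S.binOf (S.run xs ys t) x = B then (1 : ENNReal) else 0 := by
            refine Finset.sum_congr rfl fun B _ => ?_
            by_cases hB : S.binOf (S.run xs ys t) x = B
            · simp [hB]
            · simp [hB]
        _ ≤ _ := by
            rw [Finset.sum_ite_eq]
            simp only [mem_binsAt]
            exact le_rfl
    calc _ ≤ 2 * ∑ l ∈ Finset.range (L + 1),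
          (if (S.binOf (S.run xs ys t) x).1 = l then (1 : ENNReal) else 0) := by
          gcongr with l hl; exact e2 l hl
      _ ≤ 2 * 1 := by
          gcongr
          rw [Finset.sum_ite_eq]
          split_ifs
          · exact le_rfl
          · exact zero_le
      _ = 2 := mul_one 2
  refine (Finset.sum_le_sum hmain).trans ?_
  rw [Finset.sum_add_distrib, Finset.sum_const, Nat.card_Icc, nsmul_eq_mul]
  simp only [Nat.add_sub_cancel]
  rw [mul_comm]

end Potential

/-! ### The regret of the second stage -/

section Budget

variable {d K : ℕ}

/-- The levelwise costs by which the regret of the second stage is bounded: a round spent in a bin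
of level `l < top` costs `wt l` if the covariate lies in `reg l`; all rounds with covariate
in `reg'` cost `wt'`. The rates `q` are the conditional probabilities of `reg l` given the bin. -/
structure Budget (d : ℕ) where
  top : ℕ
  wt : ℕ → ℝ
  cap : ℕ → ℝ
  reg : ℕ → Set (Cov d)
  wt' : ℝ
  reg' : Set (Cov d)

/-- The conditional probability of the costly region given the bin. -/
def Budget.rate (b : Budget d) (Q : Measure (Cov d)) (B : Bin d) : ℝ :=
  Q.real (b.reg B.1 ∩ B.carrier) / Q.real B.carrier

/-- The initial budget. -/
def Budget.init (b : Budget d) (Q : Measure (Cov d)) : ℝ :=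
  ∑ l ∈ Finset.range b.top, ∑ B ∈ binsAt d l, b.wt l * b.rate Q B * b.cap l

/-- The cost of a round. -/
def Budget.cost (b : Budget d) (S : Stage d K) (T : Tree d K) (x : Cov d) : ℝ :=
  (if (S.binOf T x).1 < b.top ∧ 1 < (S.nodeOf T x).active.card then
    b.wt (S.binOf T x).1 * (if x ∈ b.reg (S.binOf T x).1 then 1 else 0) else 0) +
    b.wt' * if x ∈ b.reg' then 1 else 0

/-- The amount released from the initial budget in a round. -/
def Budget.fee (b : Budget d) (S : Stage d K) (Q : Measure (Cov d)) (T : Tree d K) (x : Cov d) : ℝ :=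
  if (S.binOf T x).1 < b.top ∧ 1 < (S.nodeOf T x).active.card then
    b.wt (S.binOf T x).1 * b.rate Q (S.binOf T x) else 0

/-- The budget after `t` rounds. -/
def Budget.value (b : Budget d) (S : Stage d K) (Q : Measure (Cov d)) (xs : ℕ → Cov d)
    (ys : ℕ → Fin K → ℝ) (t : ℕ) : ℝ :=
  b.init Q + ∑ s ∈ Finset.range t,
    (b.cost S (S.run xs ys s) (xs s) - b.fee S Q (S.run xs ys s) (xs s))

variable {b : Budget d} {S : Stage d K} {Q : Measure (Cov d)} {L N : ℕ}
  {xs : ℕ → Cov d} {ys : ℕ → Fin K → ℝ}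

theorem Budget.rate_nonneg (B : Bin d) : 0 ≤ b.rate Q B :=
  div_nonneg measureReal_nonneg measureReal_nonneg

theorem sum_bins_ite {top : ℕ} (B₀ : Bin d) (p : Prop) [Decidable p] (g : Bin d → ℝ) :
    ∑ l ∈ Finset.range top, ∑ B ∈ binsAt d l, (if B₀ = B ∧ p then g B else 0) =
      if B₀.1 < top ∧ p then g B₀ else 0 := by
  have h : ∀ l ∈ Finset.range top, ∑ B ∈ binsAt d l, (if B₀ = B ∧ p then g B else 0) =
      if B₀.1 = l then (if p then g B₀ else 0) else 0 := by
    intro l _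
    by_cases hp : p
    · simp only [hp, and_true, if_true]
      rw [Finset.sum_ite_eq]
      simp only [mem_binsAt]
    · simp [hp]
  rw [Finset.sum_congr rfl h, Finset.sum_ite_eq]
  by_cases hp : p <;> simp [hp]

/-- Each visit of `B` releases the same amount `wt * rate`, and the initial budget contains this
amount `cap` times, which bounds the number of visits. -/
theorem Budget.sum_fee_le (hwt : ∀ l, 0 ≤ b.wt l)
    (hcap : ∀ B : Bin d, B.1 < b.top → (S.visits xs ys N B : ℝ) ≤ b.cap B.1) :
    ∑ s ∈ Finset.range N, b.fee S Q (S.run xs ys s) (xs s) ≤ b.init Q := by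
  have h1 : ∀ s ∈ Finset.range N, b.fee S Q (S.run xs ys s) (xs s) =
      ∑ l ∈ Finset.range b.top, ∑ B ∈ binsAt d l,
        (if S.binOf (S.run xs ys s) (xs s) = B ∧
          1 < (S.nodeOf (S.run xs ys s) (xs s)).active.card then b.wt B.1 * b.rate Q B else 0) :=
    fun s _ => (sum_bins_ite _ _ fun B => b.wt B.1 * b.rate Q B).symm
  rw [Finset.sum_congr rfl h1, Finset.sum_comm]
  unfold Budget.init
  refine Finset.sum_le_sum fun l hl => ?_
  rw [Finset.sum_comm]
  refine Finset.sum_le_sum fun B hB => ?_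
  have hBl := mem_binsAt.1 hB
  have h2 : ∑ s ∈ Finset.range N, (if S.binOf (S.run xs ys s) (xs s) = B ∧
      1 < (S.nodeOf (S.run xs ys s) (xs s)).active.card then b.wt B.1 * b.rate Q B else 0) =
      S.visits xs ys N B * (b.wt B.1 * b.rate Q B) := by
    rw [← Finset.sum_filter, Finset.sum_const, nsmul_eq_mul]
    rfl
  rw [h2, mul_comm, hBl]
  refine mul_le_mul_of_nonneg_left ?_ (mul_nonneg (hwt l) (Budget.rate_nonneg B))
  rw [← hBl]
  exact hcap B (by rw [hBl]; exact Finset.mem_range.1 hl)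

theorem Budget.sum_cost_le (hwt : ∀ l, 0 ≤ b.wt l)
    (hcap : ∀ B : Bin d, B.1 < b.top → (S.visits xs ys N B : ℝ) ≤ b.cap B.1) :
    ∑ s ∈ Finset.range N, b.cost S (S.run xs ys s) (xs s) ≤ b.value S Q xs ys N := by
  have := Budget.sum_fee_le (Q := Q) hwt hcap
  unfold Budget.value
  rw [Finset.sum_sub_distrib]
  linarith

theorem Budget.cost_nonneg (hwt : ∀ l, 0 ≤ b.wt l) (hwt' : 0 ≤ b.wt') (T : Tree d K) (x : Cov d) :
    0 ≤ b.cost S T x := by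
  unfold Budget.cost
  have := hwt (S.binOf T x).1
  positivity

/-- The gain of a round has the same mean as the cost in the region `reg'`. -/
theorem Budget.integral_round {P : Bin d → Node K → Prop} {F : Bin d → Prop} {T : Tree d K}
    [IsProbabilityMeasure Q] (hT : TreeInv L P F T) (hsp : SplitOK S L P F)
    (hgen : ∀ᵐ x ∂Q, Generic x) (hreg : ∀ l, MeasurableSet (b.reg l))
    (hreg' : MeasurableSet b.reg') :
    Integrable (fun x => b.cost S T x - b.fee S Q T x) Q ∧
      ∫ x, (b.cost S T x - b.fee S Q T x) ∂Q = b.wt' * Q.real b.reg' := by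
  set occ : Bin d → Prop := fun B => ∃ x', Generic x' ∧ S.binOf T x' = B ∧
    1 < (S.nodeOf T x').active.card with hocc
  -- By `TreeInv.refine_eq`, whether a round ends in `B` with several active arms depends on the
  -- covariate only through its membership in `B`. So `occ B` is a property of the state alone, each
  -- `g B` has mean zero, and cost minus fee agrees almost everywhere with the measurable function
  -- `h`.
  set g : Bin d → Cov d → ℝ := fun B x => if occ B then
    b.wt B.1 * ((b.reg B.1 ∩ B.carrier).indicator 1 x - b.rate Q B * B.carrier.indicator 1 x) else 0
    with hg
  set h : Cov d → ℝ := fun x => ∑ l ∈ Finset.range b.top, ∑ B ∈ binsAt d l, g B x +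
    b.wt' * b.reg'.indicator 1 x with hh
  have hAB : ∀ B : Bin d, MeasurableSet (b.reg B.1 ∩ B.carrier) := fun B =>
    (hreg _).inter B.measurableSet_carrier
  have hind : ∀ s : Set (Cov d), MeasurableSet s → Integrable (s.indicator (1 : Cov d → ℝ)) Q :=
    fun s hs => (integrable_const (1 : ℝ)).indicator hs
  have hint : ∀ s : Set (Cov d), MeasurableSet s → ∫ x, s.indicator (1 : Cov d → ℝ) x ∂Q = Q.real s :=
    fun s hs => integral_indicator_one hs
  have hgint : ∀ B, Integrable (g B) Q := by
    intro B
    simp only [hg]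
    by_cases ho : occ B
    · simp only [if_pos ho]
      exact ((hind _ (hAB B)).sub ((hind _ B.measurableSet_carrier).const_mul _)).const_mul _
    · simp only [if_neg ho]; exact integrable_zero _ _ _
  have hgzero : ∀ B, ∫ x, g B x ∂Q = 0 := by
    intro B
    simp only [hg]
    by_cases ho : occ B
    · simp only [if_pos ho]
      rw [integral_const_mul, integral_sub (hind _ (hAB B))
        ((hind _ B.measurableSet_carrier).const_mul _), integral_const_mul, hint _ (hAB B),
        hint _ B.measurableSet_carrier]
      unfold Budget.rate
      by_cases h0 : Q.real B.carrier = 0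
      · have : Q.real (b.reg B.1 ∩ B.carrier) = 0 :=
          le_antisymm (h0 ▸ measureReal_mono Set.inter_subset_right) measureReal_nonneg
        rw [this, h0]; simp
      · rw [div_mul_cancel₀ _ h0, sub_self, mul_zero]
    · simp only [if_neg ho, integral_zero]
  have hsum : Integrable (fun x => ∑ l ∈ Finset.range b.top, ∑ B ∈ binsAt d l, g B x) Q :=
    integrable_finsetSum _ fun l _ => integrable_finsetSum _ fun B _ => hgint B
  have hhint : Integrable h Q := hsum.add ((hind _ hreg').const_mul _)
  have hhval : ∫ x, h x ∂Q = b.wt' * Q.real b.reg' := by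
    simp only [hh]
    rw [integral_add hsum ((hind _ hreg').const_mul _), integral_const_mul, hint _ hreg',
      integral_finsetSum _ fun l _ => integrable_finsetSum _ fun B _ => hgint B]
    simp only [integral_finsetSum _ (fun B _ => hgint B), hgzero, Finset.sum_const_zero, zero_add]
  have hae : (fun x => b.cost S T x - b.fee S Q T x) =ᵐ[Q] h := by
    filter_upwards [hgen] with x hx
    obtain ⟨h1, _⟩ := hT.refine hsp hx
    obtain ⟨l, hl⟩ := h1.ex x hx
    have hbin : S.binOf T x = cell l x := h1.locate_eq hx hl
    have hxB : x ∈ (S.binOf T x).carrier := by rw [hbin]; exact mem_cell hx.1 l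
    have hiff : ∀ B, (occ B ∧ x ∈ B.carrier) ↔
        (S.binOf T x = B ∧ 1 < (S.nodeOf T x).active.card) := by
      intro B
      constructor
      · rintro ⟨⟨x', hx', rfl, hc⟩, hxB'⟩
        obtain ⟨e1, e2⟩ := hT.refine_eq hsp hx' hx hxB'
        refine ⟨e2, ?_⟩
        have : S.nodeOf T x = S.nodeOf T x' := by
          unfold Stage.nodeOf
          rw [show S.binOf T x = S.binOf T x' from e2, e1]
        rwa [this]
      · rintro ⟨rfl, hc⟩
        exact ⟨⟨x, hx, rfl, hc⟩, hxB⟩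
    have hgx : ∀ B, g B x = if S.binOf T x = B ∧ 1 < (S.nodeOf T x).active.card then
        b.wt B.1 * ((if x ∈ b.reg B.1 then 1 else 0) - b.rate Q B) else 0 := by
      intro B
      simp only [hg]
      by_cases hc : S.binOf T x = B ∧ 1 < (S.nodeOf T x).active.card
      · obtain ⟨ho, hxB'⟩ := (hiff B).2 hc
        rw [if_pos hc, if_pos ho, Set.indicator_of_mem hxB']
        by_cases hr : x ∈ b.reg B.1
        · rw [Set.indicator_of_mem (show x ∈ b.reg B.1 ∩ B.carrier from ⟨hr, hxB'⟩), if_pos hr]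
          simp
        · rw [Set.indicator_of_notMem (fun hm : x ∈ b.reg B.1 ∩ B.carrier => hr hm.1), if_neg hr]
          simp
      · rw [if_neg hc]
        by_cases ho : occ B
        · have hxB' : x ∉ B.carrier := fun hm => hc ((hiff B).1 ⟨ho, hm⟩)
          rw [if_pos ho, Set.indicator_of_notMem hxB',
            Set.indicator_of_notMem fun hm : x ∈ b.reg B.1 ∩ B.carrier => hxB' hm.2]
          simp
        · rw [if_neg ho]
    simp only [hh]
    simp only [hgx]
    rw [sum_bins_ite (S.binOf T x) (1 < (S.nodeOf T x).active.card)
      (fun B => b.wt B.1 * ((if x ∈ b.reg B.1 then 1 else 0) - b.rate Q B))]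
    unfold Budget.cost Budget.fee
    have hi : b.reg'.indicator (1 : Cov d → ℝ) x = if x ∈ b.reg' then 1 else 0 := by
      rw [Set.indicator_apply]; rfl
    rw [hi]
    split_ifs <;> ring
  exact ⟨hhint.congr hae.symm, by rw [integral_congr_ae hae, hhval]⟩

/-- The potential: the budget, as long as all covariates are generic, and a multiple of the
exponential potentials. -/
def Budget.pot (b : Budget d) (S : Stage d K) (Q : Measure (Cov d)) (f : Fin K → Cov d → ℝ)
    (lams : ℕ → ℝ) (L M : ℕ) (c : ENNReal) (t : ℕ) (xs : ℕ → Cov d) (ys : ℕ → Fin K → ℝ) : ENNReal :=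
  (if ∀ i < t, Generic (xs i) then ENNReal.ofReal (b.value S Q xs ys t) else 0) +
    c * S.noisePot f lams L M xs ys t

theorem Budget.value_update (t : ℕ) (x : Cov d) (y : Fin K → ℝ) :
    b.value S Q (Function.update xs t x) (Function.update ys t y) (t + 1) =
      b.value S Q xs ys t + (b.cost S (S.run xs ys t) x - b.fee S Q (S.run xs ys t) x) := by
  have hx : ∀ i < t, Function.update xs t x i = xs i := fun i hi => by
    rw [Function.update_of_ne hi.ne]
  have hy : ∀ i < t, Function.update ys t y i = ys i := fun i hi => by
    rw [Function.update_of_ne hi.ne]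
  unfold Budget.value
  have hsum : ∑ s ∈ Finset.range t, (b.cost S (S.run (Function.update xs t x)
      (Function.update ys t y) s) (Function.update xs t x s) - b.fee S Q (S.run
        (Function.update xs t x) (Function.update ys t y) s) (Function.update xs t x s)) =
      ∑ s ∈ Finset.range t,
        (b.cost S (S.run xs ys s) (xs s) - b.fee S Q (S.run xs ys s) (xs s)) := by
    refine Finset.sum_congr rfl fun s hs => ?_
    rw [Finset.mem_range] at hs
    rw [hx s hs, Stage.run_congr (S := S) (fun i hi => hx i (hi.trans hs))
      fun i hi => hy i (hi.trans hs)]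
  rw [Finset.sum_range_succ, Function.update_self, Stage.run_congr hx hy, hsum]
  ring

/-- The covariates of a sequence of target rounds. -/
def covs (v : ℕ → RoundQ d K) : ℕ → Cov d := fun i => (v i).1.1

/-- The reward vectors of a sequence of target rounds. -/
def rews (v : ℕ → RoundQ d K) : ℕ → Fin K → ℝ := fun i => (v i).1.2

theorem covs_update (v : ℕ → RoundQ d K) (t : ℕ) (z : RoundQ d K) :
    covs (Function.update v t z) = Function.update (covs v) t z.1.1 := by
  funext i
  unfold covs
  by_cases h : i = t
  · subst h; simp
  · simp [Function.update_of_ne h]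

theorem rews_update (v : ℕ → RoundQ d K) (t : ℕ) (z : RoundQ d K) :
    rews (Function.update v t z) = Function.update (rews v) t z.1.2 := by
  funext i
  unfold rews
  by_cases h : i = t
  · subst h; simp
  · simp [Function.update_of_ne h]

theorem lintegral_lawQ_le (M : Model d K) (hK : 0 < K) (F : Cov d → (Fin K → ℝ) → ENNReal) :
    ∫⁻ z, F z.1.1 z.1.2 ∂M.lawQ ≤ ∫⁻ x, ∫⁻ y, F x y ∂(M.rewardQ x) ∂M.QX := by
  have := M.probQX
  have := M.markovQ
  have : Nonempty (Fin K) := ⟨⟨0, hK⟩⟩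
  have hU : IsProbabilityMeasure (uniformOn (Set.univ : Set (Fin K))) :=
    isProbabilityMeasure_uniformOn Set.finite_univ Set.univ_nonempty
  unfold Model.lawQ
  refine (lintegral_prod_le _).trans ?_
  simp only [lintegral_const, measure_univ, mul_one]
  exact lintegral_compProd_le _ _ fun p => F p.1 p.2

variable {M : Model d K} {f : Fin K → Cov d → ℝ} {lams : ℕ → ℝ} {Mx : ℕ}

/-- The current rewards affect only the noise potentials, so they are averaged first; averaging over
the covariate then moves the budget by the mean charge of `reg'`. The budget stays nonnegative by
the bound on visits, so that `ENNReal.ofReal` may be exchanged with an ordinary integral. -/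
theorem Budget.lintegral_pot_le (hK : 0 < K) (hS : S.Valid) (hlev : ∀ B : Bin d, L ≤ B.1 →
    (N : ℝ) + S.D.length < S.need B) (hgen : ∀ᵐ x ∂M.QX, Generic x)
    (hmean : ∀ᵐ x ∂M.QX, ∀ k, ∫ y, y k ∂(M.rewardQ x) = f k x)
    (hwt : ∀ l, 0 ≤ b.wt l) (hwt' : 0 ≤ b.wt')
    (hcap : ∀ B : Bin d, B.1 < b.top → 2 * ∑ k, (S.limit B k : ℝ) ≤ b.cap B.1)
    (hreg : ∀ l, MeasurableSet (b.reg l)) (hreg' : MeasurableSet b.reg') (c : ENNReal)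
    {t : ℕ} (ht : t < N) (v : ℕ → RoundQ d K) :
    ∫⁻ z, b.pot S M.QX f lams L Mx c (t + 1) (covs (Function.update v t z))
        (rews (Function.update v t z)) ∂M.lawQ ≤
      b.pot S M.QX f lams L Mx c t (covs v) (rews v) +
        (ENNReal.ofReal (b.wt' * M.QX.real b.reg') + c * (2 * Mx)) := by
  have := M.probQX
  have := M.markovQ
  simp only [covs_update, rews_update]
  refine (lintegral_lawQ_le M hK fun x y => b.pot S M.QX f lams L Mx c (t + 1)
    (Function.update (covs v) t x) (Function.update (rews v) t y)).trans ?_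
  set T := S.run (covs v) (rews v) t
  set a : Cov d → ENNReal := fun x => if (∀ i < t, Generic (covs v i)) ∧ Generic x then
    ENNReal.ofReal (b.value S M.QX (covs v) (rews v) t + (b.cost S T x - b.fee S M.QX T x)) else 0
  have hinner : ∀ᵐ x ∂M.QX, ∫⁻ y, b.pot S M.QX f lams L Mx c (t + 1)
      (Function.update (covs v) t x) (Function.update (rews v) t y) ∂(M.rewardQ x) ≤
      a x + c * (S.noisePot f lams L Mx (covs v) (rews v) t + 2 * Mx) := by
    filter_upwards [hmean] with x hx
    have h1 := S.lintegral_noisePot_update_le (f := f) lams L Mx t x (xs := covs v) (ys := rews v)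
      (M.rewardQ_mem x) hx
    have h2 : ∀ y, b.pot S M.QX f lams L Mx c (t + 1)
        (Function.update (covs v) t x) (Function.update (rews v) t y) = a x +
        c * S.noisePot f lams L Mx (Function.update (covs v) t x)
          (Function.update (rews v) t y) (t + 1) := by
      intro y
      unfold Budget.pot
      rw [Budget.value_update]
      congr 1
      have : (∀ i < t + 1, Generic (Function.update (covs v) t x i)) ↔
          (∀ i < t, Generic (covs v i)) ∧ Generic x := by
        constructor
        · intro h
          refine ⟨fun i hi => ?_, ?_⟩
          · have := h i (by omega)
            rwa [Function.update_of_ne hi.ne] at this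
          · have := h t (by omega)
            rwa [Function.update_self] at this
        · rintro ⟨h1, h2⟩ i hi
          by_cases hit : i = t
          · rw [hit, Function.update_self]; exact h2
          · rw [Function.update_of_ne hit]; exact h1 i (by omega)
      simp only [a, this]
      rfl
    simp only [h2]
    rw [lintegral_add_left measurable_const, lintegral_const, measure_univ, mul_one]
    refine add_le_add le_rfl ?_
    have hmeas : Measurable fun y => S.noisePot f lams L Mx (Function.update (covs v) t x)
        (Function.update (rews v) t y) (t + 1) := by
      unfold Stage.noisePot
      exact Finset.measurable_fun_sum _ fun m _ => Finset.measurable_fun_sum _ fun l _ =>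
        Finset.measurable_fun_sum _ fun B _ => Finset.measurable_fun_sum _ fun k _ =>
          (S.measurable_pot_update t x).add (S.measurable_pot_update t x)
    rw [lintegral_const_mul _ hmeas]
    gcongr
  refine (lintegral_mono_ae hinner).trans ?_
  rw [lintegral_add_right _ measurable_const, lintegral_const, measure_univ, mul_one]
  have ha : ∫⁻ x, a x ∂M.QX ≤ (if ∀ i < t, Generic (covs v i) then
      ENNReal.ofReal (b.value S M.QX (covs v) (rews v) t) else 0) +
        ENNReal.ofReal (b.wt' * M.QX.real b.reg') := by
    by_cases hg : ∀ i < t, Generic (covs v i)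
    · rw [if_pos hg]
      have hT : TreeInv L (S.LeafInv (fun _ _ => 0) L N 0 0 0 0 0 (covs v) (rews v) t)
        (S.Fresh (covs v) (rews v) t) T := treeInv_run hS hlev ht.le hg
      obtain ⟨hi, hv⟩ := Budget.integral_round (b := b) (Q := M.QX) hT
        (splitOK_leafInv hS hlev ht.le) hgen hreg hreg'
      set W := b.value S M.QX (covs v) (rews v) t
      have hnn : ∀ᵐ x ∂M.QX, 0 ≤ W + (b.cost S T x - b.fee S M.QX T x) := by
        filter_upwards [hgen] with x hx
        have hw := Budget.value_update (b := b) (S := S) (Q := M.QX) (xs := covs v) (ys := rews v)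
          t x 0
        rw [← hw]
        have hgen' : ∀ i < t + 1, Generic (Function.update (covs v) t x i) := by
          intro i hi
          by_cases hit : i = t
          · rw [hit, Function.update_self]; exact hx
          · rw [Function.update_of_ne hit]; exact hg i (by omega)
        refine le_trans (Finset.sum_nonneg fun s _ => Budget.cost_nonneg hwt hwt' _ _)
          (Budget.sum_cost_le hwt fun B hB => ?_)
        refine le_trans ?_ (hcap B hB)
        have := visits_le hS hlev (t := t + 1) ht hgen' (ys := Function.update (rews v) t 0) B
        calc _ ≤ ((2 * ∑ k, S.limit B k : ℕ) : ℝ) := by exact_mod_cast this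
          _ = _ := by push_cast; rfl
      calc ∫⁻ x, a x ∂M.QX ≤ ∫⁻ x, ENNReal.ofReal (W + (b.cost S T x - b.fee S M.QX T x)) ∂M.QX := by
            refine lintegral_mono fun x => ?_
            simp only [a]
            split_ifs
            · exact le_rfl
            · exact zero_le
        _ = ENNReal.ofReal (∫ x, (W + (b.cost S T x - b.fee S M.QX T x)) ∂M.QX) :=
            (ofReal_integral_eq_lintegral_ofReal ((integrable_const W).add hi) hnn).symm
        _ = ENNReal.ofReal (W + b.wt' * M.QX.real b.reg') := by
            rw [integral_add (integrable_const W) hi, hv]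
            simp
        _ ≤ _ := ENNReal.ofReal_add_le
    · have : ∀ x, a x = 0 := fun x => if_neg fun h => hg h.1
      simp [this]
  refine (add_le_add ha le_rfl).trans (le_of_eq ?_)
  unfold Budget.pot
  ring

theorem fMax_eq {f : Fin K → Cov d → ℝ} {x : Cov d} {b : Fin K} (hb : ∀ j, f j x ≤ f b x) :
    fMax f x = f b x := by
  have : Nonempty (Fin K) := ⟨b⟩
  exact le_antisymm (ciSup_le hb) 
    (le_ciSup (f := fun k => f k x) (Set.finite_range _).bddAbove b)

/-- The expected regret of `N` rounds of the second stage. -/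
theorem Budget.lintegral_regret_le (hK : 0 < K) (hS : S.Valid) (hlev : ∀ B : Bin d, L ≤ B.1 →
    (N : ℝ) + S.D.length < S.need B) (hMx : N + S.D.length ≤ Mx)
    (hgen : ∀ᵐ x ∂M.QX, Generic x)
    (hmean : ∀ᵐ x ∂M.QX, ∀ k, ∫ y, y k ∂(M.rewardQ x) = f k x)
    {m : ℕ} {ρ cA cm cG : ℝ}
    (hgood : ∀ xs ys, (∀ t ≤ N, ∀ B : Bin d, B.1 ≤ L → ∀ k,
      |S.srcDev f B k + ∑ i ∈ S.pulledIn xs ys t B k, (ys i k - f k (xs i))| ≤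
      √(2 * ((S.count B k : ℝ) + (S.pulledIn xs ys t B k).card) * Real.log S.n)) →
      S.Good f L N m ρ cA cm cG xs ys)
    (hgap : ∀ x ∈ cube d, ∀ j k, f j x - f k x ≤ 1)
    (hwt : ∀ l, 0 ≤ b.wt l) (hwt₀ : 1 ≤ b.wt 0)
    (hwt₁ : ∀ B : Bin d, B.1 < L → cG * S.scale B ≤ b.wt (B.1 + 1))
    (hwt' : ∀ l, b.top ≤ l → b.wt l ≤ b.wt')
    (hcap : ∀ B : Bin d, B.1 < b.top → 2 * ∑ k, (S.limit B k : ℝ) ≤ b.cap B.1)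
    (hreg : ∀ l, MeasurableSet (b.reg l)) (hreg' : MeasurableSet b.reg')
    (hmem : ∀ l, ∀ x ∈ cube d, ∀ k, 0 < fMax f x - f k x → fMax f x - f k x ≤ b.wt l → x ∈ b.reg l)
    (hmem' : ∀ x ∈ cube d, ∀ k, 0 < fMax f x - f k x → fMax f x - f k x ≤ b.wt' → x ∈ b.reg') :
    ∫⁻ v, ENNReal.ofReal (∑ s ∈ Finset.range N, (fMax f (covs v s) -
        f (S.arm (S.run (covs v) (rews v) s) (covs v s)) (covs v s)))
        ∂(Measure.infinitePi (fun _ : ℕ => M.lawQ)) ≤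
      ENNReal.ofReal (b.init M.QX) + ENNReal.ofReal (N / S.n ^ 4) *
        S.noisePot f (fun m => 4 * √(2 * Real.log S.n / m)) L Mx (fun _ => 0) (fun _ => 0) 0 +
        N * (ENNReal.ofReal (b.wt' * M.QX.real b.reg') + ENNReal.ofReal (N / S.n ^ 4) * (2 * Mx)) := by
  have := M.probQX
  have := M.markovQ
  have : Nonempty (Fin K) := ⟨⟨0, hK⟩⟩
  have hU : IsProbabilityMeasure (uniformOn (Set.univ : Set (Fin K))) :=
    isProbabilityMeasure_uniformOn Set.finite_univ Set.univ_nonempty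
  have hQ : IsProbabilityMeasure M.lawQ := by unfold Model.lawQ; infer_instance
  have hn := hS.n_gt
  have hwt'0 : 0 ≤ b.wt' := (hwt b.top).trans (hwt' _ le_rfl)
  -- Where the noise potential is at least `n ^ 4`, `c` times it pays the trivial regret `N`.
  set c := ENNReal.ofReal (N / S.n ^ 4) with hc
  set lams : ℕ → ℝ := fun m => 4 * √(2 * Real.log S.n / m) with hlams
  have hpot := lintegral_potential_le M.lawQ
    (fun t v => b.pot S M.QX f lams L Mx c t (covs v) (rews v))
    (ENNReal.ofReal (b.wt' * M.QX.real b.reg') + c * (2 * Mx)) N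
    (fun t ht v => Budget.lintegral_pot_le hK hS hlev hgen hmean hwt hwt'0 hcap hreg hreg' c ht v)
  have hzero : ∀ v : ℕ → RoundQ d K, b.pot S M.QX f lams L Mx c 0 (covs v) (rews v) =
      ENNReal.ofReal (b.init M.QX) + c * S.noisePot f lams L Mx (fun _ => 0) (fun _ => 0) 0 := by
    intro v
    unfold Budget.pot Budget.value
    simp only [Nat.not_lt_zero, false_imp_iff, implies_true, if_true, Finset.range_zero,
      Finset.sum_empty, add_zero]
    rfl
  simp only [hzero, lintegral_const, measure_univ, mul_one] at hpot
  refine le_trans (lintegral_mono_ae ?_) hpot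
  have hgenv : ∀ᵐ v ∂(Measure.infinitePi (fun _ : ℕ => M.lawQ)), ∀ i, Generic (covs v i) := by
    rw [ae_all_iff]
    intro i
    have h1 : ∀ᵐ z ∂M.lawQ, Generic z.1.1 := by
      have h2 : M.lawQ.map (fun z => z.1.1) = M.QX := by
        have e1 : M.lawQ.map Prod.fst = M.QX.compProd M.rewardQ := by
          unfold Model.lawQ
          rw [Measure.map_fst_prod]; simp
        have e2 : (M.QX.compProd M.rewardQ).map Prod.fst = M.QX := Measure.fst_compProd _ _
        rw [← e2, ← e1, Measure.map_map measurable_fst measurable_fst]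
        rfl
      rw [← h2] at hgen
      exact ae_of_ae_map (measurable_fst.comp measurable_fst).aemeasurable hgen
    have h3 := (measurePreserving_eval_infinitePi (fun _ : ℕ => M.lawQ) i).quasiMeasurePreserving
    exact h3.ae h1
  filter_upwards [hgenv] with v hv
  set xs := covs v
  set ys := rews v
  have hreg_le : ∀ s, fMax f (xs s) - f (S.arm (S.run xs ys s) (xs s)) (xs s) ≤ 1 := by
    intro s
    obtain ⟨j, hj⟩ := exists_best_arm f ⟨0, hK⟩ (xs s)
    rw [fMax_eq hj]
    exact hgap _ (hv s).1 _ _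
  by_cases hbig : S.noisePot f lams L Mx xs ys N < ENNReal.ofReal (S.n ^ 4)
  · have hG := hgood xs ys fun t ht B hB k => Stage.noise_of_pot hn hMx hbig ht hB k
    unfold Budget.pot
    rw [if_pos fun i _ => hv i]
    refine le_trans (ENNReal.ofReal_le_ofReal ?_) le_self_add
    refine le_trans (Finset.sum_le_sum fun s hs => ?_) (Budget.sum_cost_le (Q := M.QX) hwt
      fun B hB => ?_)
    · rw [Finset.mem_range] at hs
      obtain ⟨_, hbL, h3⟩ := round_spec (f := f) (m := m) (ρ := ρ) (cA := cA) (cm := cm) (cG := cG)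
        (ys := ys) hS hK hlev hs fun i _ => hv i
      have h3 := h3 hG
      obtain ⟨j, hj⟩ := exists_best_arm f ⟨0, hK⟩ (xs s)
      have hmax := fMax_eq hj
      set k := S.arm (S.run xs ys s) (xs s)
      set l := (S.binOf (S.run xs ys s) (xs s)).1 with hl
      rw [hmax]
      by_cases hcard : 1 < (S.nodeOf (S.run xs ys s) (xs s)).active.card
      swap
      · have := (h3 j).1 hcard
        linarith [Budget.cost_nonneg (S := S) hwt hwt'0 (S.run xs ys s) (xs s)]
      by_cases hpos : 0 < f j (xs s) - f k (xs s)
      swap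
      · linarith [Budget.cost_nonneg (S := S) hwt hwt'0 (S.run xs ys s) (xs s)]
      -- At the root the weight exceeds the trivial gap bound `1`; at level `l' + 1` the bound
      -- inherited from the parent bin is used.
      have hle : f j (xs s) - f k (xs s) ≤ b.wt l := by
        rcases hl0 : l with _ | l'
        · exact (hgap _ (hv s).1 _ _).trans hwt₀
        · have := (h3 j).2 l' (by rw [← hl0])
          exact this.trans (hwt₁ (cell l' (xs s)) (by rw [cell_fst]; omega))
      unfold Budget.cost
      -- Rounds at levels less than `top` are charged to the region of their own level, deeper ones
      -- to the common region `reg'`.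
      by_cases htop : l < b.top
      · rw [if_pos ⟨htop, hcard⟩, if_pos (hmem l _ (hv s).1 k (by rw [hmax]; exact hpos)
          (by rw [hmax]; exact hle))]
        have : 0 ≤ b.wt' * (if xs s ∈ b.reg' then (1 : ℝ) else 0) := by positivity
        linarith
      · have hle' := hle.trans (hwt' l (not_lt.1 htop))
        rw [if_neg fun h => htop h.1, if_pos (hmem' _ (hv s).1 k (by rw [hmax]; exact hpos)
          (by rw [hmax]; exact hle'))]
        linarith
    · refine le_trans ?_ (hcap B hB)
      have := visits_le hS hlev (t := N) le_rfl (fun i _ => hv i) (ys := ys) B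
      calc _ ≤ ((2 * ∑ k, S.limit B k : ℕ) : ℝ) := by exact_mod_cast this
        _ = _ := by push_cast; rfl
  · rw [not_lt] at hbig
    have h1 : ENNReal.ofReal (∑ s ∈ Finset.range N, (fMax f (xs s) -
        f (S.arm (S.run xs ys s) (xs s)) (xs s))) ≤ ENNReal.ofReal N := by
      refine ENNReal.ofReal_le_ofReal ?_
      refine (Finset.sum_le_sum fun s _ => hreg_le s).trans ?_
      simp
    have hn4 : 0 < S.n ^ 4 := by positivity
    have h2 : ENNReal.ofReal N = c * ENNReal.ofReal (S.n ^ 4) := by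
      rw [hc, ← ENNReal.ofReal_mul (by positivity), div_mul_cancel₀ _ hn4.ne']
    unfold Budget.pot
    refine h1.trans (h2.le.trans (le_trans ?_ le_add_self))
    gcongr

end Budget

/-! ### Decomposition of the regret of the adaptive policy -/

section Splice

variable {Ω : Type*} [MeasurableSpace Ω]

/-- The first `t` entries of `u`, followed by `v`. -/
def splice (t : ℕ) (u v : ℕ → Ω) : ℕ → Ω := fun i => if i < t then u i else v (i - t)

/-- A prefix of one i.i.d. sequence followed by an independent copy is again i.i.d.; this separates
the exploration rounds from those of the second stage. -/
theorem infinitePi_map_splice (ν : Measure Ω) [IsProbabilityMeasure ν] (t : ℕ) :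
    ((Measure.infinitePi (fun _ : ℕ => ν)).prod (Measure.infinitePi (fun _ : ℕ => ν))).map
      (fun p => splice t p.1 p.2) = Measure.infinitePi (fun _ : ℕ => ν) := by
  have hm : Measurable (fun p : (ℕ → Ω) × (ℕ → Ω) => splice t p.1 p.2) := by
    refine measurable_pi_iff.2 fun i => ?_
    unfold splice
    by_cases hi : i < t
    · simp only [if_pos hi]; exact (measurable_pi_apply i).comp measurable_fst
    · simp only [if_neg hi]; exact (measurable_pi_apply _).comp measurable_snd
  refine Measure.eq_infinitePi _ fun s A hA => ?_
  rw [Measure.map_apply hm (.pi s.countable_toSet fun i _ => hA i)]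
  have hpre : (fun p : (ℕ → Ω) × (ℕ → Ω) => splice t p.1 p.2) ⁻¹' (Set.pi s A) =
      (Set.pi (s.filter (· < t) : Finset ℕ) A) ×ˢ
        (Set.pi (((s.filter (¬ · < t)).image (· - t) : Finset ℕ)) (fun i => A (i + t))) := by
    ext ⟨u, v⟩
    simp only [Set.mem_preimage, Set.mem_pi, Set.mem_prod, Finset.mem_coe, Finset.mem_filter,
      Finset.mem_image, splice]
    constructor
    · intro h
      refine ⟨fun i hi => ?_, ?_⟩
      · have := h i hi.1
        rwa [if_pos hi.2] at this
      · rintro j ⟨i, ⟨hi, hit⟩, rfl⟩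
        have := h i hi
        rw [if_neg hit] at this
        rwa [Nat.sub_add_cancel (not_lt.1 hit)]
    · rintro ⟨h1, h2⟩ i hi
      split_ifs with hit
      · exact h1 i ⟨hi, hit⟩
      · have := h2 (i - t) ⟨i, ⟨hi, hit⟩, rfl⟩
        rwa [Nat.sub_add_cancel (not_lt.1 hit)] at this
  rw [hpre, Measure.prod_prod, Measure.infinitePi_pi _ (fun i _ => hA i),
    Measure.infinitePi_pi _ (fun i _ => hA _), Finset.prod_image]
  · rw [← Finset.prod_filter_mul_prod_filter_not s (· < t)]
    congr 1
    refine Finset.prod_congr rfl fun i hi => ?_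
    rw [Nat.sub_add_cancel (not_lt.1 (Finset.mem_filter.1 hi).2)]
  · intro i hi j hj hij
    have h1 := (Finset.mem_filter.1 hi).2
    have h2 := (Finset.mem_filter.1 hj).2
    simp only at hij
    omega

theorem lintegral_infinitePi_splice_le (ν : Measure Ω) [IsProbabilityMeasure ν] (t : ℕ)
    (F : (ℕ → Ω) → ENNReal) :
    ∫⁻ w, F w ∂(Measure.infinitePi (fun _ : ℕ => ν)) ≤
      ∫⁻ u, ∫⁻ v, F (splice t u v) ∂(Measure.infinitePi (fun _ : ℕ => ν))
        ∂(Measure.infinitePi (fun _ : ℕ => ν)) := by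
  conv_lhs => rw [← infinitePi_map_splice ν t]
  exact (lintegral_map_le _ _).trans (lintegral_prod_le _)

/-- The finite source sample becomes the beginning of an infinite i.i.d. sequence, so that the same
concentration bounds serve both samples. -/
theorem lintegral_pi_le (ν : Measure Ω) [IsProbabilityMeasure ν] (m : ℕ)
    (F : (Fin m → Ω) → ENNReal) :
    ∫⁻ z, F z ∂(Measure.pi (fun _ : Fin m => ν)) ≤
      ∫⁻ u, F (fun i => u i) ∂(Measure.infinitePi (fun _ : ℕ => ν)) := by
  have hm : Measurable (fun (u : ℕ → Ω) (i : Fin m) => u i) :=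
    measurable_pi_iff.2 fun i => measurable_pi_apply _
  have hmap : (Measure.infinitePi (fun _ : ℕ => ν)).map (fun (u : ℕ → Ω) (i : Fin m) => u i) =
      Measure.pi (fun _ : Fin m => ν) := by
    refine (Measure.pi_eq fun A hA => ?_).symm
    rw [Measure.map_apply hm (.univ_pi hA)]
    have hpre : (fun (u : ℕ → Ω) (i : Fin m) => u i) ⁻¹' (Set.univ.pi A) =
        Set.pi (Finset.range m : Finset ℕ) (fun i => if h : i < m then A ⟨i, h⟩ else Set.univ) := by
      ext u
      simp only [Set.mem_preimage, Set.mem_pi, Set.mem_univ, true_imp_iff, Finset.mem_coe,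
        Finset.mem_range]
      constructor
      · intro h i hi
        rw [dif_pos hi]; exact h ⟨i, hi⟩
      · intro h i
        have := h i i.2
        rwa [dif_pos i.2] at this
    rw [hpre, Measure.infinitePi_pi _ (fun i _ => ?_), Finset.prod_range]
    · refine Finset.prod_congr rfl fun i _ => ?_
      rw [dif_pos i.2]
    · split_ifs
      · exact hA _
      · exact MeasurableSet.univ
  rw [← hmap]
  exact lintegral_map_le _ _

end Splice

/-! ### The two stages of the adaptive policy as functions of independent samples. -/

section Decomposition

variable {d K : ℕ}

/-- A list of observations along a sequence. -/
def obsList {Ω : Type*} (φ : Ω → Obs d K) (t : ℕ) (u : ℕ → Ω) : List (Obs d K) :=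
  (List.range t).map (fun i => φ (u i))

theorem length_obsList {Ω : Type*} (φ : Ω → Obs d K) (t : ℕ) (u : ℕ → Ω) :
    (obsList φ t u).length = t := by simp [obsList]

theorem history_length (π : Policy d K) (src : List (Obs d K)) (w : ℕ → RoundQ d K) (t : ℕ) :
    (history π src w t).length = t := by
  induction t with
  | zero => rfl
  | succ t ih => simp [history, ih]

variable {θ : Tuning} {tie : Finset (Fin K) → Fin K} {nQ nP : ℕ} {src : List (Obs d K)}

theorem pulledArm_explore (w : ℕ → RoundQ d K) {t : ℕ} (ht : t < stepQ θ d nQ nP) :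
    pulledArm (adaptivePolicy θ tie nQ nP) src w t = (w t).2 := by
  unfold pulledArm adaptivePolicy
  have := history_length (adaptivePolicy θ tie nQ nP) src w t
  unfold adaptivePolicy at this
  rw [if_pos (by rw [this]; exact ht)]

theorem history_explore (w : ℕ → RoundQ d K) {t : ℕ} (ht : t ≤ stepQ θ d nQ nP) :
    history (adaptivePolicy θ tie nQ nP) src w t = obsList uniformObs t w := by
  induction t with
  | zero => rfl
  | succ t ih =>
    have h1 : pulledArm (adaptivePolicy θ tie nQ nP) src w t = (w t).2 := pulledArm_explore w ht
    unfold pulledArm at h1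
    simp only [history]
    rw [h1, ih (by omega)]
    simp [obsList, List.range_succ, uniformObs]

/-- The input of the second stage as a function of the data of the first stage. -/
def secondStage (θ : Tuning) (tie : Finset (Fin K) → Fin K) (nQ nP : ℕ) (src : List (Obs d K))
    (u : ℕ → RoundQ d K) : Stage d K :=
  stageOf θ tie nQ nP src (obsList uniformObs (stepQ θ d nQ nP) u)

/-- Target observations after the exploration rounds do not enter the smoothness estimate. The input
of the second stage, although recomputed from the full history in each round, is therefore constant.
-/
theorem stageOf_append (h₁ h₂ : List (Obs d K)) (hl : h₁.length = stepQ θ d nQ nP) :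
    stageOf θ tie nQ nP src (h₁ ++ h₂) = stageOf θ tie nQ nP src h₁ := by
  unfold stageOf estimationData
  by_cases h : nQ < nP
  · simp only [if_pos h]
  · simp only [if_neg h]
    have : h₁.length = sampleSize θ d nQ nP := by rw [hl]; unfold stepQ; rw [if_neg h]
    rw [List.take_append_of_le_length this.ge]

/-- The policy rebuilds the tree by folding over the past. With a constant input this fold is the
recursion `Stage.run`. The history records the arms pulled, so the claims about history and arm
support each other in one induction. -/
theorem history_splice (u v w : ℕ → RoundQ d K) (hu : ∀ i < stepQ θ d nQ nP, w i = u i)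
    (hv : ∀ s, w (stepQ θ d nQ nP + s) = v s) (s : ℕ) :
    (∃ h₂, history (adaptivePolicy θ tie nQ nP) src w (stepQ θ d nQ nP + s) =
        obsList uniformObs (stepQ θ d nQ nP) u ++ h₂ ∧
      h₂.foldl (fun T z => (secondStage θ tie nQ nP src u).step T z.1 z.2.2)
        (secondStage θ tie nQ nP src u).startTree =
          (secondStage θ tie nQ nP src u).run (covs v) (rews v) s) ∧
    pulledArm (adaptivePolicy θ tie nQ nP) src w (stepQ θ d nQ nP + s) =
      (secondStage θ tie nQ nP src u).arm
        ((secondStage θ tie nQ nP src u).run (covs v) (rews v) s) (covs v s) := by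
  have key : ∀ s, (∃ h₂, history (adaptivePolicy θ tie nQ nP) src w (stepQ θ d nQ nP + s) =
        obsList uniformObs (stepQ θ d nQ nP) u ++ h₂ ∧
      h₂.foldl (fun T z => (secondStage θ tie nQ nP src u).step T z.1 z.2.2)
        (secondStage θ tie nQ nP src u).startTree =
          (secondStage θ tie nQ nP src u).run (covs v) (rews v) s) →
      pulledArm (adaptivePolicy θ tie nQ nP) src w (stepQ θ d nQ nP + s) =
        (secondStage θ tie nQ nP src u).arm
          ((secondStage θ tie nQ nP src u).run (covs v) (rews v) s) (covs v s) := by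
    rintro s ⟨h₂, e1, e2⟩
    have hlen := history_length (adaptivePolicy θ tie nQ nP) src w (stepQ θ d nQ nP + s)
    unfold pulledArm
    rw [e1] at hlen ⊢
    simp only [adaptivePolicy]
    rw [if_neg (by rw [hlen]; omega), stageOf_append _ _ (length_obsList _ _ _),
      List.drop_left' (length_obsList _ _ _), hv]
    change (secondStage θ tie nQ nP src u).arm (h₂.foldl
      (fun T z => (secondStage θ tie nQ nP src u).step T z.1 z.2.2)
      (secondStage θ tie nQ nP src u).startTree) _ = _
    rw [e2]
    rfl
  suffices h : ∃ h₂, history (adaptivePolicy θ tie nQ nP) src w (stepQ θ d nQ nP + s) =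
        obsList uniformObs (stepQ θ d nQ nP) u ++ h₂ ∧
      h₂.foldl (fun T z => (secondStage θ tie nQ nP src u).step T z.1 z.2.2)
        (secondStage θ tie nQ nP src u).startTree =
          (secondStage θ tie nQ nP src u).run (covs v) (rews v) s from ⟨h, key s h⟩
  induction s with
  | zero =>
    refine ⟨[], ?_, rfl⟩
    rw [add_zero, List.append_nil, history_explore w le_rfl]
    unfold obsList
    refine List.map_congr_left fun i hi => ?_
    rw [List.mem_range] at hi
    rw [hu i hi]
  | succ s ih =>
    have hk := key s ih
    obtain ⟨h₂, e1, e2⟩ := ih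
    unfold pulledArm at hk
    refine ⟨h₂ ++ [((w (stepQ θ d nQ nP + s)).1.1, (secondStage θ tie nQ nP src u).arm
      ((secondStage θ tie nQ nP src u).run (covs v) (rews v) s) (covs v s),
      (w (stepQ θ d nQ nP + s)).1.2 ((secondStage θ tie nQ nP src u).arm
        ((secondStage θ tie nQ nP src u).run (covs v) (rews v) s) (covs v s)))], ?_, ?_⟩
    · rw [← add_assoc]
      simp only [history]
      rw [hk, e1, List.append_assoc]
    · rw [List.foldl_append, e2]
      simp only [List.foldl_cons, List.foldl_nil, hv]
      rfl

theorem regret_splice (f : Fin K → Cov d → ℝ) (u v : ℕ → RoundQ d K)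
    (hf : ∀ i k, fMax f (covs u i) - f k (covs u i) ≤ 1) :
    regret f (adaptivePolicy θ tie nQ nP) src (splice (stepQ θ d nQ nP) u v) nQ ≤
      (min nQ (stepQ θ d nQ nP) : ℕ) + ∑ s ∈ Finset.range (nQ - stepQ θ d nQ nP),
        (fMax f (covs v s) - f ((secondStage θ tie nQ nP src u).arm
          ((secondStage θ tie nQ nP src u).run (covs v) (rews v) s) (covs v s)) (covs v s)) := by
  set t := stepQ θ d nQ nP with ht
  set w := splice t u v with hw
  set π : Policy d K := adaptivePolicy θ tie nQ nP
  have h1 : ∀ i < t, w i = u i := fun i hi => by simp only [hw, splice]; rw [if_pos hi]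
  have h2 : ∀ s, w (t + s) = v s := fun s => by
    simp only [hw, splice]
    rw [if_neg (by omega)]
    congr 1; omega
  have hle : ∀ m ≤ t, ∑ i ∈ Finset.range m, (fMax f (w i).1.1 - f (pulledArm π src w i) (w i).1.1) ≤
      m := by
    intro m hm
    refine (Finset.sum_le_sum (g := fun _ => (1 : ℝ)) fun i hi => ?_).trans (by simp)
    rw [Finset.mem_range] at hi
    rw [h1 i (by omega)]
    exact hf i _
  unfold regret
  rcases le_total nQ t with hn | hn
  · rw [min_eq_left hn, Nat.sub_eq_zero_of_le hn, Finset.range_zero, Finset.sum_empty, add_zero]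
    exact hle nQ hn
  · obtain ⟨m, hm⟩ := Nat.exists_eq_add_of_le hn
    have hm' : nQ - t = m := by omega
    have hr : Finset.range nQ = Finset.range (t + m) := by rw [hm]
    rw [min_eq_right hn, hm', hr, Finset.sum_range_add]
    refine add_le_add (hle t le_rfl) (le_of_eq (Finset.sum_congr rfl fun s _ => ?_))
    rw [(history_splice (θ := θ) (tie := tie) (nQ := nQ) (nP := nP) (src := src) u v w h1 h2 s).2]
    rw [h2 s]
    rfl

theorem sourceData_restrict (u : ℕ → RoundP d K) (m : ℕ) :
    sourceData (fun i : Fin m => u i) = obsList RoundP.obs m u := by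
  unfold sourceData obsList
  apply List.ext_getElem
  · simp
  · intro i h1 h2; simp

/-- The expected regret is the cost of the first stage plus that of the second stage. -/
theorem expectedRegret_le (M : Model d K) (hK : 0 < K) {f : Fin K → Cov d → ℝ}
    (hfM : ∀ k, ∀ x ∈ cube d, f k x = M.f k x) :
    M.expectedRegret (adaptivePolicy θ tie nQ nP) nQ nP ≤
      (min nQ (stepQ θ d nQ nP) : ℕ) +
        ∫⁻ u, ∫⁻ u', ∫⁻ v, ENNReal.ofReal (∑ s ∈ Finset.range (nQ - stepQ θ d nQ nP),
          (fMax f (covs v s) - f ((secondStage θ tie nQ nP (obsList RoundP.obs nP u) u').arm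
            ((secondStage θ tie nQ nP (obsList RoundP.obs nP u) u').run (covs v) (rews v) s)
              (covs v s)) (covs v s)))
          ∂(Measure.infinitePi (fun _ : ℕ => M.lawQ)) ∂(Measure.infinitePi (fun _ : ℕ => M.lawQ))
          ∂(Measure.infinitePi (fun _ : ℕ => M.lawP)) := by
  have := M.probQX
  have := M.markovQ
  have := M.probPX
  have := M.markovP
  have := M.markovArm
  have : Nonempty (Fin K) := ⟨⟨0, hK⟩⟩
  have hU : IsProbabilityMeasure (uniformOn (Set.univ : Set (Fin K))) :=
    isProbabilityMeasure_uniformOn Set.finite_univ Set.univ_nonempty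
  have hQ : IsProbabilityMeasure M.lawQ := by unfold Model.lawQ; infer_instance
  have hP : IsProbabilityMeasure M.lawP := by unfold Model.lawP; infer_instance
  have hcube : ∀ᵐ w ∂(Measure.infinitePi (fun _ : ℕ => M.lawQ)), ∀ i, covs w i ∈ cube d := by
    rw [ae_all_iff]
    intro i
    have h1 : ∀ᵐ z ∂M.lawQ, z.1.1 ∈ cube d := by
      have h2 : M.lawQ.map (fun z => z.1.1) = M.QX := by
        have e1 : M.lawQ.map Prod.fst = M.QX.compProd M.rewardQ := by
          unfold Model.lawQ
          rw [Measure.map_fst_prod]; simp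
        have e2 : (M.QX.compProd M.rewardQ).map Prod.fst = M.QX := Measure.fst_compProd _ _
        rw [← e2, ← e1, Measure.map_map measurable_fst measurable_fst]
        rfl
      have h3 : ∀ᵐ x ∂M.QX, x ∈ cube d := by rw [ae_iff]; exact M.QX_cube
      rw [← h2] at h3
      exact ae_of_ae_map (measurable_fst.comp measurable_fst).aemeasurable h3
    exact (measurePreserving_eval_infinitePi (fun _ : ℕ => M.lawQ) i).quasiMeasurePreserving.ae h1
  have hmax : ∀ x ∈ cube d, fMax M.f x = fMax f x := fun x hx => by
    unfold fMax
    exact iSup_congr fun k => (hfM k x hx).symm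
  have hone : ∀ x ∈ cube d, ∀ k, fMax f x - f k x ≤ 1 := by
    intro x hx k
    obtain ⟨j, hj⟩ := exists_best_arm f k x
    rw [fMax_eq hj, hfM k x hx, hfM j x hx]
    linarith [(M.f_mem j x hx).2, (M.f_mem k x hx).1]
  unfold Model.expectedRegret Model.law
  refine (lintegral_prod_le _).trans ((lintegral_pi_le M.lawP nP _).trans ?_)
  have hbound : ∀ u : ℕ → RoundP d K, ∫⁻ w, ENNReal.ofReal (regret M.f (adaptivePolicy θ tie nQ nP)
      (sourceData (fun i : Fin nP => u i)) w nQ) ∂(Measure.infinitePi (fun _ : ℕ => M.lawQ)) ≤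
      (min nQ (stepQ θ d nQ nP) : ℕ) +
        ∫⁻ u', ∫⁻ v, ENNReal.ofReal (∑ s ∈ Finset.range (nQ - stepQ θ d nQ nP),
          (fMax f (covs v s) - f ((secondStage θ tie nQ nP (obsList RoundP.obs nP u) u').arm
            ((secondStage θ tie nQ nP (obsList RoundP.obs nP u) u').run (covs v) (rews v) s)
              (covs v s)) (covs v s)))
          ∂(Measure.infinitePi (fun _ : ℕ => M.lawQ)) ∂(Measure.infinitePi (fun _ : ℕ => M.lawQ)) := by
    intro u
    rw [sourceData_restrict]
    set src := obsList RoundP.obs nP u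
    calc _ ≤ ∫⁻ w, ENNReal.ofReal (regret f (adaptivePolicy θ tie nQ nP) src w nQ)
          ∂(Measure.infinitePi (fun _ : ℕ => M.lawQ)) := by
          refine lintegral_mono_ae ?_
          filter_upwards [hcube] with w hw
          refine ENNReal.ofReal_le_ofReal (le_of_eq (Finset.sum_congr rfl fun t _ => ?_))
          have hwt : (w t).1.1 ∈ cube d := hw t
          rw [hmax _ hwt, hfM _ _ hwt]
      _ ≤ _ := lintegral_infinitePi_splice_le M.lawQ (stepQ θ d nQ nP) _
      _ ≤ ∫⁻ u', ((min nQ (stepQ θ d nQ nP) : ℕ) +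
        ∫⁻ v, ENNReal.ofReal (∑ s ∈ Finset.range (nQ - stepQ θ d nQ nP),
          (fMax f (covs v s) - f ((secondStage θ tie nQ nP src u').arm
            ((secondStage θ tie nQ nP src u').run (covs v) (rews v) s)
              (covs v s)) (covs v s)))
          ∂(Measure.infinitePi (fun _ : ℕ => M.lawQ)))
          ∂(Measure.infinitePi (fun _ : ℕ => M.lawQ)) := by
          refine lintegral_mono_ae ?_
          filter_upwards [hcube] with u' hu'
          have h1 : ∀ v, ENNReal.ofReal (regret f (adaptivePolicy θ tie nQ nP) src
              (splice (stepQ θ d nQ nP) u' v) nQ) ≤ (min nQ (stepQ θ d nQ nP) : ℕ) +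
              ENNReal.ofReal (∑ s ∈ Finset.range (nQ - stepQ θ d nQ nP),
              (fMax f (covs v s) - f ((secondStage θ tie nQ nP src u').arm
                ((secondStage θ tie nQ nP src u').run (covs v) (rews v) s)
                (covs v s)) (covs v s))) := by
            intro v
            refine (ENNReal.ofReal_le_ofReal
              (regret_splice f u' v fun i k => hone _ (hu' i) k)).trans ?_
            refine ENNReal.ofReal_add_le.trans ?_
            rw [ENNReal.ofReal_natCast]
          refine (lintegral_mono h1).trans ?_
          rw [lintegral_add_left measurable_const, lintegral_const, measure_univ, mul_one]
      _ = _ := by rw [lintegral_add_left measurable_const, lintegral_const, measure_univ, mul_one]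
  refine (lintegral_mono hbound).trans ?_
  rw [lintegral_add_left measurable_const, lintegral_const, measure_univ, mul_one]

end Decomposition

/-! ### The smoothness estimate -/

section Smoothness

variable {d K : ℕ}

/-- Expanding the square around the mean, the mixed term integrates to zero. The existence of a
minimizer ensures that `Classical.epsilon` in `polyProj` really picks one. -/
theorem exists_minimizer {Ω : Type*} [MeasurableSpace Ω] {ν : Measure Ω} [IsProbabilityMeasure ν]
    {f : Ω → ℝ} (hf : AEMeasurable f ν) (hb : ∀ᵐ u ∂ν, f u ∈ Set.Icc (0 : ℝ) 1) (c : ℝ) :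
    Integrable (fun u => |f u - c| ^ 2) ν ∧
      ∫ u, |f u - ∫ u, f u ∂ν| ^ 2 ∂ν ≤ ∫ u, |f u - c| ^ 2 ∂ν := by
  have hint : ∀ c : ℝ, Integrable (fun u => |f u - c| ^ 2) ν := fun c => by
    refine Integrable.of_bound (C := (1 + |c|) ^ 2)
      ((hf.sub_const c).abs.pow_const 2).aestronglyMeasurable ?_
    filter_upwards [hb] with u hu
    rw [Real.norm_eq_abs, abs_of_nonneg (by positivity)]
    have : |f u - c| ≤ 1 + |c| := (abs_sub _ _).trans (by
      rw [abs_of_nonneg hu.1]; linarith [hu.2])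
    gcongr
  have hfi : Integrable f ν := by
    refine Integrable.of_bound (C := 1) hf.aestronglyMeasurable ?_
    filter_upwards [hb] with u hu
    rw [Real.norm_eq_abs, abs_of_nonneg hu.1]; exact hu.2
  refine ⟨hint c, ?_⟩
  set m := ∫ u, f u ∂ν with hm
  have he : ∀ u, |f u - c| ^ 2 = |f u - m| ^ 2 + (2 * (m - c) * (f u - m) + (m - c) ^ 2) := by
    intro u; rw [sq_abs, sq_abs]; ring
  simp only [he]
  have h1 : Integrable (fun u => 2 * (m - c) * (f u - m)) ν :=
    (hfi.sub (integrable_const m)).const_mul _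
  have h2 : Integrable (fun u => 2 * (m - c) * (f u - m) + (m - c) ^ 2) ν :=
    h1.add (integrable_const _)
  rw [integral_add (hint m) h2, integral_add h1 (integrable_const _),
    integral_const_mul, integral_sub hfi (integrable_const m)]
  simp only [integral_const, probReal_univ, smul_eq_mul, one_mul]
  rw [← hm, sub_self, mul_zero, zero_add]
  have := sq_nonneg (m - c)
  linarith

/-- A local constant projection deviates from `f x` by at most twice the oscillation of `f`. -/
theorem polyProj_zero_sub_le {μ : Measure (Cov d)} [IsFiniteMeasure μ] {B : Bin d}
    (hμ : 0 < μ B.carrier) {f g : Cov d → ℝ} (hg : Measurable g) (hfg : ∀ u ∈ B.carrier, f u = g u)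
    (hb : ∀ u ∈ B.carrier, f u ∈ Set.Icc (0 : ℝ) 1) {x : Cov d} (hx : x ∈ B.carrier) {s : ℝ}
    (hs : ∀ u ∈ B.carrier, |f u - f x| ≤ s) :
    |polyProj 0 B.side f x B μ - f x| ≤ 2 * s := by
  have hν : IsProbabilityMeasure (cond μ B.carrier) := cond_isProbabilityMeasure hμ.ne'
  have hmemB : ∀ᵐ u ∂(cond μ B.carrier), u ∈ B.carrier := ae_cond_mem B.measurableSet_carrier
  -- The bin has sup-norm diameter at most its side, so the window around `x` covers it and the
  -- projection is taken over the whole bin.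
  have hball : (cond μ B.carrier).restrict (Metric.closedBall x B.side) = cond μ B.carrier := by
    refine Measure.restrict_eq_self_of_ae_mem ?_
    filter_upwards [hmemB] with u hu
    rw [Metric.mem_closedBall, dist_eq_norm]
    exact Bin.dist_le hu hx
  set ν := cond μ B.carrier with hν'
  have hfm : AEMeasurable f ν := ⟨g, hg, by filter_upwards [hmemB] with u hu using hfg u hu⟩
  have hfb : ∀ᵐ u ∂ν, f u ∈ Set.Icc (0 : ℝ) 1 := by filter_upwards [hmemB] with u hu using hb u hu
  have hdeg : ∀ p : MvPolynomial (Fin d) ℝ, p.totalDegree ≤ 0 →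
      ∃ c : ℝ, ∀ u, MvPolynomial.eval u p = c := by
    intro p hp
    have := MvPolynomial.totalDegree_eq_zero_iff_eq_C.1 (Nat.le_zero.1 hp)
    exact ⟨p.coeff 0, fun u => by rw [this]; simp⟩
  have hex : ∃ p, IsPolyProj 0 B.side f x B μ p := by
    refine ⟨MvPolynomial.C (∫ u, f u ∂ν), by simp, fun p hp => ?_⟩
    obtain ⟨c, hc⟩ := hdeg p hp
    simp only [hc, MvPolynomial.eval_C, ← hν', hball]
    exact (exists_minimizer hfm hfb c).2
  have hsp := Classical.epsilon_spec hex
  obtain ⟨c, hc⟩ := hdeg _ hsp.1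
  have hmin := hsp.2 (MvPolynomial.C (f x)) (by simp)
  simp only [hc, MvPolynomial.eval_C, ← hν', hball] at hmin
  unfold polyProj
  rw [hc]
  by_contra hcon
  push Not at hcon
  have hs0 : 0 ≤ s := (abs_nonneg _).trans (hs x hx)
  -- The minimizing constant `c` is at least as good as the constant `f x`, whose error is at most
  -- `s ^ 2`; if `|c - f x| > 2 s`, its own error would be at least `(|c - f x| - s) ^ 2 > s ^ 2`.
  have h1 : ∫ u, |f u - f x| ^ 2 ∂ν ≤ s ^ 2 := by
    have : ∫ u, |f u - f x| ^ 2 ∂ν ≤ ∫ _, s ^ 2 ∂ν := by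
      refine integral_mono_ae (exists_minimizer hfm hfb (f x)).1 (integrable_const _) ?_
      filter_upwards [hmemB] with u hu
      have := hs u hu
      gcongr
    simpa using this
  have h2 : (|c - f x| - s) ^ 2 ≤ ∫ u, |f u - c| ^ 2 ∂ν := by
    have : ∫ _, (|c - f x| - s) ^ 2 ∂ν ≤ ∫ u, |f u - c| ^ 2 ∂ν := by
      refine integral_mono_ae (integrable_const _) (exists_minimizer hfm hfb c).1 ?_
      filter_upwards [hmemB] with u hu
      have h3 := hs u hu
      have h4 : |c - f x| ≤ |f u - c| + |f u - f x| := by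
        rw [abs_sub_comm (f u) c]; exact abs_sub_le _ _ _
      have h5 : 0 ≤ |c - f x| - s := by linarith
      have h6 : |c - f x| - s ≤ |f u - c| := by linarith
      change (|c - f x| - s) ^ 2 ≤ |f u - c| ^ 2
      gcongr
    simpa using this
  nlinarith

/-- Self-similarity yields two points of a bin at which `f` differs considerably. -/
theorem SelfSimilar.exists_osc {β b : ℝ} {l₀ l : ℕ} (hl : l₀ ≤ l) {f g : Cov d → ℝ}
    {μ : Measure (Cov d)} [IsFiniteMeasure μ] (h : SelfSimilar β l₀ b f μ) (hb : 0 < b)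
    (hg : Measurable g) (hfg : ∀ u ∈ cube d, f u = g u)
    (hf : ∀ u ∈ cube d, f u ∈ Set.Icc (0 : ℝ) 1) :
    ∃ B ∈ binsAt d l, ∃ u ∈ B.carrier, ∃ x ∈ B.carrier,
      b * (2 : ℝ) ^ (-(β * l)) / 5 < f u - f x := by
  obtain ⟨hpos, hsup⟩ := h l hl
  set r := b * (2 : ℝ) ^ (-(β * l)) with hr
  have hr0 : 0 < r := by positivity
  have hne : {r : ℝ | ∃ B ∈ binsAt d l, ∃ x ∈ B.carrier,
        r = |polyProj 0 ((1 / 2 : ℝ) ^ l) f x B μ - f x|}.Nonempty := by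
    by_contra hcon
    rw [Set.not_nonempty_iff_eq_empty] at hcon
    rw [hcon, Real.sSup_empty] at hsup
    linarith
  -- The supremum need not be attained, so half of it is used; an oscillation of at most `r / 5`
  -- would allow a projection error of at most `2 r / 5 < r / 2`.
  obtain ⟨_, ⟨B, hB, x, hx, rfl⟩, hlt⟩ := exists_lt_of_lt_csSup hne
    (lt_of_lt_of_le (by linarith : r / 2 < r) hsup)
  have hside : B.side = (1 / 2 : ℝ) ^ l := by unfold Bin.side; rw [mem_binsAt.1 hB]
  rw [← hside] at hlt
  by_contra hcon
  push Not at hcon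
  have := polyProj_zero_sub_le (hpos B hB) hg (fun u hu => hfg u (B.carrier_subset_cube hu))
    (fun u hu => hf u (B.carrier_subset_cube hu)) hx (s := r / 5) fun u hu => by
      rw [abs_le]
      constructor <;> linarith [hcon B hB u hu x hx, hcon B hB x hx u hu]
  linarith

theorem IsHolder.sub_le_of_mem {β C : ℝ} (hβ : 0 < β) (hC : 0 ≤ C) {g : Cov d → ℝ}
    (h : IsHolder β C g) {B : Bin d} {x y : Cov d} (hx : x ∈ B.carrier) (hy : y ∈ B.carrier) :
    |g x - g y| ≤ C * (2 : ℝ) ^ (-(β * B.1)) := by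
  refine (h x (B.carrier_subset_cube hx) y (B.carrier_subset_cube hy)).trans ?_
  have h1 : ‖x - y‖ ^ β ≤ B.side ^ β :=
    Real.rpow_le_rpow (norm_nonneg _) (Bin.dist_le hx hy) hβ.le
  have h2 : B.side ^ β = (2 : ℝ) ^ (-(β * B.1)) := by
    unfold Bin.side
    rw [one_div, inv_pow, ← Real.rpow_natCast, ← Real.rpow_neg (by norm_num), ← Real.rpow_mul
      (by norm_num)]
    congr 1; ring
  rw [← h2]
  gcongr

/-- The deviations of the local means of the data `D` at level `l` are at most `e`. -/
def Accurate (D : List (Obs d K)) (f : Fin K → Cov d → ℝ) (l : ℕ) (e : ℝ) : Prop :=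
  ∀ B ∈ binsAt d l, ∀ k, let F := D.filter (fun z => z.1 ∈ B.carrier ∧ z.2.1 = k)
    0 < F.length ∧ |(F.map (fun z => z.2.2 - f k z.1)).sum| ≤ F.length * e

/-- The distance condition in the estimate is vacuous, because the bandwidth is the side of the bin.
What remains is a bin average with noise at most `e` and bias at most the Hölder oscillation on the
bin. -/
theorem Accurate.localEstimate_sub_le {D : List (Obs d K)} {f : Fin K → Cov d → ℝ} {l : ℕ} {e β C : ℝ}
    (h : Accurate D f l e) (hβ : 0 < β) (hC : 0 ≤ C) {k : Fin K} (hf : IsHolder β C (f k))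
    {x : Cov d} (hx : x ∈ cube d) :
    |localEstimate D l k x - f k x| ≤ e + C * (2 : ℝ) ^ (-(β * l)) := by
  have hloc := locate_binsAt hx l
  set B := locate (binsAt d l) x
  have hl : B.1 = l := hloc.1
  have hfil : D.filter (fun z => z.1 ∈ B.carrier ∧ z.2.1 = k ∧ ‖z.1 - x‖ ≤ (1 / 2 : ℝ) ^ l) =
      D.filter (fun z => z.1 ∈ B.carrier ∧ z.2.1 = k) := by
    refine List.filter_congr fun z _ => ?_
    rw [decide_eq_decide]
    refine ⟨fun hz => ⟨hz.1, hz.2.1⟩, fun hz => ⟨hz.1, hz.2, ?_⟩⟩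
    rw [← hl]
    exact Bin.dist_le hz.1 hloc.2
  obtain ⟨hpos, hdev⟩ := h B (mem_binsAt.2 hl) k
  unfold localEstimate
  change |((D.filter (fun z => z.1 ∈ B.carrier ∧ z.2.1 = k ∧ ‖z.1 - x‖ ≤ (1 / 2 : ℝ) ^ l)).map
    (fun z => z.2.2)).sum / (D.filter (fun z => z.1 ∈ B.carrier ∧ z.2.1 = k ∧
      ‖z.1 - x‖ ≤ (1 / 2 : ℝ) ^ l)).length - f k x| ≤ _
  rw [hfil]
  set F := D.filter (fun z => z.1 ∈ B.carrier ∧ z.2.1 = k) with hF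
  have h1 := sum_obs_sub_le F (f k) (f k x) (C * (2 : ℝ) ^ (-(β * l))) fun z hz => by
    rw [hF, List.mem_filter, decide_eq_true_eq] at hz
    rw [← hl]
    exact hf.sub_le_of_mem hβ hC hz.2.1 hloc.2
  have hp : (0 : ℝ) < F.length := by exact_mod_cast hpos
  rw [div_sub' hp.ne', abs_div, abs_of_pos hp, div_le_iff₀ hp]
  rw [abs_le] at *
  constructor <;> linarith [h1.1, h1.2, hdev.1, hdev.2]

theorem gridPoint_mem {l : ℕ} (j : Fin d → Fin (2 ^ l + 1)) : gridPoint j ∈ cube d := by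
  have h := half_pow_pos l
  constructor <;> intro i
  · simp only [gridPoint, Pi.zero_apply]; positivity
  · simp only [gridPoint, Pi.one_apply]
    have h1 : ((j i : ℕ) : ℝ) ≤ 2 ^ l := by
      have := (j i).2
      have h2 : (j i : ℕ) ≤ 2 ^ l := by omega
      exact_mod_cast h2
    rw [half_pow_eq]
    have : (0 : ℝ) < 2 ^ l := by positivity
    rw [← div_eq_mul_inv, div_le_one this]
    exact h1

/-- Points of a bin are close to grid points in its interior. -/
theorem exists_gridPoint {l l' : ℕ} (hl : l < l') {B : Bin d} (hB : B ∈ binsAt d l) {u : Cov d}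
    (hu : u ∈ B.carrier) : ∃ j : Fin d → Fin (2 ^ l' + 1), gridPoint j ∈ B.carrier ∧
      locate (binsAt d l) (gridPoint j) = B ∧ ‖gridPoint j - u‖ ≤ 2 * (1 / 2) ^ l' := by
  obtain ⟨l₁, q⟩ := B
  obtain rfl : l₁ = l := mem_binsAt.1 hB
  obtain ⟨m, rfl⟩ := Nat.exists_eq_add_of_lt hl
  have hM : 2 ≤ 2 ^ (m + 1) := by rw [pow_succ]; have := Nat.one_le_two_pow (n := m); omega
  set h : ℝ := (1 / 2) ^ (l₁ + m + 1) with hh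
  have hpos : 0 < h := half_pow_pos _
  have hs : (1 / 2 : ℝ) ^ l₁ = (2 ^ (m + 1) : ℕ) * h := by
    have h1 : ((2 : ℝ) ^ (m + 1)) * (1 / 2) ^ (m + 1) = 1 := by rw [← mul_pow]; norm_num
    rw [hh, add_assoc, pow_add (1 / 2 : ℝ) _ (m + 1)]
    push_cast
    linear_combination (-(1 / 2 : ℝ) ^ l₁) * h1
  have key : ∀ i, ∃ j : ℕ, (q i : ℕ) * 2 ^ (m + 1) + 1 ≤ j ∧
      j + 1 ≤ ((q i : ℕ) + 1) * 2 ^ (m + 1) ∧ |(j : ℝ) * h - u i| ≤ 2 * h := by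
    intro i
    have hui : ((q i : ℕ) : ℝ) * (1 / 2) ^ l₁ ≤ u i ∧ u i ≤ (((q i : ℕ) : ℝ) + 1) * (1 / 2) ^ l₁ :=
      hu i
    rw [hs] at hui
    set A : ℕ := (q i : ℕ)
    set M : ℕ := 2 ^ (m + 1)
    set j₀ := ⌊u i / h⌋₊ with hj₀
    have hui0 : 0 ≤ u i / h := by
      refine div_nonneg (le_trans ?_ hui.1) hpos.le
      positivity
    have f1 := Nat.floor_le hui0
    have f2 := Nat.lt_floor_add_one (u i / h)
    have e1 : ((A * M : ℕ) : ℝ) ≤ u i / h := by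
      rw [le_div_iff₀ hpos]; push_cast; linarith [hui.1]
    have e2 : u i / h ≤ (((A + 1) * M : ℕ) : ℝ) := by
      rw [div_le_iff₀ hpos]; push_cast; linarith [hui.2]
    have g1 : A * M ≤ j₀ := Nat.le_floor e1
    have g2 : j₀ ≤ (A + 1) * M := by
      have := f1.trans e2
      exact_mod_cast this
    have hAM : (A + 1) * M = A * M + M := by ring
    -- Moving the lower grid index by at most one puts it strictly inside the bin, which is possible
    -- as `M ≥ 2`; at an interior point `locate` has no choice.
    obtain ⟨j, h1, h2, h3, h4⟩ : ∃ j : ℕ, A * M + 1 ≤ j ∧ j + 1 ≤ (A + 1) * M ∧ j ≤ j₀ + 1 ∧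
        j₀ ≤ j + 1 := by
      refine ⟨max (A * M + 1) (min j₀ ((A + 1) * M - 1)), ?_, ?_, ?_, ?_⟩ <;> omega
    refine ⟨j, h1, h2, ?_⟩
    have h3' : (j : ℝ) ≤ j₀ + 1 := by exact_mod_cast h3
    have h4' : (j₀ : ℝ) ≤ j + 1 := by exact_mod_cast h4
    have hu' : u i = u i / h * h := by field_simp
    rw [hu', ← sub_mul, abs_mul, abs_of_pos hpos]
    refine mul_le_mul_of_nonneg_right ?_ hpos.le
    rw [abs_le]
    constructor <;> linarith
  choose j hj1 hj2 hj3 using key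
  have hjlt : ∀ i, j i < 2 ^ (l₁ + m + 1) + 1 := by
    intro i
    have h1 : (q i : ℕ) + 1 ≤ 2 ^ l₁ := (q i).2
    have h2 : ((q i : ℕ) + 1) * 2 ^ (m + 1) ≤ 2 ^ l₁ * 2 ^ (m + 1) := Nat.mul_le_mul_right _ h1
    rw [← pow_add, ← add_assoc] at h2
    have := hj2 i
    omega
  have hstrict : ∀ i, ((q i : ℕ) : ℝ) * (1 / 2) ^ l₁ < (j i : ℝ) * h ∧
      (j i : ℝ) * h < (((q i : ℕ) : ℝ) + 1) * (1 / 2) ^ l₁ := by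
    intro i
    have h1 : (((q i : ℕ) * 2 ^ (m + 1) + 1 : ℕ) : ℝ) ≤ j i := by exact_mod_cast hj1 i
    have h2 : ((j i + 1 : ℕ) : ℝ) ≤ (((q i : ℕ) + 1) * 2 ^ (m + 1) : ℕ) := by
      exact_mod_cast hj2 i
    rw [hs]
    push_cast at h1 h2 ⊢
    constructor <;> nlinarith
  refine ⟨fun i => ⟨j i, hjlt i⟩, ?_, ?_, ?_⟩
  · exact fun i => ⟨(hstrict i).1.le, (hstrict i).2.le⟩
  · refine locate_eq hB (fun i => ⟨(hstrict i).1.le, (hstrict i).2.le⟩) fun B' hB' hx => ?_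
    obtain ⟨l₂, k₂⟩ := B'
    obtain rfl : l₂ = l₁ := mem_binsAt.1 hB'
    congr 1
    funext i
    have h1 := hstrict i
    have h2 := hx i
    have hp := half_pow_pos l₂
    simp only [gridPoint] at h2
    change (k₂ i : ℝ) * (1 / 2) ^ l₂ ≤ (j i : ℝ) * h ∧
      (j i : ℝ) * h ≤ ((k₂ i : ℝ) + 1) * (1 / 2) ^ l₂ at h2
    have e1 : ((q i : ℕ) : ℝ) < ((k₂ i : ℕ) : ℝ) + 1 :=
      lt_of_mul_lt_mul_right (h1.1.trans_le h2.2) hp.le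
    have e2 : ((k₂ i : ℕ) : ℝ) < ((q i : ℕ) : ℝ) + 1 :=
      lt_of_mul_lt_mul_right (h2.1.trans_lt h1.2) hp.le
    have e1' : (q i : ℕ) < (k₂ i : ℕ) + 1 := by exact_mod_cast e1
    have e2' : (k₂ i : ℕ) < (q i : ℕ) + 1 := by exact_mod_cast e2
    exact Fin.ext (by omega)
  · rw [pi_norm_le_iff_of_nonneg (by positivity)]
    intro i
    rw [Real.norm_eq_abs]
    exact hj3 i

/-- Bounds for the maximal difference of the estimates. -/
theorem maxDiff_bounds {θ : Tuning} {nQ nP : ℕ} {D : List (Obs d K)} {f : Fin K → Cov d → ℝ}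
    {β C e r : ℝ} (hβ : 0 < β) (hβ1 : β ≤ 1) (hC : 0 ≤ C) (hK : 0 < K) (hf : ∀ k, IsHolder β C (f k))
    (h1 : Accurate D f (level₁ θ d nQ nP) e) (h2 : Accurate D f (level₂ θ d nQ nP) e)
    (h13 : level₁ θ d nQ nP < level₃ θ d nQ nP)
    (h12 : level₁ θ d nQ nP ≤ level₂ θ d nQ nP)
    (hosc : ∃ k, ∃ B ∈ binsAt d (level₁ θ d nQ nP), ∃ u ∈ B.carrier, ∃ x ∈ B.carrier,
      r < f k u - f k x)
    (hr : 2 * e + 2 * (C * (2 : ℝ) ^ (-(β * level₂ θ d nQ nP))) +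
      4 * (C * (2 : ℝ) ^ (-(β * level₃ θ d nQ nP))) ≤ r / 2) :
    r / 4 ≤ maxDiff θ nQ nP D ∧
      maxDiff θ nQ nP D ≤ 2 * e + 2 * (C * (2 : ℝ) ^ (-(β * level₁ θ d nQ nP))) := by
  have : Nonempty (Fin K) := ⟨⟨0, hK⟩⟩
  unfold maxDiff
  set l₁ := level₁ θ d nQ nP
  set l₂ := level₂ θ d nQ nP
  set l₃ := level₃ θ d nQ nP
  constructor
  · obtain ⟨k, B, hB, u, hu, x, hx, hlt⟩ := hosc
    obtain ⟨j, hj1, hj2, hj3⟩ := exists_gridPoint h13 hB hu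
    obtain ⟨j', hj1', hj2', hj3'⟩ := exists_gridPoint h13 hB hx
    have hh : ∀ (j : Fin d → Fin (2 ^ l₃ + 1)) (u : Cov d), u ∈ cube d →
        ‖gridPoint j - u‖ ≤ 2 * (1 / 2) ^ l₃ →
        |f k (gridPoint j) - f k u| ≤ 2 * (C * (2 : ℝ) ^ (-(β * l₃))) := by
      intro j u hu hju
      refine (hf k _ (gridPoint_mem j) u hu).trans ?_
      have e1 : ‖gridPoint j - u‖ ^ β ≤ (2 * (1 / 2 : ℝ) ^ l₃) ^ β :=
        Real.rpow_le_rpow (norm_nonneg _) hju hβ.le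
      have e2 : (2 * (1 / 2 : ℝ) ^ l₃) ^ β ≤ 2 * (2 : ℝ) ^ (-(β * l₃)) := by
        rw [Real.mul_rpow (by norm_num) (by positivity)]
        have e3 : ((1 / 2 : ℝ) ^ l₃) ^ β = (2 : ℝ) ^ (-(β * l₃)) := by
          rw [one_div, inv_pow, ← Real.rpow_natCast, ← Real.rpow_neg (by norm_num),
            ← Real.rpow_mul (by norm_num)]
          congr 1; ring
        rw [e3]
        have e4 : (2 : ℝ) ^ β ≤ 2 ^ (1 : ℝ) := Real.rpow_le_rpow_of_exponent_le (by norm_num) hβ1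
        rw [Real.rpow_one] at e4
        gcongr
      have := mul_le_mul_of_nonneg_left (e1.trans e2) hC
      linarith
    have g1 := hh j u (B.carrier_subset_cube hu) hj3
    have g2 := hh j' x (B.carrier_subset_cube hx) hj3'
    have a1 := h2.localEstimate_sub_le hβ hC (hf k) (gridPoint_mem j)
    have a2 := h2.localEstimate_sub_le hβ hC (hf k) (gridPoint_mem j')
    -- The coarse estimates at the two grid points coincide, while the fine ones follow `f` and
    -- differ by at least `r / 2`; so one of them is at least `r / 4` away from the coarse value.
    have hsame : localEstimate D l₁ k (gridPoint j) = localEstimate D l₁ k (gridPoint j') := by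
      unfold localEstimate
      rw [hj2, hj2']
      have hfil : ∀ y ∈ B.carrier, D.filter (fun z => z.1 ∈ B.carrier ∧ z.2.1 = k ∧
          ‖z.1 - y‖ ≤ (1 / 2 : ℝ) ^ l₁) = D.filter (fun z => z.1 ∈ B.carrier ∧ z.2.1 = k) := by
        intro y hy
        refine List.filter_congr fun z _ => ?_
        rw [decide_eq_decide]
        refine ⟨fun hz => ⟨hz.1, hz.2.1⟩, fun hz => ⟨hz.1, hz.2, ?_⟩⟩
        have := Bin.dist_le hz.1 hy
        unfold Bin.side at this
        rwa [mem_binsAt.1 hB] at this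
      rw [hfil _ hj1, hfil _ hj1']
    have b1 := le_ciSup (f := fun p : Fin K × (Fin d → Fin (2 ^ l₃ + 1)) =>
      |localEstimate D l₁ p.1 (gridPoint p.2) - localEstimate D l₂ p.1 (gridPoint p.2)|)
      (Set.finite_range _).bddAbove (k, j)
    have b2 := le_ciSup (f := fun p : Fin K × (Fin d → Fin (2 ^ l₃ + 1)) =>
      |localEstimate D l₁ p.1 (gridPoint p.2) - localEstimate D l₂ p.1 (gridPoint p.2)|)
      (Set.finite_range _).bddAbove (k, j')
    simp only [hsame] at b1 b2
    rw [abs_le] at g1 g2 a1 a2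
    have b1' := (le_abs_self _).trans ((abs_sub_comm _ _).le.trans b1)
    have b2' := (le_abs_self _).trans b2
    linarith [g1.1, g2.2, a1.1, a2.2]
  · refine ciSup_le fun p => ?_
    have a1 := h1.localEstimate_sub_le hβ hC (hf p.1) (gridPoint_mem p.2)
    have a2 := h2.localEstimate_sub_le hβ hC (hf p.1) (gridPoint_mem p.2)
    have h3 : (2 : ℝ) ^ (-(β * l₂)) ≤ (2 : ℝ) ^ (-(β * l₁)) := by
      refine Real.rpow_le_rpow_of_exponent_le (by norm_num) ?_
      have : (l₁ : ℝ) ≤ l₂ := by exact_mod_cast h12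
      nlinarith
    have h4 := mul_le_mul_of_nonneg_left h3 hC
    rw [abs_le] at *
    constructor <;> linarith [a1.1, a1.2, a2.1, a2.2]

/-- On the logarithmic scale the two constants become errors of order `1 / l₁`. The subtracted `log
log n / log n` outweighs the upward error, so the estimate errs only downward. Truncation to an
interval containing `β` preserves both bounds. -/
theorem smoothnessEstimate_bounds {θ : Tuning} {nQ nP : ℕ} {D : List (Obs d K)} {β c C : ℝ}
    (hβ : β ∈ Set.Icc θ.βlo θ.βhi) (hc : 0 < c)
    (hl : 0 < level₁ θ d nQ nP)
    (h1 : c * (2 : ℝ) ^ (-(β * level₁ θ d nQ nP)) ≤ maxDiff θ nQ nP D)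
    (h2 : maxDiff θ nQ nP D ≤ C * (2 : ℝ) ^ (-(β * level₁ θ d nQ nP)))
    (h3 : -Real.logb 2 c / level₁ θ d nQ nP ≤
      Real.logb 2 (Real.log (nMax nQ nP)) / Real.logb 2 (nMax nQ nP)) (hC1 : 1 ≤ C)
    (h4 : 0 ≤ Real.logb 2 (Real.log (nMax nQ nP)) / Real.logb 2 (nMax nQ nP)) :
    smoothnessEstimate θ nQ nP D ≤ β ∧ θ.βlo ≤ smoothnessEstimate θ nQ nP D ∧
      β - (Real.logb 2 C / level₁ θ d nQ nP +
        Real.logb 2 (Real.log (nMax nQ nP)) / Real.logb 2 (nMax nQ nP)) ≤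
          smoothnessEstimate θ nQ nP D := by
  set l : ℝ := ((level₁ θ d nQ nP : ℕ) : ℝ)
  have hl0 : 0 < l := Nat.cast_pos.2 hl
  set m := maxDiff θ nQ nP D
  have hp : (0 : ℝ) < (2 : ℝ) ^ (-(β * l)) := by positivity
  have hm : 0 < m := lt_of_lt_of_le (by positivity) h1
  have hC : 0 < C := by linarith
  have e1 := Real.logb_le_logb_of_le (b := 2) (by norm_num) (by positivity) h1
  have e2 := Real.logb_le_logb_of_le (b := 2) (by norm_num) hm h2
  rw [Real.logb_mul hc.ne' hp.ne', Real.logb_rpow (by norm_num) (by norm_num)] at e1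
  rw [Real.logb_mul hC.ne' hp.ne', Real.logb_rpow (by norm_num) (by norm_num)] at e2
  unfold smoothnessEstimate
  rw [if_neg hm.ne']
  set q := Real.logb 2 (Real.log (nMax nQ nP)) / Real.logb 2 (nMax nQ nP)
  have e3 : -(Real.logb 2 m / l) ≤ β + -Real.logb 2 c / l := by
    rw [← neg_div, div_le_iff₀ hl0, add_mul, div_mul_cancel₀ _ hl0.ne']
    linarith
  have e4 : β - Real.logb 2 C / l ≤ -(Real.logb 2 m / l) := by
    rw [← neg_div, le_div_iff₀ hl0, sub_mul, div_mul_cancel₀ _ hl0.ne']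
    linarith
  refine ⟨min_le_of_left_le (max_le hβ.1 (by linarith)), le_min (le_max_left _ _)
    (hβ.1.trans hβ.2), ?_⟩
  have e5 : 0 ≤ Real.logb 2 C / l := div_nonneg (Real.logb_nonneg (by norm_num) hC1) hl0.le
  refine le_min (le_max_of_le_right (by linarith)) ?_
  linarith [hβ.2, h4]

end Smoothness

/-! ### Good events for the data -/

section Data

variable {d K : ℕ}

theorem sum_filter_map_list {l : List ℕ} (hl : l.Nodup) (o : ℕ → Obs d K) (p : Obs d K → Prop)
    [DecidablePred p] (g : Obs d K → ℝ) :
    (((l.map o).filter (fun z => decide (p z))).map g).sum =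
      ∑ i ∈ l.toFinset.filter (fun i => p (o i)), g (o i) := by
  rw [Finset.sum_filter, List.sum_toFinset _ hl]
  clear hl
  induction l with
  | nil => rfl
  | cons a l ih =>
    rw [List.map_cons, List.filter_cons, List.map_cons, List.sum_cons, ← ih]
    by_cases h : p (o a)
    · simp only [h, decide_true, if_true, List.map_cons, List.sum_cons]
    · simp only [h, decide_false, if_false, Bool.false_eq_true, zero_add]

theorem length_filter_map_list {l : List ℕ} (hl : l.Nodup) (o : ℕ → Obs d K) (p : Obs d K → Prop)
    [DecidablePred p] :
    ((l.map o).filter (fun z => decide (p z))).length =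
      (l.toFinset.filter (fun i => p (o i))).card := by
  have h := sum_filter_map_list hl o p (fun _ => 1)
  simp only [List.map_const', List.sum_replicate, mul_one, Finset.sum_const, nsmul_eq_mul] at h
  exact_mod_cast h

theorem toFinset_drop_range (n s : ℕ) : ((List.range n).drop s).toFinset = Finset.Ico s n := by
  ext i
  rw [List.mem_toFinset, List.mem_iff_getElem, Finset.mem_Ico]
  constructor
  · rintro ⟨j, hj, rfl⟩
    simp only [List.length_drop, List.length_range] at hj
    simp only [List.getElem_drop, List.getElem_range]
    omega
  · rintro ⟨h1, h2⟩
    refine ⟨i - s, by simp only [List.length_drop, List.length_range]; omega, ?_⟩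
    simp only [List.getElem_drop, List.getElem_range]
    omega

variable {Ω : Type*} {φ : Ω → Obs d K} {f : Fin K → Cov d → ℝ}

theorem drop_obsList (n s : ℕ) (u : ℕ → Ω) :
    (obsList φ n u).drop s = ((List.range n).drop s).map (fun i => φ (u i)) := by
  unfold obsList; rw [List.map_drop]

theorem take_obsList {n s : ℕ} (h : s ≤ n) (u : ℕ → Ω) :
    (obsList φ n u).take s = obsList φ s u := by
  unfold obsList
  rw [← List.map_take, List.take_range, min_eq_left h]

variable {S : Stage d K} {n s : ℕ} {u : ℕ → Ω}

theorem Stage.count_eq (hD : S.D = (obsList φ n u).drop s) (B : Bin d) (k : Fin K) :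
    S.count B k = (hits (Finset.Ico s n) (fun i => φ (u i)) B k).card := by
  unfold Stage.count Stage.obsIn hits
  rw [hD, drop_obsList, ← toFinset_drop_range]
  exact length_filter_map_list (List.nodup_range.sublist (List.drop_sublist _ _)) _
    (fun z => z.1 ∈ B.carrier ∧ z.2.1 = k)

theorem Stage.srcDev_eq (hD : S.D = (obsList φ n u).drop s) (B : Bin d) (k : Fin K) :
    S.srcDev f B k = dev (Finset.Ico s n) f (fun i => φ (u i)) B k := by
  unfold Stage.srcDev Stage.obsIn dev hits
  rw [hD, drop_obsList, ← toFinset_drop_range]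
  exact sum_filter_map_list (List.nodup_range.sublist (List.drop_sublist _ _)) _
    (fun z => z.1 ∈ B.carrier ∧ z.2.1 = k) (fun z => z.2.2 - f k z.1)

theorem ofReal_mul_natCast_eq {c : ℝ} (m : ℕ) :
    ENNReal.ofReal c * (m : ENNReal) = ENNReal.ofReal (c * m) := by
  rw [ENNReal.ofReal_mul' (Nat.cast_nonneg m), ENNReal.ofReal_natCast]

/-- The initial exponential potentials as a function of the data. -/
def initPot (I : Finset ℕ) (f : Fin K → Cov d → ℝ) (lams : ℕ → ℝ) (L M : ℕ) (o : ℕ → Obs d K) :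
    ENNReal :=
  ∑ m ∈ Finset.Icc 1 M, ∑ l ∈ Finset.range (L + 1), ∑ B ∈ binsAt d l, ∑ k,
    (expDev I f (lams m) o B k + expDev I f (-lams m) o B k)

theorem Stage.noisePot_zero (hD : S.D = (obsList φ n u).drop s) (lams : ℕ → ℝ) (L M : ℕ) :
    S.noisePot f lams L M (fun _ => 0) (fun _ => 0) 0 =
      initPot (Finset.Ico s n) f lams L M (fun i => φ (u i)) := by
  have h : ∀ lam m B k, S.pot f lam m B k (fun _ => 0) (fun _ => 0) 0 =
      expDev (Finset.Ico s n) f lam (fun i => φ (u i)) B k := by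
    intro lam m B k
    unfold expDev
    simp only [Stage.pot]
    rw [Stage.count_eq hD, Stage.srcDev_eq hD]
  unfold Stage.noisePot initPot
  simp only [h]

variable [MeasurableSpace Ω] {ν : Measure Ω} [IsProbabilityMeasure ν] {κ : ℝ}

theorem lintegral_initPot_le (hφ : Measurable φ) (hf : ∀ k, Measurable (f k))
    (hν : ObsLaw f κ (ν.map φ)) (I : Finset ℕ) (lams : ℕ → ℝ) (L M : ℕ) :
    ∫⁻ u, initPot I f lams L M (fun i => φ (u i)) ∂(Measure.infinitePi (fun _ : ℕ => ν)) ≤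
      ENNReal.ofReal (M * (L + 1) * (2 * K * I.card * 2 ^ d)) := by
  have := hν.prob
  have hm := fun (l : ℝ) (B : Bin d) (k : Fin K) => measurable_expDev hφ hf I l B k
  have hm1 : ∀ (m : ℕ) (B : Bin d) (k : Fin K), Measurable fun u : ℕ → Ω =>
      expDev I f (lams m) (fun i => φ (u i)) B k + expDev I f (-lams m) (fun i => φ (u i)) B k :=
    fun m B k => (hm _ B k).add (hm _ B k)
  unfold initPot
  rw [lintegral_finsetSum _ fun m _ => Finset.measurable_fun_sum _ fun l _ =>
    Finset.measurable_fun_sum _ fun B _ => Finset.measurable_fun_sum _ fun k _ => hm1 m B k]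
  have key : ∀ m ∈ Finset.Icc 1 M, ∫⁻ u, ∑ l ∈ Finset.range (L + 1), ∑ B ∈ binsAt d l, ∑ k,
      (expDev I f (lams m) (fun i => φ (u i)) B k + expDev I f (-lams m) (fun i => φ (u i)) B k)
        ∂(Measure.infinitePi (fun _ : ℕ => ν)) ≤ ENNReal.ofReal ((L + 1) * (2 * K * I.card * 2 ^ d)) := by
    intro m _
    rw [lintegral_finsetSum _ fun l _ => Finset.measurable_fun_sum _ fun B _ =>
      Finset.measurable_fun_sum _ fun k _ => hm1 m B k]
    have key2 : ∀ l ∈ Finset.range (L + 1), ∫⁻ u, ∑ B ∈ binsAt d l, ∑ k,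
        (expDev I f (lams m) (fun i => φ (u i)) B k + expDev I f (-lams m) (fun i => φ (u i)) B k)
        ∂(Measure.infinitePi (fun _ : ℕ => ν)) ≤ 2 * K * I.card * 2 ^ d := by
      intro l _
      rw [lintegral_finsetSum _ fun B _ => Finset.measurable_fun_sum _ fun k _ => hm1 m B k]
      calc _ ≤ ∑ B ∈ binsAt d l, 2 * K * I.card * (ν.map φ) {o | o.1 ∈ B.carrier} := by
            refine Finset.sum_le_sum fun B _ => ?_
            rw [lintegral_finsetSum _ fun k _ => hm1 m B k]
            calc _ ≤ ∑ _ : Fin K, 2 * (I.card * (ν.map φ) {o | o.1 ∈ B.carrier}) := by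
                  refine Finset.sum_le_sum fun k _ => ?_
                  rw [lintegral_add_left (hm _ B k), two_mul]
                  exact add_le_add (lintegral_expDev_le hφ hf hν I _ B k)
                    (lintegral_expDev_le hφ hf hν I _ B k)
              _ = _ := by
                  rw [Finset.sum_const, Finset.card_univ, Fintype.card_fin, nsmul_eq_mul]
                  ring
        _ ≤ _ := by
            rw [← Finset.mul_sum]
            gcongr
            exact sum_obsBin_le _ l
    refine (Finset.sum_le_sum key2).trans (le_of_eq ?_)
    rw [Finset.sum_const, Finset.card_range, nsmul_eq_mul]
    have : ((L + 1 : ℝ) * (2 * K * I.card * 2 ^ d)) = (((L + 1) * (2 * K * I.card * 2 ^ d) : ℕ) : ℝ) := by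
      push_cast; ring
    rw [this, ENNReal.ofReal_natCast]
    push_cast; ring
  refine (Finset.sum_le_sum key).trans (le_of_eq ?_)
  rw [Finset.sum_const, Nat.card_Icc, Nat.add_sub_cancel, nsmul_eq_mul, mul_comm,
    ofReal_mul_natCast_eq]
  congr 1; ring

theorem sum_prob_le {c : ℝ} (I : Finset ℕ) (ρ : Measure (Obs d K))
    [IsProbabilityMeasure ρ] (l : ℕ) :
    ∑ B ∈ binsAt d l, ∑ _ : Fin K, ENNReal.ofReal c * (I.card * ρ {o | o.1 ∈ B.carrier}) ≤
      ENNReal.ofReal (2 ^ d * K * I.card * c) := by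
  calc _ = ∑ B ∈ binsAt d l, K * ENNReal.ofReal c * I.card * ρ {o | o.1 ∈ B.carrier} := by
        refine Finset.sum_congr rfl fun B _ => ?_
        rw [Finset.sum_const, Finset.card_univ, Fintype.card_fin, nsmul_eq_mul]
        ring
    _ ≤ K * ENNReal.ofReal c * I.card * 2 ^ d := by
        rw [← Finset.mul_sum]
        gcongr
        exact sum_obsBin_le _ l
    _ = _ := by
        have h2 : (2 : ENNReal) ^ d = ENNReal.ofReal (2 ^ d) := by
          rw [ENNReal.ofReal_pow (by norm_num)]; norm_num
        rw [h2, ENNReal.ofReal_mul (by positivity), ENNReal.ofReal_mul (by positivity),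
          ENNReal.ofReal_mul (by positivity), ENNReal.ofReal_natCast, ENNReal.ofReal_natCast]
        ring

/-- All arms have many observations in all bins of level `l`. -/
theorem measure_exists_hits_le (hφ : Measurable φ) (hν : ObsLaw f κ (ν.map φ)) (hκ : 0 ≤ κ)
    (I : Finset ℕ) (l : ℕ) {q N : ℝ} (hq : ∀ B ∈ binsAt d l,
      ENNReal.ofReal q ≤ (ν.map φ) {o | o.1 ∈ B.carrier}) (hN : N ≤ I.card * (κ / K * q) / 4) :
    Measure.infinitePi (fun _ : ℕ => ν) {u | ∃ B ∈ binsAt d l, ∃ k : Fin K,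
        ((hits I (fun i => φ (u i)) B k).card : ℝ) ≤ N} ≤
      ENNReal.ofReal (2 ^ (l * d) * K * Real.exp (-N)) := by
  calc _ ≤ Measure.infinitePi (fun _ : ℕ => ν) (⋃ B ∈ binsAt d l, ⋃ k ∈ (Finset.univ : Finset (Fin K)),
        {u | ((hits I (fun i => φ (u i)) B k).card : ℝ) ≤ N}) := by
        refine measure_mono fun u hu => ?_
        obtain ⟨B, hB, k, hk⟩ := hu
        simp only [Set.mem_iUnion]
        exact ⟨B, hB, k, Finset.mem_univ k, hk⟩
    _ ≤ ∑ B ∈ binsAt d l, ∑ _ : Fin K, ENNReal.ofReal (Real.exp (-N)) := by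
        refine (measure_biUnion_finset_le _ _).trans (Finset.sum_le_sum fun B hB => ?_)
        refine (measure_biUnion_finset_le _ _).trans (Finset.sum_le_sum fun k _ => ?_)
        have hp : ENNReal.ofReal (κ / K * q) ≤ (ν.map φ) {o | o.1 ∈ B.carrier ∧ o.2.1 = k} := by
          rw [ENNReal.ofReal_mul (by positivity)]
          refine le_trans ?_ (hν.explore B k)
          gcongr
          exact hq B hB
        refine le_trans (measure_mono fun u hu => ?_) ((measure_hits_le hφ I B k hp).trans
          (ENNReal.ofReal_le_ofReal (Real.exp_le_exp.2 (neg_le_neg hN))))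
        exact le_trans hu hN
    _ = _ := by
        rw [Finset.sum_const, Finset.sum_const, Finset.card_univ, Fintype.card_fin, card_binsAt,
          smul_smul, nsmul_eq_mul, mul_comm, ofReal_mul_natCast_eq]
        congr 1; push_cast; ring

/-- Failure means that some arm has at most `N` observations in some bin, which is a binomial lower
tail, or that it has at least `N` and its mean deviates by more than `e`, which is Hoeffding's
bound. -/
theorem measure_not_accurate_le (hφ : Measurable φ) (hf : ∀ k, Measurable (f k))
    (hν : ObsLaw f κ (ν.map φ)) (hκ : 0 ≤ κ) (t l : ℕ) {q N e : ℝ} (hq : ∀ B ∈ binsAt d l,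
      ENNReal.ofReal q ≤ (ν.map φ) {o | o.1 ∈ B.carrier}) (hN : N ≤ t * (κ / K * q) / 4)
    (hN0 : 0 < N) (he : 0 ≤ e) :
    Measure.infinitePi (fun _ : ℕ => ν) {u | ¬ Accurate (obsList φ t u) f l e} ≤
      ENNReal.ofReal (2 ^ (l * d) * K * Real.exp (-N) +
        2 ^ d * K * t * (2 * Real.exp (-(2 * e ^ 2 * N)))) := by
  have := hν.prob
  have hcard : (Finset.range t).card = t := Finset.card_range t
  calc _ ≤ Measure.infinitePi (fun _ : ℕ => ν) ({u | ∃ B ∈ binsAt d l, ∃ k : Fin K,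
        ((hits (Finset.range t) (fun i => φ (u i)) B k).card : ℝ) ≤ N} ∪
        ⋃ B ∈ binsAt d l, ⋃ k ∈ (Finset.univ : Finset (Fin K)),
          {u | N ≤ (hits (Finset.range t) (fun i => φ (u i)) B k).card ∧
            (hits (Finset.range t) (fun i => φ (u i)) B k).card * e <
              |dev (Finset.range t) f (fun i => φ (u i)) B k|}) := by
        refine measure_mono fun u hu => ?_
        by_contra hcon
        refine hu fun B hB k => ?_
        simp only [Set.mem_union, not_or, Set.mem_iUnion, not_exists, Set.mem_ofPred_eq,
          Finset.mem_univ] at hcon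
        obtain ⟨h1, h2⟩ := hcon
        have h1 := h1 B
        push Not at h1
        have h1 := h1 hB k
        have h2 := h2 B hB k trivial
        have hr : List.range t = (List.range t).drop 0 := rfl
        have hI : (List.range t).toFinset = Finset.range t := List.toFinset_range t
        have e1 := length_filter_map_list (List.nodup_range (n := t)) (fun i => φ (u i))
          (fun z => z.1 ∈ B.carrier ∧ z.2.1 = k)
        have e2 := sum_filter_map_list (List.nodup_range (n := t)) (fun i => φ (u i))
          (fun z => z.1 ∈ B.carrier ∧ z.2.1 = k) (fun z => z.2.2 - f k z.1)
        rw [hI] at e1 e2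
        change _ = (hits (Finset.range t) (fun i => φ (u i)) B k).card at e1
        change _ = dev (Finset.range t) f (fun i => φ (u i)) B k at e2
        unfold obsList
        simp only
        rw [e1, e2]
        refine ⟨?_, not_lt.1 fun hlt => h2 ⟨h1.le, hlt⟩⟩
        have : (0 : ℝ) < (hits (Finset.range t) (fun i => φ (u i)) B k).card := hN0.trans h1
        exact_mod_cast this
    _ ≤ _ := measure_union_le _ _
    _ ≤ ENNReal.ofReal (2 ^ (l * d) * K * Real.exp (-N)) +
        ENNReal.ofReal (2 ^ d * K * t * (2 * Real.exp (-(2 * e ^ 2 * N)))) := by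
        refine add_le_add (measure_exists_hits_le hφ hν hκ _ l hq (by rwa [hcard])) ?_
        refine (measure_biUnion_finset_le _ _).trans ?_
        have h3 := sum_prob_le (c := 2 * Real.exp (-(2 * e ^ 2 * N))) (Finset.range t) (ν.map φ) l
        rw [hcard] at h3
        refine le_trans (Finset.sum_le_sum fun B _ => ?_) h3
        refine (measure_biUnion_finset_le _ _).trans (Finset.sum_le_sum fun k _ => ?_)
        have := measure_dev_gt_le hφ hf hν (Finset.range t) hN0 he B k
        rwa [hcard] at this
    _ = _ := (ENNReal.ofReal_add (by positivity) (by positivity)).symm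

theorem measure_unbalanced_le (hφ : Measurable φ) (hν : ObsLaw f κ (ν.map φ)) (hκ : 0 ≤ κ)
    (I : Finset ℕ) (L : ℕ) {N : ℝ} (hN : 0 < N) :
    Measure.infinitePi (fun _ : ℕ => ν) {u | ∃ B : Bin d, B.1 ≤ L ∧ ∃ k : Fin K,
        N ≤ (hitsBin I (fun i => φ (u i)) B).card ∧
        ((hits I (fun i => φ (u i)) B k).card : ℝ) <
          κ / (4 * K) * (hitsBin I (fun i => φ (u i)) B).card} ≤
      ENNReal.ofReal ((L + 1) * (2 ^ d * K * I.card * Real.exp (-(κ / (4 * K) * N)))) := by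
  have := hν.prob
  calc _ ≤ Measure.infinitePi (fun _ : ℕ => ν) (⋃ l ∈ Finset.range (L + 1), ⋃ B ∈ binsAt d l,
        ⋃ k ∈ (Finset.univ : Finset (Fin K)),
        {u | N ≤ (hitsBin I (fun i => φ (u i)) B).card ∧
        ((hits I (fun i => φ (u i)) B k).card : ℝ) <
          κ / (4 * K) * (hitsBin I (fun i => φ (u i)) B).card}) := by
        refine measure_mono fun u hu => ?_
        obtain ⟨B, hB, k, hk⟩ := hu
        simp only [Set.mem_iUnion]
        exact ⟨B.1, Finset.mem_range.2 (by omega), B, mem_binsAt.2 rfl, k, Finset.mem_univ k, hk⟩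
    _ ≤ ∑ l ∈ Finset.range (L + 1),
        ENNReal.ofReal (2 ^ d * K * I.card * Real.exp (-(κ / (4 * K) * N))) := by
        refine (measure_biUnion_finset_le _ _).trans (Finset.sum_le_sum fun l _ => ?_)
        refine (measure_biUnion_finset_le _ _).trans ?_
        refine le_trans (Finset.sum_le_sum fun B _ => ?_)
          (sum_prob_le I (ν.map φ) l)
        refine (measure_biUnion_finset_le _ _).trans (Finset.sum_le_sum fun k _ => ?_)
        exact measure_ratio_le hφ hν hκ I hN B k
    _ = _ := by
        rw [Finset.sum_const, Finset.card_range, nsmul_eq_mul, mul_comm, ofReal_mul_natCast_eq]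
        congr 1; push_cast; ring

end Data

/-! ### Masses of bins and of regions with a small gap -/

section Regularity

variable {d K : ℕ}

theorem Bin.side_rpow (B : Bin d) (β : ℝ) : B.side ^ β = (2 : ℝ) ^ (-(β * B.1)) := by
  unfold Bin.side
  rw [one_div, inv_pow, ← Real.rpow_natCast, ← Real.rpow_neg (by norm_num), ← Real.rpow_mul
    (by norm_num)]
  congr 1; ring

theorem Bin.half_side_rpow (B : Bin d) (a : ℝ) :
    (B.side / 2) ^ a = (2 : ℝ) ^ (-a) * (2 : ℝ) ^ (-(B.1 * a)) := by
  rw [Real.div_rpow B.side_pos.le (by norm_num), B.side_rpow, Real.rpow_neg (by norm_num) a,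
    div_eq_mul_inv, mul_comm, mul_comm a]

theorem BoundedDensity.measure_bin_ge {Q : Measure (Cov d)} {qlo qhi : ℝ}
    (h : BoundedDensity qlo qhi Q) (hs : cube d ⊆ Q.support) (B : Bin d) :
    qlo * (B.side / 2) ^ (d : ℝ) ≤ Q.real B.carrier := by
  have h1 := B.side_pos
  have h2 := B.side_le_one
  rw [B.carrier_eq_closedBall, Real.rpow_natCast]
  exact (h B.center (hs (B.carrier_subset_cube B.center_mem)) _ (by linarith) (by linarith)).1

theorem Transfer.measure_bin_ge {P Q : Measure (Cov d)} {qlo qhi γ γhi cγ : ℝ}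
    (ht : Transfer γ cγ P Q) (h : BoundedDensity qlo qhi Q) (hs : cube d ⊆ Q.support)
    (hc : 0 ≤ cγ) (hq : 0 ≤ qlo) (hγ : γ ≤ γhi) (B : Bin d) :
    cγ * qlo * (2 : ℝ) ^ (-(d + γhi)) * (2 : ℝ) ^ (-(B.1 * (d + γ))) ≤ P.real B.carrier := by
  have h1 := B.side_pos
  have h2 := B.side_le_one
  have e1 := ht B.center (hs (B.carrier_subset_cube B.center_mem)) (B.side / 2) (by linarith)
    (by linarith)
  rw [← B.carrier_eq_closedBall] at e1
  have e2 := h.measure_bin_ge hs B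
  have e3 : (2 : ℝ) ^ (-(d + γhi)) ≤ (2 : ℝ) ^ (-(d + γ)) :=
    Real.rpow_le_rpow_of_exponent_le (by norm_num) (by linarith)
  calc _ ≤ cγ * qlo * (2 : ℝ) ^ (-(d + γ)) * (2 : ℝ) ^ (-(B.1 * (d + γ))) := by gcongr
    _ = cγ * (B.side / 2) ^ γ * (qlo * (B.side / 2) ^ (d : ℝ)) := by
        rw [mul_assoc (cγ * qlo), ← B.half_side_rpow, Real.rpow_add (by linarith)]
        ring
    _ ≤ cγ * (B.side / 2) ^ γ * Q.real B.carrier := by gcongr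
    _ ≤ _ := e1

/-- The covariates at which some suboptimal arm has a gap of at most `w`. -/
def gapRegion (f : Fin K → Cov d → ℝ) (w : ℝ) : Set (Cov d) :=
  {x | ∃ k, 0 < fMax f x - f k x ∧ fMax f x - f k x ≤ w}

theorem measurableSet_gapRegion {f : Fin K → Cov d → ℝ} (hf : ∀ k, Measurable (f k)) (w : ℝ) :
    MeasurableSet (gapRegion f w) := by
  have hm : Measurable (fMax f) := Measurable.iSup hf
  have : gapRegion f w = ⋃ k, ({x | 0 < fMax f x - f k x} ∩ {x | fMax f x - f k x ≤ w}) := by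
    ext x; simp [gapRegion]
  rw [this]
  exact MeasurableSet.iUnion fun k => (measurableSet_lt measurable_const (hm.sub (hf k))).inter
    (measurableSet_le (hm.sub (hf k)) measurable_const)

/-- If some arm has a positive gap, the second largest value is at least the value of that arm, so
the margin quantity is positive and no larger than its gap. For `w > 1` the bound is trivial, which
is why the constant is made at least one. -/
theorem Margin.gapRegion_le {α Cα : ℝ} {f g : Fin K → Cov d → ℝ} {Q : Measure (Cov d)}
    [IsProbabilityMeasure Q] (h : Margin α Cα g Q) (hcube : Q (cube d)ᶜ = 0)
    (hfg : ∀ k, ∀ x ∈ cube d, f k x = g k x) (hα : 0 ≤ α) {w : ℝ} (hw : 0 < w) :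
    Q.real (gapRegion f w) ≤ max Cα 1 * w ^ α := by
  rcases le_or_gt w 1 with hw1 | hw1
  · have h1 : Q (gapRegion f w) ≤
        Q {x | 0 < fMax g x - fSecond g x ∧ fMax g x - fSecond g x ≤ w} := by
      refine measure_mono_ae ?_
      have hc : ∀ᵐ x ∂Q, x ∈ cube d := by rw [ae_iff]; exact hcube
      filter_upwards [hc] with x hx
      rintro ⟨k, hk0, hkw⟩
      have hmax : fMax f x = fMax g x := by
        unfold fMax; exact iSup_congr fun k => hfg k x hx
      rw [hmax, hfg k x hx] at hk0 hkw
      have hne : (Finset.univ.filter (fun k => g k x < fMax g x)).Nonempty :=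
        ⟨k, by rw [Finset.mem_filter]; exact ⟨Finset.mem_univ _, by linarith⟩⟩
      have hle : g k x ≤ fSecond g x := by
        unfold fSecond
        rw [dif_pos hne]
        exact Finset.le_sup' (fun k => g k x)
          (by rw [Finset.mem_filter]; exact ⟨Finset.mem_univ _, by linarith⟩)
      have hlt : fSecond g x < fMax g x := by
        unfold fSecond
        rw [dif_pos hne, Finset.sup'_lt_iff]
        intro j hj
        exact (Finset.mem_filter.1 hj).2
      exact ⟨by linarith, by linarith⟩
    refine (ENNReal.toReal_mono (measure_ne_top _ _) h1).trans ((h w hw hw1).trans ?_)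
    have := Real.rpow_nonneg hw.le α
    gcongr
    exact le_max_left _ _
  · refine measureReal_le_one.trans ?_
    have h1 := Real.one_le_rpow hw1.le hα
    have h2 := le_max_right Cα 1
    nlinarith

/-- The conditional probabilities of a region given the bins of a level. -/
theorem sum_rate_le {Q : Measure (Cov d)} [IsProbabilityMeasure Q] {qlo : ℝ} (hq : 0 < qlo)
    (h : ∀ B : Bin d, qlo * (B.side / 2) ^ (d : ℝ) ≤ Q.real B.carrier) (l : ℕ) (s : Set (Cov d)) :
    ∑ B ∈ binsAt d l, Q.real (s ∩ B.carrier) / Q.real B.carrier ≤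
      4 ^ d / qlo * (2 : ℝ) ^ ((l : ℝ) * d) * Q.real s := by
  have h1 : ∑ B ∈ binsAt d l, Q.real (s ∩ B.carrier) ≤ 2 ^ d * Q.real s := by
    have h2 := ENNReal.toReal_mono (ENNReal.mul_ne_top (by simp) (measure_ne_top _ _))
      (sum_measure_bins_le Q l (s := s))
    rw [ENNReal.toReal_sum (fun B _ => measure_ne_top _ _), ENNReal.toReal_mul] at h2
    simpa [Measure.real] using h2
  have h3 : ∀ B ∈ binsAt d l, Q.real (s ∩ B.carrier) / Q.real B.carrier ≤
      2 ^ d / qlo * (2 : ℝ) ^ ((l : ℝ) * d) * Q.real (s ∩ B.carrier) := by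
    intro B hB
    have h4 := h B
    rw [B.half_side_rpow, mem_binsAt.1 hB, Real.rpow_neg (by norm_num),
      Real.rpow_neg (by norm_num), Real.rpow_natCast] at h4
    have h5 : 0 < qlo * ((2 ^ d)⁻¹ * ((2 : ℝ) ^ ((l : ℝ) * d))⁻¹) := by positivity
    calc _ ≤ Q.real (s ∩ B.carrier) / (qlo * ((2 ^ d)⁻¹ * ((2 : ℝ) ^ ((l : ℝ) * d))⁻¹)) := by
          gcongr
      _ = _ := by field_simp
  refine (Finset.sum_le_sum h3).trans ?_
  rw [← Finset.mul_sum]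
  calc _ ≤ 2 ^ d / qlo * (2 : ℝ) ^ ((l : ℝ) * d) * (2 ^ d * Q.real s) := by gcongr
    _ = _ := by
        rw [show (4 : ℝ) = 2 * 2 by norm_num, mul_pow]; ring

end Regularity

/-! ### The accuracy of the first stage -/

section FirstStage

variable {d K : ℕ}

theorem lt_ceilStrict (a : ℝ) : a < ceilStrict a := by
  unfold ceilStrict; push_cast; exact Nat.lt_floor_add_one a

theorem ceilStrict_le {a : ℝ} (ha : 0 ≤ a) : (ceilStrict a : ℝ) ≤ a + 1 := by
  unfold ceilStrict; push_cast; linarith [Nat.floor_le ha]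

theorem half_le_floor {y : ℝ} (hy : 1 ≤ y) : y / 2 ≤ (⌊y⌋₊ : ℝ) := by
  have h1 := Nat.lt_floor_add_one y
  have h2 : (1 : ℝ) ≤ ⌊y⌋₊ := by exact_mod_cast Nat.le_floor (by simpa using hy)
  linarith

theorem two_rpow_logb {x : ℝ} (hx : 0 < x) : (2 : ℝ) ^ Real.logb 2 x = x :=
  Real.rpow_logb (by norm_num) (by norm_num) hx

theorem two_rpow_logb_mul {x : ℝ} (hx : 0 < x) (c : ℝ) : (2 : ℝ) ^ (Real.logb 2 x * c) = x ^ c := by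
  rw [Real.rpow_mul (by norm_num), two_rpow_logb hx]

variable {θ : Tuning} {nQ nP : ℕ}

/-- The exponent `d + 2 βhi + g` of the first stage. -/
def stageExp (θ : Tuning) (d nQ nP : ℕ) : ℝ := d + 2 * θ.βhi + gammaEff θ nQ nP

/-- The admissible tuning parameters. -/
structure Tuning.Valid (θ : Tuning) : Prop where
  lo_pos : 0 < θ.βlo
  lo_lt : θ.βlo < θ.βhi
  hi_le : θ.βhi ≤ 1
  γ_nonneg : 0 ≤ θ.γhi

theorem Tuning.Valid.gammaEff_nonneg (h : θ.Valid) : 0 ≤ gammaEff θ nQ nP := by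
  unfold gammaEff; split_ifs
  · exact h.γ_nonneg
  · exact le_rfl

theorem Tuning.Valid.hi_pos (h : θ.Valid) : 0 < θ.βhi := h.lo_pos.trans h.lo_lt

theorem Tuning.Valid.stageExp_pos (h : θ.Valid) : 0 < stageExp θ d nQ nP := by
  have := h.hi_pos
  have := h.gammaEff_nonneg (nQ := nQ) (nP := nP)
  unfold stageExp; positivity

theorem level₁_spec (h : θ.Valid) (hn : 1 ≤ nMax nQ nP) :
    θ.βlo * Real.logb 2 (nMax nQ nP) / stageExp θ d nQ nP ^ 2 < level₁ θ d nQ nP ∧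
      (level₁ θ d nQ nP : ℝ) ≤ θ.βlo * Real.logb 2 (nMax nQ nP) / stageExp θ d nQ nP ^ 2 + 1 := by
  have h1 := Real.logb_nonneg (b := 2) (by norm_num) hn
  have h2 := h.lo_pos
  exact ⟨lt_ceilStrict _, ceilStrict_le (by positivity)⟩

theorem level₂_spec (h : θ.Valid) (hΛ : 1 ≤ Real.log (nMax nQ nP)) :
    level₁ θ d nQ nP + θ.βlo⁻¹ * Real.logb 2 (Real.log (nMax nQ nP)) < level₂ θ d nQ nP ∧
      (level₂ θ d nQ nP : ℝ) ≤
        level₁ θ d nQ nP + θ.βlo⁻¹ * Real.logb 2 (Real.log (nMax nQ nP)) + 1 := by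
  have h1 := Real.logb_nonneg (b := 2) (by norm_num) hΛ
  have h2 := h.lo_pos
  exact ⟨lt_ceilStrict _, ceilStrict_le (by positivity)⟩

theorem level₃_spec (h : θ.Valid) :
    level₁ θ d nQ nP + θ.βlo⁻¹ * Real.logb 2 (Real.log (nMax nQ nP)) < level₃ θ d nQ nP := by
  refine lt_of_le_of_lt ?_ (lt_ceilStrict _)
  have h1 : 1 ≤ θ.βhi / θ.βlo := by rw [le_div_iff₀ h.lo_pos]; linarith [h.lo_lt]
  have h2 : (0 : ℝ) ≤ level₁ θ d nQ nP := Nat.cast_nonneg _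
  nlinarith

theorem level₁_pos : 0 < level₁ θ d nQ nP := Nat.succ_pos _

/-- The real number whose integer part is the number of samples of the first stage. -/
def sampleReal (θ : Tuning) (d nQ nP : ℕ) : ℝ :=
  nMax nQ nP ^ (θ.βlo / stageExp θ d nQ nP) *
    Real.log (nMax nQ nP) ^ ((d + θ.βhi + gammaEff θ nQ nP) / θ.βlo)

theorem sampleSize_spec (h : θ.Valid) (hn : 1 ≤ nMax nQ nP) (hΛ : 1 ≤ Real.log (nMax nQ nP)) :
    sampleReal θ d nQ nP / 2 ≤ sampleSize θ d nQ nP ∧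
      (sampleSize θ d nQ nP : ℝ) ≤ sampleReal θ d nQ nP := by
  have h1 := h.lo_pos
  have h2 := h.hi_pos
  have h3 := h.gammaEff_nonneg (nQ := nQ) (nP := nP)
  have h4 := h.stageExp_pos (d := d) (nQ := nQ) (nP := nP)
  have h5 : 1 ≤ sampleReal θ d nQ nP := by
    have e1 := Real.one_le_rpow hn (z := θ.βlo / stageExp θ d nQ nP) (by positivity)
    have e2 := Real.one_le_rpow hΛ (z := (d + θ.βhi + gammaEff θ nQ nP) / θ.βlo) (by positivity)
    exact one_le_mul_of_one_le_of_one_le e1 e2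
  exact ⟨half_le_floor h5, Nat.floor_le (zero_le_one.trans h5)⟩

/-- The number of observations per bin compensates the squared target precision. -/
theorem stage_one_count (h : θ.Valid) (hn : 1 ≤ nMax nQ nP) (hΛ : 1 ≤ Real.log (nMax nQ nP))
    {A c : ℝ} (hA : 0 ≤ A) :
    A / 2 * c ^ 2 * (2 : ℝ) ^ (-(2 * stageExp θ d nQ nP)) *
        Real.log (nMax nQ nP) ^ (θ.βhi / θ.βlo) ≤
      sampleSize θ d nQ nP * A * (2 : ℝ) ^ (-(level₂ θ d nQ nP * (d + gammaEff θ nQ nP))) *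
        (c * (2 : ℝ) ^ (-(θ.βhi * level₁ θ d nQ nP))) ^ 2 := by
  have h1 := h.lo_pos
  have h2 := h.hi_pos
  have h3 := h.gammaEff_nonneg (nQ := nQ) (nP := nP)
  have h4 := h.stageExp_pos (d := d) (nQ := nQ) (nP := nP)
  have hT := (sampleSize_spec (d := d) h hn hΛ).1
  have hl1 := (level₁_spec (d := d) h hn).2
  have hl2 := (level₂_spec (d := d) h hΛ).2
  have hn0 : 0 < nMax nQ nP := by linarith
  have hΛ0 : 0 < Real.log (nMax nQ nP) := by linarith
  unfold sampleReal at hT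
  rw [← two_rpow_logb_mul hn0, ← two_rpow_logb_mul hΛ0, ← Real.rpow_add (by norm_num)] at hT
  rw [← two_rpow_logb_mul hΛ0]
  set a := stageExp θ d nQ nP with ha
  set x := Real.logb 2 (nMax nQ nP)
  set lam := Real.logb 2 (Real.log (nMax nQ nP))
  set g := gammaEff θ nQ nP
  set l1 : ℝ := ((level₁ θ d nQ nP : ℕ) : ℝ)
  set l2 : ℝ := ((level₂ θ d nQ nP : ℕ) : ℝ)
  have hae : a = d + 2 * θ.βhi + g := rfl
  have hdg : 0 ≤ d + g := by positivity
  -- In exponents of two: `l₁ (d + g) + 2 βhi l₁ = l₁ a` is paid by the factor `n ^ (βlo / a)` of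
  -- the sample size, and `(l₂ - l₁) (d + g)` by a part of its power of `log n`. The power `βhi /
  -- βlo` of `log n` is left over; rounding up the levels costs at most `2 a`.
  have key : -(2 * a) + lam * (θ.βhi / θ.βlo) ≤
      x * (θ.βlo / a) + lam * ((d + θ.βhi + g) / θ.βlo) + -(l2 * (d + g)) +
        2 * -(θ.βhi * l1) := by
    have e1 : l2 * (d + g) ≤ (l1 + θ.βlo⁻¹ * lam + 1) * (d + g) :=
      mul_le_mul_of_nonneg_right hl2 hdg
    have e2 : l1 * a ≤ (θ.βlo * x / a ^ 2 + 1) * a := mul_le_mul_of_nonneg_right hl1 h4.le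
    have e3 : (θ.βlo * x / a ^ 2 + 1) * a = x * (θ.βlo / a) + a := by field_simp
    have e4 : lam * ((d + θ.βhi + g) / θ.βlo) =
        lam * (θ.βhi / θ.βlo) + θ.βlo⁻¹ * lam * (d + g) := by field_simp; ring
    have e5 : l1 * a = l1 * (d + g) + 2 * (θ.βhi * l1) := by rw [hae]; ring
    have e6 : d + g ≤ a := by rw [hae]; linarith
    rw [e3] at e2
    rw [e4]
    nlinarith
  calc A / 2 * c ^ 2 * (2 : ℝ) ^ (-(2 * a)) * (2 : ℝ) ^ (lam * (θ.βhi / θ.βlo))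
      = A / 2 * c ^ 2 * (2 : ℝ) ^ (-(2 * a) + lam * (θ.βhi / θ.βlo)) := by
        rw [Real.rpow_add (by norm_num)]; ring
    _ ≤ A / 2 * c ^ 2 * (2 : ℝ) ^ (x * (θ.βlo / a) + lam * ((d + θ.βhi + g) / θ.βlo) +
        -(l2 * (d + g)) + 2 * -(θ.βhi * l1)) := by
        gcongr
        norm_num
    _ = (2 : ℝ) ^ (x * (θ.βlo / a) + lam * ((d + θ.βhi + g) / θ.βlo)) / 2 * A *
        (2 : ℝ) ^ (-(l2 * (d + g))) * (c * (2 : ℝ) ^ (-(θ.βhi * l1))) ^ 2 := by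
        rw [Real.rpow_add (by norm_num), Real.rpow_add (by norm_num) _ (-(l2 * (d + g))),
          mul_comm (2 : ℝ) (-(θ.βhi * l1)), Real.rpow_mul (by norm_num) (-(θ.βhi * l1)) 2,
          show (2 : ℝ) = ((2 : ℕ) : ℝ) by norm_num, Real.rpow_natCast _ 2]
        ring
    _ ≤ _ := by gcongr

theorem exp_neg_le_inv_pow {n N : ℝ} (hn : 0 < n) (m : ℕ) (hN : m * Real.log n ≤ N) :
    Real.exp (-N) ≤ (n ^ m)⁻¹ := by
  rw [Real.exp_neg]
  refine inv_anti₀ (by positivity) ?_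
  rw [← Real.exp_log (pow_pos hn m), Real.log_pow]
  exact Real.exp_le_exp.2 hN

variable {Ω : Type*} [MeasurableSpace Ω] {φ : Ω → Obs d K} {f : Fin K → Cov d → ℝ}
  {ν : Measure Ω} [IsProbabilityMeasure ν] {κ : ℝ}

/-- The data of the first stage are accurate with high probability. -/
theorem measure_first_stage_le (hφ : Measurable φ) (hf : ∀ k, Measurable (f k))
    (hν : ObsLaw f κ (ν.map φ)) (hκ : 0 ≤ κ) (hκ1 : κ ≤ 1) (hK : 0 < K) (h : θ.Valid)
    (hn : 1 ≤ nMax nQ nP) (hΛ : 1 ≤ Real.log (nMax nQ nP))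
    (hT : (sampleSize θ d nQ nP : ℝ) ≤ nMax nQ nP) {c e₀ : ℝ} (hc : 0 ≤ c) (hc1 : c ≤ 1)
    (he : 0 ≤ e₀) (he1 : e₀ ≤ 1)
    (hmass : ∀ B : Bin d, ENNReal.ofReal (c * (2 : ℝ) ^ (-(B.1 * (d + gammaEff θ nQ nP)))) ≤
      (ν.map φ) {o | o.1 ∈ B.carrier})
    (hbig : 4 * Real.log (nMax nQ nP) ≤ κ * c / (4 * K) / 2 * e₀ ^ 2 *
      (2 : ℝ) ^ (-(2 * stageExp θ d nQ nP)) * Real.log (nMax nQ nP) ^ (θ.βhi / θ.βlo)) :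
    Measure.infinitePi (fun _ : ℕ => ν) {u | ¬ (
      Accurate (obsList φ (sampleSize θ d nQ nP) u) f (level₁ θ d nQ nP)
        (e₀ * (2 : ℝ) ^ (-(θ.βhi * level₁ θ d nQ nP))) ∧
      Accurate (obsList φ (sampleSize θ d nQ nP) u) f (level₂ θ d nQ nP)
        (e₀ * (2 : ℝ) ^ (-(θ.βhi * level₁ θ d nQ nP))))} ≤
      ENNReal.ofReal (2 ^ (d + 3) * K / nMax nQ nP ^ 3) := by
  have hcount := hbig.trans (stage_one_count (d := d) (c := e₀) h hn hΛ
    (by positivity : 0 ≤ κ * c / (4 * K)))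
  have hl12 : level₁ θ d nQ nP ≤ level₂ θ d nQ nP := by
    have h1 := (level₂_spec (d := d) h hΛ).1
    have h2 := Real.logb_nonneg (b := 2) (by norm_num) hΛ
    have h3 := h.lo_pos
    have : (level₁ θ d nQ nP : ℝ) < level₂ θ d nQ nP := lt_of_le_of_lt (by
      have : 0 ≤ θ.βlo⁻¹ * Real.logb 2 (Real.log (nMax nQ nP)) := by positivity
      linarith) h1
    exact_mod_cast this.le
  have hg := h.gammaEff_nonneg (nQ := nQ) (nP := nP)
  have hβ := h.hi_pos
  have hn0 : 0 < nMax nQ nP := by linarith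
  set n := nMax nQ nP
  set g := gammaEff θ nQ nP
  set T := sampleSize θ d nQ nP
  set l1 := level₁ θ d nQ nP
  set l2 := level₂ θ d nQ nP
  set e := e₀ * (2 : ℝ) ^ (-(θ.βhi * l1)) with hedef
  have he0 : 0 ≤ e := by positivity
  have hele : e ≤ 1 := by
    have : (2 : ℝ) ^ (-(θ.βhi * l1)) ≤ 1 :=
      Real.rpow_le_one_of_one_le_of_nonpos (by norm_num) (by
        have : 0 ≤ θ.βhi * l1 := by positivity
        linarith)
    calc e ≤ 1 * 1 := mul_le_mul he1 this (by positivity) (by norm_num)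
      _ = 1 := one_mul 1
  -- `N` is a quarter of the lower bound for the mean number of observations per arm and bin at the
  -- fine level. By `hbig`, `N * e ^ 2 ≥ 4 log n`, so both exponential factors below are at most `n
  -- ^ (-4)`.
  set N : ℝ := T * (κ * c / (4 * K)) * (2 : ℝ) ^ (-(l2 * (d + g))) with hN
  have hN0 : 0 ≤ N := by positivity
  have hesq : e ^ 2 ≤ 1 := pow_le_one₀ he0 hele
  have hN4 : 4 * Real.log n ≤ N := hcount.trans (by nlinarith)
  have hNpos : 0 < N := by linarith
  have hK0 : (0 : ℝ) < K := by exact_mod_cast hK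
  have hK1 : (1 : ℝ) ≤ K := by exact_mod_cast hK
  have hone : ∀ l ≤ l2, Measure.infinitePi (fun _ : ℕ => ν) {u | ¬ Accurate (obsList φ T u) f l e} ≤
      ENNReal.ofReal (2 ^ (d + 2) * K / n ^ 3) := by
    intro l hl
    have hll : (l : ℝ) ≤ l2 := by exact_mod_cast hl
    have hdg : 0 ≤ d + g := by positivity
    refine (measure_not_accurate_le hφ hf hν hκ T l
      (q := c * (2 : ℝ) ^ (-(l2 * (d + g)))) (N := N) (fun B hB => ?_) ?_ hNpos he0).trans ?_
    · refine le_trans (ENNReal.ofReal_le_ofReal ?_) (hmass B)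
      rw [mem_binsAt.1 hB]
      have : (2 : ℝ) ^ (-(l2 * (d + g))) ≤ (2 : ℝ) ^ (-(l * (d + g))) :=
        Real.rpow_le_rpow_of_exponent_le (by norm_num) (by nlinarith)
      gcongr
    · rw [hN]; apply le_of_eq; field_simp
    · refine ENNReal.ofReal_le_ofReal ?_
      have e1 := exp_neg_le_inv_pow hn0 4 (N := N) (by push_cast; exact hN4)
      have e2 := exp_neg_le_inv_pow hn0 4 (N := 2 * e ^ 2 * N) (by push_cast; nlinarith)
      -- From `N ≥ 1` it follows that the number of bins does not exceed `T`, hence `n`.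
      have e3 : (2 : ℝ) ^ (l * d) ≤ n := by
        have f1 : (2 : ℝ) ^ (l * d) ≤ (2 : ℝ) ^ (l2 * (d + g)) := by
          rw [← Real.rpow_natCast]
          refine Real.rpow_le_rpow_of_exponent_le (by norm_num) ?_
          push_cast
          have : (l : ℝ) * d ≤ l2 * d := by gcongr
          nlinarith [(Nat.cast_nonneg l2 : (0 : ℝ) ≤ l2)]
        refine f1.trans ?_
        have f2 : (1 : ℝ) ≤ N := by linarith
        rw [hN, Real.rpow_neg (by norm_num), ← div_eq_mul_inv, le_div_iff₀ (by positivity),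
          one_mul] at f2
        refine f2.trans ?_
        have f3 : κ * c / (4 * K) ≤ 1 := by
          rw [div_le_one (by positivity)]
          nlinarith
        calc (T : ℝ) * (κ * c / (4 * K)) ≤ T * 1 := by gcongr
          _ ≤ n := by rw [mul_one]; exact hT
      calc _ ≤ n * K * (n ^ 4)⁻¹ + 2 ^ d * K * n * (2 * (n ^ 4)⁻¹) := by gcongr
        _ = (1 + 2 * 2 ^ d) * K / n ^ 3 := by field_simp
        _ ≤ _ := by
            have : (1 : ℝ) ≤ 2 ^ d := one_le_pow₀ (by norm_num)
            gcongr
            rw [pow_add]; linarith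
  calc _ ≤ Measure.infinitePi (fun _ : ℕ => ν) ({u | ¬ Accurate (obsList φ T u) f l1 e} ∪
        {u | ¬ Accurate (obsList φ T u) f l2 e}) := by
        refine measure_mono fun u hu => ?_
        by_cases h1 : Accurate (obsList φ T u) f l1 e
        · exact Or.inr fun h2 => hu ⟨h1, h2⟩
        · exact Or.inl h1
    _ ≤ ENNReal.ofReal (2 ^ (d + 2) * K / n ^ 3) + ENNReal.ofReal (2 ^ (d + 2) * K / n ^ 3) :=
        (measure_union_le _ _).trans (add_le_add (hone l1 hl12) (hone l2 le_rfl))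
    _ = _ := by
        rw [← ENNReal.ofReal_add (by positivity) (by positivity)]
        congr 1
        rw [show d + 3 = d + 2 + 1 from rfl, pow_succ (2 : ℝ) (d + 2)]; ring

/-- Accurate data yield a smoothness estimate that is slightly too small. -/
theorem smoothnessEstimate_of_accurate (h : θ.Valid) (hn : 1 ≤ nMax nQ nP)
    (hΛ : 1 ≤ Real.log (nMax nQ nP)) {β C b : ℝ} {l₀ : ℕ} (hβ : β ∈ Set.Icc θ.βlo θ.βhi)
    (hC : 0 < C) (hb : 0 < b) (hb1 : b ≤ 1) (hK : 0 < K) {D : List (Obs d K)}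
    (hf : ∀ k, IsHolder β C (f k))
    (hosc : ∀ l, l₀ ≤ l → ∃ k, ∃ B ∈ binsAt d l, ∃ u ∈ B.carrier, ∃ x ∈ B.carrier,
      b * (2 : ℝ) ^ (-(β * l)) / 5 < f k u - f k x)
    (h1 : Accurate D f (level₁ θ d nQ nP)
      (b / 80 * (2 : ℝ) ^ (-(θ.βhi * level₁ θ d nQ nP))))
    (h2 : Accurate D f (level₂ θ d nQ nP)
      (b / 80 * (2 : ℝ) ^ (-(θ.βhi * level₁ θ d nQ nP))))
    (hl₀ : l₀ ≤ θ.βlo * Real.logb 2 (nMax nQ nP) / stageExp θ d nQ nP ^ 2)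
    (hΛC : 240 * C / b ≤ Real.log (nMax nQ nP))
    (hlam : Real.logb 2 (20 / b) * (stageExp θ d nQ nP ^ 2 / θ.βlo) ≤
      Real.logb 2 (Real.log (nMax nQ nP))) :
    smoothnessEstimate θ nQ nP D ≤ β ∧ θ.βlo ≤ smoothnessEstimate θ nQ nP D ∧
      (β - smoothnessEstimate θ nQ nP D) * Real.logb 2 (nMax nQ nP) ≤
        Real.logb 2 (2 * C + 1) * (stageExp θ d nQ nP ^ 2 / θ.βlo) +
          Real.logb 2 (Real.log (nMax nQ nP)) := by
  have hlo := h.lo_pos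
  have ha := h.stageExp_pos (d := d) (nQ := nQ) (nP := nP)
  have hl1 := (level₁_spec (d := d) h hn).1
  have hl2 := (level₂_spec (d := d) h hΛ).1
  have hl3 := level₃_spec (d := d) (nQ := nQ) (nP := nP) h
  have hlamnn := Real.logb_nonneg (b := 2) (by norm_num) hΛ
  have hpos := level₁_pos (θ := θ) (d := d) (nQ := nQ) (nP := nP)
  have hn1 : 1 < nMax nQ nP := by
    by_contra hcon
    have : nMax nQ nP = 1 := le_antisymm (not_lt.1 hcon) hn
    rw [this, Real.log_one] at hΛ
    linarith
  have hx : 0 < Real.logb 2 (nMax nQ nP) := Real.logb_pos (by norm_num) hn1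
  have hΛ0 : 0 < Real.log (nMax nQ nP) := by linarith
  have hlamrep := two_rpow_logb hΛ0
  set x := Real.logb 2 (nMax nQ nP) with hxdef
  set lam := Real.logb 2 (Real.log (nMax nQ nP)) with hlamdef
  set a := stageExp θ d nQ nP
  have hinv : 0 ≤ θ.βlo⁻¹ * lam := by positivity
  have hβ0 : 0 < β := hlo.trans_le hβ.1
  have h13 : level₁ θ d nQ nP < level₃ θ d nQ nP := by
    have : (level₁ θ d nQ nP : ℝ) < level₃ θ d nQ nP := by linarith
    exact_mod_cast this
  have h12 : level₁ θ d nQ nP ≤ level₂ θ d nQ nP := by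
    have : (level₁ θ d nQ nP : ℝ) < level₂ θ d nQ nP := by linarith
    exact_mod_cast this.le
  -- The additional `βlo⁻¹ * log₂ log n` levels gain a factor `log n` for every `β ≥ βlo`. So the
  -- fine bias and the grid error are negligible compared with the oscillation at level `l₁`.
  have hfine : ∀ l : ℝ, level₁ θ d nQ nP + θ.βlo⁻¹ * lam < l →
      (2 : ℝ) ^ (-(β * l)) ≤ (2 : ℝ) ^ (-(β * level₁ θ d nQ nP)) / Real.log (nMax nQ nP) := by
    intro l hl
    rw [← hlamrep, ← Real.rpow_sub (by norm_num)]
    refine Real.rpow_le_rpow_of_exponent_le (by norm_num) ?_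
    have e1 : β * (level₁ θ d nQ nP + θ.βlo⁻¹ * lam) ≤ β * l := by gcongr
    have e2 : lam ≤ β * (θ.βlo⁻¹ * lam) := by
      rw [← mul_assoc]
      have : 1 ≤ β * θ.βlo⁻¹ := by rw [← div_eq_mul_inv, le_div_iff₀ hlo]; linarith [hβ.1]
      nlinarith
    linarith
  have g2 := hfine _ hl2
  have g3 := hfine _ hl3
  have gT : (2 : ℝ) ^ (-(θ.βhi * level₁ θ d nQ nP)) ≤ (2 : ℝ) ^ (-(β * level₁ θ d nQ nP)) := by
    refine Real.rpow_le_rpow_of_exponent_le (by norm_num) ?_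
    have : β * (level₁ θ d nQ nP : ℝ) ≤ θ.βhi * level₁ θ d nQ nP := by gcongr; exact hβ.2
    linarith
  set w := (2 : ℝ) ^ (-(β * level₁ θ d nQ nP)) with hw
  have hw0 : 0 < w := by positivity
  have gC : C * (w / Real.log (nMax nQ nP)) ≤ b / 240 * w := by
    rw [div_le_iff₀ hb] at hΛC
    rw [mul_div_assoc', div_le_iff₀ hΛ0]
    nlinarith
  have hl0 : l₀ ≤ level₁ θ d nQ nP := by
    have : (l₀ : ℝ) ≤ level₁ θ d nQ nP := by linarith
    exact_mod_cast this
  -- With noise `b w / 80` and biases `b w / 240` the total error is at most `b w / 20`, less than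
  -- half of the oscillation `b w / 5`.
  have hmd := maxDiff_bounds (θ := θ) (nQ := nQ) (nP := nP) hβ0 (hβ.2.trans h.hi_le) hC.le hK hf
    h1 h2 h13 h12 (hosc _ hl0) (by
      have e1 := mul_le_mul_of_nonneg_left g2 hC.le
      have e2 := mul_le_mul_of_nonneg_left g3 hC.le
      have e3 := mul_le_mul_of_nonneg_left gT (by positivity : 0 ≤ b / 80)
      rw [← hw]
      linarith [mul_pos hb hw0])
  have hbd := smoothnessEstimate_bounds (θ := θ) (nQ := nQ) (nP := nP) (D := D) (β := β)
    (c := b / 20) (C := 2 * C + 1) hβ (by positivity) hpos (by linarith [hmd.1]) (by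
      have e3 := mul_le_mul_of_nonneg_left gT (by positivity : 0 ≤ b / 80)
      nlinarith [hmd.2]) (by
      rw [div_le_div_iff₀ (by exact_mod_cast hpos) hx]
      have e1 : -Real.logb 2 (b / 20) = Real.logb 2 (20 / b) := by
        rw [← Real.logb_inv, inv_div]
      rw [e1]
      have e2 : 0 ≤ Real.logb 2 (20 / b) := Real.logb_nonneg (by norm_num) (by
        rw [le_div_iff₀ hb]; linarith)
      have e3 : x ≤ level₁ θ d nQ nP * (a ^ 2 / θ.βlo) := by
        rw [div_lt_iff₀ (by positivity)] at hl1
        rw [mul_div_assoc', le_div_iff₀ hlo]; linarith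
      calc _ ≤ Real.logb 2 (20 / b) * (level₁ θ d nQ nP * (a ^ 2 / θ.βlo)) := by gcongr
        _ = Real.logb 2 (20 / b) * (a ^ 2 / θ.βlo) * level₁ θ d nQ nP := by ring
        _ ≤ _ := by gcongr) (by linarith) (by positivity)
  refine ⟨hbd.1, hbd.2.1, ?_⟩
  have hfin := hbd.2.2
  have e3 : x ≤ level₁ θ d nQ nP * (a ^ 2 / θ.βlo) := by
    rw [div_lt_iff₀ (by positivity)] at hl1
    rw [mul_div_assoc', le_div_iff₀ hlo]; linarith
  have e4 : 0 ≤ Real.logb 2 (2 * C + 1) := Real.logb_nonneg (by norm_num) (by linarith)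
  have hp : (0 : ℝ) < level₁ θ d nQ nP := by exact_mod_cast hpos
  calc _ ≤ (Real.logb 2 (2 * C + 1) / level₁ θ d nQ nP + lam / x) * x := by gcongr; linarith
    _ = Real.logb 2 (2 * C + 1) * (x / level₁ θ d nQ nP) + lam := by field_simp
    _ ≤ _ := by
        have : x / level₁ θ d nQ nP ≤ a ^ 2 / θ.βlo := by rw [div_le_iff₀ hp]; linarith
        gcongr

end FirstStage

/-! ### The second stage for good data -/

section SecondStage

variable {d K : ℕ} {S : Stage d K} {βlo β : ℝ}

theorem Stage.scale_eq (S : Stage d K) (B : Bin d) : S.scale B = (2 : ℝ) ^ (-(S.β * B.1)) :=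
  B.side_rpow S.β

theorem Stage.need_eq (S : Stage d K) (B : Bin d) :
    S.need B = 2 * Real.log S.n / S.C ^ 2 * (2 : ℝ) ^ (2 * (S.β * B.1)) := by
  unfold Stage.need
  rw [S.scale_eq, mul_pow, ← Real.rpow_natCast ((2 : ℝ) ^ (-(S.β * B.1))), ← Real.rpow_mul
    (by norm_num), show -(S.β * (B.1 : ℝ)) * ((2 : ℕ) : ℝ) = -(2 * (S.β * B.1)) by push_cast; ring,
    Real.rpow_neg (by norm_num), ← div_div, div_inv_eq_mul]

/-- The number of levels after which the confidence bounds have changed by a given factor. -/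
def levelShift (βlo ρ : ℝ) : ℕ := ⌈Real.logb 2 (1 / ρ) / (2 * βlo)⌉₊ + 1

theorem levelShift_spec (hβ : 0 < βlo) {ρ : ℝ} (hρ : 0 < ρ) {b : ℝ} (hb : βlo ≤ b) :
    (2 : ℝ) ^ (-(2 * (b * levelShift βlo ρ))) ≤ ρ := by
  have h1 : Real.logb 2 (1 / ρ) ≤ levelShift βlo ρ * (2 * βlo) := by
    have := Nat.le_ceil (Real.logb 2 (1 / ρ) / (2 * βlo))
    rw [div_le_iff₀ (by positivity)] at this
    unfold levelShift
    push_cast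
    linarith
  rw [one_div, Real.logb_inv] at h1
  have h2 := two_rpow_logb hρ
  calc _ ≤ (2 : ℝ) ^ Real.logb 2 ρ := by
        refine Real.rpow_le_rpow_of_exponent_le (by norm_num) ?_
        have : βlo * (levelShift βlo ρ : ℝ) ≤ b * levelShift βlo ρ := by gcongr
        linarith
    _ = ρ := h2

/-- The factor by which the gaps of active arms exceed the bias of the bin. -/
def gapFactor (C βlo ρ cA : ℝ) : ℝ :=
  8 * C / √ρ + cA + 2 ^ levelShift βlo ρ + 8 * C * 2 ^ levelShift βlo ρ

theorem one_le_gapFactor {C ρ cA : ℝ} (hC : 0 < C) (hcA : 0 ≤ cA) : 1 ≤ gapFactor C βlo ρ cA := by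
  have h1 : (1 : ℝ) ≤ 2 ^ levelShift βlo ρ := one_le_pow₀ (by norm_num)
  have h2 : 0 ≤ 8 * C / √ρ := by positivity
  have h3 : 0 ≤ 8 * C * 2 ^ levelShift βlo ρ := by positivity
  unfold gapFactor; linarith

/-- Balanced data and small noise make the run of the second stage well behaved. -/
theorem Stage.good_of_balanced (hS : S.Valid) {f : Fin K → Cov d → ℝ} {L N : ℕ} {Cβ c₇ ρ : ℝ}
    (hlo : 0 < βlo) (hβlo : βlo ≤ S.β) (hβ : S.β ≤ β) (hβ1 : β ≤ 1) (hCβ : 0 < Cβ) (hC : Cβ ≤ S.C)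
    (hf : ∀ k, IsHolder β Cβ (f k)) (hgap : ∀ x ∈ cube d, ∀ j k, f j x - f k x ≤ 1)
    (hΛ : S.C ^ 2 ≤ Real.log S.n) (hc₇ : 0 < c₇) (hρ : 0 < ρ) (hρ1 : ρ ≤ 1 / 4)
    (hbal : ∀ B : Bin d, B.1 ≤ L → ∀ k j, c₇ * Real.log S.n ≤ S.count B k →
      4 * ρ * S.count B k ≤ S.count B j) (xs : ℕ → Cov d) (ys : ℕ → Fin K → ℝ)
    (hnoise : ∀ t ≤ N, ∀ B : Bin d, B.1 ≤ L → ∀ k,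
      |S.srcDev f B k + ∑ i ∈ S.pulledIn xs ys t B k, (ys i k - f k (xs i))| ≤
      √(2 * ((S.count B k : ℝ) + (S.pulledIn xs ys t B k).card) * Real.log S.n)) :
    S.Good f L N (levelShift βlo ρ) ρ (√(2 * c₇) * S.C) (2 ^ levelShift βlo ρ)
      (gapFactor S.C βlo ρ (√(2 * c₇) * S.C)) xs ys := by
  have hC0 := hS.C_pos
  have hΛ0 := hS.log_pos
  have hβ0 : 0 < β := hS.β_pos.trans_le hβ
  have hSβ1 : S.β ≤ 1 := hβ.trans hβ1
  have h1 : (1 : ℝ) ≤ 2 ^ levelShift βlo ρ := one_le_pow₀ (by norm_num)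
  have h2 : 0 ≤ 8 * S.C / √ρ := by positivity
  have h3 : 0 ≤ 8 * S.C * 2 ^ levelShift βlo ρ := by positivity
  have h4 : 0 ≤ √(2 * c₇) * S.C := by positivity
  refine ⟨?_, hgap, hnoise, ?_, ?_, ?_, Nat.succ_pos _, ?_, hρ, by linarith, ?_, ?_, ?_, ?_⟩
  · intro B k x hx y hy
    refine (le_abs_self _).trans (((hf k).sub_le_of_mem hβ0 hCβ.le hx hy).trans ?_)
    rw [S.scale_eq]
    have : (2 : ℝ) ^ (-(β * B.1)) ≤ (2 : ℝ) ^ (-(S.β * B.1)) :=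
      Real.rpow_le_rpow_of_exponent_le (by norm_num) (by
        have : S.β * (B.1 : ℝ) ≤ β * B.1 := by gcongr
        linarith)
    gcongr
  · intro B hB τ k hτ
    have hneed := hS.need_pos B
    -- Either the target pulls provide a quarter of the need, or the source sample of arm `k` does
    -- and balance passes it on to all arms. If that sample is too small for balance, the need is
    -- below `4 c₇ log n` and the scale is bounded below.
    rcases le_or_gt (S.need B / 4) τ with h | h
    · right
      intro j
      have : (0 : ℝ) ≤ S.count B j := Nat.cast_nonneg _
      nlinarith
    · have hcnt : S.need B / 4 ≤ S.count B k := by linarith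
      rcases le_or_gt (c₇ * Real.log S.n) (S.count B k) with h5 | h5
      · right
        intro j
        have h6 := hbal B hB k j h5
        have : (0 : ℝ) ≤ τ := Nat.cast_nonneg _
        nlinarith
      · left
        have h6 : S.need B < 4 * (c₇ * Real.log S.n) := by linarith
        have hs := S.scale_pos B
        unfold Stage.need at h6
        rw [div_lt_iff₀ (by positivity)] at h6
        have h7 : 1 ≤ 2 * c₇ * (S.C * S.scale B) ^ 2 := by
          by_contra hcon
          push Not at hcon
          nlinarith
        have h8 : √1 ≤ √(2 * c₇ * (S.C * S.scale B) ^ 2) := Real.sqrt_le_sqrt h7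
        rw [Real.sqrt_one, Real.sqrt_mul (by positivity), Real.sqrt_sq (by positivity)] at h8
        linarith
  · intro A B hAB
    have hcast : (A.1 : ℝ) + levelShift βlo ρ = B.1 := by exact_mod_cast hAB
    rw [S.need_eq, S.need_eq, S.scale_eq, S.scale_eq]
    constructor
    · have h5 := levelShift_spec hlo hρ hβlo
      have h6 : (2 : ℝ) ^ (2 * (S.β * A.1)) =
          (2 : ℝ) ^ (-(2 * (S.β * levelShift βlo ρ))) * (2 : ℝ) ^ (2 * (S.β * B.1)) := by
        rw [← Real.rpow_add (by norm_num), ← hcast]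
        congr 1; ring
      rw [h6]
      calc _ ≤ 2 * Real.log S.n / S.C ^ 2 * (ρ * (2 : ℝ) ^ (2 * (S.β * B.1))) := by gcongr
        _ = _ := by ring
    · rw [← Real.rpow_natCast, ← Real.rpow_add (by norm_num), ← hcast]
      refine Real.rpow_le_rpow_of_exponent_le (by norm_num) ?_
      have : (0 : ℝ) ≤ levelShift βlo ρ := Nat.cast_nonneg _
      nlinarith
  · intro B hB
    rw [S.scale_eq, ← Real.rpow_natCast, ← Real.rpow_add (by norm_num)]
    refine Real.one_le_rpow (by norm_num) ?_
    have h5 : (B.1 : ℝ) ≤ levelShift βlo ρ := by exact_mod_cast hB.le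
    have : (0 : ℝ) ≤ B.1 := Nat.cast_nonneg _
    nlinarith [hS.β_pos]
  · intro B
    rw [S.need_eq]
    have h5 : (1 : ℝ) ≤ (2 : ℝ) ^ (2 * (S.β * B.1)) :=
      Real.one_le_rpow (by norm_num) (by have := hS.β_pos; positivity)
    have h6 : 2 ≤ 2 * Real.log S.n / S.C ^ 2 := by
      rw [le_div_iff₀ (by positivity)]; linarith
    nlinarith
  all_goals unfold gapFactor; linarith

/-- The weights of the levels. -/
def weight (W β : ℝ) (l : ℕ) : ℝ := W * (2 : ℝ) ^ (-(l * β))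

/-- The budget of the second stage: below level `lP` the source data suffice to eliminate arms, the
target data are used up to level `lQ`. -/
def secondBudget (f : Fin K → Cov d → ℝ) (W A β : ℝ) (lP lQ : ℕ) : Budget d where
  top := max lP lQ
  wt := weight W β
  cap := fun l => if l < lP then 0 else A * (2 : ℝ) ^ (2 * (l * β))
  reg := fun l => gapRegion f (weight W β l)
  wt' := weight W β (max lP lQ)
  reg' := gapRegion f (weight W β (max lP lQ))

/-- Level `l` contributes at most a constant times `2 ^ (l d) * 2 ^ (2 l β) * 2 ^ (-l β (1 + α))`:
bins, visits per bin, and weight times probability of a small gap. As `α β ≤ d` this increases in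
`l`, so each of at most `lQ` levels is bounded by its value at `top`, and `2 ^ (lQ (2β + d)) ≤ N`
compares it with the charge for the deep rounds. Levels contribute only if `lP < lQ`, and then `top
= lQ`. -/
theorem secondBudget_le {f : Fin K → Cov d → ℝ} {W A α A₁ qlo N : ℝ} {lP lQ : ℕ}
    {Q : Measure (Cov d)} [IsProbabilityMeasure Q] (hW : 0 < W) (hA : 0 ≤ A) (hA₁ : 0 ≤ A₁)
    (hβ : 0 < β) (hαβ : α * β ≤ d) (hq : 0 < qlo)
    (hmass : ∀ B : Bin d, qlo * (B.side / 2) ^ (d : ℝ) ≤ Q.real B.carrier)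
    (hmargin : ∀ w, 0 < w → Q.real (gapRegion f w) ≤ A₁ * w ^ α)
    (hN : (2 : ℝ) ^ (lQ * (2 * β + d)) ≤ N) :
    (secondBudget f W A β lP lQ).init Q +
        N * ((secondBudget f W A β lP lQ).wt' * Q.real (secondBudget f W A β lP lQ).reg') ≤
      N * (A₁ * W ^ (1 + α) * (1 + lQ * (A * (4 ^ d / qlo)))) *
        (2 : ℝ) ^ (-(((max lP lQ : ℕ) : ℝ) * (β * (1 + α)))) := by
  set G : ℝ := A₁ * W ^ (1 + α) with hG
  set top := max lP lQ with htop
  have hG0 : 0 ≤ G := by positivity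
  have hwt0 : ∀ l, 0 < weight W β l := fun l => by unfold weight; positivity
  have hwt : ∀ l, weight W β l * Q.real (gapRegion f (weight W β l)) ≤
      G * (2 : ℝ) ^ (-((l : ℝ) * (β * (1 + α)))) := by
    intro l
    calc _ ≤ weight W β l * (A₁ * weight W β l ^ α) := by
          have := hwt0 l
          gcongr
          exact hmargin _ this
      _ = A₁ * weight W β l ^ (1 + α) := by
          rw [Real.rpow_add (hwt0 l), Real.rpow_one]; ring
      _ = _ := by
          unfold weight
          rw [Real.mul_rpow hW.le (by positivity), ← Real.rpow_mul (by norm_num), hG, mul_assoc]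
          congr 3; ring
  have hN0 : 0 ≤ N := le_trans (by positivity) hN
  set c : ℝ := G * (A * (4 ^ d / qlo)) * N * (2 : ℝ) ^ (-((top : ℝ) * (β * (1 + α)))) with hc
  have hc0 : 0 ≤ c := by positivity
  have hterm : ∀ l ∈ Finset.range top, ∑ B ∈ binsAt d l,
      (secondBudget f W A β lP lQ).wt l * (secondBudget f W A β lP lQ).rate Q B *
        (secondBudget f W A β lP lQ).cap l ≤ if l < lQ then c else 0 := by
    intro l hl
    rw [Finset.mem_range] at hl
    by_cases hlP : l < lP
    · have : (secondBudget f W A β lP lQ).cap l = 0 := if_pos hlP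
      simp only [this, mul_zero, Finset.sum_const_zero]
      split_ifs
      · exact hc0
      · exact le_rfl
    · have hlQ : l < lQ := by omega
      have htopQ : top = lQ := by omega
      rw [if_pos hlQ]
      have hcap : (secondBudget f W A β lP lQ).cap l = A * (2 : ℝ) ^ (2 * (l * β)) := if_neg hlP
      rw [hcap]
      have hrate : ∀ B ∈ binsAt d l, (secondBudget f W A β lP lQ).rate Q B =
          Q.real (gapRegion f (weight W β l) ∩ B.carrier) / Q.real B.carrier := by
        intro B hB
        unfold Budget.rate
        rw [mem_binsAt.1 hB]
        rfl
      rw [Finset.sum_congr rfl fun B hB => by rw [hrate B hB], ← Finset.sum_mul, ← Finset.mul_sum]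
      change weight W β l * _ * _ ≤ _
      have hexp : (l : ℝ) * d + 2 * (l * β) + -((l : ℝ) * (β * (1 + α))) ≤
          top * (2 * β + d) + -((top : ℝ) * (β * (1 + α))) := by
        have h1 : (l : ℝ) ≤ top := by exact_mod_cast hl.le
        have h2 : 0 ≤ d + 2 * β - β * (1 + α) := by nlinarith
        nlinarith
      calc _ ≤ weight W β l * (4 ^ d / qlo * (2 : ℝ) ^ ((l : ℝ) * d) *
              Q.real (gapRegion f (weight W β l))) * (A * (2 : ℝ) ^ (2 * (l * β))) := by
            have := (hwt0 l).le
            gcongr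
            exact sum_rate_le hq hmass l _
        _ = 4 ^ d / qlo * A * ((2 : ℝ) ^ ((l : ℝ) * d) * (2 : ℝ) ^ (2 * (l * β))) *
            (weight W β l * Q.real (gapRegion f (weight W β l))) := by ring
        _ ≤ 4 ^ d / qlo * A * ((2 : ℝ) ^ ((l : ℝ) * d) * (2 : ℝ) ^ (2 * (l * β))) *
            (G * (2 : ℝ) ^ (-((l : ℝ) * (β * (1 + α))))) := by
            exact mul_le_mul_of_nonneg_left (hwt l) (by positivity)
        _ = G * (A * (4 ^ d / qlo)) *
            (2 : ℝ) ^ ((l : ℝ) * d + 2 * (l * β) + -((l : ℝ) * (β * (1 + α)))) := by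
            rw [Real.rpow_add (by norm_num), Real.rpow_add (by norm_num)]; ring
        _ ≤ G * (A * (4 ^ d / qlo)) *
            (2 : ℝ) ^ (top * (2 * β + d) + -((top : ℝ) * (β * (1 + α)))) := by
            gcongr; norm_num
        _ = G * (A * (4 ^ d / qlo)) * ((2 : ℝ) ^ (lQ * (2 * β + d)) *
            (2 : ℝ) ^ (-((top : ℝ) * (β * (1 + α))))) := by
            rw [Real.rpow_add (by norm_num), htopQ]
        _ ≤ G * (A * (4 ^ d / qlo)) * (N * (2 : ℝ) ^ (-((top : ℝ) * (β * (1 + α))))) := by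
            gcongr
        _ = c := by rw [hc]; ring
  have hinit : (secondBudget f W A β lP lQ).init Q ≤ lQ * c := by
    refine (Finset.sum_le_sum hterm).trans ?_
    rw [← Finset.sum_filter, Finset.sum_const, nsmul_eq_mul]
    have h1 : ((Finset.range top).filter (fun l => l < lQ)).card ≤ lQ := by
      refine (Finset.card_le_card (t := Finset.range lQ) fun l hl => ?_).trans
        (Finset.card_range lQ).le
      rw [Finset.mem_filter] at hl
      exact Finset.mem_range.2 hl.2
    have h2 : (((Finset.range top).filter (fun l => l < lQ)).card : ℝ) ≤ lQ := by exact_mod_cast h1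
    gcongr
  have hlast : N * ((secondBudget f W A β lP lQ).wt' * Q.real (secondBudget f W A β lP lQ).reg') ≤
      N * (G * (2 : ℝ) ^ (-((top : ℝ) * (β * (1 + α))))) := by
    exact mul_le_mul_of_nonneg_left (hwt top) hN0
  calc _ ≤ lQ * c + N * (G * (2 : ℝ) ^ (-((top : ℝ) * (β * (1 + α))))) := add_le_add hinit hlast
    _ = _ := by rw [hc]; ring

end SecondStage

/-! ### The regret of the second stage for good data -/

section SecondStageRegret

variable {d K : ℕ} {S : Stage d K} {βlo β : ℝ}

/-- The leading weight of the second stage. -/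
def leadWeight (cG c₈ βlo Λ : ℝ) : ℝ := 2 * cG * ((2 : ℝ) ^ c₈ * Λ) ^ (1 / βlo + 1)

/-- The number of levels that can be reached in the second stage. -/
def maxLevel (βlo n : ℝ) : ℕ := ⌊Real.logb 2 n / βlo⌋₊ + 1

/-- At these levels `2 ^ (2 β̂ l)` exceeds `n`, and its prefactor in the need is at least two. Both
samples together have at most `2 n` elements, so the depth of the partition is logarithmic. -/
theorem Stage.lt_need_of_maxLevel (hS : S.Valid) (hlo : 0 < βlo) (hβlo : βlo ≤ S.β)
    (hΛ : S.C ^ 2 ≤ Real.log S.n) {B : Bin d} (hB : maxLevel βlo S.n ≤ B.1) :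
    2 * S.n < S.need B := by
  have hC := hS.C_pos
  have hn := hS.n_gt
  have h1 : Real.logb 2 S.n < βlo * B.1 := by
    have h2 : Real.logb 2 S.n / βlo < maxLevel βlo S.n := by
      unfold maxLevel; push_cast; exact Nat.lt_floor_add_one _
    have h3 : (maxLevel βlo S.n : ℝ) ≤ B.1 := by exact_mod_cast hB
    rw [div_lt_iff₀ hlo] at h2
    nlinarith
  have h2 : βlo * (B.1 : ℝ) ≤ S.β * B.1 := by gcongr
  have h0 : 0 < Real.logb 2 S.n := Real.logb_pos (by norm_num) hn
  have h3 : S.n < (2 : ℝ) ^ (2 * (S.β * B.1)) := by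
    calc S.n = (2 : ℝ) ^ Real.logb 2 S.n := (two_rpow_logb (by linarith)).symm
      _ < _ := Real.rpow_lt_rpow_of_exponent_lt (by norm_num) (by linarith)
  have h4 : 2 ≤ 2 * Real.log S.n / S.C ^ 2 := by
    rw [le_div_iff₀ (by positivity)]; linarith
  rw [S.need_eq]
  nlinarith

/-- Using `β̂` for `β` inflates the scale at level `l` by `2 ^ ((β - β̂) l)`. With `l ≤ log₂ n /
βlo` and the bound on `β - β̂` this is a power of `log n`, which is put into the leading weight; the
factor `2` there pays for the step from the parent to the child level. -/
theorem scale_le_weight (hS : S.Valid) (hlo : 0 < βlo) (hβ : S.β ≤ β) (hβ1 : β ≤ 1)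
    {cG c₈ : ℝ} (hcG : 0 ≤ cG) (hΛ : 1 ≤ Real.log S.n) (hc₈ : 0 ≤ c₈)
    (hshift : (β - S.β) * Real.logb 2 S.n ≤ c₈ + Real.logb 2 (Real.log S.n)) {B : Bin d}
    (hB : B.1 < maxLevel βlo S.n) :
    cG * S.scale B ≤ weight (leadWeight cG c₈ βlo (Real.log S.n)) β (B.1 + 1) := by
  have hΛ0 : 0 < Real.log S.n := by linarith
  have hn := hS.n_gt
  have hx : 0 < Real.logb 2 S.n := Real.logb_pos (by norm_num) hn
  have h1 : (B.1 : ℝ) ≤ Real.logb 2 S.n / βlo := by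
    have : B.1 ≤ ⌊Real.logb 2 S.n / βlo⌋₊ := Nat.lt_succ_iff.1 hB
    calc (B.1 : ℝ) ≤ (⌊Real.logb 2 S.n / βlo⌋₊ : ℝ) := by exact_mod_cast this
      _ ≤ _ := Nat.floor_le (by positivity)
  have hlam := Real.logb_nonneg (b := 2) (by norm_num) hΛ
  have h2 : (β - S.β) * (B.1 : ℝ) ≤ (c₈ + Real.logb 2 (Real.log S.n)) * (1 / βlo + 1) := by
    have e1 : (β - S.β) * (B.1 : ℝ) ≤ (β - S.β) * (Real.logb 2 S.n / βlo) :=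
      mul_le_mul_of_nonneg_left h1 (by linarith)
    have e2 : (β - S.β) * (Real.logb 2 S.n / βlo) = (β - S.β) * Real.logb 2 S.n * (1 / βlo) := by
      ring
    have e3 : (β - S.β) * Real.logb 2 S.n * (1 / βlo) ≤
        (c₈ + Real.logb 2 (Real.log S.n)) * (1 / βlo) := by gcongr
    linarith
  have h3 : ((2 : ℝ) ^ c₈ * Real.log S.n) ^ (1 / βlo + 1) =
      (2 : ℝ) ^ ((c₈ + Real.logb 2 (Real.log S.n)) * (1 / βlo + 1)) := by
    rw [Real.rpow_mul (by norm_num), Real.rpow_add (by norm_num) c₈, two_rpow_logb hΛ0]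
  unfold weight leadWeight
  rw [h3, S.scale_eq]
  have h4 : (2 : ℝ) ^ (-(S.β * B.1)) ≤ 2 *
      ((2 : ℝ) ^ ((c₈ + Real.logb 2 (Real.log S.n)) * (1 / βlo + 1)) *
        (2 : ℝ) ^ (-(((B.1 + 1 : ℕ) : ℝ) * β))) := by
    rw [← Real.rpow_add (by norm_num)]
    nth_rewrite 2 [← Real.rpow_one (2 : ℝ)]
    rw [← Real.rpow_add (by norm_num)]
    refine Real.rpow_le_rpow_of_exponent_le (by norm_num) ?_
    push_cast
    linarith
  calc _ ≤ cG * (2 * ((2 : ℝ) ^ ((c₈ + Real.logb 2 (Real.log S.n)) * (1 / βlo + 1)) *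
        (2 : ℝ) ^ (-(((B.1 + 1 : ℕ) : ℝ) * β)))) := by gcongr
    _ = _ := by ring

theorem Stage.sum_limit_le (hS : S.Valid) (hβ : S.β ≤ β) (hΛ : S.C ^ 2 ≤ Real.log S.n) (B : Bin d) :
    2 * ∑ k, (S.limit B k : ℝ) ≤
      6 * K * Real.log S.n / S.C ^ 2 * (2 : ℝ) ^ (2 * (B.1 * β)) := by
  have hC := hS.C_pos
  have hΛ0 := hS.log_pos
  have h6 : 2 ≤ 2 * Real.log S.n / S.C ^ 2 := by
    rw [le_div_iff₀ (by positivity)]; linarith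
  have h5 : (1 : ℝ) ≤ (2 : ℝ) ^ (2 * (S.β * B.1)) :=
    Real.one_le_rpow (by norm_num) (by have := hS.β_pos; positivity)
  have hneed := S.need_eq B
  have h7 : 2 ≤ S.need B := by rw [hneed]; nlinarith
  have h8 : (2 : ℝ) ^ (2 * (S.β * B.1)) ≤ (2 : ℝ) ^ (2 * (B.1 * β)) := by
    refine Real.rpow_le_rpow_of_exponent_le (by norm_num) ?_
    have : S.β * (B.1 : ℝ) ≤ β * B.1 := by gcongr
    linarith
  calc _ ≤ 2 * ∑ _ : Fin K, (S.need B + 1) := by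
        gcongr with k
        exact hS.limit_le_need B k
    _ = 2 * (K * (S.need B + 1)) := by
        rw [Finset.sum_const, Finset.card_univ, Fintype.card_fin, nsmul_eq_mul]
    _ ≤ 2 * (K * (3 / 2 * S.need B)) := by gcongr; linarith
    _ = 6 * K * Real.log S.n / S.C ^ 2 * (2 : ℝ) ^ (2 * (S.β * B.1)) := by rw [hneed]; ring
    _ ≤ _ := by gcongr

/-- The factor in front of the rate in the bound for the second stage. -/
def secondFactor (K d : ℕ) (C α A₁ qlo W Λ lQ : ℝ) : ℝ :=
  A₁ * W ^ (1 + α) * (1 + lQ * (6 * K * Λ / C ^ 2 * (4 ^ d / qlo)))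

/-- `secondBudget` is admissible: where the source sample fills the need all limits vanish and the
cap is `0`, elsewhere the caps come from the need, and the weights dominate the gap bounds inherited
from the parent bins. -/
theorem second_stage_le {M : Model d K} (hK : 0 < K) (hS : S.Valid) {f : Fin K → Cov d → ℝ}
    (hf : ∀ k, Measurable (f k)) {N : ℕ} {Cβ c₇ c₈ ρ α A₁ qlo X : ℝ} {lP lQ : ℕ}
    (hlo : 0 < βlo) (hβlo : βlo ≤ S.β) (hβ : S.β ≤ β) (hβ1 : β ≤ 1) (hCβ : 0 < Cβ) (hC : Cβ ≤ S.C)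
    (hhol : ∀ k, IsHolder β Cβ (f k)) (hgap : ∀ x ∈ cube d, ∀ j k, f j x - f k x ≤ 1)
    (hΛ : S.C ^ 2 ≤ Real.log S.n) (hΛ1 : 1 ≤ Real.log S.n) (hc₇ : 0 < c₇) (hρ : 0 < ρ)
    (hρ1 : ρ ≤ 1 / 4) (hc₈ : 0 ≤ c₈)
    (hshift : (β - S.β) * Real.logb 2 S.n ≤ c₈ + Real.logb 2 (Real.log S.n))
    (hbal : ∀ B : Bin d, B.1 ≤ maxLevel βlo S.n → ∀ k j, c₇ * Real.log S.n ≤ S.count B k →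
      4 * ρ * S.count B k ≤ S.count B j)
    (hcnt : ∀ B : Bin d, B.1 < lP → ∀ k, S.need B ≤ S.count B k)
    {Mx : ℕ} (hMx : N + S.D.length ≤ Mx) (hMxn : (Mx : ℝ) ≤ 2 * S.n)
    (hgen : ∀ᵐ x ∂M.QX, Generic x)
    (hmean : ∀ᵐ x ∂M.QX, ∀ k, ∫ y, y k ∂(M.rewardQ x) = f k x)
    (hA₁ : 0 ≤ A₁) (hαβ : α * β ≤ d) (hq : 0 < qlo)
    (hmass : ∀ B : Bin d, qlo * (B.side / 2) ^ (d : ℝ) ≤ M.QX.real B.carrier)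
    (hmargin : ∀ w, 0 < w → M.QX.real (gapRegion f w) ≤ A₁ * w ^ α)
    (hlQ : (2 : ℝ) ^ (lQ * (2 * β + d)) ≤ X) (hNX : N ≤ X) :
    ∫⁻ v, ENNReal.ofReal (∑ s ∈ Finset.range N, (fMax f (covs v s) -
        f (S.arm (S.run (covs v) (rews v) s) (covs v s)) (covs v s)))
        ∂(Measure.infinitePi (fun _ : ℕ => M.lawQ)) ≤
      ENNReal.ofReal (X * secondFactor K d S.C α A₁ qlo
        (leadWeight (gapFactor S.C βlo ρ (√(2 * c₇) * S.C)) c₈ βlo (Real.log S.n))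
        (Real.log S.n) lQ * (2 : ℝ) ^ (-(((max lP lQ : ℕ) : ℝ) * (β * (1 + α))))) +
      ENNReal.ofReal (N / S.n ^ 4) *
        S.noisePot f (fun m => 4 * √(2 * Real.log S.n / m)) (maxLevel βlo S.n) Mx
          (fun _ => 0) (fun _ => 0) 0 +
      N * (ENNReal.ofReal (N / S.n ^ 4) * (2 * Mx)) := by
  have := M.probQX
  have hβ0 : 0 < β := hS.β_pos.trans_le hβ
  have hC0 := hS.C_pos
  have hΛ0 := hS.log_pos
  set cG := gapFactor S.C βlo ρ (√(2 * c₇) * S.C) with hcG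
  have hcG1 : 1 ≤ cG := one_le_gapFactor hC0 (by positivity)
  set W := leadWeight cG c₈ βlo (Real.log S.n) with hW
  have hone : 1 ≤ ((2 : ℝ) ^ c₈ * Real.log S.n) ^ (1 / βlo + 1) := by
    refine Real.one_le_rpow ?_ (by positivity)
    exact one_le_mul_of_one_le_of_one_le (Real.one_le_rpow (by norm_num) hc₈) hΛ1
  have hW1 : 1 ≤ W := by rw [hW]; unfold leadWeight; nlinarith
  have hW0 : 0 < W := by linarith
  set A : ℝ := 6 * K * Real.log S.n / S.C ^ 2 with hA
  set b : Budget d := secondBudget f W A β lP lQ with hb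
  have hwt0 : ∀ l, 0 ≤ weight W β l := fun l => by unfold weight; positivity
  have hmain := Budget.lintegral_regret_le (b := b) (L := maxLevel βlo S.n) (N := N) (M := M) (f := f)
    hK hS (fun B hB => by
      have e1 := S.lt_need_of_maxLevel hS hlo hβlo hΛ hB
      have e2 : (N : ℝ) + S.D.length ≤ Mx := by exact_mod_cast hMx
      linarith) hMx hgen hmean
    (fun xs ys hno => S.good_of_balanced hS hlo hβlo hβ hβ1 hCβ hC hhol hgap hΛ hc₇ hρ hρ1 hbal
      xs ys hno) hgap hwt0
    (by change 1 ≤ weight W β 0; unfold weight; simpa using hW1)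
    (fun B hB => scale_le_weight hS hlo hβ hβ1 (by linarith) hΛ1 hc₈ hshift hB)
    (fun l hl => by
      change weight W β l ≤ weight W β (max lP lQ)
      have h1 : ((max lP lQ : ℕ) : ℝ) ≤ l := by exact_mod_cast hl
      unfold weight
      have : (2 : ℝ) ^ (-((l : ℝ) * β)) ≤ (2 : ℝ) ^ (-(((max lP lQ : ℕ) : ℝ) * β)) :=
        Real.rpow_le_rpow_of_exponent_le (by norm_num) (by nlinarith)
      gcongr)
    (fun B hB => by
      change _ ≤ if B.1 < lP then 0 else A * (2 : ℝ) ^ (2 * (B.1 * β))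
      split_ifs with h
      · have : ∀ k, S.limit B k = 0 := fun k => (Stage.limit_zero_iff hS B k).2 (hcnt B h k)
        simp [this]
      · exact S.sum_limit_le hS hβ hΛ B)
    (fun l => measurableSet_gapRegion hf _) (measurableSet_gapRegion hf _)
    (fun l x _ k h1 h2 => ⟨k, h1, h2⟩) (fun x _ k h1 h2 => ⟨k, h1, h2⟩)
  have hbud := secondBudget_le (f := f) (lP := lP) (lQ := lQ) hW0 (by positivity : 0 ≤ A) hA₁ hβ0
    hαβ hq hmass hmargin hlQ
  have hX0 : 0 ≤ X := (Nat.cast_nonneg N).trans hNX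
  have hw' : 0 ≤ b.wt' * M.QX.real b.reg' := mul_nonneg (hwt0 _) measureReal_nonneg
  have hinit : 0 ≤ b.init M.QX := by
    refine Finset.sum_nonneg fun l _ => Finset.sum_nonneg fun B _ => ?_
    refine mul_nonneg (mul_nonneg (hwt0 _) (b.rate_nonneg B)) ?_
    change 0 ≤ if l < lP then 0 else A * (2 : ℝ) ^ (2 * (l * β))
    split_ifs <;> positivity
  refine hmain.trans ?_
  rw [mul_add, ← add_assoc]
  refine add_le_add ?_ le_rfl
  rw [add_right_comm]
  refine add_le_add ?_ le_rfl
  rw [mul_comm (N : ENNReal), ofReal_mul_natCast_eq, ← ENNReal.ofReal_add hinit (by positivity)]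
  refine ENNReal.ofReal_le_ofReal (le_trans ?_ hbud)
  rw [mul_comm (_ * _) (N : ℝ)]
  gcongr

end SecondStageRegret

/-! ### Bad events -/

section BadEvents

/-- The bad sets are replaced by measurable hulls of the same outer measure. Their indicators are
then measurable, which makes the lower integral additive on the majorant although neither `F` nor
`G` need be measurable. -/
theorem lintegral_lintegral_le_of_good {Ω Ω' : Type*} [MeasurableSpace Ω] [MeasurableSpace Ω']
    {μ : Measure Ω} {ν : Measure Ω'} [IsProbabilityMeasure μ] [IsProbabilityMeasure ν]
    {F : Ω → Ω' → ENNReal} {G : Ω → ENNReal} {N A : ENNReal} {B₁ : Set Ω} {B₂ : Set Ω'}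
    (h₁ : ∀ u v, F u v ≤ N)
    (h₂ : ∀ u, u ∉ B₁ → ∀ v, v ∉ B₂ → F u v ≤ A + G u) :
    ∫⁻ u, ∫⁻ v, F u v ∂ν ∂μ ≤ N * μ B₁ + N * ν B₂ + (A + ∫⁻ u, G u ∂μ) := by
  set B₁' := toMeasurable μ B₁
  set B₂' := toMeasurable ν B₂
  have hB₁ : MeasurableSet B₁' := measurableSet_toMeasurable _ _
  have hB₂ : MeasurableSet B₂' := measurableSet_toMeasurable _ _
  have hF : ∀ u v, F u v ≤ (B₁'.indicator (fun _ => N) u + (A + G u)) +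
      B₂'.indicator (fun _ => N) v := by
    intro u v
    by_cases hu : u ∈ B₁'
    · rw [Set.indicator_of_mem hu]
      exact (h₁ u v).trans (by rw [add_assoc]; exact le_self_add)
    by_cases hv : v ∈ B₂'
    · rw [Set.indicator_of_mem hv]
      exact (h₁ u v).trans le_add_self
    · refine (h₂ u (fun h => hu (subset_toMeasurable _ _ h)) v
        (fun h => hv (subset_toMeasurable _ _ h))).trans ?_
      rw [add_comm (B₁'.indicator _ _), add_assoc]
      exact le_self_add
  have hm : Measurable fun u => B₁'.indicator (fun _ => N) u := measurable_const.indicator hB₁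
  calc _ ≤ ∫⁻ u, (B₁'.indicator (fun _ => N) u + (A + G u)) + N * ν B₂ ∂μ := by
        refine lintegral_mono fun u => ?_
        refine (lintegral_mono (hF u)).trans ?_
        rw [lintegral_add_left measurable_const, lintegral_const, measure_univ, mul_one,
          lintegral_indicator_const hB₂, measure_toMeasurable]
    _ = _ := by
        rw [lintegral_add_right _ measurable_const, lintegral_add_left hm,
          lintegral_add_left measurable_const, lintegral_indicator_const hB₁, measure_toMeasurable]
        simp only [lintegral_const, measure_univ, mul_one]
        ring

variable {d K : ℕ} {Ω : Type*} [MeasurableSpace Ω] {φ : Ω → Obs d K} {f : Fin K → Cov d → ℝ}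
  {ν : Measure Ω} [IsProbabilityMeasure ν] {κ : ℝ}

/-- The threshold `16 K log n / κ₀` makes the exponent at least `4 log n`; the factors `n` from the
number of levels and the sample size leave `n ^ (-2)`. -/
theorem measure_unbalanced_le' (hφ : Measurable φ) (hν : ObsLaw f κ (ν.map φ)) {κ₀ : ℝ}
    (hκ₀ : 0 < κ₀) (hκ : κ₀ ≤ κ) (hK : 0 < K) (I : Finset ℕ) (L : ℕ) {n cL : ℝ} (hn : 1 < n)
    (hI : (I.card : ℝ) ≤ n) (hL : (L + 1 : ℝ) ≤ cL * n) :
    Measure.infinitePi (fun _ : ℕ => ν) {u | ∃ B : Bin d, B.1 ≤ L ∧ ∃ k : Fin K,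
        16 * K / κ₀ * Real.log n ≤ (hitsBin I (fun i => φ (u i)) B).card ∧
        ((hits I (fun i => φ (u i)) B k).card : ℝ) <
          κ / (4 * K) * (hitsBin I (fun i => φ (u i)) B).card} ≤
      ENNReal.ofReal (cL * 2 ^ d * K / n ^ 2) := by
  have hK0 : (0 : ℝ) < K := by exact_mod_cast hK
  have hΛ : 0 < Real.log n := Real.log_pos hn
  have hn0 : 0 < n := by linarith
  refine (measure_unbalanced_le hφ hν (hκ₀.le.trans hκ) I L (by positivity)).trans
    (ENNReal.ofReal_le_ofReal ?_)
  have e1 : 4 * Real.log n ≤ κ / (4 * K) * (16 * K / κ₀ * Real.log n) := by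
    have : κ / (4 * K) * (16 * K / κ₀ * Real.log n) = 4 * Real.log n * (κ / κ₀) := by
      field_simp; ring
    rw [this]
    have : 1 ≤ κ / κ₀ := by rw [le_div_iff₀ hκ₀]; linarith
    nlinarith
  have e2 := exp_neg_le_inv_pow hn0 4 (by push_cast; exact e1)
  have hcL : 0 ≤ cL * n := le_trans (by positivity) hL
  calc _ ≤ cL * n * (2 ^ d * K * n * (n ^ 4)⁻¹) := by gcongr
    _ = _ := by field_simp

/-- There are at most `2 n` levels with at most `n` bins each, against a failure probability of at
most `n ^ (-4)` per bin and arm. -/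
theorem measure_few_hits_le (hφ : Measurable φ) (hν : ObsLaw f κ (ν.map φ)) (hκ : 0 ≤ κ)
    (I : Finset ℕ) (lP : ℕ) {n c s : ℝ} (hn : 1 < n) (hs : 0 ≤ s)
    (hmass : ∀ B : Bin d, ENNReal.ofReal (c * (2 : ℝ) ^ (-(B.1 * (d + s)))) ≤
      (ν.map φ) {o | o.1 ∈ B.carrier})
    (hbig : ∀ l < lP, 4 * Real.log n ≤ I.card * (κ / K * (c * (2 : ℝ) ^ (-(l * (d + s))))) / 4)
    (hlev : ∀ l < lP, (2 : ℝ) ^ (l * (d + s)) ≤ n) (hd : 1 ≤ d) :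
    Measure.infinitePi (fun _ : ℕ => ν) {u | ∃ l < lP, ∃ B ∈ binsAt d l, ∃ k : Fin K,
        ((hits I (fun i => φ (u i)) B k).card : ℝ) ≤
          I.card * (κ / K * (c * (2 : ℝ) ^ (-(l * (d + s))))) / 4} ≤
      ENNReal.ofReal (2 * K / n ^ 2) := by
  have hn0 : 0 < n := by linarith
  have hd1 : (1 : ℝ) ≤ d := by exact_mod_cast hd
  have hpow : ∀ l < lP, (2 : ℝ) ^ (l * d) ≤ n := fun l hl => by
    refine le_trans ?_ (hlev l hl)
    rw [← Real.rpow_natCast]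
    refine Real.rpow_le_rpow_of_exponent_le (by norm_num) ?_
    push_cast
    gcongr
    linarith
  have hlP : (lP : ℝ) ≤ 2 * n := by
    rcases Nat.eq_zero_or_pos lP with h0 | h0
    · rw [h0]; push_cast; linarith
    have h1 := hpow (lP - 1) (by omega)
    have h2 : ((lP - 1 : ℕ) : ℝ) ≤ (2 : ℝ) ^ ((lP - 1) * d) := by
      have : lP - 1 ≤ 2 ^ ((lP - 1) * d) :=
        (Nat.le_mul_of_pos_right _ hd).trans Nat.lt_two_pow_self.le
      exact_mod_cast this
    have h3 : (lP : ℝ) = ((lP - 1 : ℕ) : ℝ) + 1 := by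
      rw [Nat.cast_sub h0]; push_cast; ring
    linarith
  calc _ ≤ Measure.infinitePi (fun _ : ℕ => ν) (⋃ l ∈ Finset.range lP,
        {u | ∃ B ∈ binsAt d l, ∃ k : Fin K, ((hits I (fun i => φ (u i)) B k).card : ℝ) ≤
          I.card * (κ / K * (c * (2 : ℝ) ^ (-(l * (d + s))))) / 4}) := by
        refine measure_mono fun u hu => ?_
        obtain ⟨l, hl, B, hB, k, hk⟩ := hu
        simp only [Set.mem_iUnion]
        exact ⟨l, Finset.mem_range.2 hl, B, hB, k, hk⟩
    _ ≤ ∑ l ∈ Finset.range lP, ENNReal.ofReal (n * K * (n ^ 4)⁻¹) := by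
        refine (measure_biUnion_finset_le _ _).trans (Finset.sum_le_sum fun l hl => ?_)
        rw [Finset.mem_range] at hl
        refine (measure_exists_hits_le hφ hν hκ I l (q := c * (2 : ℝ) ^ (-(l * (d + s))))
          (fun B hB => ?_) le_rfl).trans (ENNReal.ofReal_le_ofReal ?_)
        · have := hmass B
          rwa [mem_binsAt.1 hB] at this
        · have e2 := exp_neg_le_inv_pow hn0 4 (by push_cast; exact hbig l hl)
          have e3 := hpow l hl
          gcongr
    _ = ENNReal.ofReal (n * K * (n ^ 4)⁻¹ * lP) := by
        rw [Finset.sum_const, Finset.card_range, nsmul_eq_mul, mul_comm, ofReal_mul_natCast_eq]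
    _ ≤ _ := by
        refine ENNReal.ofReal_le_ofReal ?_
        calc _ ≤ n * K * (n ^ 4)⁻¹ * (2 * n) := by gcongr
          _ = _ := by field_simp

end BadEvents

/-! ### Model facts -/

section ModelFacts

variable {d K : ℕ} {M : Model d K} {β Cβ α Cα qlo qhi γ cγ κ b : ℝ} {l₀ : ℕ}

/-- Density, transfer and exploration are assumed on the support only. Self-similarity includes
positive mass of all fine bins, so the support contains the cube and these conditions hold at the
center of every bin. -/
theorem InClass.cube_subset (h : InClass M β Cβ α Cα qlo qhi γ cγ κ l₀ b) :
    cube d ⊆ M.QX.support := by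
  obtain ⟨k, hQ, _⟩ := h.selfSim
  exact cube_subset_support fun l hl B hB => (hQ l hl).1 B hB

theorem InClass.generic (h : InClass M β Cβ α Cα qlo qhi γ cγ κ l₀ b) : ∀ᵐ x ∂M.QX, Generic x := by
  have := M.probQX
  exact ae_generic M.QX_cube fun x hx r h0 h1 => (h.density x (h.cube_subset hx) r h0 h1).2

theorem holder_extend {g : Cov d → ℝ} (h : IsHolder β Cβ g) : IsHolder β Cβ (extend g) := by
  intro x hx y hy
  rw [extend_of_mem _ hx, extend_of_mem _ hy]
  exact h x hx y hy

theorem extend_mem_Icc (M : Model d K) (k : Fin K) (x : Cov d) :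
    extend (M.f k) x ∈ Set.Icc (0 : ℝ) 1 := by
  refine M.f_mem k _ ?_
  constructor <;> intro i <;> simp

theorem fMax_sub_le_one (M : Model d K) (k : Fin K) (x : Cov d) :
    fMax (fun k => extend (M.f k)) x - extend (M.f k) x ≤ 1 := by
  have : Nonempty (Fin K) := ⟨k⟩
  have h1 : fMax (fun k => extend (M.f k)) x ≤ 1 := ciSup_le fun j => (extend_mem_Icc M j x).2
  linarith [(extend_mem_Icc M k x).1]

theorem InClass.mass_target (h : InClass M β Cβ α Cα qlo qhi γ cγ κ l₀ b) (B : Bin d) :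
    qlo * (B.side / 2) ^ (d : ℝ) ≤ M.QX.real B.carrier :=
  h.density.measure_bin_ge h.cube_subset B

/-- The constant in the lower bounds for the masses of the bins. -/
def massConst (d : ℕ) (qlo cγ γhi : ℝ) : ℝ := min 1 (cγ * qlo * (2 : ℝ) ^ (-(d + γhi)))

/-- The exponent `s ≥ γ` is free because the first stage is calibrated with the upper bound `γhi`,
the only one known to the algorithm, while the analysis of the second stage uses `γ` itself. -/
theorem InClass.mass_obs_source (h : InClass M β Cβ α Cα qlo qhi γ cγ κ l₀ b) {γhi s : ℝ}
    (hc : 0 ≤ cγ) (hq : 0 ≤ qlo) (hγ : γ ≤ γhi) (hs : γ ≤ s) (B : Bin d) :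
    ENNReal.ofReal (massConst d qlo cγ γhi * (2 : ℝ) ^ (-(B.1 * (d + s)))) ≤
      (M.lawP.map RoundP.obs) {o | o.1 ∈ B.carrier} := by
  have := M.probPX
  rw [map_obs_bin, ENNReal.ofReal_le_iff_le_toReal (measure_ne_top _ _)]
  refine le_trans ?_ (h.transfer.measure_bin_ge h.density h.cube_subset hc hq hγ B)
  have e1 : massConst d qlo cγ γhi ≤ cγ * qlo * (2 : ℝ) ^ (-(d + γhi)) := min_le_right _ _
  have e2 : (2 : ℝ) ^ (-(B.1 * (d + s))) ≤ (2 : ℝ) ^ (-(B.1 * (d + γ))) := by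
    refine Real.rpow_le_rpow_of_exponent_le (by norm_num) ?_
    have : (B.1 : ℝ) * (d + γ) ≤ B.1 * (d + s) := by gcongr
    linarith
  gcongr

theorem InClass.mass_obs_target (h : InClass M β Cβ α Cα qlo qhi γ cγ κ l₀ b) (hK : 1 ≤ K) {γhi : ℝ}
    (hc : cγ ≤ 1) (hq : 0 ≤ qlo) (hγ : 0 ≤ γhi) (B : Bin d) :
    ENNReal.ofReal (massConst d qlo cγ γhi * (2 : ℝ) ^ (-(B.1 * ((d : ℝ) + 0)))) ≤
      (M.lawQ.map uniformObs) {o | o.1 ∈ B.carrier} := by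
  have := M.probQX
  rw [map_uniformObs_bin M hK, ENNReal.ofReal_le_iff_le_toReal (measure_ne_top _ _)]
  refine le_trans ?_ (h.mass_target B)
  rw [B.half_side_rpow, add_zero, ← mul_assoc]
  have e1 : massConst d qlo cγ γhi ≤ cγ * qlo * (2 : ℝ) ^ (-(d + γhi)) := min_le_right _ _
  have e2 : (2 : ℝ) ^ (-(d + γhi)) ≤ (2 : ℝ) ^ (-(d : ℝ)) :=
    Real.rpow_le_rpow_of_exponent_le (by norm_num) (by linarith)
  refine mul_le_mul_of_nonneg_right (e1.trans ?_) (by positivity)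
  calc cγ * qlo * (2 : ℝ) ^ (-(d + γhi)) ≤ 1 * qlo * (2 : ℝ) ^ (-(d : ℝ)) := by gcongr
    _ = _ := by rw [one_mul]

/-- Passing to `min 1 b` only weakens the bound, and permits `b ≤ 1` in the calibration of the first
stage. -/
theorem InClass.osc (h : InClass M β Cβ α Cα qlo qhi γ cγ κ l₀ b) (hβ : 0 < β) (hb : 0 < b) (l : ℕ)
    (hl : l₀ ≤ l) : ∃ k, ∃ B ∈ binsAt d l, ∃ u ∈ B.carrier, ∃ x ∈ B.carrier,
      min 1 b * (2 : ℝ) ^ (-(β * l)) / 5 < extend (M.f k) u - extend (M.f k) x := by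
  have := M.probQX
  obtain ⟨k, hQ, _⟩ := h.selfSim
  obtain ⟨B, hB, u, hu, x, hx, hlt⟩ := hQ.exists_osc hl hb
    (continuous_extend hβ (h.smooth k)).measurable
    (fun u hu => (extend_of_mem _ hu).symm) (fun u hu => M.f_mem k u hu)
  refine ⟨k, B, hB, u, hu, x, hx, ?_⟩
  rw [extend_of_mem _ (B.carrier_subset_cube hu), extend_of_mem _ (B.carrier_subset_cube hx)]
  refine lt_of_le_of_lt ?_ hlt
  gcongr
  exact min_le_right _ _

end ModelFacts

/-! ### The regret for large samples -/

section LargeSamples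

variable {d K : ℕ} {M : Model d K} {β Cβ α Cα qlo qhi γ cγ κ κ₀ b : ℝ} {l₀ : ℕ} {θ : Tuning}
  {tie : Finset (Fin K) → Fin K} {nQ nP : ℕ}

/-- The requirements on the size of the larger sample. -/
structure LargeSample (θ : Tuning) (d K : ℕ) (Cβ κ₀ c b : ℝ) (l₀ : ℕ) (n : ℝ) : Prop where
  log_ge : 1 ≤ Real.log n
  log_ge_sq : θ.Chi ^ 2 ≤ Real.log n
  sample : n ^ (θ.βlo / (d + 2 * θ.βhi)) * Real.log n ^ ((d + θ.βhi + θ.γhi) / θ.βlo) ≤ n / 2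
  count : 4 * Real.log n ≤ κ₀ * c / (4 * K) / 2 * (b / 80) ^ 2 *
    (2 : ℝ) ^ (-(2 * (d + 2 * θ.βhi + θ.γhi))) * Real.log n ^ (θ.βhi / θ.βlo)
  level : l₀ ≤ θ.βlo * Real.logb 2 n / (d + 2 * θ.βhi + θ.γhi) ^ 2
  log_bias : 240 * Cβ / b ≤ Real.log n
  log_osc : Real.logb 2 (20 / b) * ((d + 2 * θ.βhi + θ.γhi) ^ 2 / θ.βlo) ≤
    Real.logb 2 (Real.log n)

theorem one_le_nMax (h : 1 ≤ Real.log (nMax nQ nP)) : 1 < nMax nQ nP := by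
  by_contra hcon
  have : Real.log (nMax nQ nP) ≤ 0 := Real.log_nonpos (Nat.cast_nonneg _) (not_lt.1 hcon)
  linarith

theorem Tuning.Valid.gammaEff_le (h : θ.Valid) : gammaEff θ nQ nP ≤ θ.γhi := by
  unfold gammaEff; split_ifs
  · exact le_rfl
  · exact h.γ_nonneg

theorem stageExp_le (h : θ.Valid) : stageExp θ d nQ nP ≤ d + 2 * θ.βhi + θ.γhi := by
  unfold stageExp; linarith [h.gammaEff_le (nQ := nQ) (nP := nP)]

theorem sampleReal_le (h : θ.Valid) (hd : 1 ≤ d) (hΛ : 1 ≤ Real.log (nMax nQ nP)) :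
    sampleReal θ d nQ nP ≤ nMax nQ nP ^ (θ.βlo / (d + 2 * θ.βhi)) *
      Real.log (nMax nQ nP) ^ ((d + θ.βhi + θ.γhi) / θ.βlo) := by
  have h1 := h.lo_pos
  have h2 := h.hi_pos
  have h3 := h.gammaEff_nonneg (nQ := nQ) (nP := nP)
  have h4 := h.gammaEff_le (nQ := nQ) (nP := nP)
  have hn := one_le_nMax hΛ
  have hd1 : (1 : ℝ) ≤ d := by exact_mod_cast hd
  unfold sampleReal stageExp
  have e1 : nMax nQ nP ^ (θ.βlo / (d + 2 * θ.βhi + gammaEff θ nQ nP)) ≤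
      nMax nQ nP ^ (θ.βlo / (d + 2 * θ.βhi)) := by
    refine Real.rpow_le_rpow_of_exponent_le hn.le ?_
    exact div_le_div_of_nonneg_left h1.le (by positivity) (by linarith)
  have e2 : Real.log (nMax nQ nP) ^ ((d + θ.βhi + gammaEff θ nQ nP) / θ.βlo) ≤
      Real.log (nMax nQ nP) ^ ((d + θ.βhi + θ.γhi) / θ.βlo) := by
    refine Real.rpow_le_rpow_of_exponent_le hΛ ?_
    gcongr
  have := Real.rpow_nonneg (zero_le_one.trans hΛ) ((d + θ.βhi + gammaEff θ nQ nP) / θ.βlo)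
  gcongr

theorem LargeSample.sampleSize_le {c : ℝ} (hL : LargeSample θ d K Cβ κ₀ c b l₀ (nMax nQ nP))
    (h : θ.Valid) (hd : 1 ≤ d) : (sampleSize θ d nQ nP : ℝ) ≤ nMax nQ nP / 2 :=
  (sampleSize_spec h (one_le_nMax hL.log_ge).le hL.log_ge).2.trans
    ((sampleReal_le h hd hL.log_ge).trans hL.sample)

theorem LargeSample.count' {c κ : ℝ} (hL : LargeSample θ d K Cβ κ₀ c b l₀ (nMax nQ nP))
    (h : θ.Valid) (hc : 0 ≤ c) (hκ : κ₀ ≤ κ) :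
    4 * Real.log (nMax nQ nP) ≤ κ * c / (4 * K) / 2 * (b / 80) ^ 2 *
      (2 : ℝ) ^ (-(2 * stageExp θ d nQ nP)) * Real.log (nMax nQ nP) ^ (θ.βhi / θ.βlo) := by
  refine hL.count.trans ?_
  have h1 := stageExp_le (d := d) (nQ := nQ) (nP := nP) h
  have h2 : (2 : ℝ) ^ (-(2 * (d + 2 * θ.βhi + θ.γhi))) ≤ (2 : ℝ) ^ (-(2 * stageExp θ d nQ nP)) :=
    Real.rpow_le_rpow_of_exponent_le (by norm_num) (by linarith)
  have h3 := Real.rpow_nonneg (zero_le_one.trans hL.log_ge) (θ.βhi / θ.βlo)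
  have h4 : κ₀ * c / (4 * K) / 2 * (b / 80) ^ 2 ≤ κ * c / (4 * K) / 2 * (b / 80) ^ 2 := by gcongr
  have h6 : 0 ≤ κ₀ * c / (4 * K) / 2 * (b / 80) ^ 2 := by
    by_contra hcon
    push Not at hcon
    have h7 : κ₀ * c / (4 * K) / 2 * (b / 80) ^ 2 *
        (2 : ℝ) ^ (-(2 * (d + 2 * θ.βhi + θ.γhi))) * Real.log (nMax nQ nP) ^ (θ.βhi / θ.βlo) ≤ 0 :=
      mul_nonpos_of_nonpos_of_nonneg (mul_nonpos_of_nonpos_of_nonneg hcon.le (by positivity)) h3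
    linarith [hL.count, hL.log_ge]
  have h5 := h6.trans h4
  gcongr

/-- The constant in the bound for the loss of accuracy of the smoothness estimate. -/
def shiftConst (θ : Tuning) (d : ℕ) (Cβ : ℝ) : ℝ :=
  Real.logb 2 (2 * Cβ + 1) * ((d + 2 * θ.βhi + θ.γhi) ^ 2 / θ.βlo)

theorem shiftConst_nonneg (h : θ.Valid) (hC : 0 < Cβ) : 0 ≤ shiftConst θ d Cβ := by
  have h1 := h.lo_pos
  have h2 : 0 ≤ Real.logb 2 (2 * Cβ + 1) := Real.logb_nonneg (by norm_num) (by linarith)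
  unfold shiftConst; positivity

theorem LargeSample.smoothness {c : ℝ} (hL : LargeSample θ d K Cβ κ₀ c b l₀ (nMax nQ nP))
    (h : θ.Valid) (hβ : β ∈ Set.Icc θ.βlo θ.βhi) (hC : 0 < Cβ) (hb : 0 < b) (hb1 : b ≤ 1)
    (hK : 0 < K) {f : Fin K → Cov d → ℝ} {D : List (Obs d K)} (hf : ∀ k, IsHolder β Cβ (f k))
    (hosc : ∀ l, l₀ ≤ l → ∃ k, ∃ B ∈ binsAt d l, ∃ u ∈ B.carrier, ∃ x ∈ B.carrier,
      b * (2 : ℝ) ^ (-(β * l)) / 5 < f k u - f k x)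
    (h1 : Accurate D f (level₁ θ d nQ nP) (b / 80 * (2 : ℝ) ^ (-(θ.βhi * level₁ θ d nQ nP))))
    (h2 : Accurate D f (level₂ θ d nQ nP) (b / 80 * (2 : ℝ) ^ (-(θ.βhi * level₁ θ d nQ nP)))) :
    smoothnessEstimate θ nQ nP D ≤ β ∧ θ.βlo ≤ smoothnessEstimate θ nQ nP D ∧
      (β - smoothnessEstimate θ nQ nP D) * Real.logb 2 (nMax nQ nP) ≤
        shiftConst θ d Cβ + Real.logb 2 (Real.log (nMax nQ nP)) := by
  have hn := one_le_nMax hL.log_ge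
  have ha := h.stageExp_pos (d := d) (nQ := nQ) (nP := nP)
  have ha1 := stageExp_le (d := d) (nQ := nQ) (nP := nP) h
  have hlo := h.lo_pos
  have hx : 0 ≤ Real.logb 2 (nMax nQ nP) := Real.logb_nonneg (by norm_num) hn.le
  have hosc20 : 0 ≤ Real.logb 2 (20 / b) := Real.logb_nonneg (by norm_num) (by
    rw [le_div_iff₀ hb]; linarith)
  have hC0 : 0 ≤ Real.logb 2 (2 * Cβ + 1) := Real.logb_nonneg (by norm_num) (by linarith)
  have hsq : stageExp θ d nQ nP ^ 2 / θ.βlo ≤ (d + 2 * θ.βhi + θ.γhi) ^ 2 / θ.βlo := by gcongr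
  have hmain := smoothnessEstimate_of_accurate h hn.le hL.log_ge hβ hC hb hb1 hK hf hosc h1 h2
    (hL.level.trans (by gcongr)) hL.log_bias
    ((mul_le_mul_of_nonneg_left hsq hosc20).trans hL.log_osc)
  refine ⟨hmain.1, hmain.2.1, hmain.2.2.trans ?_⟩
  have := mul_le_mul_of_nonneg_left hsq hC0
  unfold shiftConst
  linarith

theorem maxLevel_le {βlo n : ℝ} (hlo : 0 < βlo) (hn : 1 ≤ n) :
    (maxLevel βlo n : ℝ) + 1 ≤ (2 / βlo + 2) * n := by
  have hx : 0 ≤ Real.logb 2 n := Real.logb_nonneg (by norm_num) hn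
  have h1 : Real.logb 2 n ≤ 2 * n := by
    unfold Real.logb
    have e1 := Real.log_two_gt_d9
    rw [div_le_iff₀ (by linarith)]
    have e2 := Real.log_le_sub_one_of_pos (by linarith : 0 < n)
    nlinarith
  have h2 := Nat.floor_le (div_nonneg hx hlo.le)
  unfold maxLevel
  push_cast
  calc (⌊Real.logb 2 n / βlo⌋₊ : ℝ) + 1 + 1 ≤ Real.logb 2 n / βlo + 1 + 1 := by gcongr
    _ ≤ 2 * n / βlo + n + n := by gcongr
    _ = _ := by ring

/-- The constant of the terms of lower order. -/
def restConst (βlo : ℝ) (d K : ℕ) : ℝ :=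
  (2 / βlo + 2) * 2 ^ d * K + 2 * K + 2 * (2 ^ (d + 3) * K) + 4 * (2 / βlo + 2) * K * 2 ^ d + 4

/-- The sample size per squared bias that suffices in the source data. -/
def sourceConst (K : ℕ) (C c : ℝ) : ℝ := 8 * K * (2 / C ^ 2 + 4) / c

end LargeSamples

/-! ### The regret in terms of the levels reached by the two samples -/

section RegretBound

variable {d K : ℕ} {M : Model d K} {β Cβ α Cα qlo qhi γ cγ κ κ₀ b : ℝ} {l₀ : ℕ} {θ : Tuning}
  {tie : Finset (Fin K) → Fin K} {nQ nP : ℕ}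

theorem Model.isProbabilityMeasure_lawQ (M : Model d K) (hK : 1 ≤ K) :
    IsProbabilityMeasure M.lawQ := by
  have := M.probQX
  have := M.markovQ
  have : Nonempty (Fin K) := ⟨⟨0, hK⟩⟩
  have hU : IsProbabilityMeasure (uniformOn (Set.univ : Set (Fin K))) :=
    isProbabilityMeasure_uniformOn Set.finite_univ Set.univ_nonempty
  unfold Model.lawQ; infer_instance

theorem Model.isProbabilityMeasure_lawP (M : Model d K) : IsProbabilityMeasure M.lawP := by
  have := M.probPX
  have := M.markovP
  have := M.markovArm
  unfold Model.lawP; infer_instance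

theorem InClass.obsLaw_source (h : InClass M β Cβ α Cα qlo qhi γ cγ κ l₀ b) (hβ : 0 < β)
    (hK : 1 ≤ K) : ObsLaw (fun k => extend (M.f k)) κ (M.lawP.map RoundP.obs) := by
  have hK0 : (0 : ℝ) < K := by exact_mod_cast hK
  refine TransferBandit.obsLaw_source M (fun k => (continuous_extend hβ (h.smooth k)).measurable)
    (fun k x hx => extend_of_mem _ hx) fun k x hx => ?_
  rw [div_le_iff₀ hK0, mul_comm]
  exact h.explore k x (h.cube_subset hx)

/-- The factor in front of the rate. -/
def rateFactor (θ : Tuning) (d K : ℕ) (Cβ α Cα qlo κ₀ Λ lQ : ℝ) : ℝ :=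
  secondFactor K d θ.Chi α (max Cα 1) qlo
    (leadWeight (gapFactor θ.Chi θ.βlo (κ₀ / (16 * K)) (√(2 * (16 * K / κ₀)) * θ.Chi))
      (shiftConst θ d Cβ) θ.βlo Λ) Λ lQ

/-- The event that the source data are not suitable for the second stage. -/
def badSource (φ : RoundP d K → Obs d K) (I : Finset ℕ) (L lP : ℕ) (κ κ₀ c γ n : ℝ) :
    Set (ℕ → RoundP d K) :=
  {u | ∃ B : Bin d, B.1 ≤ L ∧ ∃ k : Fin K,
      16 * K / κ₀ * Real.log n ≤ (hitsBin I (fun i => φ (u i)) B).card ∧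
      ((hits I (fun i => φ (u i)) B k).card : ℝ) <
        κ / (4 * K) * (hitsBin I (fun i => φ (u i)) B).card} ∪
  {u | ∃ l < lP, ∃ B ∈ binsAt d l, ∃ k : Fin K, ((hits I (fun i => φ (u i)) B k).card : ℝ) ≤
      I.card * (κ / K * (c * (2 : ℝ) ^ (-(l * (d + γ))))) / 4}

/-- The event that the data of the first stage are not accurate. -/
def badFirst {Ω : Type*} (φ : Ω → Obs d K) (f : Fin K → Cov d → ℝ) (θ : Tuning) (nQ nP : ℕ)
    (b : ℝ) : Set (ℕ → Ω) :=
  {u | ¬ (Accurate (obsList φ (sampleSize θ d nQ nP) u) f (level₁ θ d nQ nP)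
        (b / 80 * (2 : ℝ) ^ (-(θ.βhi * level₁ θ d nQ nP))) ∧
      Accurate (obsList φ (sampleSize θ d nQ nP) u) f (level₂ θ d nQ nP)
        (b / 80 * (2 : ℝ) ^ (-(θ.βhi * level₁ θ d nQ nP))))}

theorem stepP_le {c : ℝ} (hθ : θ.Valid) (hd : 1 ≤ d)
    (hL : LargeSample θ d K Cβ κ₀ c b l₀ (nMax nQ nP)) :
    stepP θ d nQ nP ≤ nP ∧ (nP : ℝ) / 2 ≤ ((nP - stepP θ d nQ nP : ℕ) : ℝ) := by
  have h1 := hL.sampleSize_le hθ hd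
  unfold stepP
  split_ifs with h
  · have h2 : nMax nQ nP = nP := by unfold nMax; rw [max_eq_right h.le]
    rw [h2] at h1
    have h3 : sampleSize θ d nQ nP ≤ nP := by
      have : (sampleSize θ d nQ nP : ℝ) ≤ nP := by
        linarith [(Nat.cast_nonneg nP : (0 : ℝ) ≤ nP)]
      exact_mod_cast this
    refine ⟨h3, ?_⟩
    rw [Nat.cast_sub h3]; linarith
  · refine ⟨Nat.zero_le _, ?_⟩
    rw [Nat.sub_zero]
    linarith [(Nat.cast_nonneg nP : (0 : ℝ) ≤ nP)]

/-- The number of observations expected in the bins of a level below `lP`. -/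
theorem source_count_ge (hθ : θ.Valid) (hd : 1 ≤ d) (hK : 1 ≤ K) {c C : ℝ} (hc : 0 < c)
    (hκ : 0 ≤ κ) (hL : LargeSample θ d K Cβ κ₀ c b l₀ (nMax nQ nP)) {l : ℕ}
    (hl : (2 : ℝ) ^ (l * (2 * β + d + γ)) * (sourceConst K C c * Real.log (nMax nQ nP)) ≤ κ * nP) :
    (2 / C ^ 2 + 4) * Real.log (nMax nQ nP) * (2 : ℝ) ^ (2 * (l * β)) ≤
      ((nP - stepP θ d nQ nP : ℕ) : ℝ) * (κ / K * (c * (2 : ℝ) ^ (-(l * (d + γ))))) / 4 := by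
  have hK0 : (0 : ℝ) < K := by exact_mod_cast hK
  have h1 := (stepP_le hθ hd hL).2
  have h2 : (2 : ℝ) ^ (2 * (l * β)) =
      (2 : ℝ) ^ (l * (2 * β + d + γ)) * (2 : ℝ) ^ (-(l * (d + γ))) := by
    rw [← Real.rpow_add (by norm_num)]; congr 1; ring
  -- The first factor of `h2` is bounded through `hl`, the second is the mass of a bin. The `8` in
  -- `sourceConst` combines the `4` of the lower tail with the half of the source sample that may be
  -- gone after the first stage.
  calc (2 / C ^ 2 + 4) * Real.log (nMax nQ nP) * (2 : ℝ) ^ (2 * (l * β))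
      = (2 : ℝ) ^ (l * (2 * β + d + γ)) * (sourceConst K C c * Real.log (nMax nQ nP)) *
        (c / (8 * K) * (2 : ℝ) ^ (-(l * (d + γ)))) := by
        rw [h2]; unfold sourceConst; field_simp
    _ ≤ κ * nP * (c / (8 * K) * (2 : ℝ) ^ (-(l * (d + γ)))) := by gcongr
    _ = nP / 2 * (κ / K * (c * (2 : ℝ) ^ (-(l * (d + γ))))) / 4 := by field_simp; ring
    _ ≤ _ := by gcongr

variable {f : Fin K → Cov d → ℝ}

/-- On the complement of the bad events the second stage has small regret. -/
theorem second_stage_le_of_good (hθ : θ.Valid) (hd : 1 ≤ d) (hK : 1 ≤ K)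
    (htie : ∀ s : Finset (Fin K), s.Nonempty → tie s ∈ s) (hCβ : 0 < Cβ) (hChi : Cβ ≤ θ.Chi)
    (hα : 0 ≤ α) (hqlo : 0 < qlo) (hκ₀ : 0 < κ₀) (hb : 0 < b) {c : ℝ}
    (hc : 0 < c) (hL : LargeSample θ d K Cβ κ₀ c (min 1 b) l₀ (nMax nQ nP))
    (hβ : β ∈ Set.Icc θ.βlo θ.βhi) (hαβ : α * β ≤ d) (hκ : κ ∈ Set.Icc κ₀ 1)
    (h : InClass M β Cβ α Cα qlo qhi γ cγ κ l₀ b) (hf : f = fun k => extend (M.f k)) {lP lQ : ℕ}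
    (hlP : ∀ l < lP, (2 : ℝ) ^ (l * (2 * β + d + γ)) *
      (sourceConst K θ.Chi c * Real.log (nMax nQ nP)) ≤ κ * nP)
    (hlQ : (2 : ℝ) ^ (lQ * (2 * β + d)) ≤ nQ) {u : ℕ → RoundP d K} {u' : ℕ → RoundQ d K}
    (hu : u ∉ badSource RoundP.obs (Finset.Ico (stepP θ d nQ nP) nP)
      (maxLevel θ.βlo (nMax nQ nP)) lP κ κ₀ c γ (nMax nQ nP))
    (hu1 : nQ < nP → u ∉ badFirst RoundP.obs f θ nQ nP (min 1 b))
    (hu2 : ¬ nQ < nP → u' ∉ badFirst uniformObs f θ nQ nP (min 1 b)) {N : ℕ} (hN : N ≤ nQ) :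
    ∫⁻ v, ENNReal.ofReal (∑ s ∈ Finset.range N,
        (fMax f (covs v s) - f ((secondStage θ tie nQ nP (obsList RoundP.obs nP u) u').arm
          ((secondStage θ tie nQ nP (obsList RoundP.obs nP u) u').run (covs v) (rews v) s)
            (covs v s)) (covs v s))) ∂(Measure.infinitePi (fun _ : ℕ => M.lawQ)) ≤
      ENNReal.ofReal (nQ * rateFactor θ d K Cβ α Cα qlo κ₀ (Real.log (nMax nQ nP)) lQ *
        (2 : ℝ) ^ (-(((max lP lQ : ℕ) : ℝ) * (β * (1 + α))))) +
      ENNReal.ofReal (N / nMax nQ nP ^ 4) * initPot (Finset.Ico (stepP θ d nQ nP) nP) f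
        (fun m => 4 * √(2 * Real.log (nMax nQ nP) / m)) (maxLevel θ.βlo (nMax nQ nP)) (nQ + nP)
        (fun i => RoundP.obs (u i)) +
      N * (ENNReal.ofReal (N / nMax nQ nP ^ 4) * (2 * ((nQ + nP : ℕ) : ENNReal))) := by
  have hK0 : (0 : ℝ) < K := by exact_mod_cast hK
  have hK1 : (1 : ℝ) ≤ K := by exact_mod_cast hK
  have := M.probQX
  have hn := one_le_nMax hL.log_ge
  have hβ0 : 0 < β := hθ.lo_pos.trans_le hβ.1
  have hβ1 : β ≤ 1 := hβ.2.trans hθ.hi_le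
  have hC0 : 0 < θ.Chi := hCβ.trans_le hChi
  have hstep := stepP_le hθ hd hL
  have hfM : ∀ k, ∀ x ∈ cube d, f k x = M.f k x := fun k x hx => by rw [hf]; exact extend_of_mem _ hx
  have hhol : ∀ k, IsHolder β Cβ (f k) := fun k => by rw [hf]; exact holder_extend (h.smooth k)
  have hfm : ∀ k, Measurable (f k) := fun k => by
    rw [hf]; exact (continuous_extend hβ0 (h.smooth k)).measurable
  set S := secondStage θ tie nQ nP (obsList RoundP.obs nP u) u' with hSdef
  have hSn : S.n = nMax nQ nP := rfl
  have hSC : S.C = θ.Chi := rfl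
  have hSD : S.D = (obsList RoundP.obs nP u).drop (stepP θ d nQ nP) := rfl
  have hSβ : S.β = smoothnessEstimate θ nQ nP (estimationData θ nQ nP (obsList RoundP.obs nP u)
    (obsList uniformObs (stepQ θ d nQ nP) u')) := rfl
  have hacc : Accurate (estimationData θ nQ nP (obsList RoundP.obs nP u)
      (obsList uniformObs (stepQ θ d nQ nP) u')) f (level₁ θ d nQ nP)
        (min 1 b / 80 * (2 : ℝ) ^ (-(θ.βhi * level₁ θ d nQ nP))) ∧
      Accurate (estimationData θ nQ nP (obsList RoundP.obs nP u)
      (obsList uniformObs (stepQ θ d nQ nP) u')) f (level₂ θ d nQ nP)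
        (min 1 b / 80 * (2 : ℝ) ^ (-(θ.βhi * level₁ θ d nQ nP))) := by
    unfold estimationData
    by_cases hlt : nQ < nP
    · have h1 : sampleSize θ d nQ nP ≤ nP := by
        have := hstep.1
        unfold stepP at this
        rwa [if_pos hlt] at this
      rw [if_pos hlt, take_obsList h1]
      exact not_not.1 (hu1 hlt)
    · have h1 : stepQ θ d nQ nP = sampleSize θ d nQ nP := if_neg hlt
      rw [if_neg hlt, h1, take_obsList le_rfl]
      exact not_not.1 (hu2 hlt)
  have hmin : 0 < min 1 b := lt_min one_pos hb
  have hsmooth := hL.smoothness hθ hβ hCβ hmin (min_le_left _ _) hK hhol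
    (fun l hl => by rw [hf]; exact h.osc hβ0 hb l hl) hacc.1 hacc.2
  rw [← hSβ] at hsmooth
  have hS : S.Valid := ⟨hn, hC0, hθ.lo_pos.trans_le hsmooth.2.1, htie⟩
  have hcountEq : ∀ (B : Bin d) (k : Fin K), S.count B k =
      (hits (Finset.Ico (stepP θ d nQ nP) nP) (fun i => RoundP.obs (u i)) B k).card :=
    fun B k => Stage.count_eq hSD B k
  have hκ0 : 0 ≤ κ := hκ₀.le.trans hκ.1
  have hmain := second_stage_le (M := M) hK hS hfm (N := N) (c₇ := 16 * K / κ₀) (c₈ := shiftConst θ d Cβ)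
    (ρ := κ₀ / (16 * K)) (α := α) (A₁ := max Cα 1) (qlo := qlo) (X := nQ) (lP := lP) (lQ := lQ)
    hθ.lo_pos hsmooth.2.1 hsmooth.1 hβ1 hCβ hChi hhol
    (fun x _ j k => by
      rw [hf]
      linarith [(extend_mem_Icc M j x).2, (extend_mem_Icc M k x).1])
    hL.log_ge_sq hL.log_ge (by positivity) (by positivity) (by
      rw [div_le_iff₀ (by positivity)]
      linarith [hκ.1.trans hκ.2]) (shiftConst_nonneg hθ hCβ) hsmooth.2.2
    -- If arm `k` alone exceeds the threshold, so does the bin, and arm `j` has its share `κ / (4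
    -- K)` of it; the choice `ρ = κ₀ / (16 K)` makes `4 ρ` at most this share.
    (fun B hB k j hk => by
      by_contra hcon
      push Not at hcon
      refine hu (Or.inl ⟨B, hB, j, ?_, ?_⟩)
      · refine hk.trans ?_
        rw [hcountEq]
        exact_mod_cast Finset.card_le_card (hits_subset_hitsBin _ _ B k)
      · rw [← hcountEq]
        refine hcon.trans_le ?_
        have e1 : (S.count B k : ℝ) ≤
            (hitsBin (Finset.Ico (stepP θ d nQ nP) nP) (fun i => RoundP.obs (u i)) B).card := by
          rw [hcountEq]
          exact_mod_cast Finset.card_le_card (hits_subset_hitsBin _ _ B k)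
        calc 4 * (κ₀ / (16 * K)) * (S.count B k : ℝ) = κ₀ / (4 * K) * S.count B k := by
              field_simp; ring
          _ ≤ _ := by
              have := hκ.1
              gcongr)
    (fun B hB k => by
      by_contra hcon
      push Not at hcon
      refine hu (Or.inr ⟨B.1, hB, B, mem_binsAt.2 rfl, k, ?_⟩)
      rw [← hcountEq, Nat.card_Ico]
      have e1 := source_count_ge (C := θ.Chi) hθ hd hK hc hκ0 hL (hlP B.1 hB)
      refine hcon.le.trans (le_trans ?_ e1)
      rw [S.need_eq, hSn, hSC]
      have e2 : (2 : ℝ) ^ (2 * (S.β * B.1)) ≤ (2 : ℝ) ^ (2 * (B.1 * β)) := by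
        refine Real.rpow_le_rpow_of_exponent_le (by norm_num) ?_
        have : S.β * (B.1 : ℝ) ≤ β * B.1 := by gcongr; exact hsmooth.1
        linarith
      have e3 : 0 < Real.log (nMax nQ nP) := by linarith [hL.log_ge]
      calc 2 * Real.log (nMax nQ nP) / θ.Chi ^ 2 * (2 : ℝ) ^ (2 * (S.β * B.1))
          ≤ 2 * Real.log (nMax nQ nP) / θ.Chi ^ 2 * (2 : ℝ) ^ (2 * (B.1 * β)) := by gcongr
        _ = (2 / θ.Chi ^ 2 + 0) * Real.log (nMax nQ nP) * (2 : ℝ) ^ (2 * (B.1 * β)) := by ring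
        _ ≤ _ := by gcongr; norm_num)
    (Mx := nQ + nP) (by
      rw [hSD, List.length_drop, length_obsList]
      omega) (by
      rw [hSn]
      unfold nMax
      have : nQ + nP ≤ 2 * max nQ nP := by omega
      exact_mod_cast this)
    h.generic (by
      have hc : ∀ᵐ x ∂M.QX, x ∈ cube d := by rw [ae_iff]; exact M.QX_cube
      filter_upwards [hc, ae_all_iff.2 M.meanQ] with x hx hm k
      rw [hm k, hfM k x hx])
    (zero_le_one.trans (le_max_right _ _)) hαβ hqlo h.mass_target
    (fun w hw => h.margin.gapRegion_le M.QX_cube hfM hα hw) hlQ (by exact_mod_cast hN)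
  rw [Stage.noisePot_zero hSD] at hmain
  exact hmain

end RegretBound

/-! ### Probability of the bad events and the total expected regret for large samples. -/

section ExpectedRegret

variable {d K : ℕ} {M : Model d K} {β Cβ α Cα qlo qhi γ cγ κ κ₀ b : ℝ} {l₀ : ℕ} {θ : Tuning}
  {tie : Finset (Fin K) → Fin K} {nQ nP : ℕ}

theorem measure_badSource_le (hd : 1 ≤ d) (hK : 1 ≤ K) (hθ : θ.Valid) (hqlo : 0 < qlo)
    (hcγ : 0 < cγ) (hκ₀ : 0 < κ₀) (hβ : β ∈ Set.Icc θ.βlo θ.βhi) (hγ : γ ∈ Set.Icc 0 θ.γhi)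
    (hκ : κ ∈ Set.Icc κ₀ 1) (h : InClass M β Cβ α Cα qlo qhi γ cγ κ l₀ b)
    (hL : LargeSample θ d K Cβ κ₀ (massConst d qlo cγ θ.γhi) (min 1 b) l₀ (nMax nQ nP)) {lP : ℕ}
    (hlP : ∀ l < lP, (2 : ℝ) ^ (l * (2 * β + d + γ)) *
      (sourceConst K θ.Chi (massConst d qlo cγ θ.γhi) * Real.log (nMax nQ nP)) ≤ κ * nP) :
    Measure.infinitePi (fun _ : ℕ => M.lawP) (badSource RoundP.obs
      (Finset.Ico (stepP θ d nQ nP) nP) (maxLevel θ.βlo (nMax nQ nP)) lP κ κ₀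
      (massConst d qlo cγ θ.γhi) γ (nMax nQ nP)) ≤
      ENNReal.ofReal ((2 / θ.βlo + 2) * 2 ^ d * K / nMax nQ nP ^ 2 + 2 * K / nMax nQ nP ^ 2) := by
  have hn := one_le_nMax hL.log_ge
  have hβ0 : 0 < β := hθ.lo_pos.trans_le hβ.1
  have hP := M.isProbabilityMeasure_lawP
  have hlo := hθ.lo_pos
  have hlaw := h.obsLaw_source hβ0 hK
  have hκ0 : 0 ≤ κ := hκ₀.le.trans hκ.1
  have hc : 0 < massConst d qlo cγ θ.γhi := lt_min one_pos (by positivity)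
  have hnP : (nP : ℝ) ≤ nMax nQ nP := by unfold nMax; exact_mod_cast le_max_right nQ nP
  have hK1 : (1 : ℝ) ≤ K := by exact_mod_cast hK
  refine (measure_union_le _ _).trans ?_
  rw [ENNReal.ofReal_add (by positivity) (by positivity)]
  refine add_le_add ?_ ?_
  · refine measure_unbalanced_le' measurable_obs hlaw hκ₀ hκ.1 hK _ _ hn ?_
      (maxLevel_le hθ.lo_pos hn.le)
    rw [Nat.card_Ico]
    refine le_trans ?_ hnP
    exact_mod_cast Nat.sub_le nP _
  · refine measure_few_hits_le measurable_obs hlaw hκ0 _ lP hn hγ.1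
      (fun B => h.mass_obs_source hcγ.le hqlo.le hγ.2 le_rfl B) (fun l hl => ?_) (fun l hl => ?_) hd
    · rw [Nat.card_Ico]
      refine le_trans ?_ (source_count_ge (C := θ.Chi) hθ hd hK hc hκ0 hL (hlP l hl))
      have e1 : (1 : ℝ) ≤ (2 : ℝ) ^ (2 * (l * β)) :=
        Real.one_le_rpow (by norm_num) (by positivity)
      have e2 : 0 ≤ 2 / θ.Chi ^ 2 := by positivity
      have e3 := hL.log_ge
      have e4 : 4 * Real.log (nMax nQ nP) ≤ (2 / θ.Chi ^ 2 + 4) * Real.log (nMax nQ nP) := by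
        gcongr; linarith
      have e5 : 0 ≤ (2 / θ.Chi ^ 2 + 4) * Real.log (nMax nQ nP) := by positivity
      nlinarith
    · have e1 : (1 : ℝ) ≤ sourceConst K θ.Chi (massConst d qlo cγ θ.γhi) * Real.log (nMax nQ nP) := by
        refine one_le_mul_of_one_le_of_one_le ?_ hL.log_ge
        unfold sourceConst
        rw [le_div_iff₀ hc, one_mul]
        have e2 : 0 ≤ 2 / θ.Chi ^ 2 := by positivity
        have e3 : massConst d qlo cγ θ.γhi ≤ 1 := min_le_left _ _
        nlinarith
      have e2 := hlP l hl
      have e3 : (2 : ℝ) ^ (l * (d + γ)) ≤ (2 : ℝ) ^ (l * (2 * β + d + γ)) := by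
        refine Real.rpow_le_rpow_of_exponent_le (by norm_num) ?_
        gcongr
        linarith
      have e4 : κ * nP ≤ 1 * nP := by gcongr; exact hκ.2
      have e5 : (2 : ℝ) ^ (l * (2 * β + d + γ)) ≤ (2 : ℝ) ^ (l * (2 * β + d + γ)) *
          (sourceConst K θ.Chi (massConst d qlo cγ θ.γhi) * Real.log (nMax nQ nP)) :=
        le_mul_of_one_le_right (by positivity) e1
      linarith

theorem rateFactor_nonneg {Λ lQ : ℝ} (hqlo : 0 < qlo) (hκ₀ : 0 < κ₀) (hK : 1 ≤ K)
    (hC0 : 0 < θ.Chi) (hΛ : 1 ≤ Λ) (hlQ : 0 ≤ lQ) :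
    0 ≤ rateFactor θ d K Cβ α Cα qlo κ₀ Λ lQ := by
  have e2 : (0 : ℝ) < K := by exact_mod_cast hK
  have e3 : 0 ≤ leadWeight (gapFactor θ.Chi θ.βlo (κ₀ / (16 * K)) (√(2 * (16 * K / κ₀)) * θ.Chi))
      (shiftConst θ d Cβ) θ.βlo Λ := by
    have e4 := one_le_gapFactor (βlo := θ.βlo) (ρ := κ₀ / (16 * K))
      (cA := √(2 * (16 * K / κ₀)) * θ.Chi) hC0 (by positivity)
    have e5 : (0 : ℝ) ≤ (2 : ℝ) ^ shiftConst θ d Cβ * Λ := by positivity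
    have e6 := Real.rpow_nonneg e5 (1 / θ.βlo + 1)
    unfold leadWeight
    exact mul_nonneg (by linarith) e6
  have e7 : 0 ≤ max Cα 1 := zero_le_one.trans (le_max_right _ _)
  unfold rateFactor secondFactor
  have e8 := Real.rpow_nonneg e3 (1 + α)
  positivity

/-- All losses from bad events are of order `q / n`. This is below the rate because the exponent of
the rate does not exceed one. -/
theorem rest_le {βlo n N q p : ℝ} (hlo : 0 < βlo) (hn : 1 ≤ n) (hN : 0 ≤ N) (hNq : N ≤ q)
    (hq : q ≤ n) (hp : p ≤ n) :
    N * ((2 / βlo + 2) * 2 ^ d * K / n ^ 2 + 2 * K / n ^ 2 + 2 ^ (d + 3) * K / n ^ 3) +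
      N * (2 ^ (d + 3) * K / n ^ 3) + N * (N / n ^ 4 * (2 * (q + p))) +
      q * (4 * (2 / βlo + 2) * K * 2 ^ d / n) ≤ q * (restConst βlo d K / n) := by
  have hn0 : 0 < n := by linarith
  have hq0 : 0 ≤ q := hN.trans hNq
  have hsq : ∀ a : ℝ, 0 ≤ a → a / n ^ 2 ≤ a / n := fun a ha => by
    gcongr
    nlinarith
  have hcu : ∀ a : ℝ, 0 ≤ a → a / n ^ 3 ≤ a / n := fun a ha => by
    gcongr
    exact le_self_pow₀ hn (by norm_num)
  have f1 := hsq ((2 / βlo + 2) * 2 ^ d * K) (by positivity)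
  have f2 := hsq (2 * K) (by positivity)
  have f3 := hcu (2 ^ (d + 3) * K) (by positivity)
  have f4 : N * (N / n ^ 4 * (2 * (q + p))) ≤ q * (4 / n) := by
    calc N * (N / n ^ 4 * (2 * (q + p))) ≤ N * (N / n ^ 4 * (2 * (2 * n))) := by
          gcongr; linarith
      _ ≤ q * (n / n ^ 4 * (2 * (2 * n))) := by
          have : N ≤ n := hNq.trans hq
          gcongr
      _ = q * (4 / n ^ 2) := by field_simp; ring
      _ ≤ _ := by
          have := hsq 4 (by norm_num)
          gcongr
  have f5 : N * ((2 / βlo + 2) * 2 ^ d * K / n ^ 2 + 2 * K / n ^ 2 + 2 ^ (d + 3) * K / n ^ 3) ≤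
      q * ((2 / βlo + 2) * 2 ^ d * K / n + 2 * K / n + 2 ^ (d + 3) * K / n) :=
    mul_le_mul hNq (by linarith) (by positivity) (by positivity)
  have f6 : N * (2 ^ (d + 3) * K / n ^ 3) ≤ q * (2 ^ (d + 3) * K / n) :=
    mul_le_mul hNq f3 (by positivity) (by positivity)
  have f7 : q * (restConst βlo d K / n) =
      q * ((2 / βlo + 2) * 2 ^ d * K / n + 2 * K / n + 2 ^ (d + 3) * K / n) +
        q * (2 ^ (d + 3) * K / n) + q * (4 / n) +
        q * (4 * (2 / βlo + 2) * K * 2 ^ d / n) := by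
    unfold restConst; ring
  rw [f7]
  linarith

/-- The first stage uses one sample only, so one of its two bad events is empty. The source sample,
the exploration rounds and the later target rounds are integrated in this order from the outside, so
good data are fixed before the second stage is averaged. -/
theorem expectedRegret_le_of_large (hθ : θ.Valid) (hd : 1 ≤ d) (hK : 1 ≤ K)
    (htie : ∀ s : Finset (Fin K), s.Nonempty → tie s ∈ s) (hCβ : 0 < Cβ) (hChi : Cβ ≤ θ.Chi)
    (hα : 0 ≤ α) (hqlo : 0 < qlo) (hcγ : 0 < cγ) (hcγ1 : cγ ≤ 1) (hκ₀ : 0 < κ₀) (hb : 0 < b)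
    (hL : LargeSample θ d K Cβ κ₀ (massConst d qlo cγ θ.γhi) (min 1 b) l₀ (nMax nQ nP))
    (hβ : β ∈ Set.Icc θ.βlo θ.βhi) (hαβ : α * β ≤ d) (hγ : γ ∈ Set.Icc 0 θ.γhi)
    (hκ : κ ∈ Set.Icc κ₀ 1) (h : InClass M β Cβ α Cα qlo qhi γ cγ κ l₀ b) {lP lQ : ℕ}
    (hlP : ∀ l < lP, (2 : ℝ) ^ (l * (2 * β + d + γ)) *
      (sourceConst K θ.Chi (massConst d qlo cγ θ.γhi) * Real.log (nMax nQ nP)) ≤ κ * nP)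
    (hlQ : (2 : ℝ) ^ (lQ * (2 * β + d)) ≤ nQ) :
    M.expectedRegret (adaptivePolicy θ tie nQ nP) nQ nP ≤
      ENNReal.ofReal ((min nQ (stepQ θ d nQ nP) : ℕ) +
        nQ * rateFactor θ d K Cβ α Cα qlo κ₀ (Real.log (nMax nQ nP)) lQ *
          (2 : ℝ) ^ (-(((max lP lQ : ℕ) : ℝ) * (β * (1 + α)))) +
        nQ * (restConst θ.βlo d K / nMax nQ nP)) := by
  have hn := one_le_nMax hL.log_ge
  have hn0 : 0 < nMax nQ nP := by linarith
  have hβ0 : 0 < β := hθ.lo_pos.trans_le hβ.1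
  have hlo := hθ.lo_pos
  have hC0 : 0 < θ.Chi := hCβ.trans_le hChi
  have hP := M.isProbabilityMeasure_lawP
  have hQ := M.isProbabilityMeasure_lawQ hK
  have hc : 0 < massConst d qlo cγ θ.γhi := lt_min one_pos (by positivity)
  have hc1 : massConst d qlo cγ θ.γhi ≤ 1 := min_le_left _ _
  have hmin : 0 < min 1 b := lt_min one_pos hb
  have hmin1 : min 1 b ≤ 1 := min_le_left _ _
  have hκ0 : 0 ≤ κ := hκ₀.le.trans hκ.1
  have hnP : (nP : ℝ) ≤ nMax nQ nP := by unfold nMax; exact_mod_cast le_max_right nQ nP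
  have hnQ : (nQ : ℝ) ≤ nMax nQ nP := by unfold nMax; exact_mod_cast le_max_left nQ nP
  have hT : (sampleSize θ d nQ nP : ℝ) ≤ nMax nQ nP :=
    (hL.sampleSize_le hθ hd).trans (by linarith)
  have hfm : ∀ k, Measurable (extend (M.f k)) := fun k =>
    (continuous_extend hβ0 (h.smooth k)).measurable
  set f : Fin K → Cov d → ℝ := fun k => extend (M.f k) with hf
  have hfM : ∀ k, ∀ x ∈ cube d, f k x = M.f k x := fun k x hx => extend_of_mem _ hx
  have hlawP : ObsLaw f κ (M.lawP.map RoundP.obs) := h.obsLaw_source hβ0 hK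
  have hlawQ : ObsLaw f 1 (M.lawQ.map uniformObs) := obsLaw_uniform M hK hfm hfM
  refine (expectedRegret_le M hK hfM).trans ?_
  set N := nQ - stepQ θ d nQ nP with hN
  have hNQ : N ≤ nQ := Nat.sub_le _ _
  have hNn : (N : ℝ) ≤ nQ := by exact_mod_cast hNQ
  set n := nMax nQ nP
  set I := Finset.Ico (stepP θ d nQ nP) nP with hI
  set L := maxLevel θ.βlo n
  set lams : ℕ → ℝ := fun m => 4 * √(2 * Real.log n / m)
  set B₁ : Set (ℕ → RoundP d K) := badSource RoundP.obs I L lP κ κ₀ (massConst d qlo cγ θ.γhi) γ n ∪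
    {u | nQ < nP ∧ u ∈ badFirst RoundP.obs f θ nQ nP (min 1 b)}
  set B₂ : Set (ℕ → RoundQ d K) := {u | ¬ nQ < nP ∧ u ∈ badFirst uniformObs f θ nQ nP (min 1 b)}
  set R : ℝ := nQ * rateFactor θ d K Cβ α Cα qlo κ₀ (Real.log n) lQ *
    (2 : ℝ) ^ (-(((max lP lQ : ℕ) : ℝ) * (β * (1 + α)))) with hR
  have hsplit := lintegral_lintegral_le_of_good (μ := Measure.infinitePi (fun _ : ℕ => M.lawP))
    (ν := Measure.infinitePi (fun _ : ℕ => M.lawQ)) (N := (N : ENNReal)) (B₁ := B₁) (B₂ := B₂)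
    (A := ENNReal.ofReal R +
      N * (ENNReal.ofReal (N / n ^ 4) * (2 * ((nQ + nP : ℕ) : ENNReal))))
    (G := fun u => ENNReal.ofReal (N / n ^ 4) *
      initPot I f lams L (nQ + nP) (fun i => RoundP.obs (u i)))
    (F := fun u u' => ∫⁻ v, ENNReal.ofReal (∑ s ∈ Finset.range N,
        (fMax f (covs v s) - f ((secondStage θ tie nQ nP (obsList RoundP.obs nP u) u').arm
          ((secondStage θ tie nQ nP (obsList RoundP.obs nP u) u').run (covs v) (rews v) s)
            (covs v s)) (covs v s))) ∂(Measure.infinitePi (fun _ : ℕ => M.lawQ)))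
    (fun u u' => by
      refine (lintegral_mono (g := fun _ => (N : ENNReal)) fun v => ?_).trans (by simp)
      rw [← ENNReal.ofReal_natCast]
      refine ENNReal.ofReal_le_ofReal ?_
      refine (Finset.sum_le_sum fun s _ => fMax_sub_le_one M _ (covs v s)).trans ?_
      simp)
    (fun u hu u' hu' => by
      refine (second_stage_le_of_good hθ hd hK htie hCβ hChi hα hqlo hκ₀ hb hc hL hβ hαβ hκ h hf hlP
        hlQ (fun h1 => hu (Or.inl h1)) (fun h1 h2 => hu (Or.inr ⟨h1, h2⟩))
        (fun h1 h2 => hu' ⟨h1, h2⟩) hNQ).trans (le_of_eq ?_)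
      rw [add_right_comm])
  have hB₁ : Measure.infinitePi (fun _ : ℕ => M.lawP) B₁ ≤ ENNReal.ofReal
      (((2 / θ.βlo + 2) * 2 ^ d * K / n ^ 2 + 2 * K / n ^ 2) + 2 ^ (d + 3) * K / n ^ 3) := by
    refine (measure_union_le _ _).trans ?_
    rw [ENNReal.ofReal_add (by positivity) (by positivity)]
    refine add_le_add (measure_badSource_le hd hK hθ hqlo hcγ hκ₀ hβ hγ hκ h hL hlP) ?_
    by_cases hlt : nQ < nP
    · have hg : gammaEff θ nQ nP = θ.γhi := if_pos hlt
      refine (measure_mono fun u hu => hu.2).trans (measure_first_stage_le measurable_obs hfm hlawP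
        hκ0 hκ.2 hK hθ hn.le hL.log_ge hT hc.le hc1 (e₀ := min 1 b / 80) (by positivity)
        (by linarith) (fun B => ?_) (hL.count' hθ hc.le hκ.1))
      rw [hg]
      exact h.mass_obs_source hcγ.le hqlo.le hγ.2 hγ.2 B
    · have : {u : ℕ → RoundP d K | nQ < nP ∧ u ∈ badFirst RoundP.obs f θ nQ nP (min 1 b)} = ∅ := by
        ext u; simp [hlt]
      rw [this, measure_empty]
      exact zero_le
  have hB₂ : Measure.infinitePi (fun _ : ℕ => M.lawQ) B₂ ≤
      ENNReal.ofReal (2 ^ (d + 3) * K / n ^ 3) := by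
    by_cases hlt : nQ < nP
    · have : B₂ = ∅ := by
        ext u; simp [B₂, hlt]
      rw [this, measure_empty]
      exact zero_le
    · have hg : gammaEff θ nQ nP = 0 := if_neg hlt
      refine (measure_mono fun u hu => hu.2).trans (measure_first_stage_le measurable_uniformObs hfm
        hlawQ zero_le_one le_rfl hK hθ hn.le hL.log_ge hT hc.le hc1 (e₀ := min 1 b / 80)
        (by positivity) (by linarith) (fun B => ?_) (hL.count' hθ hc.le (hκ.1.trans hκ.2)))
      rw [hg]
      exact h.mass_obs_target hK hcγ1 hqlo.le hθ.γ_nonneg B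
  have hG : ∫⁻ u, ENNReal.ofReal (N / n ^ 4) *
      initPot I f lams L (nQ + nP) (fun i => RoundP.obs (u i))
        ∂(Measure.infinitePi (fun _ : ℕ => M.lawP)) ≤
      ENNReal.ofReal (nQ * (4 * (2 / θ.βlo + 2) * K * 2 ^ d / n)) := by
    rw [lintegral_const_mul' _ _ ENNReal.ofReal_ne_top]
    calc _ ≤ ENNReal.ofReal (N / n ^ 4) *
          ENNReal.ofReal ((nQ + nP : ℕ) * (L + 1) * (2 * K * I.card * 2 ^ d)) :=
          mul_le_mul_right (lintegral_initPot_le measurable_obs hfm hlawP I lams L (nQ + nP)) _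
      _ ≤ _ := by
          rw [← ENNReal.ofReal_mul (by positivity)]
          refine ENNReal.ofReal_le_ofReal ?_
          have e1 : ((nQ + nP : ℕ) : ℝ) ≤ 2 * n := by push_cast; linarith
          have e2 := maxLevel_le hlo hn.le
          have e3 : (I.card : ℝ) ≤ n := by
            rw [hI, Nat.card_Ico]
            refine le_trans ?_ hnP
            exact_mod_cast Nat.sub_le nP _
          calc _ ≤ nQ / n ^ 4 * ((2 * n) * ((2 / θ.βlo + 2) * n) * (2 * K * n * 2 ^ d)) := by
                gcongr
            _ = _ := by field_simp; ring
  refine (add_le_add le_rfl (hsplit.trans (add_le_add (add_le_add (mul_le_mul_right hB₁ _)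
    (mul_le_mul_right hB₂ _)) (add_le_add le_rfl hG)))).trans ?_
  have hrate := rateFactor_nonneg (d := d) (K := K) (Cβ := Cβ) (α := α) (Cα := Cα) (qlo := qlo)
    hqlo hκ₀ hK hC0 hL.log_ge (Nat.cast_nonneg lQ)
  have hR0 : 0 ≤ R := by positivity
  have hNN : (N : ENNReal) = ENNReal.ofReal N := (ENNReal.ofReal_natCast N).symm
  have h2 : (2 : ENNReal) = ENNReal.ofReal 2 := by norm_num
  have hM : ((nQ + nP : ℕ) : ENNReal) = ENNReal.ofReal ((nQ + nP : ℕ) : ℝ) :=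
    (ENNReal.ofReal_natCast _).symm
  have hm : ((min nQ (stepQ θ d nQ nP) : ℕ) : ENNReal) =
    ENNReal.ofReal ((min nQ (stepQ θ d nQ nP) : ℕ) : ℝ) := (ENNReal.ofReal_natCast _).symm
  rw [hNN, h2, hM, hm, ← ENNReal.ofReal_mul (by positivity), ← ENNReal.ofReal_mul (by positivity),
    ← ENNReal.ofReal_mul (by positivity), ← ENNReal.ofReal_mul (by positivity),
    ← ENNReal.ofReal_mul (by positivity), ← ENNReal.ofReal_add (by positivity) (by positivity),
    ← ENNReal.ofReal_add (by positivity) (by positivity),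
    ← ENNReal.ofReal_add (by positivity) (by positivity),
    ← ENNReal.ofReal_add (by positivity) (by positivity),
    ← ENNReal.ofReal_add (by positivity) (by positivity)]
  refine ENNReal.ofReal_le_ofReal ?_
  have hfin := rest_le (βlo := θ.βlo) (d := d) (K := K) hlo hn.le (Nat.cast_nonneg N) hNn hnQ hnP
  push_cast at hfin ⊢
  linarith

end ExpectedRegret

/-! ### Rates -/

section Rates

variable {d K : ℕ} {θ : Tuning} {β γ κ α : ℝ} {nQ nP : ℕ}

/-- The effective sample size. -/
def effSize (d nQ nP : ℕ) (β γ κ : ℝ) : ℝ :=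
  (nQ : ℝ) + (κ * nP) ^ ((d + 2 * β) / (d + 2 * β + γ))

theorem one_le_effSize (hQ : 1 ≤ nQ) (hκ : 0 ≤ κ) : 1 ≤ effSize d nQ nP β γ κ := by
  have h1 : (1 : ℝ) ≤ nQ := by exact_mod_cast hQ
  have h2 := Real.rpow_nonneg (mul_nonneg hκ (Nat.cast_nonneg nP)) ((d + 2 * β) / (d + 2 * β + γ))
  unfold effSize; linarith

theorem exponent_mem (hβ : 0 < β) (hγ : 0 ≤ γ) :
    (d + 2 * β) / (d + 2 * β + γ) ∈ Set.Icc (0 : ℝ) 1 := by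
  constructor
  · positivity
  · rw [div_le_one (by positivity)]; linarith

theorem effSize_le (hβ : 0 < β) (hγ : 0 ≤ γ) (hκ : 0 ≤ κ) (hκ1 : κ ≤ 1) (hn : 1 ≤ nMax nQ nP) :
    effSize d nQ nP β γ κ ≤ 2 * nMax nQ nP := by
  have h0 := exponent_mem (d := d) hβ hγ
  have h1 : (nQ : ℝ) ≤ nMax nQ nP := by unfold nMax; exact_mod_cast le_max_left nQ nP
  have h2 : (nP : ℝ) ≤ nMax nQ nP := by unfold nMax; exact_mod_cast le_max_right nQ nP
  have h3 : κ * nP ≤ nMax nQ nP := by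
    have := (Nat.cast_nonneg nP : (0 : ℝ) ≤ nP)
    nlinarith
  have h4 : (κ * nP) ^ ((d + 2 * β) / (d + 2 * β + γ)) ≤ nMax nQ nP := by
    calc _ ≤ nMax nQ nP ^ ((d + 2 * β) / (d + 2 * β + γ)) :=
          Real.rpow_le_rpow (by positivity) h3 h0.1
      _ ≤ nMax nQ nP ^ (1 : ℝ) := Real.rpow_le_rpow_of_exponent_le hn h0.2
      _ = _ := Real.rpow_one _
  unfold effSize; linarith

/-- The exponent of the rate. -/
def rateExp (d : ℕ) (α β : ℝ) : ℝ := β * (1 + α) / (2 * β + d)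

/-- The upper bound is a reformulation of `α β ≤ d`. The margin `β / (2β + d)` below one pays for
the exploration rounds, whose number is at most `n ^ (βlo / (d + 2 βhi))` up to logarithms. -/
theorem rateExp_mem (hβ : 0 < β) (hα : 0 ≤ α) (hαβ : α * β ≤ d) :
    0 ≤ rateExp d α β ∧ rateExp d α β ≤ 1 - β / (2 * β + d) := by
  unfold rateExp
  constructor
  · positivity
  · have : 0 < 2 * β + d := by positivity
    rw [le_sub_iff_add_le, ← add_div, div_le_one this]
    nlinarith

theorem rpow_neg_ge {x y e : ℝ} (hx : 1 ≤ x) (hxy : x ≤ 2 * y) (hy : 1 ≤ y) (he : 0 ≤ e)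
    (he1 : e ≤ 1) : y ^ (-e) ≤ 2 * x ^ (-e) := by
  have hx0 : 0 < x := by linarith
  have hy0 : 0 < y := by linarith
  have h1 : (2 * y) ^ (-e) ≤ x ^ (-e) := Real.rpow_le_rpow_of_nonpos hx0 hxy (by linarith)
  rw [Real.mul_rpow (by norm_num) hy0.le] at h1
  have h2 : (2 : ℝ) ^ (-1 : ℝ) ≤ (2 : ℝ) ^ (-e) :=
    Real.rpow_le_rpow_of_exponent_le (by norm_num) (by linarith)
  rw [Real.rpow_neg_one] at h2
  have h3 : 0 < y ^ (-e) := Real.rpow_pos_of_pos hy0 _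
  nlinarith

theorem inv_le_rpow_neg {x y e : ℝ} (hx : 1 ≤ x) (hxy : x ≤ 2 * y) (hy : 1 ≤ y) (he : 0 ≤ e)
    (he1 : e ≤ 1) : 1 / y ≤ 2 * x ^ (-e) := by
  refine le_trans ?_ (rpow_neg_ge hx hxy hy he he1)
  rw [one_div, ← Real.rpow_neg_one]
  exact Real.rpow_le_rpow_of_exponent_le hy (by linarith)

/-- The level up to which the target data are used. -/
def targetLevel (d nQ : ℕ) (β : ℝ) : ℕ := ⌊Real.logb 2 nQ / (2 * β + d)⌋₊

/-- The level below which the source data suffice. -/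
def sourceLevel (y D : ℝ) : ℕ := if 1 ≤ y then ⌊Real.logb 2 y / D⌋₊ + 1 else 0

theorem targetLevel_spec (hβ : 0 < β) (hQ : 1 ≤ nQ) :
    (2 : ℝ) ^ (targetLevel d nQ β * (2 * β + d)) ≤ nQ ∧
      (nQ : ℝ) ≤ (2 : ℝ) ^ (2 * β + d) * (2 : ℝ) ^ (targetLevel d nQ β * (2 * β + d)) := by
  have h1 : (1 : ℝ) ≤ nQ := by exact_mod_cast hQ
  have hD : 0 < 2 * β + d := by positivity
  have hx : 0 ≤ Real.logb 2 nQ := Real.logb_nonneg (by norm_num) h1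
  have hq := two_rpow_logb (by linarith : (0 : ℝ) < nQ)
  have h2 := Nat.floor_le (div_nonneg hx hD.le)
  have h3 := Nat.lt_floor_add_one (Real.logb 2 nQ / (2 * β + d))
  rw [le_div_iff₀ hD] at h2
  rw [div_lt_iff₀ hD] at h3
  unfold targetLevel
  constructor
  · exact (Real.rpow_le_rpow_of_exponent_le (by norm_num) h2).trans hq.le
  · rw [← Real.rpow_add (by norm_num)]
    nth_rewrite 1 [← hq]
    exact Real.rpow_le_rpow_of_exponent_le (by norm_num) (by linarith)

theorem targetLevel_le (hβ : 0 < β) (hd : 1 ≤ d) (hQ : 1 ≤ nQ) :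
    (targetLevel d nQ β : ℝ) ≤ 2 * Real.log nQ := by
  have h1 : (1 : ℝ) ≤ nQ := by exact_mod_cast hQ
  have hd1 : (1 : ℝ) ≤ d := by exact_mod_cast hd
  have hD : 0 < 2 * β + d := by positivity
  have hx : 0 ≤ Real.logb 2 nQ := Real.logb_nonneg (by norm_num) h1
  have hl : 0 ≤ Real.log nQ := Real.log_nonneg h1
  have h2 := Nat.floor_le (div_nonneg hx hD.le)
  refine h2.trans ((div_le_self hx (by linarith)).trans ?_)
  unfold Real.logb
  have e1 := Real.log_two_gt_d9
  rw [div_le_iff₀ (by linarith)]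
  nlinarith

theorem sourceLevel_lt {y D : ℝ} (hD : 0 < D) {l : ℕ} (hl : l < sourceLevel y D) :
    (2 : ℝ) ^ (l * D) ≤ y := by
  unfold sourceLevel at hl
  split_ifs at hl with hy
  · have hx : 0 ≤ Real.logb 2 y := Real.logb_nonneg (by norm_num) hy
    have h1 : (l : ℝ) ≤ Real.logb 2 y / D := by
      have : l ≤ ⌊Real.logb 2 y / D⌋₊ := Nat.lt_succ_iff.1 hl
      calc (l : ℝ) ≤ (⌊Real.logb 2 y / D⌋₊ : ℝ) := by exact_mod_cast this
        _ ≤ _ := Nat.floor_le (by positivity)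
    rw [le_div_iff₀ hD] at h1
    rw [← two_rpow_logb (by linarith : (0 : ℝ) < y)]
    exact Real.rpow_le_rpow_of_exponent_le (by norm_num) h1
  · omega

/-- The `+ 1` makes `sourceLevel` the first level that is too fine for the source sample, hence the
reverse inequality there; if no level is admissible, then `y < 1` and level `0` will do. -/
theorem le_sourceLevel {y D : ℝ} (hD : 0 < D) : y ≤ (2 : ℝ) ^ (sourceLevel y D * D) := by
  unfold sourceLevel
  split_ifs with hy
  · have h3 := Nat.lt_floor_add_one (Real.logb 2 y / D)
    rw [div_lt_iff₀ hD] at h3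
    nth_rewrite 1 [← two_rpow_logb (by linarith : (0 : ℝ) < y)]
    refine Real.rpow_le_rpow_of_exponent_le (by norm_num) ?_
    push_cast
    exact h3.le
  · simp only [Nat.cast_zero, zero_mul, Real.rpow_zero]
    linarith

/-- The bias at the finest level reached by the data. -/
theorem rate_of_levels (hβ : 0 < β) (hβ1 : β ≤ 1) (hγ : 0 ≤ γ) (hκ : 0 ≤ κ) (hα : 0 ≤ α)
    (hαβ : α * β ≤ d) (hQ : 1 ≤ nQ) {s : ℝ} (hs : 1 ≤ s) :
    (2 : ℝ) ^ (-(((max (sourceLevel (κ * nP / s) (2 * β + d + γ)) (targetLevel d nQ β) : ℕ) : ℝ) *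
      (β * (1 + α)))) ≤ (2 ^ (d + 2) + s) * effSize d nQ nP β γ κ ^ (-rateExp d α β) := by
  have hD : 0 < 2 * β + d := by positivity
  have hs0 : 0 < s := by linarith
  set lP := sourceLevel (κ * nP / s) (2 * β + d + γ)
  set lQ := targetLevel d nQ β
  set top := max lP lQ with htop
  have h0 := exponent_mem (d := d) hβ hγ
  have hX := one_le_effSize (d := d) (nP := nP) (β := β) (γ := γ) hQ hκ
  have he := rateExp_mem (d := d) hβ hα hαβ
  have he1 : rateExp d α β ≤ 1 := he.2.trans (by
    have : 0 ≤ β / (2 * β + d) := by positivity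
    linarith)
  have hlev : ∀ l ≤ top, (2 : ℝ) ^ (l * (2 * β + d)) ≤ (2 : ℝ) ^ (top * (2 * β + d)) := by
    intro l hl
    refine Real.rpow_le_rpow_of_exponent_le (by norm_num) ?_
    gcongr
  have hq : (nQ : ℝ) ≤ 2 ^ (d + 2) * (2 : ℝ) ^ (top * (2 * β + d)) := by
    refine (targetLevel_spec (d := d) hβ hQ).2.trans ?_
    have e1 : (2 : ℝ) ^ (2 * β + d) ≤ 2 ^ (d + 2) := by
      rw [← Real.rpow_natCast]
      refine Real.rpow_le_rpow_of_exponent_le (by norm_num) ?_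
      push_cast; linarith
    exact mul_le_mul e1 (hlev lQ (le_max_right _ _)) (by positivity) (by positivity)
  -- The exponent of the effective sample size converts `2 ^ (lP (2β + d + γ))`, the source size
  -- needed per level, into `2 ^ (lP (2β + d))`, its equivalent in target data. As the exponent is
  -- at most one, the factor `s ≥ 1` does not grow.
  have hp : (κ * nP) ^ ((d + 2 * β) / (d + 2 * β + γ)) ≤ s * (2 : ℝ) ^ (top * (2 * β + d)) := by
    have e1 : κ * nP ≤ s * (2 : ℝ) ^ (lP * (2 * β + d + γ)) := by
      have := le_sourceLevel (y := κ * nP / s) (by positivity : 0 < 2 * β + d + γ)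
      rw [div_le_iff₀ hs0] at this
      linarith
    calc _ ≤ (s * (2 : ℝ) ^ (lP * (2 * β + d + γ))) ^ ((d + 2 * β) / (d + 2 * β + γ)) :=
          Real.rpow_le_rpow (by positivity) e1 h0.1
      _ = s ^ ((d + 2 * β) / (d + 2 * β + γ)) * (2 : ℝ) ^ (lP * (2 * β + d)) := by
          rw [Real.mul_rpow hs0.le (by positivity), ← Real.rpow_mul (by norm_num)]
          congr 2
          field_simp
          ring
      _ ≤ s ^ (1 : ℝ) * (2 : ℝ) ^ (top * (2 * β + d)) :=
          mul_le_mul (Real.rpow_le_rpow_of_exponent_le hs h0.2) (hlev lP (le_max_left _ _))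
            (by positivity) (by positivity)
      _ = _ := by rw [Real.rpow_one]
  have hsum : effSize d nQ nP β γ κ ≤ (2 ^ (d + 2) + s) * (2 : ℝ) ^ (top * (2 * β + d)) := by
    unfold effSize; linarith
  have hc1 : (1 : ℝ) ≤ 2 ^ (d + 2) + s := by
    have : (0 : ℝ) ≤ 2 ^ (d + 2) := by positivity
    linarith
  have hneg : ((2 ^ (d + 2) + s) * (2 : ℝ) ^ (top * (2 * β + d))) ^ (-rateExp d α β) ≤
      effSize d nQ nP β γ κ ^ (-rateExp d α β) :=
    Real.rpow_le_rpow_of_nonpos (by linarith) hsum (by linarith)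
  rw [Real.mul_rpow (by positivity) (by positivity), ← Real.rpow_mul (by norm_num)] at hneg
  have hexp : (top : ℝ) * (2 * β + d) * -rateExp d α β = -(top * (β * (1 + α))) := by
    unfold rateExp; field_simp
  rw [hexp] at hneg
  -- The exponent of the rate is at most one, so moving the constant out of the power costs at most
  -- the constant itself.
  have hinv : 1 ≤ (2 ^ (d + 2) + s) * (2 ^ (d + 2) + s) ^ (-rateExp d α β) := by
    nth_rewrite 1 [← Real.rpow_one (2 ^ (d + 2) + s)]
    rw [← Real.rpow_add (by linarith)]
    exact Real.one_le_rpow hc1 (by linarith)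
  calc (2 : ℝ) ^ (-((top : ℝ) * (β * (1 + α))))
      ≤ ((2 ^ (d + 2) + s) * (2 ^ (d + 2) + s) ^ (-rateExp d α β)) *
        (2 : ℝ) ^ (-((top : ℝ) * (β * (1 + α)))) := le_mul_of_one_le_left (by positivity) hinv
    _ = (2 ^ (d + 2) + s) * ((2 ^ (d + 2) + s) ^ (-rateExp d α β) *
        (2 : ℝ) ^ (-((top : ℝ) * (β * (1 + α))))) := by ring
    _ ≤ _ := by gcongr

/-- The cost of the first stage is of smaller order than the rate. -/
theorem first_stage_cost_le (hθ : θ.Valid) (hd : 1 ≤ d) (hβ : β ∈ Set.Icc θ.βlo θ.βhi) (hγ : 0 ≤ γ)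
    (hκ : 0 ≤ κ) (hκ1 : κ ≤ 1) (hα : 0 ≤ α) (hαβ : α * β ≤ d) (hQ : 1 ≤ nQ)
    (hΛ : 1 ≤ Real.log (nMax nQ nP)) :
    ((min nQ (stepQ θ d nQ nP) : ℕ) : ℝ) ≤ nQ * effSize d nQ nP β γ κ ^ (-rateExp d α β) *
      (2 * Real.log (nMax nQ nP) ^ ((d + θ.βhi + θ.γhi) / θ.βlo)) := by
  have hn := one_le_nMax hΛ
  have hβ0 : 0 < β := hθ.lo_pos.trans_le hβ.1
  have hX := one_le_effSize (d := d) (nP := nP) (β := β) (γ := γ) hQ hκ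
  have he := rateExp_mem (d := d) hβ0 hα hαβ
  have he1 : rateExp d α β ≤ 1 := he.2.trans (by
    have : 0 ≤ β / (2 * β + d) := by positivity
    linarith)
  have hΛp := Real.rpow_nonneg (zero_le_one.trans hΛ) ((d + θ.βhi + θ.γhi) / θ.βlo)
  have hXp := Real.rpow_nonneg (zero_le_one.trans hX) (-rateExp d α β)
  by_cases hlt : nQ < nP
  · have : stepQ θ d nQ nP = 0 := if_pos hlt
    rw [this, Nat.min_zero, Nat.cast_zero]
    positivity
  · have hstep : stepQ θ d nQ nP = sampleSize θ d nQ nP := if_neg hlt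
    have hnn : nMax nQ nP = nQ := by unfold nMax; rw [max_eq_left (not_lt.1 hlt)]
    have h1 : ((min nQ (stepQ θ d nQ nP) : ℕ) : ℝ) ≤ sampleSize θ d nQ nP := by
      rw [hstep]; exact_mod_cast min_le_right _ _
    have h2 := (sampleSize_spec (d := d) hθ hn.le hΛ).2.trans (sampleReal_le hθ hd hΛ)
    have h3 : nMax nQ nP ^ (θ.βlo / (d + 2 * θ.βhi)) ≤ nMax nQ nP ^ (1 + -rateExp d α β) := by
      refine Real.rpow_le_rpow_of_exponent_le hn.le ?_
      have e1 : θ.βlo / (d + 2 * θ.βhi) ≤ β / (2 * β + d) :=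
        div_le_div₀ hβ0.le hβ.1 (by positivity) (by linarith [hβ.2])
      linarith [he.2]
    rw [Real.rpow_add (by linarith), Real.rpow_one] at h3
    have h4 := rpow_neg_ge hX (effSize_le (d := d) hβ0 hγ hκ hκ1 hn.le) hn.le he.1 he1
    have hn0 : 0 < nMax nQ nP := by linarith
    calc _ ≤ nMax nQ nP ^ (θ.βlo / (d + 2 * θ.βhi)) *
          Real.log (nMax nQ nP) ^ ((d + θ.βhi + θ.γhi) / θ.βlo) := h1.trans h2
      _ ≤ (nMax nQ nP * (2 * effSize d nQ nP β γ κ ^ (-rateExp d α β))) *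
          Real.log (nMax nQ nP) ^ ((d + θ.βhi + θ.γhi) / θ.βlo) := by
          refine mul_le_mul_of_nonneg_right (h3.trans ?_) hΛp
          exact mul_le_mul_of_nonneg_left h4 hn0.le
      _ = _ := by rw [hnn]; ring

theorem leadWeight_eq {cG c₈ βlo Λ : ℝ} (hΛ : 0 ≤ Λ) :
    leadWeight cG c₈ βlo Λ = leadWeight cG c₈ βlo 1 * Λ ^ (1 / βlo + 1) := by
  unfold leadWeight
  rw [Real.mul_rpow (by positivity) hΛ, mul_one]; ring

/-- The powers of `Λ` come from the leading weight, raised to `1 + α`, and from two further factors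
`Λ`: one from the pull limits, one from the number of target levels. -/
theorem rateFactor_le {Cβ Cα qlo κ₀ Λ lQ : ℝ} (hqlo : 0 < qlo) (hκ₀ : 0 < κ₀) (hK : 1 ≤ K)
    (hC0 : 0 < θ.Chi) (hΛ : 1 ≤ Λ) (hlQ : lQ ≤ 2 * Λ) :
    rateFactor θ d K Cβ α Cα qlo κ₀ Λ lQ ≤ rateFactor θ d K Cβ α Cα qlo κ₀ 1 2 *
      Λ ^ ((1 / θ.βlo + 1) * (1 + α) + 2) := by
  have hK0 : (0 : ℝ) < K := by exact_mod_cast hK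
  have hΛ0 : 0 < Λ := by linarith
  unfold rateFactor secondFactor
  set cG := gapFactor θ.Chi θ.βlo (κ₀ / (16 * K)) (√(2 * (16 * K / κ₀)) * θ.Chi) with hcG
  have hcG1 : 1 ≤ cG := one_le_gapFactor hC0 (by positivity)
  have hW : 0 ≤ leadWeight cG (shiftConst θ d Cβ) θ.βlo 1 := by
    have e6 := Real.rpow_nonneg (by positivity : (0 : ℝ) ≤ (2 : ℝ) ^ shiftConst θ d Cβ * 1)
      (1 / θ.βlo + 1)
    unfold leadWeight
    exact mul_nonneg (by linarith) e6
  rw [leadWeight_eq hΛ0.le, Real.mul_rpow hW (by positivity), ← Real.rpow_mul hΛ0.le,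
    Real.rpow_add hΛ0]
  have hA : 0 ≤ max Cα 1 := zero_le_one.trans (le_max_right _ _)
  have h1 : 1 + lQ * (6 * K * Λ / θ.Chi ^ 2 * (4 ^ d / qlo)) ≤
      (1 + 2 * (6 * K * 1 / θ.Chi ^ 2 * (4 ^ d / qlo))) * Λ ^ (2 : ℝ) := by
    rw [Real.rpow_two]
    have e1 : lQ * (6 * K * Λ / θ.Chi ^ 2 * (4 ^ d / qlo)) ≤
        2 * Λ * (6 * K * Λ / θ.Chi ^ 2 * (4 ^ d / qlo)) := by gcongr
    have e2 : 1 ≤ Λ ^ 2 := one_le_pow₀ hΛ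
    calc _ ≤ Λ ^ 2 + 2 * Λ * (6 * K * Λ / θ.Chi ^ 2 * (4 ^ d / qlo)) := add_le_add e2 e1
      _ = _ := by ring
  have h2 := Real.rpow_nonneg hW (1 + α)
  calc _ ≤ max Cα 1 * (leadWeight cG (shiftConst θ d Cβ) θ.βlo 1 ^ (1 + α) *
        Λ ^ ((1 / θ.βlo + 1) * (1 + α))) *
        ((1 + 2 * (6 * K * 1 / θ.Chi ^ 2 * (4 ^ d / qlo))) * Λ ^ (2 : ℝ)) := by gcongr
    _ = _ := by ring

/-- All sufficiently large samples are large enough. -/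
theorem exists_largeSample (hθ : θ.Valid) (hd : 1 ≤ d) (hK : 1 ≤ K) {Cβ κ₀ c b : ℝ} (l₀ : ℕ)
    (hκ₀ : 0 < κ₀) (hc : 0 < c) (hb : 0 < b) :
    ∃ n₀ : ℝ, ∀ n, n₀ ≤ n → LargeSample θ d K Cβ κ₀ c b l₀ n := by
  have hlo := hθ.lo_pos
  have hhi := hθ.hi_pos
  have hγ := hθ.γ_nonneg
  have hK0 : (0 : ℝ) < K := by exact_mod_cast hK
  have hd1 : (1 : ℝ) ≤ d := by exact_mod_cast hd
  have hlog := Real.tendsto_log_atTop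
  have hlogb : Filter.Tendsto (fun x => Real.logb 2 x) Filter.atTop Filter.atTop :=
    Real.tendsto_logb_atTop (by norm_num)
  have hs : θ.βlo / (d + 2 * θ.βhi) < 1 := by
    rw [div_lt_one (by positivity)]
    linarith [hθ.lo_lt]
  have e1 := hlog.eventually_ge_atTop 1
  have e2 := hlog.eventually_ge_atTop (θ.Chi ^ 2)
  have e3 := (isLittleO_log_rpow_rpow_atTop ((d + θ.βhi + θ.γhi) / θ.βlo)
    (sub_pos.2 hs)).bound (by norm_num : (0 : ℝ) < 1 / 2)
  -- Here `βlo < βhi` must be strict: the power `βhi / βlo` of `log n` left in the first stage has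
  -- to beat the `log n` required by the deviation bounds.
  have hq : 0 < θ.βhi / θ.βlo - 1 := by
    rw [sub_pos, lt_div_iff₀ hlo]; linarith [hθ.lo_lt]
  set A : ℝ := κ₀ * c / (4 * K) / 2 * (b / 80) ^ 2 *
    (2 : ℝ) ^ (-(2 * (d + 2 * θ.βhi + θ.γhi))) with hA
  have hA0 : 0 < A := by positivity
  have e4 := ((tendsto_rpow_atTop hq).comp hlog).eventually_ge_atTop (4 / A)
  have e5 := hlogb.eventually_ge_atTop (l₀ * (d + 2 * θ.βhi + θ.γhi) ^ 2 / θ.βlo)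
  have e6 := hlog.eventually_ge_atTop (240 * Cβ / b)
  have e7 := (hlogb.comp hlog).eventually_ge_atTop
    (Real.logb 2 (20 / b) * ((d + 2 * θ.βhi + θ.γhi) ^ 2 / θ.βlo))
  have e8 := Filter.eventually_ge_atTop (1 : ℝ)
  have hall : ∀ᶠ n in Filter.atTop, LargeSample θ d K Cβ κ₀ c b l₀ n := by
    filter_upwards [e1, e2, e3, e4, e5, e6, e7, e8] with n h1 h2 h3 h4 h5 h6 h7 h8
    have hn0 : 0 < n := by linarith
    have hΛ0 : 0 < Real.log n := by linarith
    refine ⟨h1, h2, ?_, ?_, ?_, h6, h7⟩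
    · rw [Real.norm_of_nonneg (by positivity), Real.norm_of_nonneg (by positivity)] at h3
      calc _ ≤ n ^ (θ.βlo / (d + 2 * θ.βhi)) * (1 / 2 * n ^ (1 - θ.βlo / (d + 2 * θ.βhi))) := by
            gcongr
        _ = n ^ (θ.βlo / (d + 2 * θ.βhi) + (1 - θ.βlo / (d + 2 * θ.βhi))) / 2 := by
            rw [Real.rpow_add hn0]; ring
        _ = n / 2 := by rw [add_sub_cancel, Real.rpow_one]
    · have h9 : 4 / A ≤ Real.log n ^ (θ.βhi / θ.βlo - 1) := h4
      rw [Real.rpow_sub hΛ0, Real.rpow_one, div_le_div_iff₀ hA0 hΛ0, mul_comm _ A] at h9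
      exact h9
    · have : 0 < (d + 2 * θ.βhi + θ.γhi) ^ 2 := by positivity
      rw [div_le_iff₀ hlo] at h5
      rw [le_div_iff₀ this]
      linarith
  exact Filter.eventually_atTop.1 hall

end Rates

/-! ### The final bound for large samples and the trivial bound for small ones. -/

section MainBound

variable {d K : ℕ} {M : Model d K} {β Cβ α Cα qlo qhi γ cγ κ κ₀ b : ℝ} {l₀ : ℕ} {θ : Tuning}
  {tie : Finset (Fin K) → Fin K} {nQ nP : ℕ}

theorem expectedRegret_le_card (M : Model d K) (hK : 1 ≤ K) :
    M.expectedRegret (adaptivePolicy θ tie nQ nP) nQ nP ≤ nQ := by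
  have hP := M.isProbabilityMeasure_lawP
  have hQ := M.isProbabilityMeasure_lawQ hK
  have h := expectedRegret_le (θ := θ) (tie := tie) (nQ := nQ) (nP := nP) M hK
    (f := fun k => extend (M.f k)) (fun k x hx => extend_of_mem _ hx)
  refine h.trans ?_
  set N := nQ - stepQ θ d nQ nP with hN
  calc _ ≤ ((min nQ (stepQ θ d nQ nP) : ℕ) : ENNReal) + (N : ENNReal) := by
        refine add_le_add le_rfl ?_
        refine (lintegral_mono (g := fun _ => (N : ENNReal)) fun u => ?_).trans (by simp)
        refine (lintegral_mono (g := fun _ => (N : ENNReal)) fun u' => ?_).trans (by simp)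
        refine (lintegral_mono (g := fun _ => (N : ENNReal)) fun v => ?_).trans (by simp)
        rw [← ENNReal.ofReal_natCast]
        refine ENNReal.ofReal_le_ofReal ?_
        refine (Finset.sum_le_sum fun s _ => fMax_sub_le_one M _ (covs v s)).trans ?_
        simp
    _ = nQ := by
        have : min nQ (stepQ θ d nQ nP) + N = nQ := by omega
        exact_mod_cast this

/-- The exponent of the logarithm. -/
def logExp (θ : Tuning) (d : ℕ) (α : ℝ) : ℝ :=
  (d + θ.βhi + θ.γhi) / θ.βlo + (((1 / θ.βlo + 1) * (1 + α) + 2) + 1)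

/-- The constant in the bound for large samples. -/
def mainConst (θ : Tuning) (d K : ℕ) (Cβ α Cα qlo cγ κ₀ : ℝ) : ℝ :=
  2 + rateFactor θ d K Cβ α Cα qlo κ₀ 1 2 *
    (2 ^ (d + 2) + sourceConst K θ.Chi (massConst d qlo cγ θ.γhi)) + 2 * restConst θ.βlo d K

theorem one_le_sourceConst {C c : ℝ} (hK : 1 ≤ K) (hc : 0 < c) (hc1 : c ≤ 1) :
    1 ≤ sourceConst K C c := by
  have hK1 : (1 : ℝ) ≤ K := by exact_mod_cast hK
  unfold sourceConst
  rw [le_div_iff₀ hc, one_mul]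
  have e2 : 0 ≤ 2 / C ^ 2 := by positivity
  nlinarith

/-- The free levels `lP` and `lQ` are taken as fine as the two samples permit. The source level is
computed from `κ nP` divided by a multiple of `log n`, and this costs the last unit in `logExp`. -/
theorem main_bound_of_large (hθ : θ.Valid) (hd : 1 ≤ d) (hK : 1 ≤ K)
    (htie : ∀ s : Finset (Fin K), s.Nonempty → tie s ∈ s) (hCβ : 0 < Cβ) (hChi : Cβ ≤ θ.Chi)
    (hα : 0 ≤ α) (hqlo : 0 < qlo) (hcγ : 0 < cγ) (hcγ1 : cγ ≤ 1) (hκ₀ : 0 < κ₀) (hb : 0 < b)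
    (hQ : 1 ≤ nQ)
    (hL : LargeSample θ d K Cβ κ₀ (massConst d qlo cγ θ.γhi) (min 1 b) l₀ (nMax nQ nP))
    (hβ : β ∈ Set.Icc θ.βlo θ.βhi) (hαβ : α * β ≤ d) (hγ : γ ∈ Set.Icc 0 θ.γhi)
    (hκ : κ ∈ Set.Icc κ₀ 1) (h : InClass M β Cβ α Cα qlo qhi γ cγ κ l₀ b) :
    M.expectedRegret (adaptivePolicy θ tie nQ nP) nQ nP ≤
      ENNReal.ofReal (mainConst θ d K Cβ α Cα qlo cγ κ₀ * nQ *
        effSize d nQ nP β γ κ ^ (-rateExp d α β) * Real.log (nMax nQ nP) ^ logExp θ d α) := by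
  have hΛ := hL.log_ge
  have hn := one_le_nMax hΛ
  have hlo := hθ.lo_pos
  have hhi := hθ.hi_pos
  have hγhi := hθ.γ_nonneg
  have hC0 : 0 < θ.Chi := hCβ.trans_le hChi
  have hβ0 : 0 < β := hlo.trans_le hβ.1
  have hβ1 : β ≤ 1 := hβ.2.trans hθ.hi_le
  have hκ0 : 0 ≤ κ := hκ₀.le.trans hκ.1
  have hc : 0 < massConst d qlo cγ θ.γhi := lt_min one_pos (by positivity)
  have hsc := one_le_sourceConst (K := K) (C := θ.Chi) hK hc (min_le_left _ _)
  set c₄ := sourceConst K θ.Chi (massConst d qlo cγ θ.γhi) with hc₄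
  set Λ := Real.log (nMax nQ nP) with hΛdef
  have hΛ0 : 0 < Λ := by linarith
  have hs : 1 ≤ c₄ * Λ := one_le_mul_of_one_le_of_one_le hsc hΛ
  have hs0 : 0 < c₄ * Λ := by linarith
  have hX := one_le_effSize (d := d) (nP := nP) (β := β) (γ := γ) hQ hκ0
  have he := rateExp_mem (d := d) hβ0 hα hαβ
  have he1 : rateExp d α β ≤ 1 := he.2.trans (by
    have : 0 ≤ β / (2 * β + d) := by positivity
    linarith)
  have hXle := effSize_le (d := d) (nQ := nQ) (nP := nP) hβ0 hγ.1 hκ0 hκ.2 hn.le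
  have hγ0 := hγ.1
  have hD : 0 < 2 * β + d + γ := by positivity
  refine (expectedRegret_le_of_large (lP := sourceLevel (κ * nP / (c₄ * Λ)) (2 * β + d + γ))
    (lQ := targetLevel d nQ β) hθ hd hK htie hCβ hChi hα hqlo hcγ hcγ1 hκ₀ hb hL hβ hαβ hγ hκ h
    (fun l hl => by
      have := sourceLevel_lt hD hl
      rwa [le_div_iff₀ hs0] at this)
    (targetLevel_spec hβ0 hQ).1).trans (ENNReal.ofReal_le_ofReal ?_)
  have h1 := first_stage_cost_le (nP := nP) hθ hd hβ hγ.1 hκ0 hκ.2 hα hαβ hQ hΛ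
  have h2 := rate_of_levels (d := d) (nQ := nQ) (nP := nP) hβ0 hβ1 hγ.1 hκ0 hα hαβ hQ hs
  have h3 := inv_le_rpow_neg hX hXle hn.le he.1 he1
  have hlQ : (targetLevel d nQ β : ℝ) ≤ 2 * Λ := by
    refine (targetLevel_le hβ0 hd hQ).trans ?_
    have hq0 : (0 : ℝ) < nQ := by exact_mod_cast hQ
    have : Real.log nQ ≤ Λ := Real.log_le_log hq0 (by
      unfold nMax; exact_mod_cast le_max_left nQ nP)
    linarith
  have h4 := rateFactor_le (d := d) (α := α) (Cβ := Cβ) (Cα := Cα) hqlo hκ₀ hK hC0 hΛ hlQ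
  have hRF := rateFactor_nonneg (d := d) (Cβ := Cβ) (α := α) (Cα := Cα) hqlo hκ₀ hK hC0 le_rfl
    (zero_le_two)
  set X := effSize d nQ nP β γ κ ^ (-rateExp d α β) with hXdef
  have hX0 : 0 ≤ X := Real.rpow_nonneg (zero_le_one.trans hX) _
  set RF := rateFactor θ d K Cβ α Cα qlo κ₀ 1 2
  set p₁ := (d + θ.βhi + θ.γhi) / θ.βlo with hp₁
  set p₂ := (1 / θ.βlo + 1) * (1 + α) + 2 with hp₂
  have hp₁0 : 0 ≤ p₁ := by positivity
  have hp₂0 : 0 ≤ p₂ := by positivity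
  have hlogExp : logExp θ d α = p₁ + (p₂ + 1) := rfl
  have g1 : Λ ^ p₁ ≤ Λ ^ logExp θ d α :=
    Real.rpow_le_rpow_of_exponent_le hΛ (by rw [hlogExp]; linarith)
  have g2 : Λ ^ p₂ * Λ ≤ Λ ^ logExp θ d α := by
    have : Λ ^ p₂ * Λ = Λ ^ (p₂ + 1) := (Real.rpow_add_one hΛ0.ne' p₂).symm
    rw [this]
    exact Real.rpow_le_rpow_of_exponent_le hΛ (by rw [hlogExp]; linarith)
  have g3 : 1 ≤ Λ ^ logExp θ d α := Real.one_le_rpow hΛ (by rw [hlogExp]; linarith)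
  have hrest : 0 ≤ restConst θ.βlo d K := by unfold restConst; positivity
  have hq0 : (0 : ℝ) ≤ nQ := Nat.cast_nonneg nQ
  set Y := Λ ^ logExp θ d α
  have t1 : nQ * X * (2 * Λ ^ p₁) ≤ nQ * X * (2 * Y) := by gcongr
  have t2 : nQ * rateFactor θ d K Cβ α Cα qlo κ₀ Λ (targetLevel d nQ β) *
      (2 : ℝ) ^ (-(((max (sourceLevel (κ * nP / (c₄ * Λ)) (2 * β + d + γ)) (targetLevel d nQ β) : ℕ)
        : ℝ) * (β * (1 + α)))) ≤ nQ * X * (RF * (2 ^ (d + 2) + c₄) * Y) := by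
    calc _ ≤ nQ * (RF * Λ ^ p₂) * ((2 ^ (d + 2) + c₄ * Λ) * X) := by gcongr
      _ ≤ nQ * (RF * Λ ^ p₂) * ((2 ^ (d + 2) * Λ + c₄ * Λ) * X) := by
          have : (2 : ℝ) ^ (d + 2) ≤ 2 ^ (d + 2) * Λ := le_mul_of_one_le_right (by positivity) hΛ
          gcongr
      _ = nQ * X * (RF * (2 ^ (d + 2) + c₄) * (Λ ^ p₂ * Λ)) := by ring
      _ ≤ _ := by gcongr
  have t3 : nQ * (restConst θ.βlo d K / nMax nQ nP) ≤ nQ * X * (2 * restConst θ.βlo d K * Y) := by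
    calc nQ * (restConst θ.βlo d K / nMax nQ nP) = nQ * (restConst θ.βlo d K * (1 / nMax nQ nP)) := by
          ring
      _ ≤ nQ * (restConst θ.βlo d K * (2 * X)) := by gcongr
      _ = nQ * X * (2 * restConst θ.βlo d K * 1) := by ring
      _ ≤ _ := by gcongr
  calc _ ≤ nQ * X * (2 * Y) + nQ * X * (RF * (2 ^ (d + 2) + c₄) * Y) +
        nQ * X * (2 * restConst θ.βlo d K * Y) :=
        add_le_add (add_le_add (h1.trans t1) t2) t3
    _ = _ := by unfold mainConst; ring

/-- For bounded samples the trivial regret `nQ` is within a constant of the claim, since the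
effective sample size is at most `2 n₀`. The logarithm is only known to be at least `1/2`, whence
the factor `2 ^ C`. -/
theorem small_sample_bound (hβ : 0 < β) (hα : 0 ≤ α) (hαβ : α * β ≤ d) (hγ : 0 ≤ γ) (hκ : 0 ≤ κ)
    (hκ1 : κ ≤ 1) (hQ : 1 ≤ nQ) (hn : 2 ≤ max nQ nP) {n₀ C : ℝ} (hC : 0 ≤ C)
    (hn₀ : nMax nQ nP ≤ n₀) :
    (nQ : ℝ) ≤ 2 * n₀ * (2 : ℝ) ^ C * nQ * effSize d nQ nP β γ κ ^ (-rateExp d α β) *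
      Real.log (nP + nQ) ^ C := by
  have h2 : (2 : ℝ) ≤ nMax nQ nP := by unfold nMax; exact_mod_cast hn
  have hX := one_le_effSize (d := d) (nP := nP) (β := β) (γ := γ) hQ hκ
  have he := rateExp_mem (d := d) hβ hα hαβ
  have he1 : rateExp d α β ≤ 1 := he.2.trans (by
    have : 0 ≤ β / (2 * β + d) := by positivity
    linarith)
  have hXle := effSize_le (d := d) (nQ := nQ) (nP := nP) hβ hγ hκ hκ1 (by linarith)
  have h3 := inv_le_rpow_neg hX hXle (by linarith) he.1 he1
  have hn0 : 0 < nMax nQ nP := by linarith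
  have hn00 : 0 < n₀ := by linarith
  have h4 : 1 ≤ 2 * n₀ * effSize d nQ nP β γ κ ^ (-rateExp d α β) := by
    rw [div_le_iff₀ hn0] at h3
    have := Real.rpow_nonneg (zero_le_one.trans hX) (-rateExp d α β)
    nlinarith
  have h5 : nMax nQ nP ≤ nP + nQ := by
    unfold nMax
    have : max nQ nP ≤ nP + nQ := by omega
    exact_mod_cast this
  have h6 : (1 / 2 : ℝ) ≤ Real.log (nP + nQ) := by
    have e1 := Real.log_two_gt_d9
    have e2 : Real.log 2 ≤ Real.log (nP + nQ) := Real.log_le_log (by norm_num) (h2.trans h5)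
    linarith
  have h7 : 1 ≤ (2 : ℝ) ^ C * Real.log (nP + nQ) ^ C := by
    rw [← Real.mul_rpow (by norm_num) (by linarith)]
    exact Real.one_le_rpow (by linarith) hC
  have hq0 : (0 : ℝ) ≤ nQ := Nat.cast_nonneg nQ
  calc (nQ : ℝ) ≤ nQ * ((2 * n₀ * effSize d nQ nP β γ κ ^ (-rateExp d α β)) *
        ((2 : ℝ) ^ C * Real.log (nP + nQ) ^ C)) :=
        le_mul_of_one_le_right hq0 (one_le_mul_of_one_le_of_one_le h4 h7)
    _ = _ := by ring

end MainBound

end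

end TransferBandit

theorem theorem3 (d K : ℕ) (hd : 1 ≤ d) (hK : 1 ≤ K)
    -- tuning parameters of the algorithm
    (βlo βhi γhi Chi : ℝ) (hβlo : 0 < βlo) (hβ : βlo < βhi) (hβhi : βhi ≤ 1) (hγhi : 0 ≤ γhi)
    -- parameters of the class of bandits
    (α Cβ Cα qlo qhi cγ κ₀ : ℝ) (l₀ : ℕ) (b : ℝ)
    (hα : 0 ≤ α) (hCβ : 0 < Cβ) (hChi : Cβ ≤ Chi) (hCα : 0 < Cα) (hqlo : 0 < qlo)
    (hq : qlo < qhi) (hcγ : 0 < cγ) (hcγ1 : cγ ≤ 1) (hκ₀ : 0 < κ₀) (hb : 0 < b) :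
    ∃ C₁ C₂ : ℝ, 0 < C₁ ∧ 0 < C₂ ∧
      ∀ tie : Finset (Fin K) → Fin K, (∀ s : Finset (Fin K), s.Nonempty → tie s ∈ s) →
      ∀ nQ nP : ℕ, 2 ≤ max nQ nP →
      ∀ β ∈ Set.Icc βlo βhi, α * β ≤ d →
      ∀ γ ∈ Set.Icc 0 γhi, ∀ κ ∈ Set.Icc κ₀ 1,
      ∀ M : TransferBandit.Model d K,
        TransferBandit.InClass M β Cβ α Cα qlo qhi γ cγ κ l₀ b →
        M.expectedRegret (TransferBandit.adaptivePolicy ⟨βlo, βhi, γhi, Chi⟩ tie nQ nP) nQ nP ≤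
          ENNReal.ofReal (C₁ * nQ *
            ((nQ : ℝ) + (κ * nP) ^ ((d + 2 * β) / (d + 2 * β + γ))) ^
              (-(β * (1 + α) / (2 * β + d))) *
            Real.log ((nP : ℝ) + nQ) ^ C₂) := by
  open TransferBandit in
  set θ : Tuning := ⟨βlo, βhi, γhi, Chi⟩ with hθdef
  have hθ : θ.Valid := ⟨hβlo, hβ, hβhi, hγhi⟩
  have hc : 0 < massConst d qlo cγ γhi := lt_min one_pos (by positivity)
  have hC0 : 0 < θ.Chi := hCβ.trans_le hChi
  obtain ⟨n₀, hn₀⟩ := exists_largeSample (θ := θ) hθ hd hK (Cβ := Cβ) (κ₀ := κ₀) l₀ hκ₀ hc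
    (lt_min one_pos hb)
  have hβhi0 : 0 < βhi := hθ.hi_pos
  have hlogExp : 0 < logExp θ d α := by
    have : 0 < θ.βhi := hβhi0
    have : 0 < θ.βlo := hβlo
    have : 0 ≤ θ.γhi := hγhi
    unfold logExp; positivity
  have hRF := rateFactor_nonneg (d := d) (Cβ := Cβ) (α := α) (Cα := Cα) hqlo hκ₀ hK hC0 le_rfl
    (zero_le_two)
  have hsc := one_le_sourceConst (K := K) (C := θ.Chi) hK hc (min_le_left _ _)
  have hmain : 0 < mainConst θ d K Cβ α Cα qlo cγ κ₀ := by
    have : 0 ≤ restConst θ.βlo d K := by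
      have : 0 < θ.βlo := hβlo
      unfold restConst; positivity
    have h2 : 0 ≤ rateFactor θ d K Cβ α Cα qlo κ₀ 1 2 *
        (2 ^ (d + 2) + sourceConst K θ.Chi (massConst d qlo cγ θ.γhi)) :=
      mul_nonneg hRF (add_nonneg (by positivity) (zero_le_one.trans hsc))
    unfold mainConst; linarith
  -- The threshold `n₀` comes from an eventual statement and may be negative, while the constant has
  -- to be positive.
  set n₁ := max n₀ 1 with hn₁
  have hn₁0 : 0 < n₁ := lt_of_lt_of_le one_pos (le_max_right _ _)
  refine ⟨mainConst θ d K Cβ α Cα qlo cγ κ₀ + 2 * n₁ * (2 : ℝ) ^ logExp θ d α, logExp θ d α,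
    by positivity, hlogExp, ?_⟩
  intro tie htie nQ nP hn β hβm hαβ γ hγ κ hκ M h
  have hβ0 : 0 < β := hβlo.trans_le hβm.1
  have hκ0 : 0 ≤ κ := hκ₀.le.trans hκ.1
  -- Without target rounds both sides vanish; otherwise the effective sample size is at least one,
  -- as the estimates of the rate require.
  rcases Nat.eq_zero_or_pos nQ with hQ | hQ
  · refine (expectedRegret_le_card M hK).trans ?_
    rw [hQ]; simp
  have hX := one_le_effSize (d := d) (nP := nP) (β := β) (γ := γ) hQ hκ0
  have hXp := Real.rpow_nonneg (zero_le_one.trans hX) (-rateExp d α β)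
  have h1 : (1 : ℝ) ≤ nMax nQ nP := by
    unfold nMax; exact_mod_cast (by omega : 1 ≤ max nQ nP)
  have h2 : nMax nQ nP ≤ nP + nQ := by
    unfold nMax; exact_mod_cast (by omega : max nQ nP ≤ nP + nQ)
  have hl0 : 0 ≤ Real.log (nMax nQ nP) := Real.log_nonneg h1
  have hll : Real.log (nMax nQ nP) ≤ Real.log (nP + nQ) := Real.log_le_log (by linarith) h2
  have hlp : Real.log (nMax nQ nP) ^ logExp θ d α ≤ Real.log (nP + nQ) ^ logExp θ d α :=
    Real.rpow_le_rpow hl0 hll hlogExp.le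
  have hlp0 : 0 ≤ Real.log (nP + nQ) ^ logExp θ d α := Real.rpow_nonneg (hl0.trans hll) _
  change _ ≤ ENNReal.ofReal (_ * nQ * effSize d nQ nP β γ κ ^ (-rateExp d α β) * _)
  rcases le_or_gt n₀ (nMax nQ nP) with hlarge | hsmall
  · refine (main_bound_of_large hθ hd hK htie hCβ hChi hα hqlo hcγ hcγ1 hκ₀ hb hQ
      (hn₀ _ hlarge) hβm hαβ hγ hκ h).trans (ENNReal.ofReal_le_ofReal ?_)
    gcongr
    have : 0 ≤ 2 * n₁ * (2 : ℝ) ^ logExp θ d α := by positivity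
    linarith
  · refine (expectedRegret_le_card M hK).trans ?_
    rw [← ENNReal.ofReal_natCast]
    refine ENNReal.ofReal_le_ofReal ((small_sample_bound (γ := γ) (κ := κ) (α := α) hβ0 hα hαβ hγ.1 hκ0
      hκ.2 hQ hn hlogExp.le (hsmall.le.trans (le_max_left n₀ 1))).trans ?_)
    gcongr
    linarith
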